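/- Let $\Omega\subset\mathbb{R}^2\cong\mathbb{C}$ be a bounded, simply connected $C^{1,1}$ domain with outer unit normal $\nu$, unit tangent $\tau=i\nu$ and boundary curvature $\varkappa$. Let $N\ge 2$, let $a_1,\dots,a_N\in\partial\Omega$ be distinct points and let $d_1,\dots,d_N\in\{\pm1\}$ with $\sum_j d_j=2$. Let $\varphi_b:\partial\Omega\to\mathbb{R}$ be a function of bounded variation (taken in its representative that is continuous on $\partial\Omega\setminus\{a_1,\dots,a_N\}$) such that $e^{i\varphi_b}\cdot\nu=0$ on $\partial\Omega\setminus\{a_1,\dots,a_N\}$ and $$\partial_\tau\varphi_b=\varkappa-\pi\sum_{j=1}^N d_j\,\delta_{a_j}\quad\text{on }\partial\Omega$$ in the sense of distributions. Let $\varphi_*$ be the harmonic extension of $\varphi_b$ to $\Omega$, i.e. the bounded harmonic function on $\Omega$ with $\varphi_*(x)\to\varphi_b(y)$ as $x\to y$ for every $y\in\partial\Omega\setminus\{a_1,\dots,a_N\}$. Let $h_{ext}\in\mathbb{R}^2$ be constant. Write $\Omega_\rho=\Omega\setminus\bigcup_{j=1}^N B_\rho(a_j)$ and $$F(\sigma)=\int_\Omega\left(|\nabla\sigma|^2-h_{ext}\cdot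 e^{i(\sigma+\varphi_*)}\right)dx,\qquad \sigma\in H^1_0(\Omega).$$ Then the finite limit $$W_{\Omega;0}(\{(a_j,d_j)\})=\lim_{\rho\to0}\left(\int_{\Omega_\rho}|\nabla\varphi_*|^2\,dx-\pi N\log\frac1\rho\right)$$ exists and $F$ attains its minimum on $H^1_0(\Omega)$, so that the renormalized energy with external field $$W_{\Omega;h_{ext}}(\{(a_j,d_j)\})=W_{\Omega;0}(\{(a_j,d_j)\})+\min_{H^1_0(\Omega)}F$$ (relative to the fixed choice of $\varphi_b$) is well defined. For every $\psi\in H^1_{loc}(\overline\Omega\setminus\{a_1,\dots,a_N\})$ with $\psi=\varphi_b$ on $\partial\Omega\setminus\{a_1,\dots,a_N\}$ in the sense of traces, set $$G(\psi)=\liminf_{\rho\to0}\left(\int_{\Omega_\rho}|\nabla\psi|^2\,dx-\pi N\log\frac1\rho\right)-\int_\Omega h_{ext}\cdot e^{i\psi}\,dx\in[-\infty,\infty].$$ Then $$G(\psi)\ge W_{\Omega;h_{ext}}(\{(a_j,d_j)\}).$$ Moreover, for every minimizer $\sigma_*$ of $F$ on $H^1_0(\Omega)$, the function $\psi=\varphi_*+\sigma_*$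 belongs to this class and $G(\varphi_*+\sigma_*)=W_{\Omega;h_{ext}}(\{(a_j,d_j)\})$. -/

import Mathlib

open MeasureTheory Set Filter Topology
open scoped ContDiff NNReal

noncomputable section

namespace BoundaryVortex

/-! The plane `ℝ²` is identified with `ℂ` (Euclidean norm, Lebesgue measure); the Euclidean scalar
product of two vectors `v`, `w` is `inner ℝ v w`, and `Complex.I * v` is `v` rotated by `π / 2`. -/

/-- `Ω` is a set of class `C^{1,1}`: near each boundary point, in suitable orthonormal coordinates
(centred at the point and rotated by `u`), `Ω` is the region strictly above the graph of a
differentiable function with Lipschitz derivative. -/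
def IsC11 (Ω : Set ℂ) : Prop :=
  ∀ p ∈ frontier Ω, ∃ (u : ℂ) (r : ℝ) (f : ℝ → ℝ) (K : ℝ≥0),
    ‖u‖ = 1 ∧ 0 < r ∧ Differentiable ℝ f ∧ LipschitzWith K (deriv f) ∧
      ∀ x y : ℝ, |x| < r → |y| < r →
        (p + u * ((x : ℂ) + (y : ℂ) * Complex.I) ∈ Ω ↔ f x < y)

/-- `γ` is a positively oriented arc-length parametrization, of period `L`, of the boundary of `Ω`,
the boundary being one simple closed curve of class `C^{1,1}`. Its unit tangent at `γ s` is
`τ = deriv γ s`, the outer unit normal is `ν = -iτ`, and `iτ = -ν` points into `Ω`. -/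
structure IsBoundaryParam (Ω : Set ℂ) (L : ℝ) (γ : ℝ → ℂ) : Prop where
  pos : 0 < L
  differentiable : Differentiable ℝ γ
  lipschitz_deriv : ∃ K : ℝ≥0, LipschitzWith K (deriv γ)
  unit_speed : ∀ s, ‖deriv γ s‖ = 1
  periodic : Function.Periodic γ L
  injOn : InjOn γ (Ico 0 L)
  range_eq : range γ = frontier Ω
  inward : ∀ s, ∃ ε > 0, ∀ t ∈ Ioo (0 : ℝ) ε, γ s + (t : ℂ) * (Complex.I * deriv γ s) ∈ Ω

/-- The outer unit normal `ν = -iτ` at the boundary point `γ s`. -/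
def outerNormal (γ : ℝ → ℂ) (s : ℝ) : ℂ := -(Complex.I * deriv γ s)

/-- The (almost everywhere defined) curvature `ϰ` of the boundary at `γ s`, given by
`τ' = ϰ iτ = -ϰ ν`; it equals `1` for the unit circle. -/
def curvature (γ : ℝ → ℂ) (s : ℝ) : ℝ :=
  inner ℝ (deriv (deriv γ) s) (Complex.I * deriv γ s)

/-- The boundary data `φ_b : ∂Ω → ℝ` of the vortices `a_j` with multiplicities `d_j`: a function of
bounded variation, taken in its representative that is continuous off the `a_j`, with
`e^{iφ_b} · ν = 0` on `∂Ω \ {a_j}` and `∂_τ φ_b = ϰ - π ∑ d_j δ_{a_j}` in the sense of distributions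
on the closed curve `∂Ω`. -/
structure IsBoundaryData {N : ℕ} (Ω : Set ℂ) (L : ℝ) (γ : ℝ → ℂ) (a : Fin N → ℂ) (d : Fin N → ℤ)
    (φb : ℂ → ℝ) : Prop where
  boundedVariation : BoundedVariationOn (fun s => φb (γ s)) (Icc 0 L)
  continuousOn : ContinuousOn φb (frontier Ω \ range a)
  tangent : ∀ s, γ s ∉ range a →
    inner ℝ (Complex.exp ((φb (γ s) : ℂ) * Complex.I)) (outerNormal γ s) = 0
  tangentialDeriv : ∀ s : Fin N → ℝ, (∀ j, γ (s j) = a j) →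
    ∀ ζ : ℝ → ℝ, ContDiff ℝ 1 ζ → Function.Periodic ζ L →
      -∫ t in (0 : ℝ)..L, φb (γ t) * deriv ζ t =
        (∫ t in (0 : ℝ)..L, curvature γ t * ζ t) - Real.pi * ∑ j, (d j : ℝ) * ζ (s j)

/-- `φ` is the harmonic extension to `Ω` of the boundary data `φ_b`: the bounded harmonic function
on `Ω` which has boundary values `φ_b` at all points of `∂Ω` except the jump points `a_j`. -/
structure IsHarmonicExtension {N : ℕ} (Ω : Set ℂ) (a : Fin N → ℂ) (φb φ : ℂ → ℝ) : Prop where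
  harmonic : InnerProductSpace.HarmonicOnNhd φ Ω
  bounded : ∃ C : ℝ, ∀ x ∈ Ω, |φ x| ≤ C
  boundary : ∀ x ∈ frontier Ω \ range a, Tendsto φ (𝓝[Ω] x) (𝓝 (φb x))

/-- `g` is a weak gradient of `f` on the open set `Ω`. -/
def HasWeakGrad (Ω : Set ℂ) (f : ℂ → ℝ) (g : ℂ → ℂ) : Prop :=
  LocallyIntegrableOn f Ω ∧ LocallyIntegrableOn g Ω ∧
    ∀ ζ : ℂ → ℝ, ContDiff ℝ ∞ ζ → HasCompactSupport ζ → tsupport ζ ⊆ Ω →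
      ∀ v : ℂ, ∫ x in Ω, f x * fderiv ℝ ζ x v = -∫ x in Ω, inner ℝ (g x) v * ζ x

open Classical in
/-- The weak gradient of `f` on `Ω` (unique almost everywhere on `Ω`), or `0` if there is none. -/
def weakGrad (Ω : Set ℂ) (f : ℂ → ℝ) : ℂ → ℂ :=
  if h : ∃ g, HasWeakGrad Ω f g then h.choose else 0

/-- `Ω \ ⋃ B_ρ(a_j)`. -/
def perforated {N : ℕ} (Ω : Set ℂ) (a : Fin N → ℂ) (ρ : ℝ) : Set ℂ :=
  Ω \ ⋃ j, Metric.ball (a j) ρ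

/-- `f ∈ H¹_loc(Ω̄ \ {a_j})` for a bounded open set `Ω`: `f` and its weak gradient are square
integrable on `Ω \ ⋃ B_ρ(a_j)` for all `ρ > 0`. -/
def MemH1loc {N : ℕ} (Ω : Set ℂ) (a : Fin N → ℂ) (f : ℂ → ℝ) : Prop :=
  (∃ g, HasWeakGrad Ω f g) ∧ ∀ ρ > 0,
    MemLp f 2 (volume.restrict (perforated Ω a ρ)) ∧
      MemLp (weakGrad Ω f) 2 (volume.restrict (perforated Ω a ρ))

/-- The divergence of a planar vector field. -/
def divergence (Φ : ℂ → ℂ) (x : ℂ) : ℝ :=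
  (fderiv ℝ Φ x 1).re + (fderiv ℝ Φ x Complex.I).im

/-- `f = φ_b` on `∂Ω \ {a_j}` in the sense of traces, the trace being characterized by the
Gauss-Green formula `∫_Ω (f div Φ + ∇f · Φ) = ∫_{∂Ω} φ_b Φ · ν dℋ¹` for all smooth compactly supported
vector fields `Φ` on the plane that vanish near the points `a_j`. -/
def HasTrace {N : ℕ} (Ω : Set ℂ) (L : ℝ) (γ : ℝ → ℂ) (a : Fin N → ℂ) (f φb : ℂ → ℝ) : Prop :=
  ∀ Φ : ℂ → ℂ, ContDiff ℝ ∞ Φ → HasCompactSupport Φ → (∀ j, a j ∉ tsupport Φ) →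
    ∫ x in Ω, (f x * divergence Φ x + inner ℝ (weakGrad Ω f x) (Φ x)) =
      ∫ s in (0 : ℝ)..L, φb (γ s) * inner ℝ (Φ (γ s)) (outerNormal γ s)

/-- The competitors: `ψ ∈ H¹_loc(Ω̄ \ {a_j})` with `ψ = φ_b` on the boundary of `Ω`. -/
def IsCompetitor {N : ℕ} (Ω : Set ℂ) (L : ℝ) (γ : ℝ → ℂ) (a : Fin N → ℂ) (φb ψ : ℂ → ℝ) : Prop :=
  MemH1loc Ω a ψ ∧ HasTrace Ω L γ a ψ φb

/-- `f ∈ H¹₀(Ω)`: the closure of the smooth functions with compact support in `Ω` with respect to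
the `H¹(Ω)` norm. -/
def MemH10 (Ω : Set ℂ) (f : ℂ → ℝ) : Prop :=
  (∃ g, HasWeakGrad Ω f g) ∧ MemLp f 2 (volume.restrict Ω) ∧
    MemLp (weakGrad Ω f) 2 (volume.restrict Ω) ∧
    ∃ ζ : ℕ → ℂ → ℝ,
      (∀ n, ContDiff ℝ ∞ (ζ n) ∧ HasCompactSupport (ζ n) ∧ tsupport (ζ n) ⊆ Ω) ∧
      Tendsto (fun n => eLpNorm (fun x => f x - ζ n x) 2 (volume.restrict Ω)) atTop (𝓝 0) ∧
      Tendsto (fun n => eLpNorm (fun x => weakGrad Ω f x - gradient (ζ n) x) 2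
        (volume.restrict Ω)) atTop (𝓝 0)

/-- `h · e^{iψ}`. -/
def zeeman (h : ℂ) (ψ : ℂ → ℝ) (x : ℂ) : ℝ :=
  inner ℝ h (Complex.exp ((ψ x : ℂ) * Complex.I))

/-- `∫_{Ω \ ⋃ B_ρ(a_j)} |∇ψ|² - π N log (1/ρ)`. -/
def excessEnergy {N : ℕ} (Ω : Set ℂ) (a : Fin N → ℂ) (ψ : ℂ → ℝ) (ρ : ℝ) : ℝ :=
  (∫ x in perforated Ω a ρ, ‖weakGrad Ω ψ x‖ ^ 2) - Real.pi * N * Real.log (1 / ρ)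

/-- `G(ψ)`, a number in `[-∞, ∞]`. -/
def energyG {N : ℕ} (Ω : Set ℂ) (a : Fin N → ℂ) (h : ℂ) (ψ : ℂ → ℝ) : EReal :=
  liminf (fun ρ : ℝ => (excessEnergy Ω a ψ ρ : EReal)) (𝓝[>] (0 : ℝ)) -
    ((∫ x in Ω, zeeman h ψ x : ℝ) : EReal)

/-- `F(σ) = ∫_Ω (|∇σ|² - h · e^{i(σ + φ_*)})`. -/
def energyF (Ω : Set ℂ) (h : ℂ) (φ σ : ℂ → ℝ) : ℝ :=
  ∫ x in Ω, (‖weakGrad Ω σ x‖ ^ 2 - zeeman h (fun y => σ y + φ y) x)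

/-- `σ` minimizes `F` among the functions in `H¹₀(Ω)`. -/
def IsMinimizerF (Ω : Set ℂ) (h : ℂ) (φ σ : ℂ → ℝ) : Prop :=
  MemH10 Ω σ ∧ ∀ η, MemH10 Ω η → energyF Ω h φ σ ≤ energyF Ω h φ η

/-- `W₀` is the renormalized energy `W_{Ω;0}({(a_j,d_j)})` without external field, where `φ` is the
harmonic extension `φ_*` of the boundary data of `{(a_j,d_j)}`. -/
def IsRenormalizedEnergyZero {N : ℕ} (Ω : Set ℂ) (a : Fin N → ℂ) (φ : ℂ → ℝ) (W₀ : ℝ) : Prop :=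
  Tendsto (excessEnergy Ω a φ) (𝓝[>] (0 : ℝ)) (𝓝 W₀)

/-- `W` is the renormalized energy `W_{Ω;h}({(a_j,d_j)}) = W_{Ω;0}({(a_j,d_j)}) + F(σ_*)` with
external field `h`, where `σ_*` is any minimizer of `F`. -/
def IsRenormalizedEnergy {N : ℕ} (Ω : Set ℂ) (a : Fin N → ℂ) (h : ℂ) (φ : ℂ → ℝ) (W : ℝ) : Prop :=
  ∃ (W₀ : ℝ) (σ : ℂ → ℝ),
    IsRenormalizedEnergyZero Ω a φ W₀ ∧ IsMinimizerF Ω h φ σ ∧ W = W₀ + energyF Ω h φ σ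

end BoundaryVortex

end

/-!
The boundary data `φ_b` jump by `-π d_j` at `a_j`, which is exactly the jump of `d_j` times the polar
angle around a point of a `C¹` curve. Hence `φ_b` agrees on `∂Ω` with a model `Q + ∑ d_j χ_j θ_j`
(`phaseModel`), where `Q` is Lipschitz, `θ_j` is the angle around `a_j` and `χ_j` a radial cutoff: by
the chord-arc property and the lemma of du Bois-Reymond, the difference has a bounded tangential
derivative (`IsBoundaryData.exists_lipschitz_regular_part`). The gradient of the model is the sum of
the singular field `V = ∑ d_j χ_j ∇θ_j` (`singularField`) and of a bounded field `B`
(`regularField`).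

The field `V` has three properties.
* It is divergence free, since `∇θ_j` is tangential to the circles around `a_j` and `χ_j` is radial.
* For the same reason it satisfies `∫ V · ∇f = 0` on `Ω_ρ` for `f` with zero trace on
  `∂Ω \ {a_j}`: the circular parts of the boundary of `Ω_ρ` do not contribute
  (`IsSplitting.integral_inner_singularField_eq_zero`).
* Its energy on `Ω_ρ` is `π N log (1 / ρ)` plus a convergent quantity. Near `a_j` the domain is a half
  disc up to an error of second order, so that `x ↦ 2 a_j - x` maps it to its complement up to a set on
  which `|x - a_j|⁻²` is integrable (`IsPole.exists_tendsto_energy`).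

Let `w` be the difference of `φ_*` and the model. It is bounded and tends to zero at the boundary off
the `a_j`, and `Z = ∇φ_* - V = ∇w + B` is divergence free. Testing with soft thresholdings of `w`, cut
off near the `a_j` by functions of small energy, which exist because points have zero capacity in the
plane, yields `∇w ∈ L²(Ω)` (`memLp_gradient_of_orthogonal`) and zero trace of `w`
(`zeroTrace_of_tendsto`). Orthogonality of `V` to gradients then gives, for every `σ` with zero trace,
`∫_{Ω_ρ} |∇(φ_* + σ)|² - π N log (1 / ρ) = ∫_{Ω_ρ} |Z + ∇σ|² + ∫_{Ω_ρ} (|V|² + 2 B · V) - π N log (1 / ρ)`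
(`IsSplitting.excessEnergy_add`), where the terms after the first integral have a finite limit as `ρ → 0`.

For `σ ∈ H¹₀(Ω)` the fields `Z` and `∇σ` are orthogonal, and the limit is `W₀ + ∫ |∇σ|²`
(`IsSplitting.exists_tendsto_excessEnergy`); so `G (φ_* + σ) = W₀ + F σ`, and the claims for competitors
of this form follow from the existence of a minimizer of `F` by the direct method
(`exists_minimizer`). For any other competitor `ψ` the difference `σ = ψ - φ_*` has zero trace. If `G ψ`
is not `⊤`, then `∫_{Ω_ρ} |Z + ∇σ|²` is bounded along some radii `ρ → 0`, so that `∇σ ∈ L²(Ω)`, and this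
forces `σ ∈ H¹₀(Ω)` (`ZeroTrace.memH10`): truncate, cut off near the `a_j`, extend by zero,
and push the support into `Ω` along the inward cones of the `C^{1,1}` domain. Thus a competitor outside
`φ_* + H¹₀(Ω)` has `G ψ = ⊤`. Traces of Sobolev functions enter through the
Gauss-Green formula, which is proved in charts (`gauss_green`).
-/

open scoped ENNReal Pointwise

noncomputable section

namespace BoundaryVortex

/-! ### Locally Lipschitz functions and weak gradients -/

lemma inner_gradient (f : ℂ → ℝ) (x v : ℂ) : inner ℝ (gradient f x) v = fderiv ℝ f x v := by
  simp [gradient]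

lemma norm_gradient (f : ℂ → ℝ) (x : ℂ) : ‖gradient f x‖ = ‖fderiv ℝ f x‖ := by
  simp [gradient]

lemma measurable_gradient (f : ℂ → ℝ) : Measurable (gradient f) := by
  unfold gradient
  exact (InnerProductSpace.toDual ℝ ℂ).symm.continuous.measurable.comp (measurable_fderiv ℝ f)

lemma _root_.LocallyLipschitzOn.comp_locallyLipschitz {E F : Type*} [PseudoEMetricSpace E]
    [PseudoEMetricSpace F] {Ω : Set ℂ} {f : ℂ → E} (hf : LocallyLipschitzOn Ω f) {T : E → F}
    (hT : LocallyLipschitz T) : LocallyLipschitzOn Ω (fun x => T (f x)) := by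
  intro x hx
  obtain ⟨K, t, ht, h⟩ := hf hx
  obtain ⟨K', t', ht', h'⟩ := hT (f x)
  have hc : Tendsto f (𝓝[Ω] x) (𝓝 (f x)) := hf.continuousOn x hx
  exact ⟨K' * K, t ∩ f ⁻¹' t', inter_mem ht (hc ht'),
    h'.comp (h.mono inter_subset_left) fun y hy => hy.2⟩

lemma _root_.LocallyLipschitzOn.prod {E F : Type*} [PseudoEMetricSpace E]
    [PseudoEMetricSpace F] {Ω : Set ℂ} {f : ℂ → E} {g : ℂ → F}
    (hf : LocallyLipschitzOn Ω f) (hg : LocallyLipschitzOn Ω g) :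
    LocallyLipschitzOn Ω (fun x => (f x, g x)) := by
  intro x hx
  obtain ⟨K, t, ht, h⟩ := hf hx
  obtain ⟨K', t', ht', h'⟩ := hg hx
  exact ⟨max K K', t ∩ t', inter_mem ht ht',
    (h.mono inter_subset_left).prodMk (h'.mono inter_subset_right)⟩

lemma _root_.LocallyLipschitzOn.real_mul {Ω : Set ℂ} {f g : ℂ → ℝ}
    (hf : LocallyLipschitzOn Ω f) (hg : LocallyLipschitzOn Ω g) :
    LocallyLipschitzOn Ω (fun x => f x * g x) :=
  (hf.prod hg).comp_locallyLipschitz (T := fun p : ℝ × ℝ => p.1 * p.2)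
    (contDiff_fst.mul contDiff_snd : ContDiff ℝ 1 _).locallyLipschitz

lemma _root_.LocallyLipschitzOn.real_sub {Ω : Set ℂ} {f g : ℂ → ℝ}
    (hf : LocallyLipschitzOn Ω f) (hg : LocallyLipschitzOn Ω g) :
    LocallyLipschitzOn Ω (fun x => f x - g x) :=
  (hf.prod hg).comp_locallyLipschitz (T := fun p : ℝ × ℝ => p.1 - p.2)
    (contDiff_fst.sub contDiff_snd : ContDiff ℝ 1 _).locallyLipschitz

lemma locallyLipschitz_of_tsupport_subset {Ω : Set ℂ} (hΩ : IsOpen Ω) {f : ℂ → ℝ}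
    (hf : LocallyLipschitzOn Ω f) (hs : tsupport f ⊆ Ω) : LocallyLipschitz f := by
  intro x
  by_cases hx : x ∈ Ω
  · obtain ⟨K, t, ht, h⟩ := hf hx
    exact ⟨K, t, by rwa [hΩ.nhdsWithin_eq hx] at ht, h⟩
  · refine ⟨0, (tsupport f)ᶜ, (isClosed_tsupport f).isOpen_compl.mem_nhds fun h => hx (hs h), ?_⟩
    intro y hy z hz
    simp [image_eq_zero_of_notMem_tsupport hy, image_eq_zero_of_notMem_tsupport hz]

/-- Points at distance at most `1` from the support are handled by compactness, the others by the
bound on `f`. -/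
lemma _root_.LocallyLipschitz.exists_lipschitzWith {f : ℂ → ℝ}
    (hf : LocallyLipschitz f) (hc : HasCompactSupport f) : ∃ C, LipschitzWith C f := by
  obtain ⟨C, hC⟩ := LocallyLipschitzOn.exists_lipschitzOnWith_of_compact
    (IsCompact.cthickening (r := 1) hc) (hf.locallyLipschitzOn)
  obtain ⟨M, hM⟩ := hc.exists_bound_of_continuous hf.continuous
  have hM0 : 0 ≤ M := (norm_nonneg _).trans (hM 0)
  have key : ∀ x ∈ tsupport f, ∀ y, dist (f x) (f y) ≤ max (C : ℝ) M * dist x y := by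
    intro x hx y
    by_cases hy : y ∈ Metric.cthickening 1 (tsupport f)
    · refine (hC.dist_le_mul x (Metric.self_subset_cthickening _ hx) y hy).trans ?_
      gcongr
      exact le_max_left _ _
    · have h1 : y ∉ tsupport f := fun h => hy (Metric.self_subset_cthickening _ h)
      have h2 : 1 ≤ dist x y := by
        by_contra! h
        exact hy (Metric.mem_cthickening_of_dist_le y x 1 _ hx (by rw [dist_comm]; exact h.le))
      rw [image_eq_zero_of_notMem_tsupport h1, dist_zero_right]
      calc ‖f x‖ ≤ M * 1 := by simpa using hM x
        _ ≤ max (C : ℝ) M * dist x y := by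
          gcongr
          exact le_max_right _ _
  refine ⟨⟨max (C : ℝ) M, le_max_of_le_right hM0⟩, LipschitzWith.of_dist_le_mul fun x y => ?_⟩
  change dist (f x) (f y) ≤ max (C : ℝ) M * dist x y
  by_cases hx : x ∈ tsupport f
  · exact key x hx y
  by_cases hy : y ∈ tsupport f
  · rw [dist_comm, dist_comm x]
    exact key y hy x
  · rw [image_eq_zero_of_notMem_tsupport hx, image_eq_zero_of_notMem_tsupport hy, dist_self]
    positivity

lemma _root_.LocallyLipschitzOn.ae_differentiableAt {Ω : Set ℂ} (hΩ : IsOpen Ω) {f : ℂ → ℝ}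
    (hf : LocallyLipschitzOn Ω f) : ∀ᵐ x, x ∈ Ω → DifferentiableAt ℝ f x := by
  rw [ae_iff]
  refine measure_null_of_locally_null _ fun x hx => ?_
  simp only [mem_ofPred_eq, Classical.not_imp] at hx
  obtain ⟨K, t, ht, h⟩ := hf hx.1
  rw [hΩ.nhdsWithin_eq hx.1] at ht
  obtain ⟨U, hU, hUo, hxU⟩ := mem_nhds_iff.1 ht
  have := (h.mono hU).ae_differentiableWithinAt_of_mem (μ := volume)
  rw [ae_iff] at this
  refine ⟨U ∩ {y | ¬(y ∈ Ω → DifferentiableAt ℝ f y)},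
    inter_comm _ _ ▸ inter_mem_nhdsWithin _ (hUo.mem_nhds hxU), measure_mono_null ?_ this⟩
  intro y hy
  simp only [mem_ofPred_eq, Classical.not_imp] at hy ⊢
  exact ⟨hy.1, fun h => hy.2.2 (h.differentiableAt (hUo.mem_nhds hy.1))⟩

lemma _root_.LocallyLipschitzOn.exists_bound {Ω : Set ℂ} (hΩ : IsOpen Ω) {f : ℂ → ℝ}
    (hf : LocallyLipschitzOn Ω f) {K : Set ℂ} (hK : IsCompact K) (hKΩ : K ⊆ Ω) :
    ∃ C, ∀ x ∈ K, |f x| ≤ C ∧ ‖fderiv ℝ f x‖ ≤ C := by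
  obtain ⟨δ, hδ, hδK⟩ := hK.exists_cthickening_subset_open hΩ hKΩ
  obtain ⟨C, hC⟩ := LocallyLipschitzOn.exists_lipschitzOnWith_of_compact
    (hK.cthickening (r := δ)) (hf.mono hδK)
  obtain ⟨M, hM⟩ := hK.exists_bound_of_continuousOn (hf.continuousOn.mono hKΩ)
  refine ⟨max C M, fun x hx => ⟨(hM x hx).trans (le_max_right _ _), ?_⟩⟩
  refine (norm_fderiv_le_of_lipschitzOn ℝ ?_ hC).trans (le_max_left _ _)
  refine mem_of_superset (Metric.closedBall_mem_nhds x hδ) ?_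
  exact Metric.closedBall_subset_cthickening hx δ

lemma integrable_of_bound_of_compact {E : Type*} [NormedAddCommGroup E] {μ : Measure ℂ}
    [IsFiniteMeasureOnCompacts μ] {g : ℂ → E} (hg : AEStronglyMeasurable g μ) {K : Set ℂ}
    (hK : IsCompact K) {C : ℝ} (hC : ∀ x ∈ K, ‖g x‖ ≤ C) (h0 : ∀ x ∉ K, g x = 0) :
    Integrable g μ := by
  rw [← integrableOn_iff_integrable_of_support_subset (s := K)
    (fun x hx => by_contra fun h => hx (h0 x h))]
  exact IntegrableOn.of_bound hK.measure_lt_top hg.restrict C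
    ((ae_restrict_iff' hK.measurableSet).2 (.of_forall hC))

lemma _root_.LocallyLipschitzOn.locallyIntegrableOn_gradient {Ω : Set ℂ} (hΩ : IsOpen Ω) {f : ℂ → ℝ}
    (hf : LocallyLipschitzOn Ω f) : LocallyIntegrableOn (gradient f) Ω := by
  rw [locallyIntegrableOn_iff hΩ.isLocallyClosed]
  intro K hKΩ hK
  obtain ⟨C, hC⟩ := hf.exists_bound hΩ hK hKΩ
  refine IntegrableOn.of_bound hK.measure_lt_top
    (measurable_gradient f).aestronglyMeasurable C ((ae_restrict_iff' hK.measurableSet).2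
    (.of_forall fun x hx => ?_))
  rw [norm_gradient]
  exact (hC x hx).2

lemma integral_fderiv_eq_zero_of_lipschitz {C : ℝ≥0} {g : ℂ → ℝ} (hg : LipschitzWith C g)
    (hc : HasCompactSupport g) (v : ℂ) : ∫ x, fderiv ℝ g x v = 0 := by
  have h := LipschitzWith.integral_lineDeriv_mul_eq (μ := volume)
    (LipschitzWith.const (1 : ℝ) : LipschitzWith 0 (fun _ : ℂ => (1 : ℝ))) hg hc (-v)
  simp only [lineDeriv, deriv_const, zero_mul, integral_zero, mul_one, neg_neg] at h
  rw [h]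
  refine integral_congr_ae ?_
  filter_upwards [hg.ae_differentiableAt (μ := volume)] with x hx
  rw [← hx.lineDeriv_eq_fderiv]
  rfl

/-- Integration by parts on an open set for two locally Lipschitz functions, one of which has
compact support in the set. -/
lemma integral_mul_fderiv_add {Ω : Set ℂ} (hΩ : IsOpen Ω) {f ζ : ℂ → ℝ}
    (hf : LocallyLipschitzOn Ω f) (hζ : LocallyLipschitzOn Ω ζ) (hc : HasCompactSupport ζ)
    (hs : tsupport ζ ⊆ Ω) (v : ℂ) :
    IntegrableOn (fun x => f x * fderiv ℝ ζ x v) Ω ∧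
      IntegrableOn (fun x => ζ x * fderiv ℝ f x v) Ω ∧
      ∫ x in Ω, f x * fderiv ℝ ζ x v = -∫ x in Ω, ζ x * fderiv ℝ f x v := by
  obtain ⟨Cf, hCf⟩ := hf.exists_bound hΩ hc hs
  obtain ⟨Cζ, hCζ⟩ := hζ.exists_bound hΩ hc hs
  have h0 : ∀ x ∉ tsupport ζ, fderiv ℝ ζ x = 0 := fun x hx =>
    image_eq_zero_of_notMem_tsupport fun h => hx (tsupport_fderiv_subset ℝ h)
  have i1 : IntegrableOn (fun x => f x * fderiv ℝ ζ x v) Ω := by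
    refine integrable_of_bound_of_compact (C := Cf * (Cζ * ‖v‖)) ?_ hc ?_ ?_
    · exact (hf.continuousOn.aestronglyMeasurable hΩ.measurableSet).mul
        (measurable_fderiv_apply_const ℝ ζ v).aestronglyMeasurable
    · intro x hx
      rw [norm_mul]
      have h1 : 0 ≤ Cf := (abs_nonneg _).trans (hCf x hx).1
      gcongr
      · exact (hCf x hx).1
      · exact ((fderiv ℝ ζ x).le_opNorm v).trans (by gcongr; exact (hCζ x hx).2)
    · intro x hx
      simp [h0 x hx]
  have i2 : IntegrableOn (fun x => ζ x * fderiv ℝ f x v) Ω := by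
    refine integrable_of_bound_of_compact (C := Cζ * (Cf * ‖v‖)) ?_ hc ?_ ?_
    · exact (hζ.continuousOn.aestronglyMeasurable hΩ.measurableSet).mul
        (measurable_fderiv_apply_const ℝ f v).aestronglyMeasurable
    · intro x hx
      rw [norm_mul]
      have h1 : 0 ≤ Cζ := (abs_nonneg _).trans (hCζ x hx).1
      gcongr
      · exact (hCζ x hx).1
      · exact ((fderiv ℝ f x).le_opNorm v).trans (by gcongr; exact (hCf x hx).2)
    · intro x hx
      simp [image_eq_zero_of_notMem_tsupport hx]
  refine ⟨i1, i2, ?_⟩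
  rw [← add_eq_zero_iff_eq_neg, ← integral_add i1 i2]
  have hts : tsupport (fun x => f x * ζ x) ⊆ tsupport ζ := tsupport_mul_subset_right
  have hcp : HasCompactSupport (fun x => f x * ζ x) := hc.mul_left
  have hloc : LocallyLipschitz (fun x => f x * ζ x) :=
    locallyLipschitz_of_tsupport_subset hΩ (hf.real_mul hζ) (hts.trans hs)
  obtain ⟨C, hC⟩ := LocallyLipschitz.exists_lipschitzWith hloc hcp
  have hz : ∀ x ∉ Ω, fderiv ℝ (fun x => f x * ζ x) x v = 0 := fun x hx => by
    rw [image_eq_zero_of_notMem_tsupport (f := fderiv ℝ fun x => f x * ζ x)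
      fun h => hx (hs (hts (tsupport_fderiv_subset ℝ h)))]
    rfl
  rw [← integral_fderiv_eq_zero_of_lipschitz hC hcp v,
    ← setIntegral_eq_integral_of_forall_compl_eq_zero hz]
  refine setIntegral_congr_ae hΩ.measurableSet ?_
  filter_upwards [hf.ae_differentiableAt hΩ, hζ.ae_differentiableAt hΩ] with x h1 h2 hx
  rw [fderiv_fun_mul (h1 hx) (h2 hx)]
  simp

lemma _root_.ContDiffOn.locallyLipschitzOn_of_isOpen {Ω : Set ℂ} (hΩ : IsOpen Ω) {f : ℂ → ℝ}
    (hf : ContDiffOn ℝ 1 f Ω) : LocallyLipschitzOn Ω f := by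
  intro x hx
  obtain ⟨K, t, ht, h⟩ := (hf.contDiffAt (hΩ.mem_nhds hx)).exists_lipschitzOnWith
  exact ⟨K, t, mem_nhdsWithin_of_mem_nhds ht, h⟩

lemma hasWeakGrad_of_locallyLipschitzOn {Ω : Set ℂ} (hΩ : IsOpen Ω) {f : ℂ → ℝ}
    (hf : LocallyLipschitzOn Ω f) : HasWeakGrad Ω f (gradient f) := by
  refine ⟨hf.continuousOn.locallyIntegrableOn hΩ.measurableSet,
    hf.locallyIntegrableOn_gradient hΩ, fun ζ hζ hc hs v => ?_⟩
  rw [(integral_mul_fderiv_add hΩ hf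
    ((hζ.of_le (by simp)).contDiffOn.locallyLipschitzOn_of_isOpen hΩ) hc hs v).2.2]
  simp_rw [inner_gradient, mul_comm]

lemma _root_.MeasureTheory.LocallyIntegrableOn.integrableOn_mul_test {Ω : Set ℂ} (hΩ : IsOpen Ω) {f ζ : ℂ → ℝ}
    (hf : LocallyIntegrableOn f Ω) (hζ : Continuous ζ) (hc : HasCompactSupport ζ)
    (hs : tsupport ζ ⊆ Ω) : IntegrableOn (fun x => f x * ζ x) Ω := by
  have h1 := (locallyIntegrableOn_iff hΩ.isLocallyClosed).1 hf _ hs hc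
  have h2 : IntegrableOn (fun x => f x * ζ x) (tsupport ζ) :=
    h1.mul_continuousOn hζ.continuousOn hc
  rw [integrableOn_iff_integrable_of_support_subset
    (fun x hx => by_contra fun h => hx (by simp [image_eq_zero_of_notMem_tsupport h]))] at h2
  exact h2.integrableOn

lemma _root_.MeasureTheory.LocallyIntegrableOn.inner_const {Ω : Set ℂ} {g : ℂ → ℂ}
    (hg : LocallyIntegrableOn g Ω) (v : ℂ) : LocallyIntegrableOn (fun x => inner ℝ (g x) v) Ω := by
  intro x hx
  obtain ⟨t, ht, h⟩ := hg x hx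
  exact ⟨t, ht, h.inner_const v⟩

lemma HasWeakGrad.ae_eq {Ω : Set ℂ} (hΩ : IsOpen Ω) {f : ℂ → ℝ} {g g' : ℂ → ℂ}
    (h : HasWeakGrad Ω f g) (h' : HasWeakGrad Ω f g') : g =ᵐ[volume.restrict Ω] g' := by
  have key : ∀ v : ℂ, ∀ᵐ x, x ∈ Ω → inner ℝ (g x) v - inner ℝ (g' x) v = 0 := by
    intro v
    refine hΩ.ae_eq_zero_of_integral_contDiff_smul_eq_zero
      ((h.2.1.inner_const v).sub (h'.2.1.inner_const v)) fun ζ hζ hc hs => ?_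
    have e := h.2.2 ζ hζ hc hs v
    rw [h'.2.2 ζ hζ hc hs v] at e
    have i1 := (h.2.1.inner_const v).integrableOn_mul_test hΩ hζ.continuous hc hs
    have i2 := (h'.2.1.inner_const v).integrableOn_mul_test hΩ hζ.continuous hc hs
    rw [← setIntegral_eq_integral_of_forall_compl_eq_zero (s := Ω)
      (fun x hx => by simp [image_eq_zero_of_notMem_tsupport fun h => hx (hs h)])]
    calc ∫ x in Ω, ζ x • (inner ℝ (g x) v - inner ℝ (g' x) v)
        = ∫ x in Ω, (inner ℝ (g x) v * ζ x - inner ℝ (g' x) v * ζ x) := by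
          congr 1 with x
          simp only [smul_eq_mul]
          ring
      _ = 0 := by
          rw [integral_sub i1 i2]
          linarith
  rw [Filter.EventuallyEq, ae_restrict_iff' hΩ.measurableSet]
  filter_upwards [key 1, key Complex.I] with x h1 h2 hx
  have h1 := h1 hx
  have h2 := h2 hx
  simp [Complex.inner] at h1 h2
  apply Complex.ext <;> linarith

lemma hasWeakGrad_weakGrad {Ω : Set ℂ} {f : ℂ → ℝ} (h : ∃ g, HasWeakGrad Ω f g) :
    HasWeakGrad Ω f (weakGrad Ω f) := by
  rw [weakGrad, dif_pos h]
  exact h.choose_spec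

lemma HasWeakGrad.weakGrad_ae_eq {Ω : Set ℂ} (hΩ : IsOpen Ω) {f : ℂ → ℝ} {g : ℂ → ℂ}
    (h : HasWeakGrad Ω f g) : weakGrad Ω f =ᵐ[volume.restrict Ω] g :=
  (hasWeakGrad_weakGrad ⟨g, h⟩).ae_eq hΩ h

lemma HasWeakGrad.add {Ω : Set ℂ} (hΩ : IsOpen Ω) {f f' : ℂ → ℝ} {g g' : ℂ → ℂ}
    (h : HasWeakGrad Ω f g) (h' : HasWeakGrad Ω f' g') :
    HasWeakGrad Ω (fun x => f x + f' x) (fun x => g x + g' x) := by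
  refine ⟨h.1.add h'.1, h.2.1.add h'.2.1, fun ζ hζ hc hs v => ?_⟩
  have hcont : Continuous fun x => fderiv ℝ ζ x v :=
    (hζ.continuous_fderiv (by simp)).clm_apply continuous_const
  have hcs : HasCompactSupport fun x => fderiv ℝ ζ x v := hc.fderiv_apply ℝ v
  have hss : tsupport (fun x => fderiv ℝ ζ x v) ⊆ Ω := (tsupport_fderiv_apply_subset ℝ v).trans hs
  simp_rw [add_mul, inner_add_left, add_mul]
  rw [integral_add (h.1.integrableOn_mul_test hΩ hcont hcs hss)
      (h'.1.integrableOn_mul_test hΩ hcont hcs hss),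
    integral_add ((h.2.1.inner_const v).integrableOn_mul_test hΩ hζ.continuous hc hs)
      ((h'.2.1.inner_const v).integrableOn_mul_test hΩ hζ.continuous hc hs),
    h.2.2 ζ hζ hc hs v, h'.2.2 ζ hζ hc hs v]
  ring

lemma HasWeakGrad.neg {Ω : Set ℂ} {f : ℂ → ℝ} {g : ℂ → ℂ}
    (h : HasWeakGrad Ω f g) : HasWeakGrad Ω (fun x => -f x) (fun x => -g x) := by
  refine ⟨h.1.neg, h.2.1.neg, fun ζ hζ hc hs v => ?_⟩
  simp only [neg_mul, inner_neg_left, integral_neg, h.2.2 ζ hζ hc hs v]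

lemma HasWeakGrad.sub {Ω : Set ℂ} (hΩ : IsOpen Ω) {f f' : ℂ → ℝ} {g g' : ℂ → ℂ}
    (h : HasWeakGrad Ω f g) (h' : HasWeakGrad Ω f' g') :
    HasWeakGrad Ω (fun x => f x - f' x) (fun x => g x - g' x) := by
  simpa only [sub_eq_add_neg] using h.add hΩ h'.neg

/-! ### Mollification in `L²` of the plane -/

lemma eLpNorm_two_sq {α E : Type*} [MeasurableSpace α] [NormedAddCommGroup E] (f : α → E)
    (μ : Measure α) : eLpNorm f 2 μ ^ 2 = ∫⁻ x, ‖f x‖ₑ ^ 2 ∂μ := by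
  have := eLpNorm_nnreal_pow_eq_lintegral (f := f) (μ := μ) (p := 2) (by norm_num)
  simpa using this

lemma lintegral_sq_le_of_lintegral_eq_one {α : Type*} [MeasurableSpace α] {μ : Measure α}
    {k G : α → ℝ≥0∞} (hk : AEMeasurable k μ) (hG : AEMeasurable G μ) (h1 : ∫⁻ x, k x ∂μ = 1) :
    (∫⁻ x, k x * G x ∂μ) ^ 2 ≤ ∫⁻ x, k x * G x ^ 2 ∂μ := by
  have e : ∀ x, k x * G x = k x ^ (1 / 2 : ℝ) * (k x ^ (1 / 2 : ℝ) * G x) := fun x => by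
    rw [← mul_assoc, ← ENNReal.rpow_add_of_nonneg _ _ (by norm_num) (by norm_num)]
    norm_num
  have h := ENNReal.lintegral_mul_le_Lp_mul_Lq μ Real.HolderConjugate.two_two
    (hk.pow_const (1 / 2 : ℝ)) ((hk.pow_const (1 / 2 : ℝ)).mul hG)
  have e1 : ∀ x, (k x ^ (1 / 2 : ℝ)) ^ (2 : ℝ) = k x := fun x => by
    rw [← ENNReal.rpow_mul]; norm_num
  simp only [Pi.mul_apply, ENNReal.mul_rpow_of_nonneg _ _ (zero_le_two : (0 : ℝ) ≤ 2), e1, h1,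
    ← e, ENNReal.one_rpow, one_mul] at h
  calc (∫⁻ x, k x * G x ∂μ) ^ 2 ≤ ((∫⁻ x, k x * G x ^ (2 : ℝ) ∂μ) ^ (1 / 2 : ℝ)) ^ 2 := by gcongr
    _ = ∫⁻ x, k x * G x ^ 2 ∂μ := by
      rw [← ENNReal.rpow_natCast, ← ENNReal.rpow_mul]
      norm_num

/-- A smooth, compactly supported, nonnegative convolution kernel of total mass one. It is not
required to be centred at the origin, so that mollification can be combined with a translation. -/
structure IsMollifier (k : ℂ → ℝ) : Prop where
  contDiff : ContDiff ℝ ∞ k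
  hasCompactSupport : HasCompactSupport k
  nonneg : ∀ x, 0 ≤ k x
  integral_eq_one : ∫ x, k x = 1

lemma isMollifier_normed {c : ℂ} (φ : ContDiffBump c) : IsMollifier (φ.normed volume) :=
  ⟨φ.contDiff_normed, φ.hasCompactSupport_normed, φ.nonneg_normed, φ.integral_normed⟩

/-- The convolution `k ⋆ v`. -/
def mollify {E : Type*} [NormedAddCommGroup E] [NormedSpace ℝ E] (k : ℂ → ℝ) (v : ℂ → E) :
    ℂ → E :=
  convolution k v (ContinuousLinearMap.lsmul ℝ ℝ) volume

section

variable {E : Type*} [NormedAddCommGroup E] [NormedSpace ℝ E]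

lemma mollify_apply (k : ℂ → ℝ) (v : ℂ → E) (x : ℂ) : mollify k v x = ∫ t, k t • v (x - t) := by
  simp [mollify, convolution_def]

lemma IsMollifier.lintegral_eq_one {k : ℂ → ℝ} (hk : IsMollifier k) :
    ∫⁻ x, ENNReal.ofReal (k x) = 1 := by
  rw [← ofReal_integral_eq_lintegral_ofReal
    (hk.contDiff.continuous.integrable_of_hasCompactSupport hk.hasCompactSupport)
    (.of_forall hk.nonneg), hk.integral_eq_one, ENNReal.ofReal_one]

lemma IsMollifier.integrable_smul {k : ℂ → ℝ} (hk : IsMollifier k) {v : ℂ → E}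
    (hv : LocallyIntegrable v) (x : ℂ) : Integrable fun t => k t • v (x - t) :=
  hk.hasCompactSupport.convolutionExists_left (ContinuousLinearMap.lsmul ℝ ℝ)
    hk.contDiff.continuous hv x

lemma IsMollifier.contDiff_mollify [CompleteSpace E] {k : ℂ → ℝ} (hk : IsMollifier k) {v : ℂ → E}
    (hv : LocallyIntegrable v) : ContDiff ℝ ∞ (mollify k v) :=
  hk.hasCompactSupport.contDiff_convolution_left _ hk.contDiff hv

/-- The mollification error is at most the largest translation error over the kernel's support:
Jensen's inequality for the probability density `k`. -/
lemma IsMollifier.eLpNorm_mollify_sub_le [CompleteSpace E] {k : ℂ → ℝ} (hk : IsMollifier k)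
    {v : ℂ → E} (hv : LocallyIntegrable v) {ε : ℝ≥0∞}
    (hε : ∀ y, k y ≠ 0 → eLpNorm (fun x => v (x - y) - v x) 2 volume ≤ ε) :
    eLpNorm (fun x => mollify k v x - v x) 2 volume ≤ ε := by
  have hvm : AEStronglyMeasurable v volume := hv.aestronglyMeasurable
  have hkm : Measurable fun t => ENNReal.ofReal (k t) :=
    hk.contDiff.continuous.measurable.ennreal_ofReal
  have hki : Integrable k :=
    hk.contDiff.continuous.integrable_of_hasCompactSupport hk.hasCompactSupport
  have hsub : AEStronglyMeasurable (fun p : ℂ × ℂ => v (p.1 - p.2) - v p.1)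
      (volume.prod volume) := by
    refine AEStronglyMeasurable.sub ?_ hvm.comp_fst
    exact hvm.comp_quasiMeasurePreserving
      (quasiMeasurePreserving_sub_of_right_invariant volume volume)
  have h1 : ∀ x, ‖mollify k v x - v x‖ₑ ^ 2 ≤
      ∫⁻ t, ENNReal.ofReal (k t) * ‖v (x - t) - v x‖ₑ ^ 2 := by
    intro x
    have e : mollify k v x - v x = ∫ t, k t • (v (x - t) - v x) := by
      simp_rw [smul_sub]
      rw [integral_sub (hk.integrable_smul hv x) (hki.smul_const _), integral_smul_const,
        hk.integral_eq_one, one_smul, mollify_apply]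
    have hm : AEMeasurable (fun t => ‖v (x - t) - v x‖ₑ) volume := by
      refine AEStronglyMeasurable.enorm (AEStronglyMeasurable.sub ?_ aestronglyMeasurable_const)
      exact hvm.comp_quasiMeasurePreserving
        (quasiMeasurePreserving_sub_left_of_right_invariant volume x)
    calc ‖mollify k v x - v x‖ₑ ^ 2
        ≤ (∫⁻ t, ENNReal.ofReal (k t) * ‖v (x - t) - v x‖ₑ) ^ 2 := by
          gcongr
          rw [e]
          refine (enorm_integral_le_lintegral_enorm _).trans_eq (lintegral_congr fun t => ?_)
          rw [enorm_smul, Real.enorm_of_nonneg (hk.nonneg t)]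
      _ ≤ _ := lintegral_sq_le_of_lintegral_eq_one hkm.aemeasurable hm hk.lintegral_eq_one
  have h2 : eLpNorm (fun x => mollify k v x - v x) 2 volume ^ 2 ≤ ε ^ 2 := by
    rw [eLpNorm_two_sq]
    calc ∫⁻ x, ‖mollify k v x - v x‖ₑ ^ 2
        ≤ ∫⁻ x, ∫⁻ t, ENNReal.ofReal (k t) * ‖v (x - t) - v x‖ₑ ^ 2 := lintegral_mono h1
      _ = ∫⁻ t, ∫⁻ x, ENNReal.ofReal (k t) * ‖v (x - t) - v x‖ₑ ^ 2 := by
        refine lintegral_lintegral_swap ?_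
        exact (hkm.comp measurable_snd).aemeasurable.mul (hsub.enorm.pow_const 2)
      _ ≤ ∫⁻ t, ENNReal.ofReal (k t) * ε ^ 2 := by
        refine lintegral_mono fun t => ?_
        rw [lintegral_const_mul' _ _ ENNReal.ofReal_ne_top]
        by_cases hkt : k t = 0
        · simp [hkt]
        · rw [← eLpNorm_two_sq (fun x => v (x - t) - v x)]
          gcongr
          exact hε t hkt
      _ = ε ^ 2 := by
        rw [lintegral_mul_const _ hkm, hk.lintegral_eq_one, one_mul]
  exact (ENNReal.pow_le_pow_left_iff two_ne_zero).1 h2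

/-- Continuity of translations in `L²`. -/
lemma exists_eLpNorm_translate_sub_le {F : Type*} [NormedAddCommGroup F] {v : ℂ → F} (hv : MemLp v 2 volume) {ε : ℝ} (hε : 0 < ε) :
    ∃ δ > 0, ∀ y : ℂ, ‖y‖ < δ →
      eLpNorm (fun x => v (x - y) - v x) 2 volume ≤ ENNReal.ofReal ε := by
  have : Fact ((2 : ℝ≥0∞) ≠ ⊤) := ⟨by norm_num⟩
  have hc : Continuous fun c : ℂ => (DomAddAct.mk (-c)) +ᵥ hv.toLp v := by
    have : Continuous fun c : ℂ => DomAddAct.mk (-c) :=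
      DomAddAct.continuous_mk.comp continuous_neg
    fun_prop
  have h0 := Metric.continuousAt_iff.1 (hc.continuousAt (x := 0)) ε hε
  obtain ⟨δ, hδ, h⟩ := h0
  refine ⟨δ, hδ, fun y hy => ?_⟩
  have h1 := h (x := y) (by simpa using hy)
  have hz : DomAddAct.mk (-(0 : ℂ)) +ᵥ hv.toLp v = hv.toLp v := by
    simp
  rw [hz, DomAddAct.mk_vadd_toLp, dist_eq_norm, ← MemLp.toLp_sub, Lp.norm_toLp] at h1
  refine ENNReal.le_ofReal_iff_toReal_le ?_ hε.le |>.2 ?_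
  · refine (MemLp.sub (hv.comp_measurePreserving (measurePreserving_sub_right volume y)) hv).2.ne
  · refine le_trans (le_of_eq ?_) h1.le
    congr 2 with x
    simp [sub_eq_neg_add]

lemma enorm_translate_sub_sq_le {ζ : ℂ → ℝ} (hζ : ContDiff ℝ 1 ζ) (x y : ℂ) :
    ‖ζ (x - y) - ζ x‖ₑ ^ 2 ≤
      ‖y‖ₑ ^ 2 * ∫⁻ s in Ioc (0 : ℝ) 1, ‖fderiv ℝ ζ (x - s • y)‖ₑ ^ 2 := by
  have hd : ∀ s : ℝ, HasDerivAt (fun s : ℝ => ζ (x - s • y)) (fderiv ℝ ζ (x - s • y) (-y)) s := by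
    intro s
    have h1 : HasDerivAt (fun s : ℝ => x - s • y) (-y) s := by
      simpa using ((hasDerivAt_id s).smul_const y).const_sub x
    exact ((hζ.differentiable (by simp) _).hasFDerivAt).comp_hasDerivAt s h1
  have hcont : Continuous fun s : ℝ => fderiv ℝ ζ (x - s • y) (-y) :=
    ((hζ.continuous_fderiv (by simp)).comp (by fun_prop)).clm_apply continuous_const
  have e := intervalIntegral.integral_eq_sub_of_hasDerivAt (a := 0) (b := 1)
    (fun s _ => hd s) (hcont.intervalIntegrable _ _)
  simp only [one_smul, zero_smul, sub_zero] at e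
  rw [← e, intervalIntegral.integral_of_le zero_le_one]
  have hm : Measurable fun s : ℝ => ‖fderiv ℝ ζ (x - s • y)‖ₑ :=
    ((hζ.continuous_fderiv (by simp)).comp (by fun_prop)).measurable.enorm
  calc ‖∫ s in Ioc (0 : ℝ) 1, fderiv ℝ ζ (x - s • y) (-y)‖ₑ ^ 2
      ≤ (∫⁻ s in Ioc (0 : ℝ) 1, 1 * (‖y‖ₑ * ‖fderiv ℝ ζ (x - s • y)‖ₑ)) ^ 2 := by
        gcongr
        refine (enorm_integral_le_lintegral_enorm _).trans (lintegral_mono fun s => ?_)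
        rw [one_mul, mul_comm, ← enorm_neg y]
        exact ContinuousLinearMap.le_opENorm _ _
    _ ≤ ∫⁻ s in Ioc (0 : ℝ) 1, 1 * (‖y‖ₑ * ‖fderiv ℝ ζ (x - s • y)‖ₑ) ^ 2 :=
        lintegral_sq_le_of_lintegral_eq_one aemeasurable_const (hm.const_mul _).aemeasurable
          (by simp)
    _ = _ := by
        simp_rw [one_mul, mul_pow]
        rw [lintegral_const_mul _ (hm.pow_const 2)]

lemma eLpNorm_translate_sub_le {ζ : ℂ → ℝ} (hζ : ContDiff ℝ 1 ζ) (y : ℂ) :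
    eLpNorm (fun x => ζ (x - y) - ζ x) 2 volume ≤ ‖y‖ₑ * eLpNorm (fderiv ℝ ζ) 2 volume := by
  rw [← ENNReal.pow_le_pow_left_iff two_ne_zero, mul_pow, eLpNorm_two_sq, eLpNorm_two_sq]
  have hm : Measurable fun p : ℂ × ℝ => ‖fderiv ℝ ζ (p.1 - p.2 • y)‖ₑ ^ 2 :=
    (((hζ.continuous_fderiv (by simp)).comp (by fun_prop)).measurable.enorm).pow_const 2
  calc ∫⁻ x, ‖ζ (x - y) - ζ x‖ₑ ^ 2
      ≤ ∫⁻ x, ‖y‖ₑ ^ 2 * ∫⁻ s in Ioc (0 : ℝ) 1, ‖fderiv ℝ ζ (x - s • y)‖ₑ ^ 2 :=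
        lintegral_mono fun x => enorm_translate_sub_sq_le hζ x y
    _ = ‖y‖ₑ ^ 2 * ∫⁻ s in Ioc (0 : ℝ) 1, ∫⁻ x, ‖fderiv ℝ ζ (x - s • y)‖ₑ ^ 2 := by
        rw [lintegral_const_mul _ hm.lintegral_prod_right', lintegral_lintegral_swap]
        exact hm.aemeasurable
    _ = ‖y‖ₑ ^ 2 * ∫⁻ x, ‖fderiv ℝ ζ x‖ₑ ^ 2 := by
        simp_rw [lintegral_sub_right_eq_self (fun x => ‖fderiv ℝ ζ x‖ₑ ^ 2)]
        simp

lemma fderiv_comp_const_sub_apply {k : ℂ → ℝ} (hk : Differentiable ℝ k) (x t w : ℂ) :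
    fderiv ℝ (fun t => k (x - t)) t w = -(fderiv ℝ k (x - t) w) := by
  have h1 : HasFDerivAt (fun t : ℂ => x - t) (-ContinuousLinearMap.id ℝ ℂ) t :=
    (hasFDerivAt_id t).const_sub x
  have h2 : HasFDerivAt (fun t => k (x - t)) _ t := (hk (x - t)).hasFDerivAt.comp t h1
  rw [h2.fderiv]
  simp

lemma IsMollifier.fderiv_mollify_apply {k : ℂ → ℝ} (hk : IsMollifier k) {v : ℂ → ℝ}
    (hv : LocallyIntegrable v) (x w : ℂ) :
    fderiv ℝ (mollify k v) x w = ∫ t, v t * fderiv ℝ k (x - t) w := by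
  have hd := hk.hasCompactSupport.hasFDerivAt_convolution_left
    (ContinuousLinearMap.lsmul ℝ ℝ) (hk.contDiff.of_le (by simp)) hv x
  have hdk : Continuous (fderiv ℝ k) := hk.contDiff.continuous_fderiv (by simp)
  have i1 := (hk.hasCompactSupport.fderiv ℝ).convolutionExists_left
      (ContinuousLinearMap.precompL ℂ (ContinuousLinearMap.lsmul ℝ ℝ)) hdk hv x
  rw [mollify, hd.fderiv, convolution_def, ContinuousLinearMap.integral_apply i1,
    ← integral_sub_left_eq_self _ volume x]
  congr 1 with t
  rw [ContinuousLinearMap.precompL_apply, ContinuousLinearMap.lsmul_apply, sub_sub_cancel,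
    smul_eq_mul, mul_comm]

lemma IsMollifier.gradient_mollify {k : ℂ → ℝ} (hk : IsMollifier k) {v : ℂ → ℝ} {g : ℂ → ℂ}
    (h : HasWeakGrad univ v g) (x : ℂ) : gradient (mollify k v) x = mollify k g x := by
  have hv : LocallyIntegrable v := locallyIntegrableOn_univ.1 h.1
  have hg : LocallyIntegrable g := locallyIntegrableOn_univ.1 h.2.1
  refine ext_inner_right ℝ fun w => ?_
  have e2 := h.2.2 (fun t => k (x - t)) (hk.contDiff.comp (by fun_prop))
    (hk.hasCompactSupport.comp_homeomorph (Homeomorph.subLeft x)) (subset_univ _) w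
  simp only [Measure.restrict_univ,
    fderiv_comp_const_sub_apply (hk.contDiff.differentiable (by simp)), mul_neg, integral_neg,
    neg_inj] at e2
  rw [inner_gradient, hk.fderiv_mollify_apply hv, e2, mollify_apply, real_inner_comm,
    ← integral_inner (hk.integrable_smul hg x), ← integral_sub_left_eq_self _ volume x]
  congr 1 with t
  rw [sub_sub_cancel, inner_smul_right, real_inner_comm, mul_comm]

lemma IsMollifier.tsupport_mollify_subset {k : ℂ → ℝ} (hk : IsMollifier k) {v : ℂ → E}
    {K : Set ℂ} (hK : IsCompact K) (hv : ∀ x ∉ K, v x = 0) :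
    HasCompactSupport (mollify k v) ∧ tsupport (mollify k v) ⊆ tsupport k + K := by
  have hc : IsCompact (tsupport k + K) := IsCompact.add hk.hasCompactSupport hK
  have hs : Function.support (mollify k v) ⊆ tsupport k + K := by
    refine (support_convolution_subset _).trans (add_subset_add (subset_tsupport _) ?_)
    exact fun x hx => by_contra fun h => hx (hv x h)
  exact ⟨HasCompactSupport.of_support_subset_isCompact hc hs, closure_minimal hs hc.isClosed⟩

end

/-! ### Approximation of functions with vanishing boundary values -/

/-- `ζ` is a smooth function with compact support in `Ω`. -/
def IsTest (Ω : Set ℂ) (ζ : ℂ → ℝ) : Prop :=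
  ContDiff ℝ ∞ ζ ∧ HasCompactSupport ζ ∧ tsupport ζ ⊆ Ω

lemma IsTest.continuous_gradient {Ω : Set ℂ} {ζ : ℂ → ℝ} (h : IsTest Ω ζ) :
    Continuous (gradient ζ) :=
  (InnerProductSpace.toDual ℝ ℂ).symm.continuous.comp (h.1.continuous_fderiv (by simp))

lemma isTest_zero (Ω : Set ℂ) : IsTest Ω (fun _ => 0) := by
  refine ⟨contDiff_const, HasCompactSupport.zero, ?_⟩
  simp [tsupport, Function.support]

lemma IsTest.add {Ω : Set ℂ} {ζ ξ : ℂ → ℝ} (h : IsTest Ω ζ) (h' : IsTest Ω ξ) :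
    IsTest Ω (fun x => ζ x + ξ x) :=
  ⟨h.1.add h'.1, h.2.1.add h'.2.1,
    (tsupport_add ζ ξ).trans (union_subset h.2.2 h'.2.2)⟩

lemma gradient_fun_add {f f' : ℂ → ℝ} {x : ℂ} (h : DifferentiableAt ℝ f x)
    (h' : DifferentiableAt ℝ f' x) :
    gradient (fun x => f x + f' x) x = gradient f x + gradient f' x := by
  simp only [gradient, fderiv_fun_add h h', map_add]

lemma gradient_fun_mul {f f' : ℂ → ℝ} {x : ℂ} (h : DifferentiableAt ℝ f x)
    (h' : DifferentiableAt ℝ f' x) :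
    gradient (fun x => f x * f' x) x = f x • gradient f' x + f' x • gradient f x := by
  simp [gradient, fderiv_fun_mul h h']

lemma IsTest.sum {ι : Type*} {Ω : Set ℂ} (s : Finset ι) {ζ : ι → ℂ → ℝ}
    (h : ∀ i, IsTest Ω (ζ i)) :
    IsTest Ω (fun x => ∑ i ∈ s, ζ i x) ∧
      ∀ x, gradient (fun x => ∑ i ∈ s, ζ i x) x = ∑ i ∈ s, gradient (ζ i) x := by
  classical
  induction s using Finset.induction_on with
  | empty => exact ⟨by simpa using isTest_zero Ω, fun x => by simp [gradient]⟩
  | insert i s hi ih =>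
    simp only [Finset.sum_insert hi]
    refine ⟨(h i).add ih.1, fun x => ?_⟩
    rw [gradient_fun_add ((h i).1.differentiable (by simp) x) (ih.1.1.differentiable (by simp) x),
      ih.2]

/-- `Ω` satisfies a uniform inward cone condition: close to each point of its closure, some
fixed direction (possibly zero, at interior points) leads from the closure into `Ω`, with room
for a perturbation proportional to the length of the step. -/
def HasInwardCone (Ω : Set ℂ) : Prop :=
  ∀ p ∈ closure Ω, ∃ V : Set ℂ, IsOpen V ∧ p ∈ V ∧ ∃ b : ℂ, ∃ c > 0, ∃ t₀ > 0,
    ∀ z ∈ V ∩ closure Ω, ∀ t ∈ Ioo (0 : ℝ) t₀, ∀ w : ℂ, ‖w‖ ≤ c * t → z + t • b + w ∈ Ω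

lemma exists_finite_partition {K : Set ℂ} (hK : IsCompact K) {V : ℂ → Set ℂ}
    (hV : ∀ p ∈ K, IsOpen (V p) ∧ p ∈ V p) :
    ∃ (ι : Type) (_ : Fintype ι) (p : ι → ℂ) (χ : ι → ℂ → ℝ), (∀ i, p i ∈ K ∧
      ContDiff ℝ ∞ (χ i) ∧ HasCompactSupport (χ i) ∧ tsupport (χ i) ⊆ V (p i)) ∧
      ∀ x ∈ K, ∑ i, χ i x = 1 := by
  obtain ⟨s, hs, hcov⟩ := hK.elim_nhds_subcover (fun p => V p ∩ Metric.ball p 1)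
    (fun p hp => inter_mem ((hV p hp).1.mem_nhds (hV p hp).2) (Metric.ball_mem_nhds _ one_pos))
  obtain ⟨f, hf⟩ := SmoothPartitionOfUnity.exists_isSubordinate (modelWithCornersSelf ℝ ℂ)
    hK.isClosed (fun i : s => V i ∩ Metric.ball (i : ℂ) 1)
    (fun i => (hV i (hs i i.2)).1.inter Metric.isOpen_ball) (by
      intro x hx
      obtain ⟨p, hp, hxp⟩ := mem_iUnion₂.1 (hcov hx)
      exact mem_iUnion.2 ⟨⟨p, hp⟩, hxp⟩)
  refine ⟨s, inferInstance, fun i => i, fun i => f i, fun i => ⟨hs i i.2, (f i).contMDiff.contDiff,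
    ?_, (hf i).trans inter_subset_left⟩, fun x hx => ?_⟩
  · exact HasCompactSupport.of_support_subset_isCompact (isCompact_closedBall (i : ℂ) 1)
      ((subset_tsupport _).trans ((hf i).trans (inter_subset_right.trans
        Metric.ball_subset_closedBall)))
  · rw [← finsum_eq_sum_of_fintype]
    exact f.sum_eq_one hx

/-- The product rule for weak gradients: `χ ζ` is again a test function. -/
lemma HasWeakGrad.mul_smooth {Ω : Set ℂ} (hΩ : IsOpen Ω) {σ χ : ℂ → ℝ} {g : ℂ → ℂ}
    (h : HasWeakGrad Ω σ g) (hχ : ContDiff ℝ ∞ χ) :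
    HasWeakGrad Ω (fun x => χ x * σ x) (fun x => χ x • g x + σ x • gradient χ x) := by
  have hgr : Continuous (gradient χ) :=
    (InnerProductSpace.toDual ℝ ℂ).symm.continuous.comp (hχ.continuous_fderiv (by simp))
  have hl1 : LocallyIntegrableOn (fun x => χ x * σ x) Ω :=
    h.1.continuousOn_smul hΩ.isLocallyClosed hχ.continuous.continuousOn
  have hl2 : LocallyIntegrableOn (fun x => χ x • g x + σ x • gradient χ x) Ω :=
    (h.2.1.continuousOn_smul hΩ.isLocallyClosed hχ.continuous.continuousOn).add
      (h.1.smul_continuousOn hΩ.isLocallyClosed hgr.continuousOn)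
  refine ⟨hl1, hl2, fun ζ hζ hc hs v => ?_⟩
  have e := h.2.2 (fun x => χ x * ζ x) (hχ.mul hζ) hc.mul_left
    (tsupport_mul_subset_right.trans hs) v
  have hd : ∀ x, fderiv ℝ (fun x => χ x * ζ x) x v = χ x * fderiv ℝ ζ x v + fderiv ℝ χ x v * ζ x :=
    fun x => by
      rw [fderiv_fun_mul (hχ.differentiable (by simp) x) (hζ.differentiable (by simp) x)]
      simp [mul_comm]
  have c1 : Continuous fun x => χ x * fderiv ℝ ζ x v :=
    hχ.continuous.mul ((hζ.continuous_fderiv (by simp)).clm_apply continuous_const)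
  have c2 : Continuous fun x => fderiv ℝ χ x v :=
    (hχ.continuous_fderiv (by simp)).clm_apply continuous_const
  have i1 : IntegrableOn (fun x => σ x * (χ x * fderiv ℝ ζ x v)) Ω :=
    h.1.integrableOn_mul_test hΩ c1 (hc.fderiv_apply ℝ v).mul_left
      (tsupport_mul_subset_right.trans ((tsupport_fderiv_apply_subset ℝ v).trans hs))
  have i2 : IntegrableOn (fun x => σ x * (fderiv ℝ χ x v * ζ x)) Ω :=
    h.1.integrableOn_mul_test hΩ (c2.mul hζ.continuous) hc.mul_left
      (tsupport_mul_subset_right.trans hs)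
  have i3 : IntegrableOn (fun x => inner ℝ (g x) v * (χ x * ζ x)) Ω :=
    (h.2.1.inner_const v).integrableOn_mul_test hΩ (hχ.continuous.mul hζ.continuous) hc.mul_left
      (tsupport_mul_subset_right.trans hs)
  simp_rw [hd, mul_add] at e
  rw [integral_add i1 i2] at e
  simp_rw [inner_add_left, real_inner_smul_left, inner_gradient]
  rw [show (fun x => (χ x * inner ℝ (g x) v + σ x * fderiv ℝ χ x v) * ζ x) =
    fun x => inner ℝ (g x) v * (χ x * ζ x) + σ x * (fderiv ℝ χ x v * ζ x) from
      funext fun x => by ring, integral_add i3 i2]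
  rw [show (fun x => χ x * σ x * fderiv ℝ ζ x v) = fun x => σ x * (χ x * fderiv ℝ ζ x v) from
    funext fun x => by ring]
  linarith

/-- Translating into the cone and mollifying approximates an `H¹` function of the plane that
vanishes off a compact set by test functions of `Ω`. -/
lemma exists_isTest_of_cone {Ω : Set ℂ} {v : ℂ → ℝ} {g : ℂ → ℂ} (hv : MemLp v 2 volume)
    (hg : MemLp g 2 volume) (hw : HasWeakGrad univ v g) {K : Set ℂ} (hK : IsCompact K)
    (hvK : ∀ x ∉ K, v x = 0) {b : ℂ} {c t₀ : ℝ} (hc : 0 < c) (ht₀ : 0 < t₀)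
    (hcone : ∀ z ∈ K, ∀ t ∈ Ioo (0 : ℝ) t₀, ∀ w : ℂ, ‖w‖ ≤ c * t → z + t • b + w ∈ Ω)
    {ε : ℝ} (hε : 0 < ε) :
    ∃ ζ, IsTest Ω ζ ∧ eLpNorm (fun x => ζ x - v x) 2 volume ≤ ENNReal.ofReal ε ∧
      eLpNorm (fun x => gradient ζ x - g x) 2 volume ≤ ENNReal.ofReal ε := by
  obtain ⟨δ, hδ, h1⟩ := exists_eLpNorm_translate_sub_le hv hε
  obtain ⟨δ', hδ', h2⟩ := exists_eLpNorm_translate_sub_le hg hε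
  have hb : 0 < ‖b‖ + c := by positivity
  obtain ⟨t, ht, htm⟩ : ∃ t : ℝ, 0 < t ∧ t < min t₀ (min (δ / (‖b‖ + c)) (δ' / (‖b‖ + c))) :=
    exists_between (by positivity)
  simp only [lt_min_iff, lt_div_iff₀ hb] at htm
  -- the kernel is supported in the ball around `t • b`, so that convolution moves `K` into `Ω`
  let φ : ContDiffBump (t • b) := ⟨c * t / 2, c * t, by positivity, by linarith [mul_pos hc ht]⟩
  have hk := isMollifier_normed φ
  have hsup : ∀ y, φ.normed volume y ≠ 0 → ‖y‖ < t * (‖b‖ + c) := by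
    intro y hy
    have hy' : y ∈ Function.support (φ.normed volume) := hy
    rw [φ.support_normed_eq, Metric.mem_ball, dist_eq_norm] at hy'
    have hy'' : ‖y - t • b‖ < c * t := hy'
    calc ‖y‖ = ‖(y - t • b) + t • b‖ := by simp
      _ ≤ ‖y - t • b‖ + ‖t • b‖ := norm_add_le _ _
      _ < c * t + t * ‖b‖ := by
        rw [norm_smul, Real.norm_of_nonneg ht.le]
        gcongr
      _ = _ := by ring
  have hvl : LocallyIntegrable v := hv.locallyIntegrable (by norm_num)
  have hgl : LocallyIntegrable g := hg.locallyIntegrable (by norm_num)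
  refine ⟨mollify (φ.normed volume) v, ⟨hk.contDiff_mollify hvl,
    (hk.tsupport_mollify_subset hK hvK).1, ?_⟩, ?_, ?_⟩
  · refine (hk.tsupport_mollify_subset hK hvK).2.trans ?_
    rw [φ.tsupport_normed_eq]
    rintro _ ⟨y, hy, z, hz, rfl⟩
    have := hcone z hz t ⟨ht, htm.1⟩ (y - t • b) (by rw [← dist_eq_norm]; exact hy)
    rw [show z + t • b + (y - t • b) = y + z by ring] at this
    exact this
  · exact hk.eLpNorm_mollify_sub_le hvl fun y hy => h1 y ((hsup y hy).trans htm.2.1)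
  · rw [show (fun x => gradient (mollify (φ.normed volume) v) x - g x) =
      fun x => mollify (φ.normed volume) g x - g x from funext fun x => by
        rw [hk.gradient_mollify hw]]
    exact hk.eLpNorm_mollify_sub_le hgl fun y hy => h2 y ((hsup y hy).trans htm.2.2)

lemma _root_.MeasureTheory.MemLp.bdd_mul_compact {E : Type*} [NormedAddCommGroup E] [NormedSpace ℝ E]
    {f : ℂ → E} (hf : MemLp f 2 volume) {χ : ℂ → ℝ} (hχ : Continuous χ)
    (hc : HasCompactSupport χ) : MemLp (fun x => χ x • f x) 2 volume := by
  obtain ⟨C, hC⟩ := hc.exists_bound_of_continuous hχ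
  exact MemLp.smul (p := ⊤) (q := 2) (r := 2) hf
    (memLp_top_of_bound hχ.aestronglyMeasurable C (.of_forall hC))

/-- On a bounded set with the inward cone property, an `H¹` function of the plane that vanishes
outside the set is an `H¹` limit of test functions. -/
lemma exists_isTest_of_hasWeakGrad_univ {Ω : Set ℂ} (hΩ : IsOpen Ω)
    (hb : Bornology.IsBounded Ω) (hcone : HasInwardCone Ω) {v : ℂ → ℝ} {g : ℂ → ℂ}
    (hv : MemLp v 2 volume) (hg : MemLp g 2 volume) (hw : HasWeakGrad univ v g)
    (hv0 : ∀ x ∉ Ω, v x = 0) (hg0 : ∀ x ∉ Ω, g x = 0) {ε : ℝ} (hε : 0 < ε) :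
    ∃ ζ, IsTest Ω ζ ∧ eLpNorm (fun x => ζ x - v x) 2 volume ≤ ENNReal.ofReal ε ∧
      eLpNorm (fun x => gradient ζ x - g x) 2 volume ≤ ENNReal.ofReal ε := by
  -- localize by a partition of unity on `closure Ω` subordinate to the cones
  choose! V hVo hpV b c hc t₀ ht₀ hV using hcone
  obtain ⟨ι, _, p, χ, hχ, hone'⟩ := exists_finite_partition hb.isCompact_closure
    (fun p hp => ⟨hVo p hp, hpV p hp⟩)
  obtain ⟨ε', hε', hsum⟩ : ∃ ε' > 0, (Fintype.card ι : ℝ) * ε' ≤ ε := by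
    refine ⟨ε / (Fintype.card ι + 1), by positivity, ?_⟩
    rw [mul_div_assoc', div_le_iff₀ (by positivity)]
    nlinarith
  have hgr : ∀ i, Continuous (gradient (χ i)) := fun i =>
    (InnerProductSpace.toDual ℝ ℂ).symm.continuous.comp ((hχ i).2.1.continuous_fderiv (by simp))
  have hgc : ∀ i, HasCompactSupport (gradient (χ i)) := fun i =>
    ((hχ i).2.2.1.fderiv ℝ).comp_left (map_zero _)
  have hi : ∀ i, ∃ ζ, IsTest Ω ζ ∧
      eLpNorm (fun x => ζ x - χ i x * v x) 2 volume ≤ ENNReal.ofReal ε' ∧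
      eLpNorm (fun x => gradient ζ x - (χ i x • g x + v x • gradient (χ i) x)) 2 volume ≤
        ENNReal.ofReal ε' := by
    intro i
    have hp := (hχ i).1
    refine exists_isTest_of_cone (K := tsupport (χ i) ∩ closure Ω)
      (hv.bdd_mul_compact (hχ i).2.1.continuous (hχ i).2.2.1)
      ((hg.bdd_mul_compact (hχ i).2.1.continuous (hχ i).2.2.1).add ?_)
      (hw.mul_smooth isOpen_univ (hχ i).2.1) ((hχ i).2.2.1.inter_right isClosed_closure) ?_
      (hc _ hp) (ht₀ _ hp) (fun z hz => hV _ hp z ⟨(hχ i).2.2.2 hz.1, hz.2⟩) hε'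
    · obtain ⟨C, hC⟩ := (hgc i).exists_bound_of_continuous (hgr i)
      exact MemLp.smul (p := 2) (q := ⊤) (r := 2)
        (memLp_top_of_bound (hgr i).aestronglyMeasurable C (.of_forall hC)) hv
    · intro x hx
      by_cases h : x ∈ Ω
      · rw [image_eq_zero_of_notMem_tsupport fun h' => hx ⟨h', subset_closure h⟩, zero_smul]
      · rw [hv0 x h, smul_zero]
  choose ζ hζ h1 h2 using hi
  have hs := IsTest.sum Finset.univ hζ
  have hone : ∀ x ∈ Ω, ∑ i, χ i x = 1 := fun x hx => hone' x (subset_closure hx)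
  -- the gradients of the cutoffs cancel in the sum
  have hgrad : ∀ x ∈ Ω, ∑ i, gradient (χ i) x = 0 := by
    intro x hx
    have e : gradient (fun x => ∑ i, χ i x) x = ∑ i, gradient (χ i) x := by
      simp only [gradient]
      rw [fderiv_fun_sum (fun i _ => (hχ i).2.1.differentiable (by simp) x), map_sum]
    rw [← e, gradient]
    have : (fun x => ∑ i, χ i x) =ᶠ[𝓝 x] fun _ => 1 :=
      eventually_of_mem (hΩ.mem_nhds hx) hone
    rw [this.fderiv_eq]
    simp
  have hle : ∀ {E : Type} [NormedAddCommGroup E] (f : ι → ℂ → E),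
      (∀ i, AEStronglyMeasurable (f i) volume) →
      (∀ i, eLpNorm (f i) 2 volume ≤ ENNReal.ofReal ε') →
      eLpNorm (fun x => ∑ i, f i x) 2 volume ≤ ENNReal.ofReal ε := by
    intro E _ f hm hf
    have : (fun x => ∑ i, f i x) = ∑ i, f i := by
      ext x
      simp
    rw [this]
    calc eLpNorm (∑ i, f i) 2 volume ≤ ∑ i, eLpNorm (f i) 2 volume :=
          eLpNorm_sum_le (fun i _ => hm i) (by norm_num)
      _ ≤ ∑ _i : ι, ENNReal.ofReal ε' := Finset.sum_le_sum fun i _ => hf i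
      _ = ENNReal.ofReal (Fintype.card ι * ε') := by
        rw [Finset.sum_const, nsmul_eq_mul, ENNReal.ofReal_mul (by positivity),
          ENNReal.ofReal_natCast, Finset.card_univ]
      _ ≤ _ := ENNReal.ofReal_le_ofReal hsum
  refine ⟨_, hs.1, ?_, ?_⟩
  · have e : (fun x => ∑ i, ζ i x - v x) = fun x => ∑ i, (ζ i x - χ i x * v x) := by
      ext x
      rw [Finset.sum_sub_distrib, ← Finset.sum_mul]
      by_cases hx : x ∈ Ω
      · rw [hone x hx, one_mul]
      · rw [hv0 x hx, mul_zero]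
    rw [e]
    refine hle _ (fun i => ?_) h1
    exact (hζ i).1.continuous.aestronglyMeasurable.sub
      ((hχ i).2.1.continuous.aestronglyMeasurable.mul hv.1)
  · have e : (fun x => gradient (fun x => ∑ i, ζ i x) x - g x) =
        fun x => ∑ i, (gradient (ζ i) x - (χ i x • g x + v x • gradient (χ i) x)) := by
      ext x
      rw [hs.2, Finset.sum_sub_distrib, Finset.sum_add_distrib, ← Finset.sum_smul,
        ← Finset.smul_sum]
      by_cases hx : x ∈ Ω
      · rw [hone x hx, one_smul, hgrad x hx, smul_zero, add_zero]
      · rw [hg0 x hx, hv0 x hx, smul_zero, zero_smul, add_zero]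
    rw [e]
    refine hle _ (fun i => ?_) h2
    exact (hζ i).continuous_gradient.aestronglyMeasurable.sub
      (((hχ i).2.1.continuous.aestronglyMeasurable.smul hg.1).add
        (hv.1.smul (hgr i).aestronglyMeasurable))

/-! ### Cutoff functions of small energy -/

lemma measurableSet_annulus (a : ℂ) (ρ R : ℝ) :
    MeasurableSet {x : ℂ | ρ ≤ ‖x - a‖ ∧ ‖x - a‖ < R} := by
  have h : Measurable fun x : ℂ => ‖x - a‖ := by fun_prop
  have e : {x : ℂ | ρ ≤ ‖x - a‖ ∧ ‖x - a‖ < R} = (fun x : ℂ => ‖x - a‖) ⁻¹' Ico ρ R := by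
    ext x
    simp
  rw [e]
  exact h measurableSet_Ico

/-- The energy of the vortex field on an annulus. -/
lemma integral_annulus_inv_sq (a : ℂ) {ρ R : ℝ} (hρ : 0 < ρ) (hR : ρ ≤ R) :
    IntegrableOn (fun x : ℂ => (‖x - a‖ ^ 2)⁻¹) {x | ρ ≤ ‖x - a‖ ∧ ‖x - a‖ < R} ∧
    ∫ x in {x : ℂ | ρ ≤ ‖x - a‖ ∧ ‖x - a‖ < R}, (‖x - a‖ ^ 2)⁻¹ =
      2 * Real.pi * Real.log (R / ρ) := by
  have hm : MeasurableSet {x : ℂ | ρ ≤ ‖x - a‖ ∧ ‖x - a‖ < R} := measurableSet_annulus a ρ R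
  constructor
  · refine IntegrableOn.of_bound (C := (ρ ^ 2)⁻¹) ?_ ?_ ?_
    · refine (measure_mono (t := Metric.ball a R) fun x hx => ?_).trans_lt measure_ball_lt_top
      simpa [dist_eq_norm] using hx.2
    · exact Measurable.aestronglyMeasurable (by fun_prop)
    · refine (ae_restrict_iff' hm).2 (.of_forall fun x hx => ?_)
      rw [Real.norm_of_nonneg (by positivity)]
      gcongr
      exact hx.1
  · have h := integral_fun_norm_addHaar (E := ℂ) volume
      (fun r : ℝ => (Ico ρ R).indicator (fun r => (r ^ 2)⁻¹) r)
    rw [← integral_sub_right_eq_self _ a] at h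
    have e1 : (fun x : ℂ => (Ico ρ R).indicator (fun r : ℝ => (r ^ 2)⁻¹) ‖x - a‖) =
        {x : ℂ | ρ ≤ ‖x - a‖ ∧ ‖x - a‖ < R}.indicator fun x => (‖x - a‖ ^ 2)⁻¹ := by
      ext x
      simp [indicator]
    rw [e1, integral_indicator hm] at h
    rw [h]
    have e2 : ∀ y : ℝ, y ^ (Module.finrank ℝ ℂ - 1) • (Ico ρ R).indicator (fun r => (r ^ 2)⁻¹) y =
        (Ico ρ R).indicator (fun r => r⁻¹) y := by
      intro y
      by_cases hy : y ∈ Ico ρ R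
      · have : y ≠ 0 := (hρ.trans_le hy.1).ne'
        simp only [Complex.finrank_real_complex, indicator_of_mem hy]
        simp
        field_simp
      · simp [indicator_of_notMem hy]
    simp_rw [e2]
    rw [integral_indicator measurableSet_Ico, Measure.restrict_restrict measurableSet_Ico,
      inter_eq_left.2 (show Ico ρ R ⊆ Ioi 0 from fun y hy => hρ.trans_le hy.1), integral_Ico_eq_integral_Ioo,
      ← integral_Ioc_eq_integral_Ioo, ← intervalIntegral.integral_of_le hR,
      integral_inv_of_pos hρ (hρ.trans_le hR)]
    simp [Measure.real, Complex.volume_ball]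
    ring

lemma exists_deriv_smoothTransition_bound :
    ∃ C, 0 ≤ C ∧ ∀ s, |deriv Real.smoothTransition s| ≤ C := by
  have hc : Continuous (deriv Real.smoothTransition) :=
    (Real.smoothTransition.contDiff (n := 1)).continuous_deriv le_rfl
  obtain ⟨C, hC⟩ := (isCompact_Icc (a := (0 : ℝ)) (b := 1)).exists_bound_of_continuousOn
    hc.continuousOn
  refine ⟨C, (norm_nonneg _).trans (hC 0 (by simp)), fun s => ?_⟩
  have hC0 : 0 ≤ C := (norm_nonneg _).trans (hC 0 (by simp))
  by_cases hs : s ∈ Icc (0 : ℝ) 1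
  · exact hC s hs
  have : deriv Real.smoothTransition s = 0 := by
    rw [mem_Icc, not_and_or, not_le, not_le] at hs
    rcases hs with h | h
    · have : Real.smoothTransition =ᶠ[𝓝 s] fun _ => 0 :=
        eventually_of_mem (Iio_mem_nhds h) fun y hy =>
          Real.smoothTransition.zero_of_nonpos (le_of_lt hy)
      rw [this.deriv_eq, deriv_const]
    · have : Real.smoothTransition =ᶠ[𝓝 s] fun _ => 1 :=
        eventually_of_mem (Ioi_mem_nhds h) fun y hy =>
          Real.smoothTransition.one_of_one_le (le_of_lt hy)
      rw [this.deriv_eq, deriv_const]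
  rw [this, abs_zero]
  exact hC0

lemma deriv_smoothTransition_eq_zero_of_neg {s : ℝ} (hs : s < 0) :
    deriv Real.smoothTransition s = 0 := by
  have : Real.smoothTransition =ᶠ[𝓝 s] fun _ => 0 :=
    eventually_of_mem (Iio_mem_nhds hs) fun y hy =>
      Real.smoothTransition.zero_of_nonpos (le_of_lt hy)
  rw [this.deriv_eq, deriv_const]

lemma deriv_smoothTransition_eq_zero_of_one_lt {s : ℝ} (hs : 1 < s) :
    deriv Real.smoothTransition s = 0 := by
  have : Real.smoothTransition =ᶠ[𝓝 s] fun _ => 1 :=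
    eventually_of_mem (Ioi_mem_nhds hs) fun y hy =>
      Real.smoothTransition.one_of_one_le (le_of_lt hy)
  rw [this.deriv_eq, deriv_const]

lemma hasFDerivAt_norm_sub_sq (a x : ℂ) :
    HasFDerivAt (fun x : ℂ => ‖x - a‖ ^ 2) (2 • (innerSL ℝ (x - a))) x := by
  have h := (hasStrictFDerivAt_norm_sq (x - a)).hasFDerivAt.comp x ((hasFDerivAt_id x).sub_const a)
  exact h

/-- Points have zero capacity in the plane: the logarithmic cutoff. -/
lemma exists_cutoff_point (a : ℂ) {ε : ℝ} (hε : 0 < ε) :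
    ∃ η : ℂ → ℝ, ContDiff ℝ ∞ η ∧ (∀ x, 0 ≤ η x ∧ η x ≤ 1) ∧ a ∉ tsupport η ∧
      (∀ x, ε ≤ ‖x - a‖ → η x = 1) ∧ eLpNorm (gradient η) 2 volume ≤ ENNReal.ofReal ε := by
  obtain ⟨C, hC0, hC⟩ := exists_deriv_smoothTransition_bound
  -- With `R = ‖x - a‖`, the cutoff is `T (2 + log (R² + δ) / m)` for a smooth step `T` from `0` to `1`.
  -- The step takes place where `exp (-2m) ≤ R² + δ ≤ exp (-m)`, and there the gradient is at most
  -- `2 C / (m R)`, whose square has an integral of order `1 / m`.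
  obtain ⟨m, hm1, hm2, hm3⟩ : ∃ m : ℝ, 1 ≤ m ∧ Real.exp (-m) ≤ ε ^ 2 ∧
      20 * Real.pi * C ^ 2 / m ≤ ε ^ 2 := by
    have t1 : Tendsto (fun m : ℝ => Real.exp (-m)) atTop (𝓝 0) :=
      Real.tendsto_exp_neg_atTop_nhds_zero
    have t2 : Tendsto (fun m : ℝ => 20 * Real.pi * C ^ 2 / m) atTop (𝓝 0) :=
      tendsto_const_nhds.div_atTop tendsto_id
    have hε2 : 0 < ε ^ 2 := by positivity
    obtain ⟨m, h⟩ := ((eventually_ge_atTop 1).and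
      ((t1.eventually_le_const hε2).and (t2.eventually_le_const hε2))).exists
    exact ⟨m, h.1, h.2.1, h.2.2⟩
  have hm0 : 0 < m := by linarith
  -- `δ` makes the logarithm smooth at `a`, and is small enough for the cutoff to vanish near `a`
  set δ : ℝ := Real.exp (-(2 * m)) / 2 with hδ
  have hδ0 : 0 < δ := by positivity
  let f : ℂ → ℝ := fun x => 2 + Real.log (‖x - a‖ ^ 2 + δ) / m
  have hpos : ∀ x, 0 < ‖x - a‖ ^ 2 + δ := fun x => by positivity
  have hf : ContDiff ℝ ∞ f := by
    have h0 : ContDiff ℝ ∞ fun x : ℂ => ‖x - a‖ ^ 2 + δ :=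
      ((contDiff_id.sub contDiff_const).norm_sq ℝ).add contDiff_const
    exact contDiff_const.add ((h0.log fun x => (hpos x).ne').div_const m)
  have hfn : ∀ x, f x ≤ 0 ↔ ‖x - a‖ ^ 2 + δ ≤ Real.exp (-(2 * m)) := by
    intro x
    rw [← Real.log_le_iff_le_exp (hpos x)]
    simp only [f]
    rw [← le_neg_iff_add_nonpos_left, div_le_iff₀ hm0]
    constructor <;> intro h <;> linarith
  have hf1 : ∀ x, 1 ≤ f x ↔ Real.exp (-m) ≤ ‖x - a‖ ^ 2 + δ := by
    intro x
    rw [← Real.le_log_iff_exp_le (hpos x)]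
    simp only [f]
    rw [← sub_le_iff_le_add', le_div_iff₀ hm0]
    constructor <;> intro h <;> linarith
  have hgrad : ∀ x, ‖gradient (fun x => Real.smoothTransition (f x)) x‖ ≤
      {x : ℂ | Real.exp (-m) / 2 ≤ ‖x - a‖ ∧ ‖x - a‖ < 2 * Real.exp (-m / 2)}.indicator
        (fun x => 2 * C / m * (‖x - a‖)⁻¹) x := by
    intro x
    have hd : HasFDerivAt (fun x => Real.smoothTransition (f x))
        (deriv Real.smoothTransition (f x) • fderiv ℝ f x) x :=
      ((Real.smoothTransition.contDiff (n := 1)).differentiable one_ne_zero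
        (f x)).hasDerivAt.comp_hasFDerivAt x (hf.differentiable (by simp) x).hasFDerivAt
    rw [norm_gradient, hd.fderiv, norm_smul]
    by_cases h0 : f x < 0
    · rw [deriv_smoothTransition_eq_zero_of_neg h0, norm_zero, zero_mul]
      exact indicator_nonneg (fun _ _ => by positivity) x
    by_cases h1 : 1 < f x
    · rw [deriv_smoothTransition_eq_zero_of_one_lt h1, norm_zero, zero_mul]
      exact indicator_nonneg (fun _ _ => by positivity) x
    have hb1 : Real.exp (-(2 * m)) ≤ ‖x - a‖ ^ 2 + δ := by
      by_contra! h
      rcases ((hfn x).2 h.le).lt_or_eq with h' | h'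
      · exact h0 h'
      · simp only [f] at h'
        have : Real.log (‖x - a‖ ^ 2 + δ) < -(2 * m) := (Real.log_lt_iff_lt_exp (hpos x)).2 h
        have e : Real.log (‖x - a‖ ^ 2 + δ) = -2 * m := by
          field_simp at h'
          linarith
        linarith
    have hb2 : ‖x - a‖ ^ 2 + δ ≤ Real.exp (-m) := by
      by_contra! h
      rcases ((hf1 x).2 h.le).lt_or_eq with h' | h'
      · exact h1 h'
      · simp only [f] at h'
        have : -m < Real.log (‖x - a‖ ^ 2 + δ) := (Real.lt_log_iff_exp_lt (hpos x)).2 h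
        have e : Real.log (‖x - a‖ ^ 2 + δ) = - m := by
          field_simp at h'
          linarith
        linarith
    have hs1 : Real.exp (-(2 * m)) = Real.exp (-m) ^ 2 := by
      rw [← Real.exp_nat_mul]; congr 1; push_cast; ring
    have hs2 : Real.exp (-m) = Real.exp (-m / 2) ^ 2 := by
      rw [← Real.exp_nat_mul]; congr 1; push_cast; ring
    have hr1 : Real.exp (-m) / 2 ≤ ‖x - a‖ := by
      refine le_of_sq_le_sq ?_ (norm_nonneg _)
      rw [hδ, hs1] at hb1
      nlinarith [sq_nonneg (Real.exp (-m))]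
    have hr2 : ‖x - a‖ < 2 * Real.exp (-m / 2) := by
      refine lt_of_pow_lt_pow_left₀ 2 (by positivity) ?_
      have : 0 < Real.exp (-m / 2) ^ 2 := by positivity
      nlinarith
    have hr0 : 0 < ‖x - a‖ := lt_of_lt_of_le (by positivity) hr1
    rw [indicator_of_mem (show x ∈ {x : ℂ | Real.exp (-m) / 2 ≤ ‖x - a‖ ∧
      ‖x - a‖ < 2 * Real.exp (-m / 2)} from ⟨hr1, hr2⟩)]
    have hdf : fderiv ℝ f x = ((‖x - a‖ ^ 2 + δ)⁻¹ / m) • (2 • innerSL ℝ (x - a)) := by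
      have h1 := ((hasFDerivAt_norm_sub_sq a x).add_const δ).log (hpos x).ne'
      have h2 := (h1.mul_const m⁻¹).const_add 2
      rw [show f = fun x => 2 + Real.log (‖x - a‖ ^ 2 + δ) * m⁻¹ from rfl, h2.fderiv]
      ext v
      simp
      ring
    have hnn : ‖(‖x - a‖ ^ 2 + δ)⁻¹ / m‖ = (‖x - a‖ ^ 2 + δ)⁻¹ / m :=
      Real.norm_of_nonneg (div_nonneg (inv_nonneg.2 (hpos x).le) hm0.le)
    rw [hdf, norm_smul, hnn]
    have hn : ‖(2 • innerSL ℝ (x - a) : ℂ →L[ℝ] ℝ)‖ = 2 * ‖x - a‖ := by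
      rw [← Nat.cast_smul_eq_nsmul ℝ, norm_smul, innerSL_apply_norm]
      simp
    rw [hn]
    calc ‖deriv Real.smoothTransition (f x)‖ * ((‖x - a‖ ^ 2 + δ)⁻¹ / m * (2 * ‖x - a‖))
        ≤ C * ((‖x - a‖ ^ 2)⁻¹ / m * (2 * ‖x - a‖)) := by
          gcongr
          · exact hC _
          · linarith
      _ = 2 * C / m * (‖x - a‖)⁻¹ := by field_simp
  refine ⟨fun x => Real.smoothTransition (f x), Real.smoothTransition.contDiff.comp hf,
    fun x => ⟨Real.smoothTransition.nonneg _, Real.smoothTransition.le_one _⟩, ?_, ?_, ?_⟩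
  · rw [notMem_tsupport_iff_eventuallyEq]
    refine eventually_of_mem (Metric.ball_mem_nhds a (Real.sqrt_pos.2 hδ0)) fun x hx => ?_
    refine Real.smoothTransition.zero_of_nonpos ((hfn x).2 ?_)
    rw [Metric.mem_ball, dist_eq_norm, Real.lt_sqrt (norm_nonneg _)] at hx
    linarith
  · intro x hx
    refine Real.smoothTransition.one_of_one_le ((hf1 x).2 ?_)
    have : ε ^ 2 ≤ ‖x - a‖ ^ 2 := by gcongr
    linarith
  · rw [← ENNReal.pow_le_pow_left_iff two_ne_zero, eLpNorm_two_sq,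
      ← ENNReal.ofReal_pow hε.le]
    set A := {x : ℂ | Real.exp (-m) / 2 ≤ ‖x - a‖ ∧ ‖x - a‖ < 2 * Real.exp (-m / 2)} with hA
    have hmA : MeasurableSet A := measurableSet_annulus a _ _
    have hle : Real.exp (-m) / 2 ≤ 2 * Real.exp (-m / 2) := by
      have : Real.exp (-m) ≤ Real.exp (-m / 2) := Real.exp_le_exp.2 (by linarith)
      have := Real.exp_pos (-m / 2)
      linarith
    have hann := integral_annulus_inv_sq a (by positivity) hle
    calc ∫⁻ x, ‖gradient (fun x => Real.smoothTransition (f x)) x‖ₑ ^ 2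
        ≤ ∫⁻ x, A.indicator (fun x => ENNReal.ofReal ((2 * C / m) ^ 2 * (‖x - a‖ ^ 2)⁻¹)) x := by
          refine lintegral_mono fun x => ?_
          have hx := hgrad x
          by_cases h : x ∈ A
          · simp only [indicator_of_mem h] at hx ⊢
            rw [← ofReal_norm, ← ENNReal.ofReal_pow (norm_nonneg _)]
            refine ENNReal.ofReal_le_ofReal ?_
            rw [← inv_pow, ← mul_pow]
            gcongr
          · simp only [indicator_of_notMem h] at hx ⊢
            have : gradient (fun x => Real.smoothTransition (f x)) x = 0 :=
              norm_le_zero_iff.1 hx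
            simp [this]
      _ = ENNReal.ofReal (∫ x in A, (2 * C / m) ^ 2 * (‖x - a‖ ^ 2)⁻¹) := by
          rw [lintegral_indicator hmA, ofReal_integral_eq_lintegral_ofReal]
          · exact hann.1.const_mul _
          · exact .of_forall fun x => by positivity
      _ ≤ ENNReal.ofReal (ε ^ 2) := by
          refine ENNReal.ofReal_le_ofReal (le_trans ?_ hm3)
          rw [integral_const_mul, hann.2]
          have e : Real.log (2 * Real.exp (-m / 2) / (Real.exp (-m) / 2)) =
              Real.log 4 + m / 2 := by
            rw [show 2 * Real.exp (-m / 2) / (Real.exp (-m) / 2) = 4 * Real.exp (m / 2) by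
              rw [div_div_eq_mul_div, mul_comm _ (2 : ℝ), ← mul_assoc, mul_div_assoc,
                ← Real.exp_sub]
              congr 1
              · norm_num
              · congr 1; ring]
            rw [Real.log_mul (by norm_num) (Real.exp_pos _).ne', Real.log_exp]
          have h4 : Real.log 4 ≤ 2 := by
            rw [show (4 : ℝ) = 2 ^ 2 by norm_num, Real.log_pow]
            have := Real.log_two_lt_d9
            push_cast
            linarith
          rw [e, div_pow, mul_pow, div_mul_eq_mul_div, div_le_div_iff₀ (by positivity) hm0]
          have hpi := Real.pi_pos
          have : Real.log 4 + m / 2 ≤ 5 / 2 * m := by linarith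
          calc 2 ^ 2 * C ^ 2 * (2 * Real.pi * (Real.log 4 + m / 2)) * m
              ≤ 2 ^ 2 * C ^ 2 * (2 * Real.pi * (5 / 2 * m)) * m := by gcongr
            _ = 20 * Real.pi * C ^ 2 * m ^ 2 := by ring

/-- The product of the logarithmic cutoffs at the points of `s`. -/
lemma exists_cutoff (s : Finset ℂ) {ε : ℝ} (hε : 0 < ε) :
    ∃ η : ℂ → ℝ, ContDiff ℝ ∞ η ∧ (∀ x, 0 ≤ η x ∧ η x ≤ 1) ∧ (∀ a ∈ s, a ∉ tsupport η) ∧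
      (∀ x, (∀ a ∈ s, ε ≤ ‖x - a‖) → η x = 1) ∧
      eLpNorm (gradient η) 2 volume ≤ ENNReal.ofReal ε := by
  classical
  induction s using Finset.induction_on generalizing ε with
  | empty =>
    refine ⟨fun _ => 1, contDiff_const, fun _ => by norm_num, by simp, by simp, ?_⟩
    have : gradient (fun _ : ℂ => (1 : ℝ)) = 0 := by
      ext x
      simp [gradient]
    simp [this]
  | insert b s _ ih =>
    obtain ⟨η, h1, h2, h3, h4, h5⟩ := ih (half_pos hε)
    obtain ⟨ξ, k1, k2, k3, k4, k5⟩ := exists_cutoff_point b (half_pos hε)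
    refine ⟨fun x => η x * ξ x, h1.mul k1, fun x => ⟨mul_nonneg (h2 x).1 (k2 x).1,
      mul_le_one₀ (h2 x).2 (k2 x).1 (k2 x).2⟩, fun a ha => ?_, fun x hx => ?_, ?_⟩
    · rcases Finset.mem_insert.1 ha with rfl | ha
      · exact fun h => k3 (tsupport_mul_subset_right h)
      · exact fun h => h3 a ha (tsupport_mul_subset_left h)
    · show η x * ξ x = 1
      rw [h4 x fun a ha => (by linarith : ε / 2 ≤ ε).trans (hx a (Finset.mem_insert_of_mem ha)),
        k4 x ((by linarith : ε / 2 ≤ ε).trans (hx b (Finset.mem_insert_self _ _))), one_mul]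
    · have e : gradient (fun x => η x * ξ x) =
          (fun x => η x • gradient ξ x) + fun x => ξ x • gradient η x := by
        ext x
        rw [gradient_fun_mul (h1.differentiable (by simp) x) (k1.differentiable (by simp) x)]
        rfl
      have hm : ∀ {f : ℂ → ℝ} (g : ℂ → ℝ), ContDiff ℝ ∞ f →
          AEStronglyMeasurable (fun x => f x • gradient g x) volume := fun g hf =>
        hf.continuous.aestronglyMeasurable.smul (measurable_gradient g).aestronglyMeasurable
      rw [e]
      refine (eLpNorm_add_le (hm ξ h1) (hm η k1) (by norm_num)).trans ?_
      rw [← add_halves ε, ENNReal.ofReal_add (by positivity) (by positivity)]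
      refine add_le_add ((eLpNorm_mono fun x => ?_).trans k5) ((eLpNorm_mono fun x => ?_).trans h5)
      · rw [norm_smul, Real.norm_of_nonneg (h2 x).1]
        exact mul_le_of_le_one_left (norm_nonneg _) (h2 x).2
      · rw [norm_smul, Real.norm_of_nonneg (k2 x).1]
        exact mul_le_of_le_one_left (norm_nonneg _) (k2 x).2

lemma exists_smooth_eq_one {K U : Set ℂ} (hK : IsCompact K) (hU : IsOpen U) (hKU : K ⊆ U) :
    ∃ χ : ℂ → ℝ, ContDiff ℝ ∞ χ ∧ HasCompactSupport χ ∧ tsupport χ ⊆ U ∧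
      ∀ x ∈ K, χ =ᶠ[𝓝 x] fun _ => 1 := by
  obtain ⟨δ, hδ, hδU⟩ := hK.exists_cthickening_subset_open hU hKU
  obtain ⟨ι, _, p, χ, hχ, h1⟩ := exists_finite_partition (hK.cthickening (r := δ))
    (V := fun _ => U) (fun p hp => ⟨hU, hδU hp⟩)
  have hs := IsTest.sum (Ω := U) Finset.univ
    fun i => (⟨(hχ i).2.1, (hχ i).2.2.1, (hχ i).2.2.2⟩ : IsTest U (χ i))
  refine ⟨_, hs.1.1, hs.1.2.1, hs.1.2.2, fun x hx => ?_⟩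
  refine eventually_of_mem (Metric.closedBall_mem_nhds x hδ) fun y hy => h1 y ?_
  exact Metric.closedBall_subset_cthickening hx δ hy

/-! ### Functions with zero trace off finitely many points belong to `H¹₀` -/

lemma measurableSet_perforated {N : ℕ} {Ω : Set ℂ} (hΩ : IsOpen Ω) (a : Fin N → ℂ) (ρ : ℝ) :
    MeasurableSet (perforated Ω a ρ) :=
  hΩ.measurableSet.diff (MeasurableSet.iUnion fun _ => measurableSet_ball)

lemma mem_perforated {N : ℕ} {Ω : Set ℂ} {a : Fin N → ℂ} {ρ : ℝ} {x : ℂ} :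
    x ∈ perforated Ω a ρ ↔ x ∈ Ω ∧ ∀ j, ρ ≤ ‖x - a j‖ := by
  simp [perforated, dist_eq_norm]

lemma perforated_subset {N : ℕ} (Ω : Set ℂ) (a : Fin N → ℂ) (ρ : ℝ) : perforated Ω a ρ ⊆ Ω :=
  sdiff_subset

lemma exists_radius {N : ℕ} {a : Fin N → ℂ} {S : Set ℂ} (hS : IsClosed S) (h : ∀ j, a j ∉ S) :
    ∃ ρ > 0, ∀ x ∈ S, ∀ j, ρ ≤ ‖x - a j‖ := by
  have h1 : ∀ j, ∀ᶠ ρ in 𝓝[>] (0 : ℝ), ∀ x ∈ S, ρ ≤ ‖x - a j‖ := by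
    intro j
    obtain ⟨r, hr, hrS⟩ := Metric.isOpen_iff.1 hS.isOpen_compl (a j) (h j)
    filter_upwards [Ioo_mem_nhdsGT hr] with ρ hρ x hx
    by_contra! hlt
    refine hrS (?_ : x ∈ Metric.ball (a j) r) hx
    rw [Metric.mem_ball, dist_eq_norm]
    exact hlt.trans hρ.2
  obtain ⟨ρ, h2, h3⟩ := ((eventually_all.2 h1).and self_mem_nhdsWithin).exists
  exact ⟨ρ, h3, fun x hx j => h2 j x hx⟩

/-- `f` has zero trace on `∂Ω \ {a_j}`, in the sense of the Gauss-Green formula with `g` in the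
place of `∇f`; equivalently, the extension of `f` by zero has the weak gradient `g`, extended by
zero, on the plane without the points `a_j`. -/
def ZeroTrace {N : ℕ} (Ω : Set ℂ) (a : Fin N → ℂ) (f : ℂ → ℝ) (g : ℂ → ℂ) : Prop :=
  ∀ ζ : ℂ → ℝ, ContDiff ℝ ∞ ζ → HasCompactSupport ζ → (∀ j, a j ∉ tsupport ζ) →
    ∀ v : ℂ, ∫ x in Ω, (f x * fderiv ℝ ζ x v + inner ℝ (g x) v * ζ x) = 0

lemma memLp_indicator_of_bound {N : ℕ} {Ω : Set ℂ} (hΩ : IsOpen Ω) {a : Fin N → ℂ}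
    {E F : Type*} [NormedAddCommGroup E] [NormedAddCommGroup F] {f : ℂ → E} {b : ℂ → F} {S : Set ℂ}
    (hS : IsClosed S) (haS : ∀ j, a j ∉ S)
    (hf : ∀ ρ > 0, MemLp f 2 (volume.restrict (perforated Ω a ρ)))
    (hb : AEStronglyMeasurable b (volume.restrict Ω)) {C : ℝ} (hC : ∀ x, ‖b x‖ ≤ C * ‖f x‖)
    (hb0 : ∀ x ∉ S, b x = 0) : MemLp (Ω.indicator b) 2 volume := by
  obtain ⟨ρ, hρ, h⟩ := exists_radius hS haS
  have e : Ω.indicator b = (perforated Ω a ρ).indicator b := by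
    ext x
    by_cases hx : x ∈ perforated Ω a ρ
    · rw [indicator_of_mem hx, indicator_of_mem (perforated_subset _ _ _ hx)]
    · rw [indicator_of_notMem hx]
      by_cases hxΩ : x ∈ Ω
      · rw [indicator_of_mem hxΩ, hb0]
        exact fun hxS => hx (mem_perforated.2 ⟨hxΩ, h x hxS⟩)
      · rw [indicator_of_notMem hxΩ]
  rw [e, memLp_indicator_iff_restrict (measurableSet_perforated hΩ a ρ)]
  exact (hf ρ hρ).of_le_mul (hb.mono_measure
    (Measure.restrict_mono (perforated_subset _ _ _) le_rfl)) (.of_forall hC)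

lemma MemLp.integrable_mul_test {f ζ : ℂ → ℝ} (hf : MemLp f 2 volume) (hζ : Continuous ζ)
    (hc : HasCompactSupport ζ) : Integrable fun x => f x * ζ x := by
  have h := LocallyIntegrableOn.integrableOn_mul_test (Ω := univ) isOpen_univ
    (locallyIntegrableOn_univ.2 (hf.locallyIntegrable (by norm_num))) hζ hc (subset_univ _)
  rwa [integrableOn_univ] at h

/-- Multiplication by a cutoff that vanishes near the points `a_j` turns a function with zero trace
into an `H¹` function of the plane. -/
lemma ZeroTrace.hasWeakGrad_univ {N : ℕ} {Ω : Set ℂ} (hΩ : IsOpen Ω) {a : Fin N → ℂ}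
    {σ : ℂ → ℝ} {g : ℂ → ℂ} (hz : ZeroTrace Ω a σ g)
    (hσ : ∀ ρ > 0, MemLp σ 2 (volume.restrict (perforated Ω a ρ)))
    (hg : ∀ ρ > 0, MemLp g 2 (volume.restrict (perforated Ω a ρ)))
    (hσm : AEStronglyMeasurable σ (volume.restrict Ω))
    (hgm : AEStronglyMeasurable g (volume.restrict Ω)) {χ : ℂ → ℝ} (hχ : ContDiff ℝ ∞ χ)
    (hc : HasCompactSupport χ) (ha : ∀ j, a j ∉ tsupport χ) :
    MemLp (Ω.indicator fun x => χ x * σ x) 2 volume ∧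
    MemLp (Ω.indicator fun x => χ x • g x + σ x • gradient χ x) 2 volume ∧
    HasWeakGrad univ (Ω.indicator fun x => χ x * σ x)
      (Ω.indicator fun x => χ x • g x + σ x • gradient χ x) := by
  have hgr : Continuous (gradient χ) :=
    (InnerProductSpace.toDual ℝ ℂ).symm.continuous.comp (hχ.continuous_fderiv (by simp))
  have hgc : HasCompactSupport (gradient χ) := (hc.fderiv ℝ).comp_left (map_zero _)
  have hgs : ∀ x ∉ tsupport χ, gradient χ x = 0 := fun x hx => by
    rw [gradient, image_eq_zero_of_notMem_tsupport fun h => hx (tsupport_fderiv_subset ℝ h),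
      map_zero]
  obtain ⟨C, hC⟩ := hc.exists_bound_of_continuous hχ.continuous
  obtain ⟨D, hD⟩ := hgc.exists_bound_of_continuous hgr
  have m1 : MemLp (Ω.indicator fun x => χ x * σ x) 2 volume :=
    memLp_indicator_of_bound hΩ (isClosed_tsupport χ) ha hσ
      (hχ.continuous.aestronglyMeasurable.mul hσm) (C := C)
      (fun x => by rw [norm_mul]; gcongr; exact hC x)
      (fun x hx => by rw [image_eq_zero_of_notMem_tsupport hx, zero_mul])
  have m2 : MemLp (Ω.indicator fun x => χ x • g x) 2 volume :=
    memLp_indicator_of_bound hΩ (isClosed_tsupport χ) ha hg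
      (hχ.continuous.aestronglyMeasurable.smul hgm) (C := C)
      (fun x => by rw [norm_smul]; gcongr; exact hC x)
      (fun x hx => by rw [image_eq_zero_of_notMem_tsupport hx, zero_smul])
  have m3 : MemLp (Ω.indicator fun x => σ x • gradient χ x) 2 volume :=
    memLp_indicator_of_bound hΩ (isClosed_tsupport χ) ha hσ
      (hσm.smul hgr.aestronglyMeasurable) (C := D)
      (fun x => by rw [norm_smul, mul_comm]; gcongr; exact hD x)
      (fun x hx => by rw [hgs x hx, smul_zero])
  have m4 : MemLp (Ω.indicator fun x => χ x • g x + σ x • gradient χ x) 2 volume := by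
    have := m2.add m3
    rwa [← indicator_add'] at this
  refine ⟨m1, m4, locallyIntegrableOn_univ.2 (m1.locallyIntegrable (by norm_num)),
    locallyIntegrableOn_univ.2 (m4.locallyIntegrable (by norm_num)), fun ζ hζ hcζ _ v => ?_⟩
  have e := hz (fun x => χ x * ζ x) (hχ.mul hζ) hc.mul_right
    (fun j h => ha j (tsupport_mul_subset_left h)) v
  have hd : ∀ x, fderiv ℝ (fun x => χ x * ζ x) x v = χ x * fderiv ℝ ζ x v + fderiv ℝ χ x v * ζ x :=
    fun x => by
      rw [fderiv_fun_mul (hχ.differentiable (by simp) x) (hζ.differentiable (by simp) x)]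
      simp [mul_comm]
  have i1 : Integrable fun x => (Ω.indicator fun x => χ x * σ x) x * fderiv ℝ ζ x v :=
    MemLp.integrable_mul_test m1 ((hζ.continuous_fderiv (by simp)).clm_apply continuous_const)
      (hcζ.fderiv_apply ℝ v)
  have i2 : Integrable fun x =>
      inner ℝ ((Ω.indicator fun x => χ x • g x + σ x • gradient χ x) x) v * ζ x :=
    MemLp.integrable_mul_test (m4.inner_const v) hζ.continuous hcζ
  simp only [Measure.restrict_univ]
  rw [← add_eq_zero_iff_eq_neg, ← integral_add i1 i2, ← e, ← integral_indicator hΩ.measurableSet]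
  congr 1 with x
  by_cases hx : x ∈ Ω
  · simp only [indicator_of_mem hx, hd, inner_add_left, real_inner_smul_left, inner_gradient]
    ring
  · simp [indicator_of_notMem hx]

/-- A smooth, bounded, nonexpansive truncation, which tends to the identity as `M → ∞`. -/
def softTrunc (M t : ℝ) : ℝ := M * Real.arctan (t / M)

lemma contDiff_softTrunc (M : ℝ) : ContDiff ℝ ∞ (softTrunc M) :=
  contDiff_const.mul (Real.contDiff_arctan.comp (contDiff_id.div_const M))

lemma hasDerivAt_softTrunc {M : ℝ} (hM : 0 < M) (t : ℝ) :
    HasDerivAt (softTrunc M) (1 + (t / M) ^ 2)⁻¹ t := by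
  have h := ((hasDerivAt_id t).div_const M).arctan.const_mul M
  refine h.congr_deriv ?_
  simp
  field_simp

lemma deriv_softTrunc {M : ℝ} (hM : 0 < M) (t : ℝ) :
    deriv (softTrunc M) t = (1 + (t / M) ^ 2)⁻¹ := (hasDerivAt_softTrunc hM t).deriv

lemma abs_deriv_softTrunc_le {M : ℝ} (hM : 0 < M) (t : ℝ) : |deriv (softTrunc M) t| ≤ 1 := by
  rw [deriv_softTrunc hM, abs_of_nonneg (by positivity)]
  exact inv_le_one_of_one_le₀ (by nlinarith [sq_nonneg (t / M)])

lemma abs_softTrunc_le {M : ℝ} (hM : 0 < M) (t : ℝ) : |softTrunc M t| ≤ 2 * M := by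
  rw [softTrunc, abs_mul, abs_of_pos hM, mul_comm]
  gcongr
  have := Real.neg_pi_div_two_lt_arctan (t / M)
  have := Real.arctan_lt_pi_div_two (t / M)
  have := Real.pi_lt_four
  rw [abs_le]
  constructor <;> linarith

lemma abs_softTrunc_sub_le {M : ℝ} (hM : 0 < M) (s t : ℝ) :
    |softTrunc M s - softTrunc M t| ≤ |s - t| := by
  have := Convex.norm_image_sub_le_of_norm_deriv_le (f := softTrunc M) (s := univ) (C := 1)
    (x := t) (y := s) (fun x _ => (hasDerivAt_softTrunc hM x).differentiableAt)
    (fun x _ => abs_deriv_softTrunc_le hM x) convex_univ (mem_univ _) (mem_univ _)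
  simpa using this

lemma tendsto_softTrunc (t : ℝ) :
    Tendsto (fun n : ℕ => softTrunc (n + 1) t) atTop (𝓝 t) := by
  have h : HasDerivAt (fun s : ℝ => Real.arctan (t * s)) t 0 := by
    have := ((hasDerivAt_id (0 : ℝ)).const_mul t).arctan
    simpa using this
  have h1 : Tendsto (fun n : ℕ => (1 : ℝ) / (n + 1)) atTop (𝓝[≠] 0) :=
    tendsto_nhdsWithin_iff.2 ⟨tendsto_one_div_add_atTop_nhds_zero_nat,
      .of_forall fun n => by simp; positivity⟩
  refine ((hasDerivAt_iff_tendsto_slope_zero.1 h).comp h1).congr fun n => ?_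
  simp [softTrunc, div_eq_mul_inv]

lemma tendsto_deriv_softTrunc (t : ℝ) :
    Tendsto (fun n : ℕ => deriv (softTrunc (n + 1)) t) atTop (𝓝 1) := by
  have h1 : Tendsto (fun n : ℕ => t * ((1 : ℝ) / (n + 1))) atTop (𝓝 (t * 0)) :=
    tendsto_one_div_add_atTop_nhds_zero_nat.const_mul t
  have h2 : Tendsto (fun n : ℕ => (1 + (t * ((1 : ℝ) / (n + 1))) ^ 2)⁻¹) atTop
      (𝓝 (1 + (t * 0) ^ 2)⁻¹) :=
    ((h1.pow 2).const_add 1).inv₀ (by simp)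
  simp only [mul_zero, ne_eq, OfNat.ofNat_ne_zero, not_false_eq_true, zero_pow, add_zero,
    inv_one] at h2
  refine h2.congr fun n => ?_
  rw [deriv_softTrunc (by positivity), mul_one_div]

lemma tendsto_eLpNorm_two_of_dominated {α E : Type*} [MeasurableSpace α] {μ : Measure α}
    [NormedAddCommGroup E] {F : ℕ → α → E} {b : α → ℝ} (hF : ∀ n, AEStronglyMeasurable (F n) μ)
    (hb : MemLp b 2 μ) (hFb : ∀ n, ∀ᵐ x ∂μ, ‖F n x‖ ≤ b x)
    (hlim : ∀ᵐ x ∂μ, Tendsto (fun n => F n x) atTop (𝓝 0)) :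
    Tendsto (fun n => eLpNorm (F n) 2 μ) atTop (𝓝 0) := by
  have h : Tendsto (fun n => ∫⁻ x, ‖F n x‖ₑ ^ 2 ∂μ) atTop (𝓝 (∫⁻ _, 0 ∂μ)) := by
    refine tendsto_lintegral_of_dominated_convergence' (fun x => ‖b x‖ₑ ^ 2)
      (fun n => (hF n).enorm.pow_const 2) (fun n => ?_) ?_ ?_
    · filter_upwards [hFb n] with x hx
      gcongr
      rw [← ofReal_norm, ← ofReal_norm]
      exact ENNReal.ofReal_le_ofReal (hx.trans (le_abs_self _))
    · rw [← eLpNorm_two_sq]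
      exact (ENNReal.pow_lt_top hb.2).ne
    · filter_upwards [hlim] with x hx
      have := (continuous_enorm.tendsto _).comp hx
      have h2 := ((ENNReal.continuous_pow 2).tendsto _).comp this
      simp only [enorm_zero, ne_eq, OfNat.ofNat_ne_zero, not_false_eq_true, zero_pow] at h2
      exact h2
  rw [lintegral_zero] at h
  simp_rw [← eLpNorm_two_sq] at h
  have h2 := (ENNReal.continuous_rpow_const (y := 1 / 2)).tendsto 0 |>.comp h
  refine (h2.congr fun n => ?_).trans (by simp)
  simp only [Function.comp]
  rw [← ENNReal.rpow_natCast, ← ENNReal.rpow_mul]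
  norm_num

lemma IsTest.mul_comp {Ω : Set ℂ} {η ζ : ℂ → ℝ} (hη : ContDiff ℝ ∞ η) (hζ : IsTest Ω ζ) {T : ℝ → ℝ}
    (hT : ContDiff ℝ ∞ T) (hT0 : T 0 = 0) :
    IsTest Ω (fun x => η x * T (ζ x)) ∧ ∀ x, gradient (fun x => η x * T (ζ x)) x =
      (η x * deriv T (ζ x)) • gradient ζ x + T (ζ x) • gradient η x := by
  have hs : tsupport (fun x => T (ζ x)) ⊆ tsupport ζ := by
    refine closure_mono fun x hx hx' => hx ?_
    simp [hx', hT0]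
  refine ⟨⟨hη.mul (hT.comp hζ.1), HasCompactSupport.mul_left (hζ.2.1.comp_left hT0),
    tsupport_mul_subset_right.trans (hs.trans hζ.2.2)⟩, fun x => ?_⟩
  have h1 : HasFDerivAt (fun x => T (ζ x)) (deriv T (ζ x) • fderiv ℝ ζ x) x :=
    (hT.differentiable (by simp) (ζ x)).hasDerivAt.comp_hasFDerivAt x
      (hζ.1.differentiable (by simp) x).hasFDerivAt
  rw [gradient_fun_mul (hη.differentiable (by simp) x) h1.differentiableAt, mul_smul]
  congr 2
  simp only [gradient, h1.fderiv, map_smul]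

/-! ### Functions with zero trace and finite energy belong to `H¹₀` -/

/-- Soft truncation and a cutoff near the points `a_j` turn a function with zero trace into an
`H¹` limit of test functions. -/
lemma ZeroTrace.exists_isTest_truncate {N : ℕ} {Ω : Set ℂ} (hΩ : IsOpen Ω)
    (hb : Bornology.IsBounded Ω) (hcone : HasInwardCone Ω) {a : Fin N → ℂ}
    {σ : ℂ → ℝ} {g : ℂ → ℂ} (hz : ZeroTrace Ω a σ g)
    (hσ : ∀ ρ > 0, MemLp σ 2 (volume.restrict (perforated Ω a ρ)))
    (hg : MemLp g 2 (volume.restrict Ω)) (hσm : AEStronglyMeasurable σ (volume.restrict Ω))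
    {η : ℂ → ℝ} (hη : ContDiff ℝ ∞ η) (hη1 : ∀ x, 0 ≤ η x ∧ η x ≤ 1) (ha : ∀ j, a j ∉ tsupport η)
    {M : ℝ} (hM : 0 < M) {ε : ℝ} (hε : 0 < ε) :
    ∃ z, IsTest Ω z ∧
      eLpNorm (fun x => z x - η x * softTrunc M (σ x)) 2 (volume.restrict Ω) ≤ ENNReal.ofReal ε ∧
      eLpNorm (fun x => gradient z x - ((η x * deriv (softTrunc M) (σ x)) • g x +
        softTrunc M (σ x) • gradient η x)) 2 (volume.restrict Ω) ≤ ENNReal.ofReal ε := by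
  have hgη : Continuous (gradient η) :=
    (InnerProductSpace.toDual ℝ ℂ).symm.continuous.comp (hη.continuous_fderiv (by simp))
  obtain ⟨D, hD⟩ := hb.isCompact_closure.exists_bound_of_continuousOn hgη.continuousOn
  obtain ⟨χ, hχ, hχc, hχs, hχ1⟩ := exists_smooth_eq_one
    (hb.isCompact_closure.inter_left (isClosed_tsupport η)) (finite_range a).isClosed.isOpen_compl
    (fun x hx ⟨j, hj⟩ => ha j (hj ▸ hx.1))
  have hχa : ∀ j, a j ∉ tsupport χ := fun j h => hχs h (mem_range_self j)
  have hg' : ∀ ρ > 0, MemLp g 2 (volume.restrict (perforated Ω a ρ)) := fun ρ _ =>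
    hg.mono_measure (Measure.restrict_mono (perforated_subset _ _ _) le_rfl)
  obtain ⟨m1, m2, hw⟩ := hz.hasWeakGrad_univ hΩ hσ hg' hσm hg.1 hχ hχc hχa
  -- `χ σ`, extended by zero, is a limit of test functions and equals `σ` where `η` does not vanish
  set v := Ω.indicator fun x => χ x * σ x with hv
  set G := Ω.indicator fun x => χ x • g x + σ x • gradient χ x with hG
  have hseq : ∀ n : ℕ, ∃ ζ, IsTest Ω ζ ∧
      eLpNorm (fun x => ζ x - v x) 2 volume ≤ ENNReal.ofReal (1 / (n + 1)) ∧
      eLpNorm (fun x => gradient ζ x - G x) 2 volume ≤ ENNReal.ofReal (1 / (n + 1)) := fun n =>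
    exists_isTest_of_hasWeakGrad_univ hΩ hb hcone m1 m2 hw
      (fun x hx => indicator_of_notMem hx _) (fun x hx => indicator_of_notMem hx _) (by positivity)
  choose ζ hζ h1 h2 using hseq
  have hlim0 : Tendsto (fun n : ℕ => ENNReal.ofReal (1 / ((n : ℝ) + 1))) atTop (𝓝 0) := by
    simpa using ENNReal.tendsto_ofReal tendsto_one_div_add_atTop_nhds_zero_nat
  have t1 : Tendsto (fun n => eLpNorm (fun x => ζ n x - v x) 2 volume) atTop (𝓝 0) :=
    tendsto_of_tendsto_of_tendsto_of_le_of_le tendsto_const_nhds hlim0 (fun _ => zero_le) h1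
  have t2 : Tendsto (fun n => eLpNorm (fun x => gradient (ζ n) x - G x) 2 volume) atTop (𝓝 0) :=
    tendsto_of_tendsto_of_tendsto_of_le_of_le tendsto_const_nhds hlim0 (fun _ => zero_le) h2
  obtain ⟨φ, hφ, hae⟩ := (tendstoInMeasure_of_tendsto_eLpNorm (by norm_num)
    (fun n => (hζ n).1.continuous.aestronglyMeasurable) m1.1
    (show Tendsto (fun n => eLpNorm (ζ n - v) 2 volume) atTop (𝓝 0) from t1)).exists_seq_tendsto_ae
  have t1' := t1.comp hφ.tendsto_atTop
  have t2' := t2.comp hφ.tendsto_atTop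
  have hdT : Continuous (deriv (softTrunc M)) := (contDiff_softTrunc M).continuous_deriv (by simp)
  have hT0 : softTrunc M 0 = 0 := by simp [softTrunc]
  -- the only term that needs the almost everywhere convergence
  have t3 : Tendsto (fun n => eLpNorm (fun x =>
      (deriv (softTrunc M) (ζ (φ n) x) - deriv (softTrunc M) (v x)) • G x) 2 volume)
      atTop (𝓝 0) := by
    refine tendsto_eLpNorm_two_of_dominated (b := fun x => 2 * ‖G x‖) (fun n => ?_)
      (m2.norm.const_mul 2) (fun n => .of_forall fun x => ?_) ?_
    · exact ((hdT.comp (hζ _).1.continuous).aestronglyMeasurable.sub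
        (hdT.comp_aestronglyMeasurable m1.1)).smul m2.1
    · rw [norm_smul]
      gcongr
      refine (norm_sub_le _ _).trans ?_
      have := abs_deriv_softTrunc_le hM (ζ (φ n) x)
      have := abs_deriv_softTrunc_le hM (v x)
      simp only [Real.norm_eq_abs]
      linarith
    · filter_upwards [hae] with x hx
      have := ((hdT.tendsto (v x)).comp hx).sub_const (deriv (softTrunc M) (v x))
      simpa using this.smul_const (G x)
  have hsum := (t2'.add t3).add (ENNReal.Tendsto.const_mul (a := ENNReal.ofReal D) t1'
    (Or.inr ENNReal.ofReal_ne_top))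
  simp only [add_zero, mul_zero] at hsum
  have hpos : 0 < ENNReal.ofReal ε := ENNReal.ofReal_pos.2 hε
  obtain ⟨n, hn1, hn2⟩ := ((t1'.eventually_le_const hpos).and
    (hsum.eventually_le_const hpos)).exists
  have hmul := (hζ (φ n)).mul_comp hη (contDiff_softTrunc M) hT0
  have hvx : ∀ x ∈ Ω, η x ≠ 0 → v x = σ x ∧ G x = g x := by
    intro x hx hηx
    have h := hχ1 x ⟨subset_tsupport _ hηx, subset_closure hx⟩
    have h' : gradient χ x = 0 := by simp [gradient, h.fderiv_eq]
    simp [hv, hG, indicator_of_mem hx, h.eq_of_nhds, h']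
  refine ⟨_, hmul.1, ?_, ?_⟩
  · refine le_trans ?_ hn1
    refine le_trans ?_ (eLpNorm_mono_measure _ (Measure.restrict_le_self (s := Ω)))
    refine eLpNorm_mono_ae ((ae_restrict_iff' hΩ.measurableSet).2 (.of_forall fun x hx => ?_))
    by_cases hηx : η x = 0
    · simp only [hηx, zero_mul, sub_self, norm_zero]
      positivity
    · rw [← (hvx x hx hηx).1, ← mul_sub, norm_mul, Real.norm_of_nonneg (hη1 x).1]
      exact (mul_le_of_le_one_left (norm_nonneg _) (hη1 x).2).trans (abs_softTrunc_sub_le hM _ _)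
  · refine le_trans ?_ hn2
    set F1 : ℂ → ℂ := fun x => gradient (ζ (φ n)) x - G x
    set F2 : ℂ → ℂ := fun x =>
      (deriv (softTrunc M) (ζ (φ n) x) - deriv (softTrunc M) (v x)) • G x
    set F3 : ℂ → ℝ := fun x => D * (ζ (φ n) x - v x)
    have hm1 : AEStronglyMeasurable F1 volume :=
      (hζ _).continuous_gradient.aestronglyMeasurable.sub m2.1
    have hm2 : AEStronglyMeasurable F2 volume :=
      ((hdT.comp (hζ _).1.continuous).aestronglyMeasurable.sub
        (hdT.comp_aestronglyMeasurable m1.1)).smul m2.1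
    have hm3 : AEStronglyMeasurable F3 volume :=
      aestronglyMeasurable_const.mul ((hζ _).1.continuous.aestronglyMeasurable.sub m1.1)
    have hF3 : eLpNorm F3 2 volume ≤
        ENNReal.ofReal D * eLpNorm (fun x => ζ (φ n) x - v x) 2 volume := by
      -- the bound `D` of the gradient of `η` is known to be nonnegative only if `Ω` has a point
      by_cases hΩe : Ω.Nonempty
      · obtain ⟨x₀, hx₀⟩ := hΩe
        have hD0 : 0 ≤ D := (norm_nonneg _).trans (hD x₀ (subset_closure hx₀))
        refine (eLpNorm_const_smul_le (c := D) (f := fun x => ζ (φ n) x - v x)).trans_eq ?_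
        rw [Real.enorm_of_nonneg hD0]
      · have h0 : F3 = 0 := by
          have hΩ0 := not_nonempty_iff_eq_empty.1 hΩe
          ext x
          have : ζ (φ n) x = 0 := image_eq_zero_of_notMem_tsupport fun h => by
            have := (hζ (φ n)).2.2 h
            simp [hΩ0] at this
          simp [F3, this, hv, hΩ0]
        simp [h0]
    calc _ ≤ eLpNorm (fun x => ‖F1 x‖ + ‖F2 x‖ + ‖F3 x‖) 2 (volume.restrict Ω) := by
          refine eLpNorm_mono_ae_real ((ae_restrict_iff' hΩ.measurableSet).2
            (.of_forall fun x hx => ?_))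
          rw [hmul.2]
          have hDx := hD x (subset_closure hx)
          by_cases hηx : η x = 0
          · -- here `η` has a minimum, so that its gradient vanishes
            have hg0 : gradient η x = 0 := by
              have : IsLocalMin η x := .of_forall fun y => by rw [hηx]; exact (hη1 y).1
              simp [gradient, this.fderiv_eq_zero]
            simp only [hηx, hg0, zero_mul, zero_smul, smul_zero, add_zero, sub_self, norm_zero]
            positivity
          · obtain ⟨e1, e2⟩ := hvx x hx hηx
            have e : (η x * deriv (softTrunc M) (ζ (φ n) x)) • gradient (ζ (φ n)) x +
                softTrunc M (ζ (φ n) x) • gradient η x - ((η x * deriv (softTrunc M) (σ x)) • g x +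
                softTrunc M (σ x) • gradient η x) =
                (η x * deriv (softTrunc M) (ζ (φ n) x)) • F1 x + η x • F2 x +
                (softTrunc M (ζ (φ n) x) - softTrunc M (v x)) • gradient η x := by
              simp only [F1, F2, e1, e2]
              module
            rw [e]
            refine (norm_add₃_le).trans (add_le_add (add_le_add ?_ ?_) ?_)
            · rw [norm_smul, norm_mul, Real.norm_of_nonneg (hη1 x).1]
              refine mul_le_of_le_one_left (norm_nonneg _) ?_
              exact mul_le_one₀ (hη1 x).2 (norm_nonneg _) (abs_deriv_softTrunc_le hM _)
            · rw [norm_smul, Real.norm_of_nonneg (hη1 x).1]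
              exact mul_le_of_le_one_left (norm_nonneg _) (hη1 x).2
            · rw [norm_smul, norm_mul, mul_comm]
              refine mul_le_mul (hDx.trans (le_abs_self D)) (abs_softTrunc_sub_le hM _ _)
                (norm_nonneg _) (abs_nonneg _)
      _ ≤ eLpNorm (fun x => ‖F1 x‖ + ‖F2 x‖ + ‖F3 x‖) 2 volume :=
          eLpNorm_mono_measure _ Measure.restrict_le_self
      _ ≤ eLpNorm F1 2 volume + eLpNorm F2 2 volume + eLpNorm F3 2 volume := by
          refine (eLpNorm_add_le (hm1.norm.add hm2.norm) hm3.norm (by norm_num)).trans ?_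
          rw [eLpNorm_norm]
          gcongr
          refine (eLpNorm_add_le hm1.norm hm2.norm (by norm_num)).trans ?_
          rw [eLpNorm_norm, eLpNorm_norm]
      _ ≤ _ := by
          exact add_le_add le_rfl hF3

/-- The Poincaré inequality for test functions. -/
lemma exists_poincare {Ω : Set ℂ} (hb : Bornology.IsBounded Ω) :
    ∃ C : ℝ≥0, ∀ ζ, IsTest Ω ζ → eLpNorm ζ 2 (volume.restrict Ω) ≤
      C * eLpNorm (gradient ζ) 2 (volume.restrict Ω) := by
  have hfin : volume Ω < ⊤ := hb.measure_lt_top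
  refine ⟨eLpNormLESNormFDerivOfLeConst ℝ volume Ω 1 2 *
    (volume Ω).toNNReal ^ (1 / 2 : ℝ), fun ζ hζ => ?_⟩
  have h1 := eLpNorm_le_eLpNorm_fderiv_of_le (F := ℝ) volume (u := ζ) (s := Ω)
    (hζ.1.of_le (by simp)) ((subset_tsupport _).trans hζ.2.2) (p := 1) (q := 2) le_rfl
    (by simp) (by simp; norm_num) hb
  have hsup : Function.support (fderiv ℝ ζ) ⊆ Ω :=
    (subset_tsupport _).trans ((tsupport_fderiv_subset ℝ).trans hζ.2.2)
  have hgn : eLpNorm (fderiv ℝ ζ) 2 (volume.restrict Ω) =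
      eLpNorm (gradient ζ) 2 (volume.restrict Ω) :=
    eLpNorm_congr_norm_ae (.of_forall fun x => (norm_gradient ζ x).symm)
  have h2 : eLpNorm (fderiv ℝ ζ) 1 (volume.restrict Ω) ≤
      eLpNorm (fderiv ℝ ζ) 2 (volume.restrict Ω) * volume Ω ^ (1 / 2 : ℝ) := by
    have := eLpNorm_le_eLpNorm_mul_rpow_measure_univ (μ := volume.restrict Ω) (p := 1) (q := 2)
      (f := fderiv ℝ ζ) (by norm_num) (hζ.1.continuous_fderiv (by simp)).aestronglyMeasurable
    rw [Measure.restrict_apply_univ] at this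
    norm_num at this ⊢
    exact this
  refine (eLpNorm_mono_measure _ Measure.restrict_le_self).trans ?_
  push_cast at h1
  refine h1.trans ?_
  rw [← eLpNorm_restrict_eq_of_support_subset (f := fderiv ℝ ζ) hsup, ← hgn]
  push_cast
  rw [ENNReal.coe_rpow_of_nonneg _ (by norm_num), ENNReal.coe_toNNReal hfin.ne, mul_assoc,
    mul_comm (volume Ω ^ _)]
  gcongr

lemma IsTest.memLp {Ω : Set ℂ} {ζ : ℂ → ℝ} (h : IsTest Ω ζ) (μ : Measure ℂ)
    [IsFiniteMeasureOnCompacts μ] : MemLp ζ 2 μ :=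
  h.1.continuous.memLp_of_hasCompactSupport h.2.1

lemma IsTest.memLp_gradient {Ω : Set ℂ} {ζ : ℂ → ℝ} (h : IsTest Ω ζ) (μ : Measure ℂ)
    [IsFiniteMeasureOnCompacts μ] : MemLp (gradient ζ) 2 μ :=
  h.continuous_gradient.memLp_of_hasCompactSupport ((h.2.1.fderiv ℝ).comp_left (map_zero _))

lemma IsTest.sub {Ω : Set ℂ} {ζ ξ : ℂ → ℝ} (h : IsTest Ω ζ) (h' : IsTest Ω ξ) :
    IsTest Ω (fun x => ζ x - ξ x) :=
  ⟨h.1.sub h'.1, h.2.1.sub h'.2.1, (tsupport_sub ζ ξ).trans (union_subset h.2.2 h'.2.2)⟩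

lemma gradient_fun_sub {f f' : ℂ → ℝ} {x : ℂ} (h : DifferentiableAt ℝ f x)
    (h' : DifferentiableAt ℝ f' x) :
    gradient (fun x => f x - f' x) x = gradient f x - gradient f' x := by
  simp only [gradient, fderiv_fun_sub h h', map_sub]

/-- By the Poincaré inequality, test functions whose gradients converge in `L²` converge. -/
lemma exists_tendsto_of_tendsto_gradient {Ω : Set ℂ} (hb : Bornology.IsBounded Ω)
    {z : ℕ → ℂ → ℝ} (hz : ∀ n, IsTest Ω (z n)) {g : ℂ → ℂ} (hg : MemLp g 2 (volume.restrict Ω))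
    (h : Tendsto (fun n => eLpNorm (fun x => gradient (z n) x - g x) 2 (volume.restrict Ω))
      atTop (𝓝 0)) :
    ∃ f, MemLp f 2 (volume.restrict Ω) ∧
      Tendsto (fun n => eLpNorm (fun x => z n x - f x) 2 (volume.restrict Ω)) atTop (𝓝 0) := by
  obtain ⟨C, hC⟩ := exists_poincare hb
  have hG : Tendsto (fun n => ((hz n).memLp_gradient (volume.restrict Ω)).toLp (gradient (z n)))
      atTop (𝓝 (hg.toLp g)) := by
    rw [Lp.tendsto_Lp_iff_tendsto_eLpNorm'' _ (fun n => (hz n).memLp_gradient _) _ hg]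
    exact h
  have hcau : CauchySeq fun n => ((hz n).memLp (volume.restrict Ω)).toLp (z n) := by
    have hGc := hG.cauchySeq
    rw [EMetric.cauchySeq_iff] at hGc ⊢
    intro ε hε
    obtain ⟨n₀, hn₀⟩ := hGc (ε / (C + 1)) (ENNReal.div_pos hε.ne' (by simp))
    refine ⟨n₀, fun m hm n hn => ?_⟩
    have h1 := hn₀ m hm n hn
    rw [Lp.edist_toLp_toLp] at h1 ⊢
    have h2 := hC _ ((hz m).sub (hz n))
    have e : gradient (fun x => z m x - z n x) = gradient (z m) - gradient (z n) := by
      ext x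
      rw [gradient_fun_sub ((hz m).1.differentiable (by simp) x)
        ((hz n).1.differentiable (by simp) x)]
      rfl
    rw [e] at h2
    refine h2.trans_lt ?_
    calc C * eLpNorm (gradient (z m) - gradient (z n)) 2 (volume.restrict Ω)
        ≤ (C + 1) * eLpNorm (gradient (z m) - gradient (z n)) 2 (volume.restrict Ω) := by
          gcongr
          exact le_self_add
      _ < ε := by
          rw [mul_comm]
          exact (ENNReal.lt_div_iff_mul_lt (by simp) (by simp)).1 h1
  obtain ⟨f, hf⟩ := cauchySeq_tendsto_of_complete hcau
  refine ⟨f, Lp.memLp f, ?_⟩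
  rw [← Lp.toLp_coeFn f (Lp.memLp f),
    Lp.tendsto_Lp_iff_tendsto_eLpNorm'' _ (fun n => (hz n).memLp _) _ (Lp.memLp f)] at hf
  exact hf

lemma memH10_of_tendsto {Ω : Set ℂ} (hΩ : IsOpen Ω) {σ : ℂ → ℝ} {g : ℂ → ℂ}
    (hw : HasWeakGrad Ω σ g) (hσ : MemLp σ 2 (volume.restrict Ω))
    (hg : MemLp g 2 (volume.restrict Ω)) {z : ℕ → ℂ → ℝ} (hz : ∀ n, IsTest Ω (z n))
    (h1 : Tendsto (fun n => eLpNorm (fun x => z n x - σ x) 2 (volume.restrict Ω)) atTop (𝓝 0))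
    (h2 : Tendsto (fun n => eLpNorm (fun x => gradient (z n) x - g x) 2 (volume.restrict Ω))
      atTop (𝓝 0)) : MemH10 Ω σ := by
  have e := hw.weakGrad_ae_eq hΩ
  refine ⟨⟨g, hw⟩, hσ, (memLp_congr_ae e).2 hg, z, hz, ?_, ?_⟩
  · refine h1.congr fun n => ?_
    rw [← eLpNorm_neg]
    congr 1 with x
    simp
  · refine h2.congr fun n => ?_
    rw [← eLpNorm_neg]
    refine eLpNorm_congr_ae ?_
    filter_upwards [e] with x hx
    simp [hx]

/-- A function that is `H¹` away from the points `a_j`, has zero trace there and a square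
integrable gradient on all of `Ω` belongs to `H¹₀(Ω)`: points have zero capacity. -/
theorem ZeroTrace.memH10 {N : ℕ} {Ω : Set ℂ} (hΩ : IsOpen Ω)
    (hb : Bornology.IsBounded Ω) (hcone : HasInwardCone Ω) {a : Fin N → ℂ}
    {σ : ℂ → ℝ} {g : ℂ → ℂ} (hz : ZeroTrace Ω a σ g) (hw : HasWeakGrad Ω σ g)
    (hσ : ∀ ρ > 0, MemLp σ 2 (volume.restrict (perforated Ω a ρ)))
    (hg : MemLp g 2 (volume.restrict Ω)) : MemH10 Ω σ := by
  classical
  have hσm : AEStronglyMeasurable σ (volume.restrict Ω) := hw.1.aestronglyMeasurable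
  -- The truncations are bounded by `2 (n + 1)`, and the norm of the gradient of the cutoff by
  -- `1 / (n + 1) ^ 2`: the term with the gradient of the cutoff vanishes in the limit.
  have hη : ∀ n : ℕ, ∃ η : ℂ → ℝ, ContDiff ℝ ∞ η ∧ (∀ x, 0 ≤ η x ∧ η x ≤ 1) ∧
      (∀ j, a j ∉ tsupport η) ∧ (∀ x, (∀ j, 1 / ((n : ℝ) + 1) ^ 2 ≤ ‖x - a j‖) → η x = 1) ∧
      eLpNorm (gradient η) 2 volume ≤ ENNReal.ofReal (1 / ((n : ℝ) + 1) ^ 2) := by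
    intro n
    obtain ⟨η, h1, h2, h3, h4, h5⟩ := exists_cutoff (Finset.univ.image a)
      (show 0 < 1 / ((n : ℝ) + 1) ^ 2 by positivity)
    exact ⟨η, h1, h2, fun j => h3 _ (by simp), fun x hx => h4 x (by simpa using hx), h5⟩
  choose η h1 h2 h3 h4 h5 using hη
  have hz' := fun n : ℕ => hz.exists_isTest_truncate hΩ hb hcone hσ hg hσm (h1 n) (h2 n) (h3 n)
    (show (0 : ℝ) < n + 1 by positivity) (show (0 : ℝ) < 1 / (n + 1) by positivity)
  choose z hzt k1 k2 using hz'
  have hgη : ∀ n, Continuous (gradient (η n)) := fun n =>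
    (InnerProductSpace.toDual ℝ ℂ).symm.continuous.comp ((h1 n).continuous_fderiv (by simp))
  have hlim0 : Tendsto (fun n : ℕ => ENNReal.ofReal (1 / ((n : ℝ) + 1))) atTop (𝓝 0) := by
    simpa using ENNReal.tendsto_ofReal tendsto_one_div_add_atTop_nhds_zero_nat
  have hη1 : ∀ᵐ x ∂volume.restrict Ω, ∀ᶠ n in atTop, η n x = 1 := by
    have hae : ∀ᵐ x : ℂ, x ∉ range a := by
      exact measure_eq_zero_iff_ae_notMem.1 ((finite_range a).measure_zero volume)
    filter_upwards [ae_restrict_of_ae hae] with x hx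
    have ht : Tendsto (fun n : ℕ => 1 / ((n : ℝ) + 1) ^ 2) atTop (𝓝 0) := by
      have := (tendsto_one_div_add_atTop_nhds_zero_nat (𝕜 := ℝ)).pow 2
      simpa [div_pow] using this
    have : ∀ j, ∀ᶠ n : ℕ in atTop, 1 / ((n : ℝ) + 1) ^ 2 ≤ ‖x - a j‖ := fun j =>
      ht.eventually_le_const (norm_pos_iff.2 (sub_ne_zero.2 fun h => hx ⟨j, h.symm⟩))
    filter_upwards [eventually_all.2 this] with n hn
    exact h4 n x hn
  have hdT : ∀ M, Continuous (deriv (softTrunc M)) := fun M =>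
    (contDiff_softTrunc M).continuous_deriv (by simp)
  -- convergence of the gradients
  have T1 : Tendsto (fun n : ℕ => eLpNorm (fun x =>
      (η n x * deriv (softTrunc (n + 1)) (σ x) - 1) • g x) 2 (volume.restrict Ω)) atTop (𝓝 0) := by
    refine tendsto_eLpNorm_two_of_dominated (b := fun x => 2 * ‖g x‖) (fun n => ?_)
      (hg.norm.const_mul 2) (fun n => .of_forall fun x => ?_) ?_
    · exact (((h1 n).continuous.aestronglyMeasurable.mul
        ((hdT _).comp_aestronglyMeasurable hσm)).sub aestronglyMeasurable_const).smul hg.1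
    · rw [norm_smul]
      gcongr
      refine (norm_sub_le _ _).trans ?_
      rw [norm_mul, norm_one, Real.norm_of_nonneg (h2 n x).1]
      have := mul_le_one₀ (h2 n x).2 (abs_nonneg _)
        (abs_deriv_softTrunc_le (show (0 : ℝ) < n + 1 by positivity) (σ x))
      simp only [Real.norm_eq_abs] at this ⊢
      linarith
    · filter_upwards [hη1] with x hx
      have e1 : Tendsto (fun n => η n x) atTop (𝓝 1) :=
        tendsto_const_nhds.congr' (hx.mono fun n hn => hn.symm)
      have := (((e1.mul (tendsto_deriv_softTrunc (σ x))).sub_const 1).smul_const (g x))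
      simpa using this
  have T2 : ∀ n : ℕ, eLpNorm (fun x => softTrunc (n + 1) (σ x) • gradient (η n) x) 2
      (volume.restrict Ω) ≤ ENNReal.ofReal (2 * (1 / (n + 1))) := by
    intro n
    have hn : (0 : ℝ) < n + 1 := by positivity
    calc _ ≤ ENNReal.ofReal (2 * (n + 1)) * eLpNorm (gradient (η n)) 2 (volume.restrict Ω) := by
          refine eLpNorm_le_mul_eLpNorm_of_ae_le_mul (.of_forall fun x => ?_) 2
          rw [norm_smul]
          gcongr
          exact abs_softTrunc_le hn _
      _ ≤ ENNReal.ofReal (2 * (n + 1)) * ENNReal.ofReal (1 / ((n : ℝ) + 1) ^ 2) := by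
          gcongr
          exact (eLpNorm_mono_measure _ Measure.restrict_le_self).trans (h5 n)
      _ = _ := by
          rw [← ENNReal.ofReal_mul (by positivity)]
          congr 1
          field_simp
  have Tg : Tendsto (fun n => eLpNorm (fun x => gradient (z n) x - g x) 2 (volume.restrict Ω))
      atTop (𝓝 0) := by
    have hlim2 : Tendsto (fun n : ℕ => ENNReal.ofReal (2 * (1 / ((n : ℝ) + 1)))) atTop (𝓝 0) := by
      have := (tendsto_one_div_add_atTop_nhds_zero_nat (𝕜 := ℝ)).const_mul 2
      simpa using ENNReal.tendsto_ofReal this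
    have hsum := (hlim0.add T1).add hlim2
    simp only [add_zero] at hsum
    refine tendsto_of_tendsto_of_tendsto_of_le_of_le tendsto_const_nhds hsum (fun _ => zero_le)
      fun n => ?_
    have mA : AEStronglyMeasurable (fun x => gradient (z n) x -
        ((η n x * deriv (softTrunc (n + 1)) (σ x)) • g x +
          softTrunc (n + 1) (σ x) • gradient (η n) x)) (volume.restrict Ω) := by
      refine (hzt n).continuous_gradient.aestronglyMeasurable.sub (.add ?_ ?_)
      · exact ((h1 n).continuous.aestronglyMeasurable.mul
          ((hdT _).comp_aestronglyMeasurable hσm)).smul hg.1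
      · exact ((contDiff_softTrunc _).continuous.comp_aestronglyMeasurable hσm).smul
          (hgη n).aestronglyMeasurable
    have mB : AEStronglyMeasurable (fun x =>
        (η n x * deriv (softTrunc (n + 1)) (σ x) - 1) • g x) (volume.restrict Ω) :=
      (((h1 n).continuous.aestronglyMeasurable.mul
        ((hdT _).comp_aestronglyMeasurable hσm)).sub aestronglyMeasurable_const).smul hg.1
    have mC : AEStronglyMeasurable (fun x => softTrunc (n + 1) (σ x) • gradient (η n) x)
        (volume.restrict Ω) :=
      ((contDiff_softTrunc _).continuous.comp_aestronglyMeasurable hσm).smul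
        (hgη n).aestronglyMeasurable
    have e : (fun x => gradient (z n) x - g x) = ((fun x => gradient (z n) x -
        ((η n x * deriv (softTrunc (n + 1)) (σ x)) • g x +
          softTrunc (n + 1) (σ x) • gradient (η n) x)) + fun x =>
        (η n x * deriv (softTrunc (n + 1)) (σ x) - 1) • g x) +
        fun x => softTrunc (n + 1) (σ x) • gradient (η n) x := by
      ext1 x
      simp only [Pi.add_apply]
      module
    rw [e]
    refine (eLpNorm_add_le (mA.add mB) mC (by norm_num)).trans (add_le_add ?_ (T2 n))
    exact (eLpNorm_add_le mA mB (by norm_num)).trans (add_le_add (k2 n) le_rfl)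
  -- identification of the limit of the functions
  obtain ⟨f, hf, hzf⟩ := exists_tendsto_of_tendsto_gradient hb hzt hg Tg
  have hdiff : Tendsto (fun n : ℕ => eLpNorm
      (fun x => f x - η n x * softTrunc (n + 1) (σ x)) 2 (volume.restrict Ω)) atTop (𝓝 0) := by
    have hsum := hzf.add hlim0
    simp only [add_zero] at hsum
    refine tendsto_of_tendsto_of_tendsto_of_le_of_le tendsto_const_nhds hsum (fun _ => zero_le)
      fun n => ?_
    have mT : AEStronglyMeasurable (fun x => η n x * softTrunc (n + 1) (σ x)) (volume.restrict Ω) :=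
      (h1 n).continuous.aestronglyMeasurable.mul
        ((contDiff_softTrunc _).continuous.comp_aestronglyMeasurable hσm)
    have mz : AEStronglyMeasurable (z n) (volume.restrict Ω) :=
      (hzt n).1.continuous.aestronglyMeasurable
    have e : (fun x => f x - η n x * softTrunc (n + 1) (σ x)) =
        -(fun x => z n x - f x) + fun x => z n x - η n x * softTrunc (n + 1) (σ x) := by
      ext1 x
      simp
    rw [e]
    refine (eLpNorm_add_le (mz.sub hf.1).neg (mz.sub mT) (by norm_num)).trans
      (add_le_add ?_ (k1 n))
    rw [eLpNorm_neg]
    rfl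
  obtain ⟨φ, hφ, hae⟩ := (tendstoInMeasure_of_tendsto_eLpNorm (p := 2) (by norm_num)
    (f := fun (n : ℕ) x => f x - η n x * softTrunc (n + 1) (σ x)) (g := fun _ => 0)
    (fun n => hf.1.sub ((h1 n).continuous.aestronglyMeasurable.mul
        ((contDiff_softTrunc _).continuous.comp_aestronglyMeasurable hσm)))
    aestronglyMeasurable_const (by
      refine hdiff.congr fun n => ?_
      congr 1 with x
      simp)).exists_seq_tendsto_ae
  have hfσ : f =ᵐ[volume.restrict Ω] σ := by
    filter_upwards [hae, hη1] with x hx hx1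
    have e1 : Tendsto (fun n => η n x) atTop (𝓝 1) :=
      tendsto_const_nhds.congr' (hx1.mono fun n hn => hn.symm)
    have e2 := ((e1.mul (tendsto_softTrunc (σ x))).const_sub (f x)).comp hφ.tendsto_atTop
    have e3 := tendsto_nhds_unique hx e2
    linarith
  refine memH10_of_tendsto hΩ hw ((memLp_congr_ae hfσ).1 hf) hg hzt (hzf.congr fun n => ?_) Tg
  refine eLpNorm_congr_ae ?_
  filter_upwards [hfσ] with x hx
  rw [hx]

/-! ### Compactness and existence of minimizers -/

section L2

variable {α : Type*} [MeasurableSpace α] {μ : Measure α} {E : Type*} [NormedAddCommGroup E]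
  [InnerProductSpace ℝ E]

lemma inner_toLp {u w : α → E} (hu : MemLp u 2 μ) (hw : MemLp w 2 μ) :
    inner ℝ (hu.toLp u) (hw.toLp w) = ∫ x, inner ℝ (u x) (w x) ∂μ := by
  rw [L2.inner_def]
  refine integral_congr_ae ?_
  filter_upwards [hu.coeFn_toLp, hw.coeFn_toLp] with x h1 h2
  rw [h1, h2]

lemma norm_toLp_sq {u : α → E} (hu : MemLp u 2 μ) : ‖hu.toLp u‖ ^ 2 = ∫ x, ‖u x‖ ^ 2 ∂μ := by
  rw [← real_inner_self_eq_norm_sq, inner_toLp]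
  simp_rw [real_inner_self_eq_norm_sq]

lemma integrable_inner_of_memLp {u w : α → E} (hu : MemLp u 2 μ) (hw : MemLp w 2 μ) :
    Integrable (fun x => inner ℝ (u x) (w x)) μ := by
  refine (L2.integrable_inner (𝕜 := ℝ) (hu.toLp u) (hw.toLp w)).congr ?_
  filter_upwards [hu.coeFn_toLp, hw.coeFn_toLp] with x h1 h2
  rw [h1, h2]

lemma integrable_norm_sq_of_memLp {u : α → E} (hu : MemLp u 2 μ) :
    Integrable (fun x => ‖u x‖ ^ 2) μ := by
  simpa only [real_inner_self_eq_norm_sq] using integrable_inner_of_memLp hu hu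

lemma tendsto_toLp {F : Type*} [NormedAddCommGroup F] {u : ℕ → α → F} {v : α → F}
    (hu : ∀ n, MemLp (u n) 2 μ) (hv : MemLp v 2 μ)
    (h : Tendsto (fun n => eLpNorm (fun x => u n x - v x) 2 μ) atTop (𝓝 0)) :
    Tendsto (fun n => (hu n).toLp (u n)) atTop (𝓝 (hv.toLp v)) := by
  rw [Lp.tendsto_Lp_iff_tendsto_eLpNorm'' _ hu _ hv]
  exact h

lemma tendsto_integral_inner {u : ℕ → α → E} {v w : α → E} (hu : ∀ n, MemLp (u n) 2 μ)
    (hv : MemLp v 2 μ) (hw : MemLp w 2 μ)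
    (h : Tendsto (fun n => eLpNorm (fun x => u n x - v x) 2 μ) atTop (𝓝 0)) :
    Tendsto (fun n => ∫ x, inner ℝ (u n x) (w x) ∂μ) atTop (𝓝 (∫ x, inner ℝ (v x) (w x) ∂μ)) := by
  have := (tendsto_toLp hu hv h).inner (𝕜 := ℝ) (tendsto_const_nhds (x := hw.toLp w))
  simpa only [inner_toLp] using this

end L2

/-- Weak gradients are closed under limits in `L²`. -/
lemma hasWeakGrad_of_tendsto {Ω : Set ℂ} (hΩ : IsOpen Ω) {f : ℂ → ℝ} {g : ℂ → ℂ}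
    (hf : MemLp f 2 (volume.restrict Ω)) (hg : MemLp g 2 (volume.restrict Ω))
    {z : ℕ → ℂ → ℝ} (hz : ∀ n, IsTest Ω (z n))
    (h1 : Tendsto (fun n => eLpNorm (fun x => z n x - f x) 2 (volume.restrict Ω)) atTop (𝓝 0))
    (h2 : Tendsto (fun n => eLpNorm (fun x => gradient (z n) x - g x) 2 (volume.restrict Ω))
      atTop (𝓝 0)) : HasWeakGrad Ω f g := by
  have hloc : ∀ {E : Type} [NormedAddCommGroup E] {f : ℂ → E}, MemLp f 2 (volume.restrict Ω) →
      LocallyIntegrableOn f Ω := fun hf =>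
    (locallyIntegrableOn_of_locallyIntegrable_restrict (hf.locallyIntegrable (by norm_num)))
  refine ⟨hloc hf, hloc hg, fun ζ hζ hc hs v => ?_⟩
  have hζt : IsTest Ω ζ := ⟨hζ, hc, hs⟩
  have hd : MemLp (fun x => fderiv ℝ ζ x v) 2 (volume.restrict Ω) :=
    ((hζ.continuous_fderiv (by simp)).clm_apply continuous_const).memLp_of_hasCompactSupport
      (hc.fderiv_apply ℝ v)
  have hv : MemLp (fun x => ζ x • v) 2 (volume.restrict Ω) :=
    (hζ.continuous.smul continuous_const).memLp_of_hasCompactSupport hc.smul_right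
  have t1 := tendsto_integral_inner (fun n => (hz n).memLp _) hf hd h1
  have t2 := (tendsto_integral_inner (fun n => (hz n).memLp_gradient _) hg hv h2).neg
  have e : ∀ n, ∫ x in Ω, inner ℝ (z n x) (fderiv ℝ ζ x v) =
      -∫ x in Ω, inner ℝ (gradient (z n) x) (ζ x • v) := by
    intro n
    have hl : LocallyLipschitzOn Ω (z n) :=
      ((hz n).1.of_le (by simp)).contDiffOn.locallyLipschitzOn_of_isOpen hΩ
    have := (integral_mul_fderiv_add hΩ hl
      ((hζ.of_le (by simp)).contDiffOn.locallyLipschitzOn_of_isOpen hΩ) hc hs v).2.2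
    simp_rw [inner_smul_right, inner_gradient]
    rw [← this]
    congr 1 with x
    simp [mul_comm]
  simp_rw [e] at t1
  have := tendsto_nhds_unique t1 t2
  simp_rw [inner_smul_right] at this
  rw [show (fun x => inner ℝ (g x) v * ζ x) = fun x => ζ x * inner ℝ (g x) v from
    funext fun x => mul_comm _ _, ← this]
  congr 1 with x
  simp [mul_comm]

/-- Bounded sequences in a separable Hilbert space have weakly convergent subsequences. -/
lemma exists_weak_subseq {H : Type*} [NormedAddCommGroup H] [InnerProductSpace ℝ H]
    [CompleteSpace H] [TopologicalSpace.SeparableSpace H] {u : ℕ → H} {r : ℝ} (hu : ∀ n, ‖u n‖ ≤ r) :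
    ∃ φ : ℕ → ℕ, StrictMono φ ∧ ∀ y, ∃ l, Tendsto (fun n => inner ℝ (u (φ n)) y) atTop (𝓝 l) := by
  have hmem : ∀ n, StrongDual.toWeakDual (InnerProductSpace.toDual ℝ H (u n)) ∈
      (WeakDual.toStrongDual ⁻¹' Metric.closedBall (0 : StrongDual ℝ H) r) := by
    intro n
    simpa using hu n
  obtain ⟨l, _, φ, hφ, hl⟩ := WeakDual.isSeqCompact_closedBall ℝ H 0 r hmem
  refine ⟨φ, hφ, fun y => ⟨l y, ?_⟩⟩
  have := ((WeakDual.eval_continuous y).tendsto l).comp hl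
  exact this

/-- The mollifications of a weakly convergent sequence in `L²` with a common bounded support converge
strongly. -/
lemma exists_tendsto_mollify {k : ℂ → ℝ} (hkm : IsMollifier k) {δ R A : ℝ}
    (hksup : ∀ y, k y ≠ 0 → ‖y‖ < δ) {z : ℕ → ℂ → ℝ} (hM : ∀ n, MemLp (z n) 2 volume)
    (hsub : ∀ n, Function.support (z n) ⊆ Metric.closedBall 0 R)
    (hnorm : ∀ n, ‖(hM n).toLp (z n)‖ ≤ A)
    (hw : ∀ y, ∃ l, Tendsto (fun n => inner ℝ ((hM n).toLp (z n)) y) atTop (𝓝 l)) :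
    ∃ m, AEStronglyMeasurable m volume ∧
      Tendsto (fun n => eLpNorm (fun x => mollify k (z n) x - m x) 2 volume) atTop (𝓝 0) := by
  -- `mollify k (z n) x` is the inner product of `z n` with `κ x = k (x - ·)`: it converges for every
  -- `x`, with a bound that is uniform in `n` and `x`
  have hkx : ∀ x, MemLp (fun t => k (x - t)) 2 volume := fun x =>
    (hkm.contDiff.continuous.comp (by fun_prop)).memLp_of_hasCompactSupport
      (hkm.hasCompactSupport.comp_homeomorph (Homeomorph.subLeft x))
  obtain ⟨κ, hκ⟩ : ∃ κ : ℂ → Lp ℝ 2 (volume : Measure ℂ),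
      ∀ x, κ x = (hkx x).toLp (fun t => k (x - t)) := ⟨_, fun _ => rfl⟩
  have hmol : ∀ n x, mollify k (z n) x = inner ℝ ((hM n).toLp (z n)) (κ x) := by
    intro n x
    rw [hκ, inner_toLp, mollify_apply, ← integral_sub_left_eq_self _ volume x]
    congr 1 with t
    simp
  choose m hm using fun x => hw (κ x)
  obtain ⟨B, hB⟩ : ∃ B : ℝ, ∀ x, ‖κ x‖ ≤ B := by
    refine ⟨(eLpNorm k 2 volume).toReal, fun x => ?_⟩
    rw [hκ, Lp.norm_toLp]
    refine le_of_eq ?_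
    congr 1
    exact eLpNorm_comp_measurePreserving (f := fun t => x - t)
      hkm.contDiff.continuous.aestronglyMeasurable (Measure.measurePreserving_sub_left volume x)
  have hA : 0 ≤ A := (norm_nonneg _).trans (hnorm 0)
  have hB' : ∀ n x, ‖mollify k (z n) x‖ ≤ A * B := fun n x => by
    rw [hmol]
    refine (norm_inner_le_norm _ _).trans ?_
    exact mul_le_mul (hnorm n) (hB x) (norm_nonneg _) hA
  have hout : ∀ n, ∀ x ∉ Metric.closedBall (0 : ℂ) (R + δ), mollify k (z n) x = 0 := by
    intro n x hx
    rw [mollify_apply]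
    refine integral_eq_zero_of_ae (.of_forall fun t => ?_)
    by_cases ht : k t = 0
    · simp [ht]
    · have : z n (x - t) = 0 := by
        by_contra h
        have h1 := hsub n h
        rw [mem_closedBall_zero_iff] at h1 hx
        have h2 := hksup t ht
        have : ‖x‖ ≤ ‖x - t‖ + ‖t‖ := by simpa using norm_add_le (x - t) t
        linarith
      simp [this]
  have hmt : ∀ x, Tendsto (fun n => mollify k (z n) x) atTop (𝓝 (m x)) := fun x => by
    simpa only [hmol] using hm x
  have hcm : ∀ n, Continuous (mollify k (z n)) := fun n =>
    (hkm.contDiff_mollify ((hM n).locallyIntegrable (by norm_num))).continuous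
  have hmm : AEStronglyMeasurable m volume :=
    aestronglyMeasurable_of_tendsto_ae atTop (fun n => (hcm n).aestronglyMeasurable)
      (.of_forall hmt)
  refine ⟨m, hmm, tendsto_eLpNorm_two_of_dominated
    (b := (Metric.closedBall (0 : ℂ) (R + δ)).indicator fun _ => 2 * (A * B))
    (fun n => (hcm _).aestronglyMeasurable.sub hmm)
    (memLp_indicator_const 2 measurableSet_closedBall _
      (Or.inr measure_closedBall_lt_top.ne)) (fun n => .of_forall fun x => ?_)
    (.of_forall fun x => by simpa using (hmt x).sub_const (m x))⟩
  have hmx : ‖m x‖ ≤ A * B := le_of_tendsto (hmt x).norm (.of_forall fun n => hB' _ x)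
  by_cases hx : x ∈ Metric.closedBall (0 : ℂ) (R + δ)
  · rw [indicator_of_mem hx]
    refine (norm_sub_le _ _).trans ?_
    linarith [hB' n x]
  · have : m x = 0 := tendsto_nhds_unique (hmt x) (by simp [hout _ x hx])
    simp [indicator_of_notMem hx, this, hout _ x hx]

/-- **Rellich compactness.** A weakly convergent subsequence has pointwise convergent and uniformly
bounded mollifications, and the mollification error is controlled by the gradients. -/
lemma exists_subseq_tendsto_of_gradient_bounded {Ω : Set ℂ} (hb : Bornology.IsBounded Ω)
    {z : ℕ → ℂ → ℝ} (hz : ∀ n, IsTest Ω (z n)) {K : ℝ≥0}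
    (hK : ∀ n, eLpNorm (gradient (z n)) 2 volume ≤ K) :
    ∃ φ : ℕ → ℕ, StrictMono φ ∧ ∃ f, MemLp f 2 volume ∧
      Tendsto (fun n => eLpNorm (fun x => z (φ n) x - f x) 2 volume) atTop (𝓝 0) := by
  obtain ⟨C, hC⟩ := exists_poincare hb
  have hsub : ∀ n, Function.support (z n) ⊆ Ω := fun n => (subset_tsupport _).trans (hz n).2.2
  have hzb : ∀ n, eLpNorm (z n) 2 volume ≤ C * K := fun n => by
    rw [← eLpNorm_restrict_eq_of_support_subset (hsub n)]
    refine (hC _ (hz n)).trans ?_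
    gcongr
    exact (eLpNorm_mono_measure _ Measure.restrict_le_self).trans (hK n)
  have hM : ∀ n, MemLp (z n) 2 volume := fun n => (hz n).memLp _
  have hnorm : ∀ n, ‖(hM n).toLp (z n)‖ ≤ (C * K : ℝ≥0) := fun n => by
    rw [Lp.norm_toLp]
    exact ENNReal.toReal_le_coe_of_le_coe (by push_cast; exact hzb n)
  have : Fact ((2 : ℝ≥0∞) ≠ ⊤) := ⟨by norm_num⟩
  obtain ⟨φ, hφ, hw⟩ := exists_weak_subseq hnorm
  refine ⟨φ, hφ, ?_⟩
  have hcau : CauchySeq fun n => (hM (φ n)).toLp (z (φ n)) := by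
    rw [EMetric.cauchySeq_iff]
    intro ε hε
    obtain ⟨ε', hε', hεε⟩ : ∃ ε' : ℝ, 0 < ε' ∧ ENNReal.ofReal (4 * ε') < ε := by
      obtain ⟨q, hq0, hq⟩ := ENNReal.lt_iff_exists_nnreal_btwn.1 hε
      refine ⟨q / 4, by have := ENNReal.coe_pos.1 hq0; positivity, ?_⟩
      rw [mul_div_cancel₀ _ (by norm_num), ENNReal.ofReal_coe_nnreal]
      exact hq
    obtain ⟨δ, hδ0, hδ⟩ : ∃ δ : ℝ, 0 < δ ∧ δ * K ≤ ε' := by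
      refine ⟨ε' / (K + 1), by positivity, ?_⟩
      rw [div_mul_eq_mul_div, div_le_iff₀ (by positivity)]
      nlinarith
    obtain ⟨k, hkm, hksup⟩ : ∃ k, IsMollifier k ∧ ∀ y, k y ≠ 0 → ‖y‖ < δ := by
      let ψ : ContDiffBump (0 : ℂ) := ⟨δ / 2, δ, by positivity, by linarith⟩
      refine ⟨ψ.normed volume, isMollifier_normed ψ, fun y hy => ?_⟩
      have hy' : y ∈ Function.support (ψ.normed volume) := hy
      rw [ψ.support_normed_eq, mem_ball_zero_iff] at hy'
      exact hy'
    -- translations by `y` cost at most `‖y‖` times the norm of the gradient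
    have herr : ∀ n, eLpNorm (fun x => mollify k (z n) x - z n x) 2 volume ≤ ENNReal.ofReal ε' := by
      intro n
      refine hkm.eLpNorm_mollify_sub_le ((hM n).locallyIntegrable (by norm_num)) fun y hy => ?_
      refine (eLpNorm_translate_sub_le ((hz n).1.of_le (by simp)) y).trans ?_
      rw [show eLpNorm (fderiv ℝ (z n)) 2 volume = eLpNorm (gradient (z n)) 2 volume from
        eLpNorm_congr_norm_ae (.of_forall fun x => (norm_gradient _ x).symm)]
      calc ‖y‖ₑ * eLpNorm (gradient (z n)) 2 volume ≤ ENNReal.ofReal δ * K := by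
            gcongr
            · rw [← ofReal_norm]
              exact ENNReal.ofReal_le_ofReal (hksup y hy).le
            · exact hK n
        _ ≤ ENNReal.ofReal ε' := by
            rw [← ENNReal.ofReal_coe_nnreal, ← ENNReal.ofReal_mul hδ0.le]
            exact ENNReal.ofReal_le_ofReal hδ
    obtain ⟨R, hR⟩ := hb.subset_closedBall 0
    obtain ⟨m, hmm, hconv⟩ := exists_tendsto_mollify hkm hksup (fun n => hM (φ n))
      (fun n => (hsub _).trans hR) (fun n => hnorm _) hw
    have hpos : 0 < ENNReal.ofReal ε' := ENNReal.ofReal_pos.2 hε'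
    obtain ⟨n₀, hn₀⟩ := eventually_atTop.1 (hconv.eventually_le_const hpos)
    have hnm : ∀ n ≥ n₀, eLpNorm (fun x => z (φ n) x - m x) 2 volume ≤
        ENNReal.ofReal (2 * ε') := by
      intro n hn
      have hc : AEStronglyMeasurable (mollify k (z (φ n))) volume :=
        (hkm.contDiff_mollify ((hM _).locallyIntegrable (by norm_num))).continuous.aestronglyMeasurable
      have e : (fun x => z (φ n) x - m x) = -(fun x => mollify k (z (φ n)) x - z (φ n) x) +
          fun x => mollify k (z (φ n)) x - m x := by
        ext1 x
        simp
      rw [e, two_mul, ENNReal.ofReal_add hε'.le hε'.le]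
      refine (eLpNorm_add_le (hc.sub (hM _).1).neg (hc.sub hmm) (by norm_num)).trans
        (add_le_add ?_ (hn₀ n hn))
      rw [eLpNorm_neg]
      exact herr _
    refine ⟨n₀, fun n hn n' hn' => ?_⟩
    rw [Lp.edist_toLp_toLp]
    refine lt_of_le_of_lt ?_ hεε
    have e : z (φ n) - z (φ n') = (fun x => z (φ n) x - m x) - fun x => z (φ n') x - m x := by
      ext1 x
      simp
    rw [e, show 4 * ε' = 2 * ε' + 2 * ε' by ring, ENNReal.ofReal_add (by positivity) (by positivity)]
    exact (eLpNorm_sub_le ((hM _).1.sub hmm) ((hM _).1.sub hmm) (by norm_num)).trans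
      (add_le_add (hnm n hn) (hnm n' hn'))
  obtain ⟨f, hf⟩ := cauchySeq_tendsto_of_complete hcau
  refine ⟨f, Lp.memLp f, ?_⟩
  rw [← Lp.toLp_coeFn f (Lp.memLp f),
    Lp.tendsto_Lp_iff_tendsto_eLpNorm'' _ (fun n => hM (φ n)) _ (Lp.memLp f)] at hf
  exact hf

lemma abs_zeeman_le (h : ℂ) (ψ : ℂ → ℝ) (x : ℂ) : |zeeman h ψ x| ≤ ‖h‖ := by
  refine (abs_real_inner_le_norm _ _).trans ?_
  rw [Complex.norm_exp_ofReal_mul_I, mul_one]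

lemma abs_zeeman_sub_le (h : ℂ) (ψ ψ' : ℂ → ℝ) (x : ℂ) :
    |zeeman h ψ x - zeeman h ψ' x| ≤ ‖h‖ * |ψ x - ψ' x| := by
  rw [zeeman, zeeman, ← inner_sub_right]
  refine (abs_real_inner_le_norm _ _).trans ?_
  gcongr
  have e : Complex.exp ((ψ x : ℂ) * Complex.I) - Complex.exp ((ψ' x : ℂ) * Complex.I) =
      Complex.exp ((ψ' x : ℂ) * Complex.I) *
        (Complex.exp (Complex.I * ((ψ x - ψ' x : ℝ) : ℂ)) - 1) := by
    rw [mul_sub, ← Complex.exp_add, mul_one]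
    push_cast
    ring_nf
  rw [e, norm_mul, Complex.norm_exp_ofReal_mul_I, one_mul]
  exact Real.norm_exp_I_mul_ofReal_sub_one_le

lemma aestronglyMeasurable_zeeman {μ : Measure ℂ} (h : ℂ) {ψ : ℂ → ℝ}
    (hψ : AEStronglyMeasurable ψ μ) : AEStronglyMeasurable (zeeman h ψ) μ :=
  (Continuous.comp_aestronglyMeasurable
    (g := fun t : ℝ => inner ℝ h (Complex.exp ((t : ℂ) * Complex.I))) (by fun_prop) hψ)

lemma integrable_zeeman {μ : Measure ℂ} [IsFiniteMeasure μ] (h : ℂ) {ψ : ℂ → ℝ}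
    (hψ : AEStronglyMeasurable ψ μ) : Integrable (zeeman h ψ) μ :=
  .of_bound (aestronglyMeasurable_zeeman h hψ) ‖h‖ (.of_forall fun x => abs_zeeman_le h ψ x)

/-- The Zeeman energy is Lipschitz continuous on `L²`. -/
lemma exists_zeeman_lipschitz {μ : Measure ℂ} [IsFiniteMeasure μ] (h : ℂ) {φ : ℂ → ℝ}
    (hφ : AEStronglyMeasurable φ μ) :
    ∃ A : ℝ, 0 ≤ A ∧ ∀ (σ τ : ℂ → ℝ) (hσ : MemLp σ 2 μ) (hτ : MemLp τ 2 μ),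
      |(∫ x, zeeman h (fun y => σ y + φ y) x ∂μ) - ∫ x, zeeman h (fun y => τ y + φ y) x ∂μ| ≤
        A * ‖hσ.toLp σ - hτ.toLp τ‖ := by
  refine ⟨‖h‖ * (μ univ ^ (1 / (1 : ℝ≥0∞).toReal - 1 / (2 : ℝ≥0∞).toReal)).toReal, by positivity,
    fun σ τ hσ hτ => ?_⟩
  have hd : MemLp (fun x => σ x - τ x) 2 μ := hσ.sub hτ
  have iσ : Integrable (zeeman h fun y => σ y + φ y) μ := integrable_zeeman h (hσ.1.add hφ)
  have iτ : Integrable (zeeman h fun y => τ y + φ y) μ := integrable_zeeman h (hτ.1.add hφ)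
  rw [← integral_sub iσ iτ, ← Real.norm_eq_abs]
  refine (norm_integral_le_integral_norm _).trans ?_
  refine (integral_mono_of_nonneg (.of_forall fun _ => norm_nonneg _)
    ((hd.integrable (by norm_num)).norm.const_mul ‖h‖)
    (.of_forall fun x => ?_)).trans (b := ∫ x, ‖h‖ * ‖σ x - τ x‖ ∂μ) ?_
  · simpa using abs_zeeman_sub_le h (fun y => σ y + φ y) (fun y => τ y + φ y) x
  rw [integral_const_mul, mul_assoc]
  gcongr
  rw [integral_norm_eq_lintegral_enorm hd.1, ← eLpNorm_one_eq_lintegral_enorm, ← MemLp.toLp_sub,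
    Lp.norm_toLp, mul_comm, ← ENNReal.toReal_mul]
  refine ENNReal.toReal_mono ?_ (eLpNorm_le_eLpNorm_mul_rpow_measure_univ (by norm_num) hd.1)
  exact ENNReal.mul_ne_top hd.2.ne (ENNReal.rpow_ne_top_of_nonneg (by norm_num)
    (measure_ne_top _ _))

lemma MemH10.aestronglyMeasurable {Ω : Set ℂ} {σ : ℂ → ℝ} (h : MemH10 Ω σ) :
    AEStronglyMeasurable σ (volume.restrict Ω) := h.2.1.1

lemma MemH10.memLp_weakGrad {Ω : Set ℂ} {σ : ℂ → ℝ} (h : MemH10 Ω σ) :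
    MemLp (weakGrad Ω σ) 2 (volume.restrict Ω) := h.2.2.1

lemma energyF_eq {Ω : Set ℂ} (hb : Bornology.IsBounded Ω) (h : ℂ) {φ σ : ℂ → ℝ}
    (hφ : AEStronglyMeasurable φ (volume.restrict Ω)) (hσ : MemH10 Ω σ) :
    energyF Ω h φ σ = ‖hσ.memLp_weakGrad.toLp _‖ ^ 2 - ∫ x in Ω, zeeman h (fun y => σ y + φ y) x := by
  have : IsFiniteMeasure (volume.restrict Ω) := ⟨by simpa using hb.measure_lt_top⟩
  have i : IntegrableOn (zeeman h fun y => σ y + φ y) Ω :=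
    integrable_zeeman h (hσ.aestronglyMeasurable.add hφ)
  rw [energyF, integral_sub (integrable_norm_sq_of_memLp hσ.memLp_weakGrad) i, norm_toLp_sq]

/-- The direct method: along a minimizing sequence of test functions, Rellich compactness handles the
Zeeman term, and the parallelogram identity for the Dirichlet term upgrades this to convergence of
the gradients. -/
theorem exists_minimizer {Ω : Set ℂ} (hΩ : IsOpen Ω) (hb : Bornology.IsBounded Ω) (h : ℂ)
    {φ : ℂ → ℝ} (hφ : AEStronglyMeasurable φ (volume.restrict Ω)) :
    ∃ σ, IsMinimizerF Ω h φ σ := by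
  have : IsFiniteMeasure (volume.restrict Ω) := ⟨by simpa using hb.measure_lt_top⟩
  obtain ⟨A, hA, hE⟩ := exists_zeeman_lipschitz h hφ
  obtain ⟨E, hEdef⟩ : ∃ E : (ℂ → ℝ) → ℝ,
    ∀ σ, E σ = ∫ x in Ω, zeeman h (fun y => σ y + φ y) x := ⟨_, fun _ => rfl⟩
  simp only [← hEdef] at hE
  let G : (ζ : {ζ // IsTest Ω ζ}) → Lp ℂ 2 (volume.restrict Ω) := fun ζ =>
    (ζ.2.memLp_gradient _).toLp _
  have hGdef : ∀ ζ (hζ : IsTest Ω ζ), G ⟨ζ, hζ⟩ = (hζ.memLp_gradient _).toLp _ := fun _ _ => rfl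
  let J : {ζ // IsTest Ω ζ} → ℝ := fun ζ => ‖G ζ‖ ^ 2 - E ζ
  have hJdef : ∀ ζ, J ζ = ‖G ζ‖ ^ 2 - E ζ := fun _ => rfl
  have hEb : ∀ σ, E σ ≤ ‖h‖ * volume.real Ω := fun σ => by
    rw [hEdef]
    refine (le_abs_self _).trans ?_
    rw [← Real.norm_eq_abs]
    exact norm_setIntegral_le_of_norm_le_const hb.measure_lt_top
      fun x _ => abs_zeeman_le h _ x
  -- continuity of the energy along approximating test functions
  have hcont : ∀ (z : ℕ → {ζ // IsTest Ω ζ}) (σ : ℂ → ℝ) (hσ : MemH10 Ω σ),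
      Tendsto (fun n => eLpNorm (fun x => (z n).1 x - σ x) 2 (volume.restrict Ω)) atTop (𝓝 0) →
      Tendsto (fun n => eLpNorm (fun x => gradient (z n).1 x - weakGrad Ω σ x) 2
        (volume.restrict Ω)) atTop (𝓝 0) →
      Tendsto (fun n => J (z n)) atTop (𝓝 (energyF Ω h φ σ)) := by
    intro z σ hσ h1 h2
    rw [energyF_eq hb h hφ hσ, ← hEdef]
    have t1 := tendsto_toLp (fun n => (z n).2.memLp_gradient _) hσ.memLp_weakGrad h2
    have t2 := tendsto_toLp (fun n => (z n).2.memLp _) hσ.2.1 h1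
    refine (t1.norm.pow 2).sub ?_
    rw [tendsto_iff_norm_sub_tendsto_zero] at t2 ⊢
    exact squeeze_zero (fun _ => norm_nonneg _)
      (fun n => hE _ _ ((z n).2.memLp _) hσ.2.1) (by simpa using t2.const_mul A)
  have hbdd : BddBelow (range J) := by
    refine ⟨-(‖h‖ * volume.real Ω), ?_⟩
    rintro _ ⟨ζ, rfl⟩
    rw [hJdef]
    nlinarith [hEb ζ, sq_nonneg ‖G ζ‖]
  have hne : (range J).Nonempty := ⟨_, ⟨⟨_, isTest_zero Ω⟩, rfl⟩⟩
  set m := sInf (range J) with hm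
  have hmle : ∀ ζ, m ≤ J ζ := fun ζ => csInf_le hbdd ⟨ζ, rfl⟩
  have hseq : ∀ n : ℕ, ∃ ζ, J ζ < m + 1 / ((n : ℝ) + 1) := fun n => by
    obtain ⟨_, ⟨ζ, rfl⟩, hζ⟩ := exists_lt_of_csInf_lt hne
      (show m < m + 1 / ((n : ℝ) + 1) by have : (0 : ℝ) < 1 / ((n : ℝ) + 1) := by positivity
                                         linarith)
    exact ⟨ζ, hζ⟩
  choose z hz using hseq
  have hG2 : ∀ n, ‖G (z n)‖ ^ 2 ≤ m + 1 + ‖h‖ * volume.real Ω := fun n => by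
    have h1 := hz n
    have h2 : 1 / ((n : ℝ) + 1) ≤ 1 := by
      rw [div_le_one (by positivity)]
      linarith [n.cast_nonneg (α := ℝ)]
    rw [hJdef] at h1
    linarith [hEb (z n)]
  obtain ⟨K, hK⟩ : ∃ K : ℝ≥0, ∀ n, eLpNorm (gradient (z n).1) 2 volume ≤ K := by
    refine ⟨(Real.sqrt (m + 1 + ‖h‖ * volume.real Ω)).toNNReal, fun n => ?_⟩
    have hs : Function.support (gradient (z n).1) ⊆ Ω := by
      refine fun x hx => (z n).2.2.2 (support_fderiv_subset ℝ (a := x) ?_)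
      rwa [Function.mem_support, ← norm_ne_zero_iff, norm_gradient, norm_ne_zero_iff] at hx
    rw [← eLpNorm_restrict_eq_of_support_subset hs]
    have h1 : ‖G (z n)‖ ≤ Real.sqrt (m + 1 + ‖h‖ * volume.real Ω) :=
      Real.le_sqrt_of_sq_le (hG2 n)
    rw [Lp.norm_toLp] at h1
    rw [← ENNReal.ofReal_toReal ((z n).2.memLp_gradient _).2.ne]
    exact ENNReal.ofReal_le_ofReal h1
  obtain ⟨s, hs, f, hf, hlim⟩ := exists_subseq_tendsto_of_gradient_bounded hb (fun n => (z n).2) hK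
  have hfΩ := hf.mono_measure (Measure.restrict_le_self (s := Ω))
  have hlimΩ : Tendsto (fun n => eLpNorm (fun x => (z (s n)).1 x - f x) 2 (volume.restrict Ω))
      atTop (𝓝 0) :=
    tendsto_of_tendsto_of_tendsto_of_le_of_le tendsto_const_nhds hlim (fun _ => zero_le)
      fun n => eLpNorm_mono_measure _ Measure.restrict_le_self
  have hSc := (tendsto_toLp (fun n => (z (s n)).2.memLp _) hfΩ hlimΩ).cauchySeq
  -- parallelogram identity
  have hpar : ∀ n k, ‖G (z n) - G (z k)‖ ^ 2 ≤ 2 * (1 / ((n : ℝ) + 1)) + 2 * (1 / ((k : ℝ) + 1)) +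
      2 * A * ‖((z n).2.memLp (volume.restrict Ω)).toLp _ -
        ((z k).2.memLp (volume.restrict Ω)).toLp _‖ := by
    intro n k
    have hmid : IsTest Ω (fun x => (1 / 2 : ℝ) * ((z n).1 x + (z k).1 x)) := by
      have := ((z n).2.add (z k).2)
      exact ⟨contDiff_const.mul this.1, this.2.1.mul_left, (tsupport_mul_subset_right).trans this.2.2⟩
    have hGmid : G ⟨_, hmid⟩ = (1 / 2 : ℝ) • (G (z n) + G (z k)) := by
      rw [hGdef, hGdef, hGdef, ← MemLp.toLp_add, ← MemLp.toLp_const_smul]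
      refine MemLp.toLp_congr _ _ (.of_forall fun x => ?_)
      have h1 := ((z n).2.1.differentiable (by simp) x)
      have h2 := ((z k).2.1.differentiable (by simp) x)
      have e := gradient_fun_mul (differentiableAt_const (1 / 2 : ℝ)) (h1.add h2)
      have : gradient (fun _ : ℂ => (1 / 2 : ℝ)) x = 0 := by
        rw [← norm_eq_zero, norm_gradient]
        simp
      rw [this, smul_zero, add_zero] at e
      refine e.trans ?_
      simp only [Pi.smul_apply, Pi.add_apply]
      congr 1
      exact gradient_fun_add h1 h2
    have h1 := hmle ⟨_, hmid⟩
    have h2 := hz n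
    have h3 := hz k
    have h4 := parallelogram_law_with_norm ℝ (G (z n)) (G (z k))
    have hSn : (hmid.memLp (volume.restrict Ω)).toLp _ = (1 / 2 : ℝ) •
        (((z n).2.memLp (volume.restrict Ω)).toLp _ + ((z k).2.memLp (volume.restrict Ω)).toLp _) := by
      rw [← MemLp.toLp_add, ← MemLp.toLp_const_smul]
      rfl
    have hEn := hE _ _ ((z n).2.memLp _) (hmid.memLp _)
    have hEk := hE _ _ ((z k).2.memLp _) (hmid.memLp _)
    rw [hSn] at hEn hEk
    set X := ((z n).2.memLp (volume.restrict Ω)).toLp _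
    set Y := ((z k).2.memLp (volume.restrict Ω)).toLp _
    rw [show X - (1 / 2 : ℝ) • (X + Y) = (1 / 2 : ℝ) • (X - Y) by module, norm_smul] at hEn
    rw [show Y - (1 / 2 : ℝ) • (X + Y) = (-(1 / 2) : ℝ) • (X - Y) by module, norm_smul] at hEk
    rw [hJdef, hGmid, norm_smul, mul_pow] at h1
    rw [hJdef] at h2 h3
    norm_num at hEn hEk h1 h2 h3 h4 ⊢
    have e1 := (abs_le.1 hEn).1
    have e2 := (abs_le.1 hEk).1
    have e3 := (abs_le.1 hEn).2
    have e4 := (abs_le.1 hEk).2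
    nlinarith
  have hGc : CauchySeq fun n => G (z (s n)) := by
    rw [Metric.cauchySeq_iff']
    intro ε hε
    have t1 : Tendsto (fun n : ℕ => 1 / ((n : ℝ) + 1)) atTop (𝓝 0) :=
      tendsto_one_div_add_atTop_nhds_zero_nat
    obtain ⟨n₁, hn₁⟩ := eventually_atTop.1 (t1.eventually_lt_const
      (show (0 : ℝ) < ε ^ 2 / 8 by positivity))
    obtain ⟨n₂, hn₂⟩ := Metric.cauchySeq_iff.1 hSc (ε ^ 2 / (4 * (A + 1))) (by positivity)
    refine ⟨max n₁ n₂, fun n hn => ?_⟩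
    have i1 := hn₁ (s n) ((le_max_left _ _).trans (hn.trans hs.le_apply))
    have i2 := hn₁ (s (max n₁ n₂)) ((le_max_left _ _).trans hs.le_apply)
    have i3 := hn₂ n ((le_max_right _ _).trans hn) (max n₁ n₂) (le_max_right _ _)
    have i4 := hpar (s n) (s (max n₁ n₂))
    rw [dist_eq_norm] at i3 ⊢
    refine lt_of_pow_lt_pow_left₀ 2 hε.le (lt_of_le_of_lt i4 ?_)
    rw [lt_div_iff₀ (by positivity)] at i3
    nlinarith [norm_nonneg (((z (s n)).2.memLp (volume.restrict Ω)).toLp _ -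
        ((z (s (max n₁ n₂))).2.memLp (volume.restrict Ω)).toLp _)]
  obtain ⟨g, hg⟩ := cauchySeq_tendsto_of_complete hGc
  have hgL := Lp.memLp g
  have hlimG : Tendsto (fun n => eLpNorm (fun x => gradient (z (s n)).1 x - g x) 2
      (volume.restrict Ω)) atTop (𝓝 0) := by
    rw [← Lp.toLp_coeFn g hgL,
      Lp.tendsto_Lp_iff_tendsto_eLpNorm'' _ (fun n => (z (s n)).2.memLp_gradient _) _ hgL] at hg
    exact hg
  have hfg := hasWeakGrad_of_tendsto hΩ hfΩ hgL (fun n => (z (s n)).2) hlimΩ hlimG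
  have hmem : MemH10 Ω f := memH10_of_tendsto hΩ hfg hfΩ hgL (fun n => (z (s n)).2) hlimΩ hlimG
  have hwg := hfg.weakGrad_ae_eq hΩ
  have hlimW : Tendsto (fun n => eLpNorm (fun x => gradient (z (s n)).1 x - weakGrad Ω f x) 2
      (volume.restrict Ω)) atTop (𝓝 0) := by
    refine hlimG.congr fun n => eLpNorm_congr_ae ?_
    filter_upwards [hwg] with x hx
    rw [hx]
  have hJf := hcont _ f hmem hlimΩ hlimW
  have hfm : energyF Ω h φ f ≤ m := by
    have t1 : Tendsto (fun n : ℕ => m + 1 / ((s n : ℝ) + 1)) atTop (𝓝 (m + 0)) :=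
      tendsto_const_nhds.add ((tendsto_one_div_add_atTop_nhds_zero_nat (𝕜 := ℝ)).comp
        hs.tendsto_atTop)
    rw [add_zero] at t1
    exact le_of_tendsto_of_tendsto' hJf t1 fun n => (hz (s n)).le
  refine ⟨f, hmem, fun η hη => hfm.trans ?_⟩
  obtain ⟨ζ, hζ, h1, h2⟩ := hη.2.2.2
  refine ge_of_tendsto' (hcont (fun n => ⟨ζ n, hζ n⟩) η hη ?_ ?_) fun n => hmle _
  · refine h1.congr fun n => ?_
    rw [← eLpNorm_neg]
    congr 1 with x
    simp
  · refine h2.congr fun n => ?_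
    rw [← eLpNorm_neg]
    congr 1 with x
    simp

/-! ### Local structure of the boundary -/

/-- `Ω` is the region above the graph of `f` in the box of size `r` centred at the boundary point `p`,
in the orthonormal coordinates `z = p + u * w`. -/
structure IsChart (Ω : Set ℂ) (p u : ℂ) (r : ℝ) (f : ℝ → ℝ) (K : ℝ≥0) : Prop where
  norm_eq : ‖u‖ = 1
  pos : 0 < r
  differentiable : Differentiable ℝ f
  lipschitz : LipschitzWith K (deriv f)
  zero : f 0 = 0
  mem_iff : ∀ w : ℂ, |w.re| < r → |w.im| < r → (p + u * w ∈ Ω ↔ f w.re < w.im)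
  mem_frontier_iff : ∀ w : ℂ, |w.re| < r → |w.im| < r → (p + u * w ∈ frontier Ω ↔ f w.re = w.im)

lemma isOpen_box (r : ℝ) : IsOpen {w : ℂ | |w.re| < r ∧ |w.im| < r} := by
  have h1 : IsOpen {w : ℂ | |w.re| < r} := isOpen_lt Complex.continuous_re.abs continuous_const
  have h2 : IsOpen {w : ℂ | |w.im| < r} := isOpen_lt Complex.continuous_im.abs continuous_const
  convert h1.inter h2 using 1
  ext w
  simp

/-- The definition of a `C^{1,1}` domain only describes `Ω` in the chart; the description of the
frontier follows. -/
lemma IsC11.exists_isChart {Ω : Set ℂ} (hΩ : IsOpen Ω) (h : IsC11 Ω) {p : ℂ}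
    (hp : p ∈ frontier Ω) : ∃ u r f K, IsChart Ω p u r f K := by
  obtain ⟨u, r, f, K, hu, hr, hf, hK, hΩf⟩ := h p hp
  have hmem : ∀ w : ℂ, |w.re| < r → |w.im| < r → (p + u * w ∈ Ω ↔ f w.re < w.im) := by
    intro w h1 h2
    rw [← hΩf _ _ h1 h2, Complex.re_add_im]
  have hfr : ∀ w : ℂ, |w.re| < r → |w.im| < r → (p + u * w ∈ frontier Ω ↔ f w.re = w.im) := by
    intro w h1 h2
    have hc : Continuous fun z : ℂ => starRingEnd ℂ u * (z - p) := by fun_prop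
    have hinv : ∀ z, p + u * (starRingEnd ℂ u * (z - p)) = z := fun z => by
      rw [← mul_assoc, Complex.mul_conj, Complex.normSq_eq_norm_sq, hu]
      simp
    have hinv' : starRingEnd ℂ u * (p + u * w - p) = w := by
      rw [add_sub_cancel_left, ← mul_assoc, mul_comm (starRingEnd ℂ u), Complex.mul_conj,
        Complex.normSq_eq_norm_sq, hu]
      simp
    rw [hΩ.frontier_eq, Set.mem_sdiff, hmem w h1 h2]
    constructor
    · rintro ⟨hcl, hn⟩
      refine le_antisymm ?_ (not_lt.1 hn)
      by_contra! hlt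
      -- below the graph there is a neighbourhood disjoint from `Ω`
      have hev : ∀ᶠ z in 𝓝 (p + u * w), z ∉ Ω := by
        have hopen : IsOpen {w : ℂ | w.im < f w.re} :=
          isOpen_lt (by fun_prop) (hf.continuous.comp Complex.continuous_re)
        have hw : w ∈ {w : ℂ | w.im < f w.re} ∩ {w : ℂ | |w.re| < r ∧ |w.im| < r} := ⟨hlt, h1, h2⟩
        have := hc.continuousAt (x := p + u * w) |>.preimage_mem_nhds
          (t := {w : ℂ | w.im < f w.re} ∩ {w : ℂ | |w.re| < r ∧ |w.im| < r})
          (by rw [hinv']; exact (hopen.inter (isOpen_box r)).mem_nhds hw)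
        filter_upwards [this] with z hz hzΩ
        have := (hmem _ hz.2.1 hz.2.2).1 (by rwa [hinv])
        exact lt_asymm this hz.1
      exact (mem_closure_iff_frequently.1 hcl) (hev.mono fun z hz => hz)
    · intro he
      refine ⟨?_, he.not_lt⟩
      have ht : Tendsto (fun t : ℝ => p + u * (w + t * Complex.I)) (𝓝[>] 0) (𝓝 (p + u * w)) := by
        have : Continuous fun t : ℝ => p + u * (w + t * Complex.I) := by fun_prop
        simpa using (this.tendsto 0).mono_left (nhdsWithin_le_nhds (s := Ioi 0))
      refine mem_closure_of_tendsto ht ?_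
      have hpos : (0 : ℝ) < r - |w.im| := by linarith
      filter_upwards [Ioo_mem_nhdsGT hpos] with t ht
      refine (hmem _ (by simpa using h1) ?_).2 ?_
      · simp only [Complex.add_im, Complex.mul_im, Complex.ofReal_re, Complex.I_im, mul_one,
          Complex.ofReal_im, Complex.I_re, mul_zero, add_zero]
        exact (abs_add_le _ _).trans_lt (by rw [abs_of_pos ht.1]; linarith [ht.2])
      · simp [he, ht.1]
  refine ⟨u, r, f, K, hu, hr, hf, hK, ?_, hmem, hfr⟩
  simpa using (hfr 0 (by simpa using hr) (by simpa using hr)).1 (by simpa using hp)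

namespace IsChart

variable {Ω : Set ℂ} {p u : ℂ} {r : ℝ} {f : ℝ → ℝ} {K : ℝ≥0}

/-- The coordinate of a point in the chart. -/
lemma add_mul_conj (h : IsChart Ω p u r f K) (z : ℂ) :
    p + u * (starRingEnd ℂ u * (z - p)) = z := by
  rw [← mul_assoc, Complex.mul_conj, Complex.normSq_eq_norm_sq, h.norm_eq]
  simp

lemma conj_mul_self (h : IsChart Ω p u r f K) (w : ℂ) : starRingEnd ℂ u * (u * w) = w := by
  rw [← mul_assoc, mul_comm (starRingEnd ℂ u), Complex.mul_conj, Complex.normSq_eq_norm_sq,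
    h.norm_eq]
  simp

lemma norm_conj_mul (h : IsChart Ω p u r f K) (z : ℂ) : ‖starRingEnd ℂ u * z‖ = ‖z‖ := by
  rw [norm_mul, RCLike.norm_conj, h.norm_eq, one_mul]

lemma mem_iff' (h : IsChart Ω p u r f K) {z : ℂ} (h1 : |(starRingEnd ℂ u * (z - p)).re| < r)
    (h2 : |(starRingEnd ℂ u * (z - p)).im| < r) :
    z ∈ Ω ↔ f (starRingEnd ℂ u * (z - p)).re < (starRingEnd ℂ u * (z - p)).im := by
  rw [← h.mem_iff _ h1 h2, h.add_mul_conj]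

lemma mem_frontier_iff' (h : IsChart Ω p u r f K) {z : ℂ}
    (h1 : |(starRingEnd ℂ u * (z - p)).re| < r) (h2 : |(starRingEnd ℂ u * (z - p)).im| < r) :
    z ∈ frontier Ω ↔ f (starRingEnd ℂ u * (z - p)).re = (starRingEnd ℂ u * (z - p)).im := by
  rw [← h.mem_frontier_iff _ h1 h2, h.add_mul_conj]

/-- Second order Taylor estimate for the graph. -/
lemma abs_sub_le (h : IsChart Ω p u r f K) (x : ℝ) : |f x - deriv f 0 * x| ≤ K * x ^ 2 := by
  have h1 : ∀ y ∈ Icc (-|x|) |x|, HasDerivWithinAt (fun y => f y - deriv f 0 * y)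
      (deriv f y - deriv f 0) (Icc (-|x|) |x|) y := fun y _ => by
    have := (h.differentiable y).hasDerivAt.fun_sub ((hasDerivAt_id y).const_mul (deriv f 0))
    simpa using this.hasDerivWithinAt
  have h2 : ∀ y ∈ Icc (-|x|) |x|, ‖deriv f y - deriv f 0‖ ≤ K * |x| := fun y hy => by
    have := h.lipschitz.dist_le_mul y 0
    rw [Real.dist_eq, Real.dist_eq, sub_zero] at this
    exact this.trans (mul_le_mul_of_nonneg_left (abs_le.2 hy) K.2)
  have := (convex_Icc (-|x|) |x|).norm_image_sub_le_of_norm_hasDerivWithin_le h1 h2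
    (show (0 : ℝ) ∈ _ by simp) (show x ∈ _ by exact ⟨neg_abs_le x, le_abs_self x⟩)
  simp only [mul_zero, h.zero, sub_zero, Real.norm_eq_abs] at this
  rwa [mul_assoc, ← abs_mul, ← sq, abs_of_nonneg (sq_nonneg x)] at this

lemma continuous_deriv (h : IsChart Ω p u r f K) : Continuous (deriv f) := h.lipschitz.continuous

lemma abs_deriv_le (h : IsChart Ω p u r f K) {x R : ℝ} (hx : |x| ≤ R) :
    |deriv f x| ≤ |deriv f 0| + K * R := by
  have := h.lipschitz.dist_le_mul x 0
  rw [Real.dist_eq, Real.dist_eq, sub_zero] at this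
  have h2 : (K : ℝ) * |x| ≤ K * R := by gcongr
  have h3 := abs_sub_abs_le_abs_sub (deriv f x) (deriv f 0)
  linarith

/-- Where the boundary curve lies in the chart, it runs through the graph from left to right. -/
lemma tangent (h : IsChart Ω p u r f K) {L : ℝ} {γ : ℝ → ℂ} (hγ : IsBoundaryParam Ω L γ) {s : ℝ}
    (h1 : |(starRingEnd ℂ u * (γ s - p)).re| < r) (h2 : |(starRingEnd ℂ u * (γ s - p)).im| < r) :
    0 < (starRingEnd ℂ u * deriv γ s).re ∧
    (starRingEnd ℂ u * deriv γ s).im =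
      deriv f (starRingEnd ℂ u * (γ s - p)).re * (starRingEnd ℂ u * deriv γ s).re := by
  set w : ℝ → ℂ := fun t => starRingEnd ℂ u * (γ t - p) with hw
  have hwd : HasDerivAt w (starRingEnd ℂ u * deriv γ s) s :=
    ((hγ.differentiable s).hasDerivAt.sub_const p).const_mul _
  set v := starRingEnd ℂ u * deriv γ s with hv
  have hre : HasDerivAt (fun t => (w t).re) v.re s :=
    (Complex.reCLM.hasFDerivAt.comp_hasDerivAt s hwd)
  have him : HasDerivAt (fun t => (w t).im) v.im s :=
    (Complex.imCLM.hasFDerivAt.comp_hasDerivAt s hwd)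
  have hfd : HasDerivAt f (deriv f (w s).re) (w s).re := (h.differentiable _).hasDerivAt
  have hcomp : HasDerivAt (fun t => f (w t).re) (deriv f (w s).re * v.re) s := hfd.comp s hre
  have hbox : ∀ᶠ t in 𝓝 s, |(w t).re| < r ∧ |(w t).im| < r :=
    hwd.continuousAt.preimage_mem_nhds ((isOpen_box r).mem_nhds ⟨h1, h2⟩)
  have heq : (fun t => f (w t).re) =ᶠ[𝓝 s] fun t => (w t).im := by
    filter_upwards [hbox] with t ht
    exact (h.mem_frontier_iff' ht.1 ht.2).1 (hγ.range_eq ▸ mem_range_self t)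
  have hvim : v.im = deriv f (w s).re * v.re :=
    (him.unique (hcomp.congr_of_eventuallyEq heq.symm))
  refine ⟨?_, hvim⟩
  have hvn : v.re ^ 2 * (1 + deriv f (w s).re ^ 2) = 1 := by
    have : ‖v‖ ^ 2 = 1 := by rw [hv, h.norm_conj_mul, hγ.unit_speed, one_pow]
    rw [← Complex.normSq_eq_norm_sq, Complex.normSq_apply, hvim] at this
    linarith
  have hv0 : v.re ≠ 0 := fun h0 => by simp [h0] at hvn
  by_contra! hneg
  have hneg' := lt_of_le_of_ne hneg hv0
  set m := deriv f (w s).re with hm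
  -- along the inward normal the height over the graph has negative derivative
  have hline : HasDerivAt (fun t : ℝ => (w s).re + t * -v.im) (-v.im) 0 := by
    simpa using ((hasDerivAt_id (0 : ℝ)).mul_const (-v.im)).const_add (w s).re
  have hfl : HasDerivAt (fun t : ℝ => f ((w s).re + t * -v.im)) (m * -v.im) 0 := by
    refine HasDerivAt.comp (𝕜' := ℝ) (0 : ℝ) ?_ hline
    simpa using hfd
  have hg : HasDerivAt (fun t : ℝ => (w s).im + t * v.re - f ((w s).re + t * -v.im))
      (v.re - m * -v.im) 0 := by
    have := (((hasDerivAt_id (0 : ℝ)).mul_const v.re).const_add (w s).im).fun_sub hfl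
    simpa using this
  have hgneg : v.re - m * -v.im < 0 := by
    rw [hvim]
    nlinarith [sq_nonneg m]
  have hg0 : (w s).im + 0 * v.re - f ((w s).re + 0 * -v.im) = 0 := by
    have := heq.eq_of_nhds
    simp [this]
  obtain ⟨ε, hε, hin⟩ := hγ.inward s
  have hev1 : ∀ᶠ t : ℝ in 𝓝[>] (0 : ℝ), γ s + (t : ℂ) * (Complex.I * deriv γ s) ∈ Ω := by
    filter_upwards [Ioo_mem_nhdsGT hε] with t ht
    exact hin t ht
  have hev2 : ∀ᶠ t in 𝓝[>] (0 : ℝ),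
      (w s).im + t * v.re - f ((w s).re + t * -v.im) < 0 := by
    have := (hasDerivAt_iff_tendsto_slope.1 hg).eventually_lt_const hgneg
    have := this.filter_mono (nhdsWithin_mono 0 (fun x (hx : (0 : ℝ) < x) => hx.ne'))
    filter_upwards [this, self_mem_nhdsWithin] with t ht (ht0 : 0 < t)
    rw [slope_def_field, hg0, sub_zero, sub_zero, div_lt_iff₀ ht0, zero_mul] at ht
    exact ht
  have hcoord : ∀ t : ℝ, starRingEnd ℂ u * (γ s + (t : ℂ) * (Complex.I * deriv γ s) - p) =
      w s + t * (Complex.I * v) := fun t => by rw [hw, hv]; ring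
  have hev3 : ∀ᶠ t : ℝ in 𝓝[>] (0 : ℝ), w s + t * (Complex.I * v) ∈
      {w : ℂ | |w.re| < r ∧ |w.im| < r} := by
    have hc : Continuous fun t : ℝ => w s + t * (Complex.I * v) := by fun_prop
    refine (hc.continuousAt (x := 0)).continuousWithinAt.preimage_mem_nhdsWithin
      ((isOpen_box r).mem_nhds ?_)
    simpa using ⟨h1, h2⟩
  obtain ⟨t, t1, t2, t3⟩ := (hev1.and (hev2.and hev3)).exists
  have := (h.mem_iff' (by rw [hcoord]; exact t3.1) (by rw [hcoord]; exact t3.2)).1 t1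
  rw [hcoord] at this
  have e1 : (w s + t * (Complex.I * v)).re = (w s).re + t * -v.im := by simp
  have e2 : (w s + t * (Complex.I * v)).im = (w s).im + t * v.re := by simp
  rw [e1, e2] at this
  linarith

end IsChart

namespace IsChart

variable {Ω : Set ℂ} {p u : ℂ} {r : ℝ} {f : ℝ → ℝ} {K : ℝ≥0}

/-- Near a boundary point, `Ω` is a half plane up to a quadratic error. -/
lemma half_plane (h : IsChart Ω p u r f K) {L : ℝ} {γ : ℝ → ℂ} (hγ : IsBoundaryParam Ω L γ) {s : ℝ}
    (hs : γ s = p) {z : ℂ} (hz : ‖z - p‖ < r) :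
    (z ∈ Ω → -(K * ‖z - p‖ ^ 2) < inner ℝ (Complex.I * deriv γ s) (z - p)) ∧
    (z ∉ Ω → inner ℝ (Complex.I * deriv γ s) (z - p) ≤ K * ‖z - p‖ ^ 2) := by
  set w := starRingEnd ℂ u * (z - p) with hw
  set v := starRingEnd ℂ u * deriv γ s with hv
  have hnw : ‖w‖ = ‖z - p‖ := h.norm_conj_mul _
  have hinner : inner ℝ (Complex.I * deriv γ s) (z - p) = -v.im * w.re + v.re * w.im := by
    have e1 : deriv γ s = u * v := by
      rw [hv, ← mul_assoc, Complex.mul_conj, Complex.normSq_eq_norm_sq, h.norm_eq]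
      simp
    have e2 : z - p = u * w := by
      rw [hw, ← mul_assoc, Complex.mul_conj, Complex.normSq_eq_norm_sq, h.norm_eq]
      simp
    rw [Complex.inner, e1, e2, map_mul, map_mul, show u * w * (starRingEnd ℂ Complex.I *
      (starRingEnd ℂ u * starRingEnd ℂ v)) = (u * starRingEnd ℂ u) *
        (starRingEnd ℂ Complex.I * starRingEnd ℂ v * w) by ring, Complex.mul_conj,
      Complex.normSq_eq_norm_sq, h.norm_eq]
    simp
    ring
  obtain ⟨hpos, him⟩ := h.tangent hγ (s := s) (by simpa [hs] using h.pos)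
    (by simpa [hs] using h.pos)
  rw [← hv] at hpos him
  simp only [hs, sub_self, mul_zero, Complex.zero_re] at him
  have hv1 : v.re ≤ 1 := (Complex.re_le_norm v).trans (by rw [hv, h.norm_conj_mul, hγ.unit_speed])
  have h1 : |w.re| < r := (Complex.abs_re_le_norm w).trans_lt (hnw ▸ hz)
  have h2 : |w.im| < r := (Complex.abs_im_le_norm w).trans_lt (hnw ▸ hz)
  have hT := abs_le.1 (h.abs_sub_le w.re)
  have hsq : w.re ^ 2 ≤ ‖z - p‖ ^ 2 := by
    rw [← hnw, ← Complex.normSq_eq_norm_sq, Complex.normSq_apply]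
    nlinarith [sq_nonneg w.im]
  have hKsq : (K : ℝ) * w.re ^ 2 ≤ K * ‖z - p‖ ^ 2 := by gcongr
  have hK0 : 0 ≤ (K : ℝ) * ‖z - p‖ ^ 2 := by positivity
  rw [hinner, him, h.mem_iff' h1 h2, ← hw]
  constructor
  · intro hlt
    have : -(K * ‖z - p‖ ^ 2) < w.im - deriv f 0 * w.re := by linarith [hT.1]
    nlinarith
  · intro hlt
    have : w.im - deriv f 0 * w.re ≤ K * ‖z - p‖ ^ 2 := by linarith [hT.2, not_lt.1 hlt]
    nlinarith

lemma abs_sub_le_mul (h : IsChart Ω p u r f K) {R x y : ℝ} (hx : |x| ≤ R) (hy : |y| ≤ R) :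
    |f y - f x| ≤ (|deriv f 0| + K * R) * |y - x| := by
  have h1 : ∀ t ∈ Icc (-R) R, DifferentiableAt ℝ f t := fun t _ => h.differentiable t
  exact (convex_Icc (-R) R).norm_image_sub_le_of_norm_deriv_le h1
    (fun t ht => h.abs_deriv_le (abs_le.2 ht)) (abs_le.1 hx) (abs_le.1 hy)

/-- Points of the closure of `Ω` lie above the graph. -/
lemma le_of_mem_closure (h : IsChart Ω p u r f K) {z : ℂ} (hz : z ∈ closure Ω)
    (h1 : |(starRingEnd ℂ u * (z - p)).re| < r) (h2 : |(starRingEnd ℂ u * (z - p)).im| < r) :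
    f (starRingEnd ℂ u * (z - p)).re ≤ (starRingEnd ℂ u * (z - p)).im := by
  rw [closure_eq_self_union_frontier] at hz
  rcases hz with hz | hz
  · exact ((h.mem_iff' h1 h2).1 hz).le
  · exact ((h.mem_frontier_iff' h1 h2).1 hz).le

end IsChart

/-- A `C^{1,1}` domain has the cone property: at a boundary point the cone opens along the vertical
axis of a chart. -/
lemma IsC11.hasInwardCone {Ω : Set ℂ} (hΩ : IsOpen Ω) (h : IsC11 Ω) : HasInwardCone Ω := by
  intro p hp
  rw [closure_eq_self_union_frontier] at hp
  rcases hp with hp | hp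
  · obtain ⟨ε, hε, hball⟩ := Metric.isOpen_iff.1 hΩ p hp
    refine ⟨Metric.ball p (ε / 2), Metric.isOpen_ball, Metric.mem_ball_self (by positivity), 0, 1,
      one_pos, ε / 2, by positivity, fun z hz t ht w hw => hball ?_⟩
    have h1 := mem_ball_iff_norm.1 hz.1
    rw [mem_ball_iff_norm, smul_zero, add_zero, add_sub_right_comm]
    refine (norm_add_le _ _).trans_lt ?_
    linarith [ht.2]
  · obtain ⟨u, r, f, K, hc⟩ := h.exists_isChart hΩ hp
    set M := |deriv f 0| + K * r with hM
    have hM0 : 0 ≤ M := by have := hc.pos; positivity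
    have hr := hc.pos
    have hc1 : (1 : ℝ) / (M + 2) < 1 := by rw [div_lt_one (by positivity)]; linarith
    -- `M` bounds the slope of the graph in the box; radius `r / 3` and height `r / 3` keep all points
    -- in the box, and a cone of slope larger than `M` stays above the graph
    refine ⟨Metric.ball p (r / 3), Metric.isOpen_ball, Metric.mem_ball_self (by positivity),
      u * Complex.I, 1 / (M + 2), by positivity, r / 3, by positivity, fun z hz t ht w hw => ?_⟩
    have h1 := mem_ball_iff_norm.1 hz.1
    set b := starRingEnd ℂ u * (z - p) with hb
    set y := starRingEnd ℂ u * w with hy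
    have hbn : ‖b‖ < r / 3 := by rwa [hb, hc.norm_conj_mul]
    have hyn : ‖y‖ ≤ 1 / (M + 2) * t := by rwa [hy, hc.norm_conj_mul]
    have hyt : ‖y‖ < t := hyn.trans_lt (by nlinarith [ht.1])
    have hcoord : starRingEnd ℂ u * (z + t • (u * Complex.I) + w - p) = b + t * Complex.I + y := by
      have : starRingEnd ℂ u * (u * (t * Complex.I)) = t * Complex.I := hc.conj_mul_self _
      rw [hb, hy, Complex.real_smul]
      linear_combination this
    have e1 : (b + t * Complex.I + y).re = b.re + y.re := by simp
    have e2 : (b + t * Complex.I + y).im = b.im + t + y.im := by simp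
    have a1 := (Complex.abs_re_le_norm b).trans_lt hbn
    have a2 := (Complex.abs_im_le_norm b).trans_lt hbn
    have a3 := (Complex.abs_re_le_norm y)
    have a4 := (Complex.abs_im_le_norm y)
    have b1 : |b.re + y.re| < r := (abs_add_le _ _).trans_lt (by linarith [ht.2])
    have b2 : |b.im + t + y.im| < r := by
      refine (abs_add_three _ _ _).trans_lt ?_
      rw [abs_of_pos ht.1]
      linarith [ht.2]
    have hcl := hc.le_of_mem_closure hz.2 (z := z) (by rw [← hb]; linarith)
      (by rw [← hb]; linarith)
    rw [← hb] at hcl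
    rw [hc.mem_iff' (by rw [hcoord, e1]; exact b1) (by rw [hcoord, e2]; exact b2), hcoord, e1, e2]
    have hlip := hc.abs_sub_le_mul (R := r) (x := b.re) (y := b.re + y.re) (by linarith) b1.le
    rw [add_sub_cancel_left, ← hM] at hlip
    have h3 : M * |y.re| ≤ M * (1 / (M + 2) * t) :=
      mul_le_mul_of_nonneg_left (a3.trans hyn) hM0
    have h4 : M * (1 / (M + 2) * t) + 1 / (M + 2) * t < t := by
      have : M * (1 / (M + 2) * t) + 1 / (M + 2) * t = (M + 1) / (M + 2) * t := by ring
      rw [this]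
      have : (M + 1) / (M + 2) < 1 := by rw [div_lt_one (by positivity)]; linarith
      nlinarith [ht.1]
    linarith [(abs_le.1 hlip).2, (abs_le.1 (a4.trans hyn)).1]

/-! ### The Gauss-Green formula -/

lemma continuous_divergence {X : ℂ → ℂ} (hX : ContDiff ℝ 1 X) : Continuous (divergence X) := by
  have h := hX.continuous_fderiv (by simp)
  exact (Complex.continuous_re.comp (h.clm_apply continuous_const)).add
    (Complex.continuous_im.comp (h.clm_apply continuous_const))

lemma hasCompactSupport_divergence {X : ℂ → ℂ} (hc : HasCompactSupport X) :
    HasCompactSupport (divergence X) := by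
  refine (hc.fderiv ℝ).mono fun x hx => ?_
  contrapose! hx
  have : fderiv ℝ X x = 0 := by simpa using hx
  simp [divergence, this]

lemma divergence_eq_zero {X : ℂ → ℂ} {x : ℂ} (hx : x ∉ tsupport X) : divergence X x = 0 := by
  have : fderiv ℝ X x = 0 := by
    by_contra h
    exact hx (support_fderiv_subset ℝ (a := x) h)
  simp [divergence, this]

/-- The shear which straightens the graph of `f`. -/
def shear {f : ℝ → ℝ} (hf : Continuous f) : ℝ × ℝ ≃ₜ ℂ where
  toFun q := q.1 + (f q.1 + q.2 : ℝ) * Complex.I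
  invFun w := (w.re, w.im - f w.re)
  left_inv q := by simp
  right_inv w := by apply Complex.ext <;> simp
  continuous_toFun := by fun_prop
  continuous_invFun := by fun_prop

lemma shear_apply {f : ℝ → ℝ} (hf : Continuous f) (x t : ℝ) :
    shear hf (x, t) = x + (f x + t : ℝ) * Complex.I := rfl

/-- Integration over the region above a graph. -/
lemma setIntegral_epigraph {f : ℝ → ℝ} (hf : Continuous f) {g : ℂ → ℝ} (hg : Continuous g)
    (hc : HasCompactSupport g) :
    ∫ w in {w : ℂ | f w.re < w.im}, g w = ∫ x, ∫ t in Ioi (0 : ℝ), g (shear hf (x, t)) := by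
  have hm : MeasurableSet {w : ℂ | f w.re < w.im} :=
    (isOpen_lt (hf.comp Complex.continuous_re) Complex.continuous_im).measurableSet
  rw [← integral_indicator hm,
    ← (Complex.volume_preserving_equiv_real_prod.symm).integral_comp'
      (g := {w : ℂ | f w.re < w.im}.indicator g), Measure.volume_eq_prod, integral_prod]
  · congr 1 with x
    rw [← integral_indicator measurableSet_Ioi, ← integral_add_left_eq_self _ (f x)]
    congr 1 with t
    have e : Complex.measurableEquivRealProd.symm (x, f x + t) = shear hf (x, t) := by
      apply Complex.ext <;> simp [shear_apply, Complex.measurableEquivRealProd]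
    rw [e]
    by_cases ht : 0 < t
    · rw [indicator_of_mem, indicator_of_mem]
      · exact ht
      · simp [shear_apply, ht]
    · rw [indicator_of_notMem, indicator_of_notMem]
      · exact ht
      · simpa [shear_apply] using ht
  · rw [← Measure.volume_eq_prod]
    exact ((Complex.volume_preserving_equiv_real_prod.symm).integrable_comp_emb
      (MeasurableEquiv.measurableEmbedding _)).2
      ((hg.integrable_of_hasCompactSupport hc).indicator hm)

lemma _root_.HasCompactSupport.slice_left {E : Type*} [Zero E] {B : ℝ × ℝ → E}
    (h : HasCompactSupport B) (t : ℝ) : HasCompactSupport fun x => B (x, t) :=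
  .intro (h.isCompact.image continuous_fst) fun x hx => by
    by_contra hB
    exact hx ⟨(x, t), subset_tsupport _ hB, rfl⟩

lemma _root_.HasCompactSupport.slice_right {E : Type*} [Zero E] {B : ℝ × ℝ → E}
    (h : HasCompactSupport B) (x : ℝ) : HasCompactSupport fun t => B (x, t) :=
  .intro (h.isCompact.image continuous_snd) fun t ht => by
    by_contra hB
    exact ht ⟨(x, t), subset_tsupport _ hB, rfl⟩

/-- The divergence theorem for the region above the graph of a `C¹` function. -/
lemma integral_divergence_epigraph {f : ℝ → ℝ} (hf : Differentiable ℝ f)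
    (hf' : Continuous (deriv f)) {Y : ℂ → ℂ} (hY : ContDiff ℝ 1 Y) (hc : HasCompactSupport Y) :
    ∫ w in {w : ℂ | f w.re < w.im}, divergence Y w =
      ∫ x : ℝ, (deriv f x * (Y (x + f x * Complex.I)).re - (Y (x + f x * Complex.I)).im) := by
  have hfc := hf.continuous
  set S := shear hfc with hS
  have hYd := hY.differentiable (by simp)
  have hD := hY.continuous_fderiv (by simp)
  have hSt : ∀ x t : ℝ, HasDerivAt (fun t => S (x, t)) Complex.I t := fun x t => by
    have := (((hasDerivAt_id t).const_add (f x)).ofReal_comp.mul_const Complex.I).const_add (x : ℂ)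
    exact this.congr_deriv (by simp)
  have hSx : ∀ x t : ℝ, HasDerivAt (fun x => S (x, t)) (1 + ((deriv f x : ℝ) : ℂ) * Complex.I) x :=
    fun x t => by
    have h1 := ((hf x).hasDerivAt.add_const t).ofReal_comp.mul_const Complex.I
    exact ((hasDerivAt_id x).ofReal_comp.add h1).congr_deriv (by simp)
  have hYt : ∀ x t : ℝ, HasDerivAt (fun t => Y (S (x, t))) (fderiv ℝ Y (S (x, t)) Complex.I) t :=
    fun x t => (hYd _).hasFDerivAt.comp_hasDerivAt t (hSt x t)
  have hYx : ∀ x t : ℝ, HasDerivAt (fun x => Y (S (x, t)))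
      (fderiv ℝ Y (S (x, t)) (1 + ((deriv f x : ℝ) : ℂ) * Complex.I)) x :=
    fun x t => (hYd _).hasFDerivAt.comp_hasDerivAt x (hSx x t)
  have hS0 : ∀ x : ℝ, S (x, 0) = x + f x * Complex.I := fun x => by simp [hS, shear_apply]
  rw [setIntegral_epigraph hfc (continuous_divergence hY) (hasCompactSupport_divergence hc), ← hS]
  clear_value S
  have hYS : HasCompactSupport fun q => Y (S q) := hc.comp_homeomorph S
  have hDS : HasCompactSupport fun q => fderiv ℝ Y (S q) := (hc.fderiv ℝ).comp_homeomorph S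
  -- the horizontal derivative along the sheared lines and the remaining vertical derivative
  let P : ℝ × ℝ → ℝ := fun q => (fderiv ℝ Y (S q) (1 + ((deriv f q.1 : ℝ) : ℂ) * Complex.I)).re
  let V : ℝ × ℝ → ℝ := fun q =>
    (fderiv ℝ Y (S q) Complex.I).im - deriv f q.1 * (fderiv ℝ Y (S q) Complex.I).re
  have hPV : ∀ q, divergence Y (S q) = P q + V q := fun q => by
    simp only [divergence, P, V, map_add]
    rw [show ((deriv f q.1 : ℝ) : ℂ) * Complex.I = deriv f q.1 • Complex.I by simp, map_smul]
    simp
  have hcs : ∀ {B : ℝ × ℝ → ℝ}, (∀ q, fderiv ℝ Y (S q) = 0 → B q = 0) → HasCompactSupport B :=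
    fun h0 => hDS.mono fun q hq h => hq (h0 q h)
  have hint : ∀ {B : ℝ × ℝ → ℝ}, Continuous B → (∀ q, fderiv ℝ Y (S q) = 0 → B q = 0) →
      Integrable B (volume.prod (volume.restrict (Ioi (0 : ℝ)))) := by
    intro B hB h0
    have := hB.integrable_of_hasCompactSupport (hcs h0) (μ := volume.prod volume)
    rw [← Measure.restrict_univ (μ := (volume : Measure ℝ)), Measure.prod_restrict,
      Measure.restrict_univ]
    exact this.restrict
  have hScont : Continuous S := S.continuous
  have hPc : Continuous P := Complex.continuous_re.comp ((hD.comp hScont).clm_apply (by fun_prop))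
  have hVc : Continuous V := by
    have : Continuous fun q => fderiv ℝ Y (S q) Complex.I :=
      (hD.comp hScont).clm_apply continuous_const
    exact (Complex.continuous_im.comp this).sub
      ((hf'.comp continuous_fst).mul (Complex.continuous_re.comp this))
  have hPi := hint hPc fun q h => by simp [P, h]
  have hVi := hint hVc fun q h => by simp [V, h]
  have hsplit : ∫ x, ∫ t in Ioi (0 : ℝ), divergence Y (S (x, t)) =
      (∫ x, ∫ t in Ioi (0 : ℝ), P (x, t)) + ∫ x, ∫ t in Ioi (0 : ℝ), V (x, t) := by
    rw [← integral_integral_add hPi hVi]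
    simp only [hPV]
  have hline : ∀ {B : ℝ → ℝ} {B' : ℝ → ℝ}, (∀ t, HasDerivAt B (B' t) t) → Continuous B' →
      ContDiff ℝ 1 B := fun h1 h2 => contDiff_one_iff_deriv.2
    ⟨fun t => (h1 t).differentiableAt, by rwa [funext fun t => (h1 t).deriv]⟩
  have hP0 : ∫ x, ∫ t in Ioi (0 : ℝ), P (x, t) = 0 := by
    rw [integral_integral_swap hPi]
    refine integral_eq_zero_of_ae (.of_forall fun t => ?_)
    have h1 : ∀ x, HasDerivAt (fun x => (Y (S (x, t))).re) (P (x, t)) x := fun x =>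
      Complex.reCLM.hasFDerivAt.comp_hasDerivAt x (hYx x t)
    have h2 := hline h1 (hPc.comp (by fun_prop))
    have h3 : HasCompactSupport fun x => (Y (S (x, t))).re :=
      (hYS.slice_left t).mono fun x hx h => hx (by simpa using congrArg Complex.re h)
    have h4 := integral_eq_zero_of_hasDerivAt_of_integrable h1
      ((hPc.comp (by fun_prop)).integrable_of_hasCompactSupport
        ((hcs (fun q h => by simp [P, h])).slice_left t))
      (h2.continuous.integrable_of_hasCompactSupport h3)
    exact h4
  have hV0 : ∀ x, ∫ t in Ioi (0 : ℝ), V (x, t) =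
      deriv f x * (Y (x + f x * Complex.I)).re - (Y (x + f x * Complex.I)).im := by
    intro x
    have h1 : ∀ t, HasDerivAt (fun t => (Y (S (x, t))).im - deriv f x * (Y (S (x, t))).re)
        (V (x, t)) t := fun t =>
      (Complex.imCLM.hasFDerivAt.comp_hasDerivAt t (hYt x t)).sub
        ((Complex.reCLM.hasFDerivAt.comp_hasDerivAt t (hYt x t)).const_mul _)
    have h2 := hline h1 (hVc.comp (by fun_prop))
    have h3 : HasCompactSupport fun t => (Y (S (x, t))).im - deriv f x * (Y (S (x, t))).re := by
      refine (hYS.slice_right x).mono fun t ht h => ht ?_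
      have : Y (S (x, t)) = 0 := h
      simp [this]
    have h4 := h3.integral_Ioi_deriv_eq h2 0
    rw [funext fun t => (h1 t).deriv] at h4
    rw [h4, hS0]
    ring
  rw [hsplit, hP0, zero_add]
  simp only [hV0]

/-- The divergence does not depend on the orthonormal coordinates. -/
lemma divergence_rotate {X : ℂ → ℂ} (hX : Differentiable ℝ X) {u : ℂ} (hu : ‖u‖ = 1) (p w : ℂ) :
    divergence (fun w => starRingEnd ℂ u * X (p + u * w)) w = divergence X (p + u * w) := by
  have h1 : HasFDerivAt (fun w : ℂ => p + u * w) (u • (ContinuousLinearMap.id ℝ ℂ)) w := by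
    have := ((hasFDerivAt_id (𝕜 := ℝ) w).const_smul u).const_add p
    simpa [smul_eq_mul] using this
  have h2 := ((hX (p + u * w)).hasFDerivAt.comp w h1).const_smul (starRingEnd ℂ u)
  have h3 : fderiv ℝ (fun w => starRingEnd ℂ u * X (p + u * w)) w = _ := h2.fderiv
  have hA : ∀ v : ℂ, fderiv ℝ X (p + u * w) v =
      v.re • fderiv ℝ X (p + u * w) 1 + v.im • fderiv ℝ X (p + u * w) Complex.I := fun v => by
    conv_lhs => rw [show v = v.re • (1 : ℂ) + v.im • Complex.I by simp, map_add, map_smul, map_smul]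
  have hn : u.re * u.re + u.im * u.im = 1 := by
    rw [← Complex.normSq_apply, Complex.normSq_eq_norm_sq, hu, one_pow]
  rw [divergence, divergence, h3]
  simp only [smul_apply, ContinuousLinearMap.comp_apply,
    ContinuousLinearMap.id_apply, smul_eq_mul, mul_one]
  rw [hA u, hA (u * Complex.I)]
  simp
  linear_combination ((fderiv ℝ X (p + u * w) 1).re + (fderiv ℝ X (p + u * w) Complex.I).im) * hn

lemma IsBoundaryParam.continuous_deriv {Ω : Set ℂ} {L : ℝ} {γ : ℝ → ℂ}
    (hγ : IsBoundaryParam Ω L γ) : Continuous (deriv γ) := by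
  obtain ⟨K, hK⟩ := hγ.lipschitz_deriv
  exact hK.continuous

/-- Every boundary point has a parameter in a given period. -/
lemma IsBoundaryParam.exists_mem_Ico {Ω : Set ℂ} {L : ℝ} {γ : ℝ → ℂ}
    (hγ : IsBoundaryParam Ω L γ) {z : ℂ} (hz : z ∈ frontier Ω) (t : ℝ) :
    ∃ s ∈ Ico t (t + L), γ s = z := by
  rw [← hγ.range_eq] at hz
  obtain ⟨s, rfl⟩ := hz
  obtain ⟨y, hy, he⟩ := hγ.periodic.exists_mem_Ico hγ.pos s t
  exact ⟨y, hy, he.symm⟩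

/-- The Gauss-Green formula for fields supported in a chart. -/
lemma IsChart.gauss_green {Ω : Set ℂ} {p u : ℂ} {r : ℝ} {f : ℝ → ℝ} {K : ℝ≥0}
    (h : IsChart Ω p u r f K) (hΩ : IsOpen Ω) {L : ℝ} {γ : ℝ → ℂ} (hγ : IsBoundaryParam Ω L γ)
    {X : ℂ → ℂ} (hX : ContDiff ℝ 1 X) (hc : HasCompactSupport X)
    (hs : ∀ z ∈ tsupport X, |(starRingEnd ℂ u * (z - p)).re| < r ∧
      |(starRingEnd ℂ u * (z - p)).im| < r) :
    ∫ z in Ω, divergence X z = ∫ s in (0 : ℝ)..L, inner ℝ (X (γ s)) (outerNormal γ s) := by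
  have hu0 : u ≠ 0 := fun h0 => by simpa [h0] using h.norm_eq
  let Y : ℂ → ℂ := fun w => starRingEnd ℂ u * X (p + u * w)
  have hY : ContDiff ℝ 1 Y := contDiff_const.mul (hX.comp (by fun_prop))
  let T : ℂ ≃ₜ ℂ := (Homeomorph.mulLeft₀ u hu0).trans (Homeomorph.addLeft p)
  have hcY : HasCompactSupport Y := (hc.comp_homeomorph T).mul_left
  have hXY : ∀ z, X z = u * Y (starRingEnd ℂ u * (z - p)) := fun z => by
    simp only [Y]
    rw [h.add_mul_conj, ← mul_assoc, Complex.mul_conj, Complex.normSq_eq_norm_sq, h.norm_eq]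
    simp
  have hYs : ∀ w, Y w ≠ 0 → |w.re| < r ∧ |w.im| < r := fun w hw => by
    have : X (p + u * w) ≠ 0 := fun h0 => hw (by simp [Y, h0])
    have := hs _ (subset_tsupport _ this)
    rwa [add_sub_cancel_left, h.conj_mul_self] at this
  have hdY : ∀ w, divergence Y w = divergence X (p + u * w) := fun w =>
    divergence_rotate (hX.differentiable (by simp)) h.norm_eq p w
  have hleft : ∫ z in Ω, divergence X z = ∫ w in {w : ℂ | f w.re < w.im}, divergence Y w := by
    have hm : MeasurableSet {w : ℂ | f w.re < w.im} :=
      (isOpen_lt (h.differentiable.continuous.comp Complex.continuous_re)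
        Complex.continuous_im).measurableSet
    let R : ℂ ≃ₗᵢ[ℝ] ℂ := rotation ⟨u, by simp [Submonoid.unitSphere, h.norm_eq]⟩
    have hR : ∀ w, R w = u * w := fun w => rfl
    rw [← integral_indicator hΩ.measurableSet, ← integral_indicator hm,
      ← integral_add_left_eq_self _ p,
      ← (R.measurePreserving).integral_comp R.toHomeomorph.measurableEmbedding]
    congr 1 with w
    rw [hR]
    by_cases hw : |w.re| < r ∧ |w.im| < r
    · simp only [indicator]
      congr 1
      · simpa using h.mem_iff w hw.1 hw.2
      · exact (hdY w).symm
    · have : divergence X (p + u * w) = 0 := by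
        refine divergence_eq_zero fun hz => hw ?_
        have := hs _ hz
        rwa [add_sub_cancel_left, h.conj_mul_self] at this
      simp [indicator, hdY, this]
  rw [hleft, integral_divergence_epigraph h.differentiable h.continuous_deriv hY hcY]
  -- change of variables from the graph to the curve
  let x : ℝ → ℝ := fun s => (starRingEnd ℂ u * (γ s - p)).re
  let A : Set ℝ := Ico 0 L ∩ {s | |(starRingEnd ℂ u * (γ s - p)).re| < r ∧
      |(starRingEnd ℂ u * (γ s - p)).im| < r}
  have hγc : Continuous γ := hγ.differentiable.continuous
  have hcoord : Continuous fun s => starRingEnd ℂ u * (γ s - p) := by fun_prop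
  have hAm : MeasurableSet A :=
    measurableSet_Ico.inter ((isOpen_box r).preimage hcoord).measurableSet
  have hxd : ∀ s ∈ A, HasDerivWithinAt x (starRingEnd ℂ u * deriv γ s).re A s := fun s _ =>
    (Complex.reCLM.hasFDerivAt.comp_hasDerivAt s
      (((hγ.differentiable s).hasDerivAt.sub_const p).const_mul _)).hasDerivWithinAt
  have hgraph : ∀ s ∈ A, starRingEnd ℂ u * (γ s - p) = x s + f (x s) * Complex.I := fun s hs => by
    have := (h.mem_frontier_iff' hs.2.1 hs.2.2).1 (hγ.range_eq ▸ mem_range_self s)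
    apply Complex.ext
    · simp [x]
    · simp only [x]
      rw [this]
      simp
  have hinj : InjOn x A := fun s hs t ht hst => by
    refine hγ.injOn hs.1 ht.1 ?_
    rw [← h.add_mul_conj (γ s), hgraph s hs, hst, ← hgraph t ht, h.add_mul_conj]
  let G : ℝ → ℝ := fun x => deriv f x * (Y (x + f x * Complex.I)).re - (Y (x + f x * Complex.I)).im
  have hGs : ∀ y ∉ x '' A, G y = 0 := fun y hy => by
    by_contra hG
    have hY0 : Y (y + f y * Complex.I) ≠ 0 := fun h0 => hG (by simp [G, h0])
    obtain ⟨h1, h2⟩ := hYs _ hY0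
    have hf := (h.mem_frontier_iff _ h1 h2).2 (by simp)
    obtain ⟨s, hs, he⟩ := hγ.exists_mem_Ico hf 0
    rw [zero_add] at hs
    have e : starRingEnd ℂ u * (γ s - p) = y + f y * Complex.I := by
      rw [he, add_sub_cancel_left, h.conj_mul_self]
    refine hy ⟨s, ⟨hs, ?_⟩, ?_⟩
    · change |_| < r ∧ |_| < r
      rw [e]
      exact ⟨h1, h2⟩
    · simp only [x]
      rw [e]
      simp
  have hcv := integral_image_eq_integral_abs_deriv_smul hAm hxd hinj G
  rw [setIntegral_eq_integral_of_forall_compl_eq_zero hGs] at hcv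
  refine hcv.trans ?_
  have hset := setIntegral_eq_of_subset_of_forall_sdiff_eq_zero (μ := volume)
    (f := fun s => inner ℝ (X (γ s)) (outerNormal γ s)) measurableSet_Ico
    (inter_subset_left : A ⊆ Ico 0 L) fun s hs' => by
      have : X (γ s) = 0 := by
        by_contra h0
        exact hs'.2 ⟨hs'.1, hs _ (subset_tsupport _ h0)⟩
      simp [this]
  rw [intervalIntegral.integral_of_le hγ.pos.le, ← integral_Ico_eq_integral_Ioc, hset]
  refine setIntegral_congr_fun hAm fun s hs => ?_
  obtain ⟨hpos, him⟩ := h.tangent hγ hs.2.1 hs.2.2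
  have e1 : deriv γ s = u * (starRingEnd ℂ u * deriv γ s) := by
    rw [← mul_assoc, Complex.mul_conj, Complex.normSq_eq_norm_sq, h.norm_eq]
    simp
  set v := starRingEnd ℂ u * deriv γ s with hv
  simp only [smul_eq_mul, abs_of_pos hpos, G]
  rw [outerNormal, hXY, Complex.inner, hgraph s hs, e1]
  set y := Y (x s + f (x s) * Complex.I)
  rw [show -(Complex.I * (u * v)) * starRingEnd ℂ (u * y) =
    (u * starRingEnd ℂ u) * (-(Complex.I * v) * starRingEnd ℂ y) by rw [map_mul]; ring,
    Complex.mul_conj, Complex.normSq_eq_norm_sq, h.norm_eq]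
  simp
  rw [him]
  simp only [x]
  ring

lemma continuous_outerNormal {Ω : Set ℂ} {L : ℝ} {γ : ℝ → ℂ} (hγ : IsBoundaryParam Ω L γ) :
    Continuous (outerNormal γ) :=
  (continuous_const.mul hγ.continuous_deriv).neg

lemma divergence_smul {χ : ℂ → ℝ} {X : ℂ → ℂ} {x : ℂ} (hχ : DifferentiableAt ℝ χ x)
    (hX : DifferentiableAt ℝ X x) :
    divergence (fun x => χ x • X x) x = χ x * divergence X x + inner ℝ (gradient χ x) (X x) := by
  have hA : fderiv ℝ χ x (X x) =
      (X x).re * fderiv ℝ χ x 1 + (X x).im * fderiv ℝ χ x Complex.I := by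
    conv_lhs => rw [show X x = (X x).re • (1 : ℂ) + (X x).im • Complex.I by simp, map_add,
      map_smul, map_smul]
    simp
  have h := fderiv_fun_smul hχ hX
  rw [inner_gradient, hA, divergence, divergence, h]
  simp
  ring

lemma integral_divergence_eq_zero {X : ℂ → ℂ} (hX : ContDiff ℝ 1 X) (hc : HasCompactSupport X) :
    ∫ x, divergence X x = 0 := by
  have hd := hX.differentiable (by simp)
  have key : ∀ (l : ℂ →L[ℝ] ℝ) (v : ℂ), Integrable (fun x => l (fderiv ℝ X x v)) ∧
      ∫ x, l (fderiv ℝ X x v) = 0 := by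
    intro l v
    have hl : ContDiff ℝ 1 fun x => l (X x) := l.contDiff.comp hX
    have hlc : HasCompactSupport fun x => l (X x) := hc.comp_left (map_zero l)
    obtain ⟨C, hC⟩ := hl.lipschitzWith_of_hasCompactSupport hlc (by simp)
    have e : ∀ x, l (fderiv ℝ X x v) = fderiv ℝ (fun x => l (X x)) x v := fun x => by
      have h1 := l.hasFDerivAt.comp x (hd x).hasFDerivAt
      have h2 : HasFDerivAt (fun x => l (X x)) (l.comp (fderiv ℝ X x)) x := h1
      rw [h2.fderiv]
      rfl
    simp_rw [e]
    exact ⟨((hl.continuous_fderiv (by simp)).clm_apply continuous_const).integrable_of_hasCompactSupport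
      (hlc.fderiv_apply ℝ v), integral_fderiv_eq_zero_of_lipschitz hC hlc v⟩
  have h1 := key Complex.reCLM 1
  have h2 := key Complex.imCLM Complex.I
  simp only [Complex.reCLM_apply, Complex.imCLM_apply] at h1 h2
  simp only [divergence]
  rw [integral_add h1.1 h2.1, h1.2, h2.2, add_zero]

/-- Every point has a neighbourhood such that the Gauss-Green formula holds for fields supported there:
a chart at a boundary point, where the formula is `IsChart.gauss_green`, and a set without boundary
points otherwise. -/
lemma exists_gauss_green_nhds {Ω : Set ℂ} (hΩ : IsOpen Ω) (hC : IsC11 Ω) {L : ℝ} {γ : ℝ → ℂ}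
    (hγ : IsBoundaryParam Ω L γ) (p : ℂ) :
    ∃ V : Set ℂ, IsOpen V ∧ p ∈ V ∧ ∀ X : ℂ → ℂ, ContDiff ℝ 1 X →
      HasCompactSupport X → tsupport X ⊆ V →
      ∫ z in Ω, divergence X z =
        ∫ s in (0 : ℝ)..L, inner ℝ (X (γ s)) (outerNormal γ s) := by
  have hfr : ∀ {X : ℂ → ℂ} {V : Set ℂ}, tsupport X ⊆ V → Disjoint V (frontier Ω) →
      ∫ s in (0 : ℝ)..L, inner ℝ (X (γ s)) (outerNormal γ s) = 0 := by
    intro X V hXV hV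
    have : ∀ s, X (γ s) = 0 := fun s => by
      by_contra h0
      exact hV.notMem_of_mem_left (hXV (subset_tsupport _ h0)) (hγ.range_eq ▸ mem_range_self s)
    simp [this]
  by_cases hp : p ∈ frontier Ω
  · obtain ⟨u, r, f, K, h⟩ := hC.exists_isChart hΩ hp
    refine ⟨{z | starRingEnd ℂ u * (z - p) ∈ {w : ℂ | |w.re| < r ∧ |w.im| < r}},
      (isOpen_box r).preimage (by fun_prop), ?_, fun X hX hc hs => h.gauss_green hΩ hγ hX hc
        fun z hz => hs hz⟩
    simpa using h.pos
  by_cases hpΩ : p ∈ Ω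
  · refine ⟨Ω, hΩ, hpΩ, fun X hX hc hs => ?_⟩
    rw [hfr hs (disjoint_left.2 fun z hz hz' => (hΩ.frontier_eq ▸ hz').2 hz),
      setIntegral_eq_integral_of_forall_compl_eq_zero fun z hz =>
        divergence_eq_zero fun h => hz (hs h), integral_divergence_eq_zero hX hc]
  · have hcl : p ∉ closure Ω := fun h => by
      rw [closure_eq_self_union_frontier] at h
      exact h.elim hpΩ hp
    refine ⟨(closure Ω)ᶜ, isClosed_closure.isOpen_compl, hcl, fun X hX hc hs => ?_⟩
    rw [hfr hs (disjoint_left.2 fun z hz hz' => hz (frontier_subset_closure hz'))]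
    exact setIntegral_eq_zero_of_forall_eq_zero fun z hz =>
      divergence_eq_zero fun h => hs h (subset_closure hz)

lemma divergence_sum {ι : Type*} (s : Finset ι) {X : ι → ℂ → ℂ} (hX : ∀ i, Differentiable ℝ (X i))
    (x : ℂ) : divergence (fun x => ∑ i ∈ s, X i x) x = ∑ i ∈ s, divergence (X i) x := by
  have : fderiv ℝ (fun x => ∑ i ∈ s, X i x) x = ∑ i ∈ s, fderiv ℝ (X i) x :=
    fderiv_fun_sum fun i _ => hX i x
  simp only [divergence, this, sum_apply, Complex.re_sum, Complex.im_sum,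
    Finset.sum_add_distrib]

/-- **Gauss-Green formula** for `C¹` fields with compact support on a `C^{1,1}` domain. -/
theorem gauss_green {Ω : Set ℂ} (hΩ : IsOpen Ω) (hC : IsC11 Ω) {L : ℝ} {γ : ℝ → ℂ}
    (hγ : IsBoundaryParam Ω L γ) {X : ℂ → ℂ} (hX : ContDiff ℝ 1 X) (hc : HasCompactSupport X) :
    ∫ z in Ω, divergence X z = ∫ s in (0 : ℝ)..L, inner ℝ (X (γ s)) (outerNormal γ s) := by
  obtain ⟨V, hV⟩ := Classical.skolem.1 (exists_gauss_green_nhds hΩ hC hγ)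
  obtain ⟨ι, _, p, χ, hχ, hsum⟩ := exists_finite_partition (K := tsupport X) hc.isCompact
    (V := V) fun q _ => ⟨(hV q).1, (hV q).2.1⟩
  have hXs : ∀ x, X x = ∑ i, χ i x • X x := fun x => by
    rw [← Finset.sum_smul]
    by_cases hx : x ∈ tsupport X
    · rw [hsum x hx, one_smul]
    · rw [image_eq_zero_of_notMem_tsupport hx, smul_zero]
  have hXi : ∀ i, ContDiff ℝ 1 fun x => χ i x • X x := fun i => by
    have h1 : ContDiff ℝ 1 (χ i) := (hχ i).2.1.of_le (by simp)
    exact h1.smul hX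
  have hXc : ∀ i, HasCompactSupport fun x => χ i x • X x := fun i =>
    hc.mono fun x hx h => hx (by simp [show X x = 0 from h])
  have hdiv : ∀ x, divergence X x = ∑ i, divergence (fun x => χ i x • X x) x := fun x => by
    rw [← divergence_sum _ fun i => (hXi i).differentiable (by simp)]
    exact congrArg (fun X => divergence X x) (funext hXs)
  have hγc : Continuous γ := hγ.differentiable.continuous
  have hbd : ∀ s, inner ℝ (X (γ s)) (outerNormal γ s) =
      ∑ i, inner ℝ (χ i (γ s) • X (γ s)) (outerNormal γ s) := fun s => by
    rw [← sum_inner, ← hXs]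
  simp_rw [hdiv, hbd]
  rw [integral_finsetSum, intervalIntegral.integral_finsetSum]
  · exact Finset.sum_congr rfl fun i _ => (hV (p i)).2.2 _ (hXi i) (hXc i)
      ((tsupport_smul_subset_left _ _).trans (hχ i).2.2.2)
  · intro i _
    exact ((((hXi i).continuous.comp hγc).inner (continuous_outerNormal hγ))).intervalIntegrable _ _
  · intro i _
    exact ((continuous_divergence (hXi i)).integrable_of_hasCompactSupport
      (hasCompactSupport_divergence (hXc i))).integrableOn

/-! ### Functions of the arc length -/

/-- The slope of the secant of the curve, extended continuously to the diagonal. -/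
def secant (γ : ℝ → ℂ) (s t : ℝ) : ℂ := ∫ θ in (0 : ℝ)..1, deriv γ (s + θ * (t - s))

namespace IsBoundaryParam

variable {Ω : Set ℂ} {L : ℝ} {γ : ℝ → ℂ}

lemma sub_eq_smul_secant (hγ : IsBoundaryParam Ω L γ) (s t : ℝ) :
    γ t - γ s = (t - s : ℝ) • secant γ s t := by
  have h1 : ∀ θ ∈ uIcc (0 : ℝ) 1, HasDerivAt (fun θ => γ (s + θ * (t - s)))
      ((t - s) • deriv γ (s + θ * (t - s))) θ := fun θ _ => by
    have h2 : HasDerivAt (fun θ : ℝ => s + θ * (t - s)) (t - s) θ := by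
      simpa using ((hasDerivAt_id θ).mul_const (t - s)).const_add s
    exact (hγ.differentiable _).hasDerivAt.scomp θ h2
  have hc := hγ.continuous_deriv
  have h3 : Continuous fun θ : ℝ => (t - s) • deriv γ (s + θ * (t - s)) := by fun_prop
  have := intervalIntegral.integral_eq_sub_of_hasDerivAt h1 (h3.intervalIntegrable _ _)
  rw [intervalIntegral.integral_smul] at this
  rw [secant, this]
  simp

lemma secant_self (γ : ℝ → ℂ) (s : ℝ) : secant γ s s = deriv γ s := by simp [secant]

lemma continuous_secant (hγ : IsBoundaryParam Ω L γ) :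
    Continuous fun q : ℝ × ℝ => secant γ q.1 q.2 := by
  have hc := hγ.continuous_deriv
  refine intervalIntegral.continuous_parametric_intervalIntegral_of_continuous' (μ := volume)
    (f := fun (q : ℝ × ℝ) (θ : ℝ) => deriv γ (q.1 + θ * (q.2 - q.1))) ?_ 0 1
  fun_prop

lemma exists_secant_lipschitz (hγ : IsBoundaryParam Ω L γ) (s : ℝ) :
    ∃ K : ℝ≥0, LipschitzWith K (secant γ s) := by
  obtain ⟨K, hK⟩ := hγ.lipschitz_deriv
  have hc := hγ.continuous_deriv
  refine ⟨K, LipschitzWith.of_dist_le_mul fun t t' => ?_⟩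
  have hi : ∀ t, IntervalIntegrable (fun θ : ℝ => deriv γ (s + θ * (t - s))) volume 0 1 := fun t =>
    (show Continuous fun θ : ℝ => deriv γ (s + θ * (t - s)) by fun_prop).intervalIntegrable _ _
  rw [dist_eq_norm, secant, secant, ← intervalIntegral.integral_sub (hi t) (hi t')]
  refine (intervalIntegral.norm_integral_le_of_norm_le_const (C := K * dist t t')
    fun θ hθ => ?_).trans (by simp)
  rw [uIoc_of_le zero_le_one] at hθ
  rw [← dist_eq_norm]
  refine (hK.dist_le_mul _ _).trans ?_
  gcongr
  rw [Real.dist_eq, Real.dist_eq, show s + θ * (t - s) - (s + θ * (t' - s)) = θ * (t - t') by ring,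
    abs_mul, abs_of_pos hθ.1]
  exact mul_le_of_le_one_left (abs_nonneg _) hθ.2

lemma eq_of_abs_sub_lt (hγ : IsBoundaryParam Ω L γ) {s t : ℝ} (h : |t - s| < L)
    (he : γ s = γ t) : s = t := by
  wlog hst : s ≤ t generalizing s t
  · exact (this (by rwa [abs_sub_comm]) he.symm (le_of_not_ge hst)).symm
  rw [abs_of_nonneg (sub_nonneg.2 hst)] at h
  have hinj : InjOn γ (Ico s (s + L)) := by
    intro x hx y hy hxy
    obtain ⟨n, hn, -⟩ := existsUnique_add_zsmul_mem_Ico hγ.pos x 0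
    obtain ⟨m, hm, -⟩ := existsUnique_add_zsmul_mem_Ico hγ.pos y 0
    simp only [zsmul_eq_mul, zero_add] at hn hm
    have e : x + n * L = y + m * L := by
      refine hγ.injOn hn hm ?_
      rw [hγ.periodic.int_mul n x, hγ.periodic.int_mul m y, hxy]
    have hnm : n = m := by
      have h1 : ((m - n : ℤ) : ℝ) * L = x - y := by push_cast; linarith
      have h2 : |x - y| < L := abs_sub_lt_iff.2 ⟨by linarith [hx.2, hy.1], by linarith [hy.2, hx.1]⟩
      rw [← h1, abs_mul, abs_of_pos hγ.pos] at h2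
      have h3 : |((m - n : ℤ) : ℝ)| < 1 := by
        have := hγ.pos
        by_contra! h4
        nlinarith
      have h4 : |m - n| < 1 := by exact_mod_cast h3
      have := Int.abs_lt_one_iff.1 h4
      omega
    rw [hnm] at e
    linarith
  exact hinj ⟨le_rfl, by linarith [hγ.pos]⟩ ⟨hst, by linarith⟩ he

/-- The chord-arc property of the boundary curve. -/
lemma exists_chord_arc (hγ : IsBoundaryParam Ω L γ) :
    ∃ c > 0, ∀ s t, |t - s| ≤ L / 2 → c * |t - s| ≤ ‖γ t - γ s‖ := by
  have hL := hγ.pos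
  -- the secant slope does not vanish on a compact set of parameters, as the curve is injective and
  -- its derivative has length one
  let S : Set (ℝ × ℝ) := Icc 0 L ×ˢ Icc (-(L / 2)) (L / 2)
  have hS : IsCompact S := isCompact_Icc.prod isCompact_Icc
  have hne : S.Nonempty := ⟨(0, 0), by simp [S, hL.le]; linarith⟩
  have hcont : Continuous fun q : ℝ × ℝ => ‖secant γ q.1 (q.1 + q.2)‖ :=
    (hγ.continuous_secant.comp (by fun_prop : Continuous fun q : ℝ × ℝ => (q.1, q.1 + q.2))).norm
  obtain ⟨q, hq, hmin⟩ := hS.exists_isMinOn hne hcont.continuousOn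
  refine ⟨‖secant γ q.1 (q.1 + q.2)‖, norm_pos_iff.2 fun h0 => ?_, fun s t hst => ?_⟩
  · by_cases h2 : q.2 = 0
    · rw [h2, add_zero, secant_self] at h0
      simpa [h0] using hγ.unit_speed q.1
    · have h1 := hγ.sub_eq_smul_secant q.1 (q.1 + q.2)
      rw [h0, smul_zero, sub_eq_zero] at h1
      have h3 := hγ.eq_of_abs_sub_lt (s := q.1) (t := q.1 + q.2) (by
        rw [add_sub_cancel_left]
        exact (abs_le.2 hq.2).trans_lt (by linarith)) h1.symm
      exact h2 (by linarith)
  · obtain ⟨n, hn, -⟩ := existsUnique_add_zsmul_mem_Ico hL s 0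
    simp only [zsmul_eq_mul, zero_add] at hn
    have hmem : (s + n * L, t - s) ∈ S := ⟨⟨hn.1, hn.2.le⟩, abs_le.1 hst⟩
    have h1 := hmin hmem
    have h2 := hγ.sub_eq_smul_secant (s + n * L) (s + n * L + (t - s))
    have h3 : γ (s + n * L + (t - s)) = γ t := by
      rw [show s + n * L + (t - s) = t + n * L by ring]
      exact hγ.periodic.int_mul n t
    rw [h3, hγ.periodic.int_mul n s] at h2
    rw [h2, norm_smul, Real.norm_eq_abs, add_sub_cancel_left, mul_comm]
    gcongr
    exact h1

end IsBoundaryParam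

/-- Integration by parts for a Lipschitz function. -/
lemma integral_mul_deriv_of_lipschitz {F ζ : ℝ → ℝ} {C : ℝ≥0} (hF : LipschitzWith C F)
    (hζ : ContDiff ℝ 1 ζ) (a b : ℝ) :
    ∫ t in a..b, F t * deriv ζ t = F b * ζ b - F a * ζ a - ∫ t in a..b, deriv F t * ζ t :=
  (hF.lipschitzOnWith.absolutelyContinuousOnInterval).integral_mul_deriv_eq_deriv_mul
    (hζ.contDiffOn.absolutelyContinuousOnInterval)

lemma intervalIntegrable_of_bound {k : ℝ → ℝ} (hk : Measurable k) {M : ℝ} (hM : ∀ t, |k t| ≤ M)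
    (a b : ℝ) : IntervalIntegrable k volume a b :=
  (intervalIntegrable_const (c := M)).mono_fun hk.aestronglyMeasurable
    (.of_forall fun t => (hM t).trans (le_abs_self M))

/-- **Lemma of du Bois-Reymond** on a circle: a function with bounded weak derivative agrees at
its points of continuity with a Lipschitz function. -/
lemma exists_lipschitz_of_weak_deriv {L : ℝ} (hL : 0 < L) {u k : ℝ → ℝ} {M : ℝ}
    (hup : Function.Periodic u L) (hui : IntervalIntegrable u volume 0 L)
    (hkp : Function.Periodic k L) (hkm : Measurable k) (hkM : ∀ t, |k t| ≤ M)
    (h : ∀ ζ : ℝ → ℝ, ContDiff ℝ 1 ζ → Function.Periodic ζ L →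
      -∫ t in (0 : ℝ)..L, u t * deriv ζ t = ∫ t in (0 : ℝ)..L, k t * ζ t) :
    ∃ v : ℝ → ℝ, LipschitzWith M.toNNReal v ∧ ∀ c, ContinuousAt u c → u c = v c := by
  have hki := intervalIntegrable_of_bound hkm hkM
  have hM0 : 0 ≤ M := (abs_nonneg _).trans (hkM 0)
  -- the Lipschitz function is the primitive `I` of `k` up to the mean value `m` of `u - I`
  set I : ℝ → ℝ := fun s => ∫ t in (0 : ℝ)..s, k t with hI
  have hILip : LipschitzWith M.toNNReal I := by
    refine LipschitzWith.of_dist_le_mul fun x y => ?_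
    rw [Real.dist_eq, hI, intervalIntegral.integral_interval_sub_left (hki _ _) (hki _ _),
      Real.coe_toNNReal _ hM0, Real.dist_eq]
    rw [← Real.norm_eq_abs]
    exact intervalIntegral.norm_integral_le_of_norm_le_const fun t _ => (hkM t)
  have hk0 : ∫ t in (0 : ℝ)..L, k t = 0 := by
    have := h (fun _ => 1) contDiff_const (fun _ => rfl)
    simpa using this.symm
  have hIL : I L = 0 := hk0
  have hI0 : I 0 = 0 := by simp [hI]
  have hIp : Function.Periodic I L := fun s => by
    have := hkp.intervalIntegral_add_eq s 0
    rw [zero_add, hk0] at this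
    simp only [hI]
    rw [← intervalIntegral.integral_add_adjacent_intervals (hki 0 s) (hki s (s + L)), this, add_zero]
  have hIi : ∀ a b, IntervalIntegrable I volume a b := fun a b =>
    hILip.continuous.intervalIntegrable a b
  have hderiv : ∀ᵐ t, deriv I t = k t := by
    have hloc : LocallyIntegrable k volume := by
      refine (locallyIntegrable_const M).mono hkm.aestronglyMeasurable (.of_forall fun t => ?_)
      exact (hkM t).trans (le_abs_self M)
    filter_upwards [LocallyIntegrable.ae_hasDerivAt_integral hloc] with t ht
    exact (ht 0).deriv
  set m := (∫ t in (0 : ℝ)..L, (u t - I t)) / L with hm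
  have hzi : IntervalIntegrable (fun t => u t - I t - m) volume 0 L :=
    (hui.sub (hIi 0 L)).sub intervalIntegrable_const
  have hz0 : ∫ t in (0 : ℝ)..L, (u t - I t - m) = 0 := by
    rw [intervalIntegral.integral_sub (hui.sub (hIi 0 L)) intervalIntegrable_const, hm]
    simp
    field_simp
    ring
  -- `u - I - m` is orthogonal to all continuous periodic functions
  have horth : ∀ G : ℝ → ℝ, Continuous G → Function.Periodic G L →
      ∫ t in (0 : ℝ)..L, (u t - I t - m) * G t = 0 := by
    intro G hG hGp
    -- test with the periodic primitive of `G` minus its mean value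
    set μ := (∫ t in (0 : ℝ)..L, G t) / L with hμ
    set ζ : ℝ → ℝ := fun s => ∫ t in (0 : ℝ)..s, (G t - μ) with hζ
    have hgc : Continuous fun t => G t - μ := hG.sub continuous_const
    have hζd : ∀ s, HasDerivAt ζ (G s - μ) s := fun s =>
      intervalIntegral.integral_hasDerivAt_right (hgc.intervalIntegrable _ _)
        hgc.stronglyMeasurable.stronglyMeasurableAtFilter hgc.continuousAt
    have hζ' : deriv ζ = fun s => G s - μ := funext fun s => (hζd s).deriv
    have hζ1 : ContDiff ℝ 1 ζ := contDiff_one_iff_deriv.2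
      ⟨fun s => (hζd s).differentiableAt, by rw [hζ']; exact hgc⟩
    have hg0 : ∫ t in (0 : ℝ)..L, (G t - μ) = 0 := by
      rw [intervalIntegral.integral_sub (hG.intervalIntegrable _ _) intervalIntegrable_const, hμ]
      simp
      field_simp
      ring
    have hζp : Function.Periodic ζ L := fun s => by
      have hgp : Function.Periodic (fun t => G t - μ) L := fun t => by simp [hGp t]
      have := hgp.intervalIntegral_add_eq s 0
      rw [zero_add, hg0] at this
      simp only [hζ]
      rw [← intervalIntegral.integral_add_adjacent_intervals (hgc.intervalIntegrable 0 s)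
        (hgc.intervalIntegrable s (s + L)), this, add_zero]
    have h1 := h ζ hζ1 hζp
    have h2 := integral_mul_deriv_of_lipschitz hILip hζ1 0 L
    rw [hIL, hI0, zero_mul, zero_mul, sub_zero, zero_sub] at h2
    have h3 : ∫ t in (0 : ℝ)..L, deriv I t * ζ t = ∫ t in (0 : ℝ)..L, k t * ζ t :=
      intervalIntegral.integral_congr_ae (hderiv.mono fun t ht _ => by rw [ht])
    rw [h3, hζ'] at h2
    rw [hζ'] at h1
    have h4 : ∫ t in (0 : ℝ)..L, (u t - I t - m) * (G t - μ) = 0 := by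
      have i1 := hui.mul_continuousOn hgc.continuousOn
      have i2 := (hIi 0 L).mul_continuousOn hgc.continuousOn
      have i3 : IntervalIntegrable (fun t => m * (G t - μ)) volume 0 L :=
        (continuous_const.mul hgc).intervalIntegrable _ _
      have e : (fun t => (u t - I t - m) * (G t - μ)) =
          fun t => u t * (G t - μ) - I t * (G t - μ) - m * (G t - μ) := by ext t; ring
      rw [e, intervalIntegral.integral_sub (i1.sub i2) i3, intervalIntegral.integral_sub i1 i2,
        intervalIntegral.integral_const_mul, hg0]
      linarith
    have e : (fun t => (u t - I t - m) * G t) =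
        fun t => (u t - I t - m) * (G t - μ) + μ * (u t - I t - m) := by ext t; ring
    rw [e, intervalIntegral.integral_add (hzi.mul_continuousOn hgc.continuousOn) (hzi.const_mul μ),
      h4, intervalIntegral.integral_const_mul, hz0]
    simp
  refine ⟨fun s => I s + m, by simpa using hILip.add (LipschitzWith.const m), fun c hc => ?_⟩
  -- otherwise `u - I - m` has a fixed sign near `c`, and is not orthogonal to a bump there
  by_contra hne
  set e := u c - I c - m with he
  have he0 : e ≠ 0 := fun h0 => hne (by linarith)
  have hzc : ContinuousAt (fun t => e * (u t - I t - m)) c :=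
    continuousAt_const.mul ((hc.sub hILip.continuous.continuousAt).sub continuousAt_const)
  have hpos : ∀ᶠ t in 𝓝 c, 0 < e * (u t - I t - m) :=
    hzc.eventually_const_lt (mul_self_pos.2 he0)
  obtain ⟨δ', hδ', hball⟩ := Metric.eventually_nhds_iff.1 hpos
  set δ := min δ' (L / 2) with hδ
  have hδ0 : 0 < δ := lt_min hδ' (by linarith)
  have hδL : δ ≤ L / 2 := min_le_right _ _
  -- a periodic bump at `c`
  set G : ℝ → ℝ := fun t => max 0 (Real.cos (2 * Real.pi * (t - c) / L) -
    Real.cos (2 * Real.pi * δ / L)) with hG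
  have hGc : Continuous G := by fun_prop
  have hGp : Function.Periodic G L := fun t => by
    simp only [hG]
    rw [show 2 * Real.pi * (t + L - c) / L = 2 * Real.pi * (t - c) / L + 2 * Real.pi by
      field_simp; ring, Real.cos_add_two_pi]
  have hcos : ∀ t, |t - c| ≤ L / 2 → (0 < G t ↔ |t - c| < δ) := by
    intro t ht
    have hpi := Real.pi_pos
    have e1 : Real.cos (2 * Real.pi * (t - c) / L) = Real.cos (2 * Real.pi * |t - c| / L) := by
      rw [← Real.cos_abs (2 * Real.pi * (t - c) / L), abs_div, abs_mul, abs_of_pos hL,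
        abs_of_pos (by positivity : 0 < 2 * Real.pi)]
    have hmem : ∀ x, 0 ≤ x → x ≤ L / 2 → 2 * Real.pi * x / L ∈ Icc 0 Real.pi := fun x h0 h1 => by
      refine ⟨by positivity, ?_⟩
      rw [div_le_iff₀ hL]
      nlinarith
    simp only [hG, lt_max_iff, lt_irrefl, false_or, sub_pos]
    rw [e1, Real.strictAntiOn_cos.lt_iff_gt (hmem δ hδ0.le hδL) (hmem _ (abs_nonneg _) ht),
      div_lt_div_iff_of_pos_right hL, mul_lt_mul_iff_right₀ (by positivity)]
  have hprod : Function.Periodic (fun t => e * (u t - I t - m) * G t) L := fun t => by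
    simp only [hup t, hIp t, hGp t]
  have hint : IntervalIntegrable (fun t => e * (u t - I t - m) * G t) volume 0 L :=
    (hzi.const_mul e).mul_continuousOn hGc.continuousOn
  have hint' := hprod.intervalIntegrable₀ hL.ne' hint (c - L / 2) (c - L / 2 + L)
  have hI1 : ∫ t in (c - L / 2)..(c - L / 2 + L), e * (u t - I t - m) * G t = 0 := by
    rw [hprod.intervalIntegral_add_eq _ 0, zero_add]
    simp_rw [mul_assoc]
    rw [intervalIntegral.integral_const_mul, horth G hGc hGp, mul_zero]
  have hnear : ∀ t ∈ Ioc (c - L / 2) (c - L / 2 + L), |t - c| ≤ L / 2 := fun t ht =>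
    abs_le.2 ⟨by linarith [ht.1], by linarith [ht.2]⟩
  have hposδ : ∀ t, |t - c| < δ → 0 < e * (u t - I t - m) * G t := fun t ht => by
    have h1 := (hcos t (ht.le.trans hδL)).2 ht
    have h2 : 0 < e * (u t - I t - m) :=
      hball (by rw [Real.dist_eq]; exact ht.trans_le (min_le_left _ _))
    positivity
  have hnn : 0 ≤ᵐ[volume.restrict (Ioc (c - L / 2) (c - L / 2 + L))]
      fun t => e * (u t - I t - m) * G t := by
    filter_upwards [ae_restrict_mem measurableSet_Ioc] with t ht
    by_cases h1 : |t - c| < δ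
    · exact (hposδ t h1).le
    · have h2 : G t = 0 := le_antisymm (not_lt.1 fun h2 => h1 ((hcos t (hnear t ht)).1 h2))
        (le_max_left _ _)
      simp [h2]
  rw [intervalIntegral.integral_of_le (by linarith),
    setIntegral_eq_zero_iff_of_nonneg_ae hnn
      ((intervalIntegrable_iff_integrableOn_Ioc_of_le (by linarith)).1 hint')] at hI1
  have hsub : Ioo (c - δ) (c + δ) ⊆ Ioc (c - L / 2) (c - L / 2 + L) := fun t ht =>
    ⟨by linarith [ht.1], by linarith [ht.2]⟩
  have hae := ae_restrict_of_ae_restrict_of_subset hsub hI1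
  have : ∀ᵐ t ∂volume.restrict (Ioo (c - δ) (c + δ)), False := by
    filter_upwards [hae, ae_restrict_mem measurableSet_Ioo] with t ht ht'
    exact (hposδ t (abs_sub_lt_iff.2 ⟨by linarith [ht'.2], by linarith [ht'.1]⟩)).ne' ht
  have h0 : volume (Ioo (c - δ) (c + δ)) = 0 := by
    rw [ae_iff] at this
    simpa only [not_false_eq_true, ofPred_true, Measure.restrict_apply_univ] using this
  rw [Real.volume_Ioo, ENNReal.ofReal_eq_zero] at h0
  linarith

/-! ### The angle around a boundary vortex -/

/-- The angle of `z - a`, measured from the direction `e`. -/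
def vortexAngle (a e z : ℂ) : ℝ := Complex.arg ((z - a) / e)

/-- A radial cutoff, equal to `1` for `‖z - a‖ ≤ r` and to `0` for `2 * r ≤ ‖z - a‖`. -/
def vortexCutoff (a : ℂ) (r : ℝ) (z : ℂ) : ℝ := Real.smoothTransition (2 - ‖z - a‖ ^ 2 / r ^ 2)

/-- The gradient of the angle around `a`. -/
def vortexField (a z : ℂ) : ℂ := (‖z - a‖ ^ 2)⁻¹ • (Complex.I * (z - a))

/-- In the ball of radius `R` around `a`, the set `Ω` agrees up to a quadratic error with the half
plane with inner normal `e`, and the error is so small that `Ω` avoids the direction `-e`. -/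
structure IsPole (Ω : Set ℂ) (a e : ℂ) (K R : ℝ) : Prop where
  norm_eq : ‖e‖ = 1
  pos : 0 < R
  small : K * R < 1
  lower : ∀ z ∈ Ω, ‖z - a‖ < R → -(K * ‖z - a‖ ^ 2) < inner ℝ e (z - a)
  upper : ∀ z ∉ Ω, ‖z - a‖ < R → inner ℝ e (z - a) ≤ K * ‖z - a‖ ^ 2

lemma IsC11.exists_isPole {Ω : Set ℂ} (hΩ : IsOpen Ω) (h : IsC11 Ω) {L : ℝ} {γ : ℝ → ℂ}
    (hγ : IsBoundaryParam Ω L γ) (s : ℝ) : ∃ K ≥ 0, ∃ R₀ > 0, ∀ R, 0 < R → R ≤ R₀ →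
      IsPole Ω (γ s) (Complex.I * deriv γ s) K R := by
  obtain ⟨u, r, f, K, hc⟩ := h.exists_isChart hΩ (p := γ s) (hγ.range_eq ▸ mem_range_self s)
  refine ⟨K, K.2, min r (1 / (K + 2)), lt_min hc.pos (by positivity), fun R hR hRr => ?_⟩
  have hRr' : R ≤ r := hRr.trans (min_le_left _ _)
  refine ⟨by simp [hγ.unit_speed], hR, ?_,
    fun z hz hzR => (hc.half_plane hγ rfl (hzR.trans_le hRr')).1 hz,
    fun z hz hzR => (hc.half_plane hγ rfl (hzR.trans_le hRr')).2 hz⟩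
  have h1 : R ≤ 1 / (K + 2) := hRr.trans (min_le_right _ _)
  rw [le_div_iff₀ (by positivity)] at h1
  nlinarith

lemma re_div_eq_inner {e : ℂ} (he : ‖e‖ = 1) (w : ℂ) : (w / e).re = inner ℝ e w := by
  have : e⁻¹ = starRingEnd ℂ e := by
    rw [Complex.inv_def, Complex.normSq_eq_norm_sq, he]
    simp
  rw [div_eq_mul_inv, this, Complex.inner]

namespace IsPole

variable {Ω : Set ℂ} {a e : ℂ} {K R : ℝ}

lemma lower_closure (h : IsPole Ω a e K R) {z : ℂ} (hz : z ∈ closure Ω) (hzR : ‖z - a‖ < R) :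
    -(K * ‖z - a‖ ^ 2) ≤ inner ℝ e (z - a) := by
  have hopen : IsOpen {z : ℂ | ‖z - a‖ < R} := isOpen_lt (by fun_prop) continuous_const
  have h1 : z ∈ closure (Ω ∩ {z : ℂ | ‖z - a‖ < R}) := by
    rw [inter_comm]
    exact hopen.inter_closure ⟨hzR, hz⟩
  have hcl : IsClosed {z : ℂ | -(K * ‖z - a‖ ^ 2) ≤ inner ℝ e (z - a)} :=
    isClosed_le (by fun_prop) (by fun_prop)
  exact hcl.closure_subset_iff.2 (fun z hz => (h.lower z hz.1 hz.2).le) h1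

/-- Near the pole, the closure of `Ω` avoids the branch cut of the angle. -/
lemma mem_slitPlane (h : IsPole Ω a e K R) {z : ℂ} (hz : z ∈ closure Ω) (hza : z ≠ a)
    (hzR : ‖z - a‖ < R) : (z - a) / e ∈ Complex.slitPlane := by
  have he : e ≠ 0 := fun h0 => by simpa [h0] using h.norm_eq
  rw [Complex.mem_slitPlane_iff_not_le_zero, Complex.nonpos_iff]
  rintro ⟨h1, h2⟩
  have h3 : ‖(z - a) / e‖ = ‖z - a‖ := by rw [norm_div, h.norm_eq, div_one]
  have h4 : ((z - a) / e).re = -‖z - a‖ := by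
    rw [← h3, ← Complex.abs_re_eq_norm.2 h2, abs_of_nonpos h1, neg_neg]
  have h5 := h.lower_closure hz hzR
  rw [← re_div_eq_inner h.norm_eq, h4] at h5
  have h6 : 0 < ‖z - a‖ := norm_pos_iff.2 (sub_ne_zero.2 hza)
  have h7 : 1 ≤ K * ‖z - a‖ := by nlinarith
  have h8 := h.small
  have h9 : 0 < K := by
    by_contra! hK
    nlinarith
  nlinarith

end IsPole

lemma hasFDerivAt_vortexAngle {a e z : ℂ} (he : e ≠ 0) (hz : (z - a) / e ∈ Complex.slitPlane) :
    HasFDerivAt (vortexAngle a e) (innerSL ℝ (vortexField a z)) z := by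
  have hza : z - a ≠ 0 := fun h0 => Complex.slitPlane_ne_zero hz (by simp [h0])
  have h1 : HasDerivAt (fun z => Complex.log ((z - a) / e)) (((1 : ℂ) / e) / ((z - a) / e)) z :=
    (((hasDerivAt_id z).sub_const a).div_const e).clog hz
  have h2 := Complex.imCLM.hasFDerivAt.comp z (h1.hasFDerivAt.restrictScalars ℝ)
  refine (h2.congr_fderiv ?_).congr_of_eventuallyEq (.of_forall fun z => ?_)
  · ext1 v
    have e1 : (1 : ℂ) / e / ((z - a) / e) = (z - a)⁻¹ := by field_simp
    simp only [e1, ContinuousLinearMap.comp_apply, innerSL_apply_apply, vortexField,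
      real_inner_smul_left, Complex.imCLM_apply, ContinuousLinearMap.coe_restrictScalars',
      ContinuousLinearMap.toSpanSingleton_apply, smul_eq_mul]
    rw [Complex.inner, Complex.inv_def, Complex.normSq_eq_norm_sq]
    generalize (‖z - a‖ ^ 2)⁻¹ = n
    simp
    ring
  · simp [vortexAngle, Complex.log_im]

lemma norm_vortexField (a z : ℂ) : ‖vortexField a z‖ = ‖z - a‖⁻¹ := by
  rw [vortexField, norm_smul, norm_mul, Complex.norm_I, one_mul, norm_inv, norm_pow, norm_norm]
  by_cases h : ‖z - a‖ = 0
  · simp [h]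
  · field_simp

lemma abs_vortexAngle_le (a e z : ℂ) : |vortexAngle a e z| ≤ Real.pi := Complex.abs_arg_le_pi _

lemma measurable_vortexAngle (a e : ℂ) : Measurable (vortexAngle a e) :=
  Complex.measurable_arg.comp (by fun_prop)

section cutoff

variable (a : ℂ) (r : ℝ)

lemma contDiff_vortexCutoff : ContDiff ℝ ∞ (vortexCutoff a r) := by
  have h1 : ContDiff ℝ ∞ fun z : ℂ => 2 - ‖z - a‖ ^ 2 / r ^ 2 := by
    have : ContDiff ℝ ∞ fun z : ℂ => ‖z - a‖ ^ 2 := (contDiff_norm_sq ℝ).comp (by fun_prop)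
    fun_prop
  exact Real.smoothTransition.contDiff.comp h1

lemma vortexCutoff_nonneg (z : ℂ) : 0 ≤ vortexCutoff a r z := Real.smoothTransition.nonneg _

lemma vortexCutoff_le_one (z : ℂ) : vortexCutoff a r z ≤ 1 := Real.smoothTransition.le_one _

variable {a r}

lemma vortexCutoff_eq_one (hr : 0 < r) {z : ℂ} (hz : ‖z - a‖ ≤ r) : vortexCutoff a r z = 1 := by
  refine Real.smoothTransition.one_of_one_le ?_
  have : ‖z - a‖ ^ 2 / r ^ 2 ≤ 1 := by
    rw [div_le_one (by positivity)]
    gcongr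
  linarith

lemma vortexCutoff_eq_zero (hr : 0 < r) {z : ℂ} (hz : 2 * r ≤ ‖z - a‖) :
    vortexCutoff a r z = 0 := by
  refine Real.smoothTransition.zero_of_nonpos ?_
  have : 2 ≤ ‖z - a‖ ^ 2 / r ^ 2 := by
    rw [le_div_iff₀ (by positivity)]
    nlinarith
  linarith

lemma norm_lt_of_vortexCutoff_ne_zero (hr : 0 < r) {z : ℂ} (hz : vortexCutoff a r z ≠ 0) :
    ‖z - a‖ < 2 * r := by
  by_contra! h
  exact hz (vortexCutoff_eq_zero hr h)

lemma tsupport_vortexCutoff_subset (hr : 0 < r) :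
    tsupport (vortexCutoff a r) ⊆ Metric.closedBall a (2 * r) := by
  refine closure_minimal (fun z hz => ?_) Metric.isClosed_closedBall
  rw [mem_closedBall_iff_norm]
  exact (norm_lt_of_vortexCutoff_ne_zero hr hz).le

lemma hasCompactSupport_vortexCutoff (hr : 0 < r) : HasCompactSupport (vortexCutoff a r) :=
  (isCompact_closedBall a (2 * r)).of_isClosed_subset (isClosed_tsupport _)
    (tsupport_vortexCutoff_subset hr)

end cutoff

/-- The singular part of the phase at a pole. -/
def vortexPhase (a e : ℂ) (r : ℝ) (z : ℂ) : ℝ := vortexCutoff a r z * vortexAngle a e z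

lemma abs_vortexPhase_le (a e : ℂ) (r : ℝ) (z : ℂ) : |vortexPhase a e r z| ≤ Real.pi := by
  rw [vortexPhase, abs_mul, abs_of_nonneg (vortexCutoff_nonneg a r z)]
  exact (mul_le_of_le_one_left (abs_nonneg _) (vortexCutoff_le_one a r z)).trans
    (abs_vortexAngle_le a e z)

lemma measurable_vortexPhase (a e : ℂ) (r : ℝ) : Measurable (vortexPhase a e r) :=
  (contDiff_vortexCutoff a r).continuous.measurable.mul (measurable_vortexAngle a e)

lemma vortexPhase_eventuallyEq_zero {a e : ℂ} {r : ℝ} (hr : 0 < r) {z : ℂ}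
    (hz : 2 * r < ‖z - a‖) : vortexPhase a e r =ᶠ[𝓝 z] fun _ => 0 := by
  have : IsOpen {z : ℂ | 2 * r < ‖z - a‖} := isOpen_lt continuous_const (by fun_prop)
  filter_upwards [this.mem_nhds hz] with y hy
  rw [vortexPhase, vortexCutoff_eq_zero hr (le_of_lt hy), zero_mul]

namespace IsPole

variable {Ω : Set ℂ} {a e : ℂ} {K R r : ℝ}

lemma ne_zero (h : IsPole Ω a e K R) : e ≠ 0 := fun h0 => by simpa [h0] using h.norm_eq

lemma gradient_vortexPhase (h : IsPole Ω a e K R) (hr : 0 < r) (hR : 2 * r < R) {z : ℂ}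
    (hz : z ∈ closure Ω) (hza : z ≠ a) : gradient (vortexPhase a e r) z =
      vortexCutoff a r z • vortexField a z +
        vortexAngle a e z • gradient (vortexCutoff a r) z := by
  by_cases hzr : ‖z - a‖ < R
  · have h1 := hasFDerivAt_vortexAngle h.ne_zero (h.mem_slitPlane hz hza hzr)
    have h2 : gradient (vortexAngle a e) z = vortexField a z := by
      refine ext_inner_right ℝ fun v => ?_
      rw [inner_gradient, h1.fderiv]
      rfl
    rw [← h2]
    exact gradient_fun_mul ((contDiff_vortexCutoff a r).differentiable (by simp) z)
      h1.differentiableAt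
  · have hz2 := hR.trans_le (not_lt.1 hzr)
    have h1 : gradient (vortexPhase a e r) z = 0 := by
      rw [← norm_eq_zero, norm_gradient, (vortexPhase_eventuallyEq_zero hr hz2).fderiv_eq]
      simp
    have h2 : gradient (vortexCutoff a r) z = 0 := by
      have : vortexCutoff a r =ᶠ[𝓝 z] fun _ => 0 := by
        have : IsOpen {z : ℂ | 2 * r < ‖z - a‖} := isOpen_lt continuous_const (by fun_prop)
        filter_upwards [this.mem_nhds hz2] with y hy
        exact vortexCutoff_eq_zero hr (le_of_lt hy)
      rw [← norm_eq_zero, norm_gradient, this.fderiv_eq]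
      simp
    rw [h1, h2, vortexCutoff_eq_zero hr hz2.le]
    simp

lemma contDiffAt_vortexPhase (h : IsPole Ω a e K R) (hr : 0 < r) (hR : 2 * r < R) {z : ℂ}
    (hz : z ∈ closure Ω) (hza : z ≠ a) : ContDiffAt ℝ 1 (vortexPhase a e r) z := by
  by_cases hzr : ‖z - a‖ < R
  · have h1 : ContDiffAt ℝ 1 (fun z => Complex.log ((z - a) / e)) z := by
      have : ContDiffAt ℂ 1 (fun z => Complex.log ((z - a) / e)) z :=
        (Complex.contDiffAt_log (h.mem_slitPlane hz hza hzr)).comp z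
          ((contDiffAt_id.sub contDiffAt_const).div_const e)
      exact this.restrict_scalars ℝ
    have h2 : ContDiffAt ℝ 1 (vortexAngle a e) z := by
      have := Complex.imCLM.contDiff.contDiffAt.comp z h1
      refine this.congr_of_eventuallyEq (.of_forall fun z => ?_)
      simp [vortexAngle, Complex.log_im]
    exact ((contDiff_vortexCutoff a r).of_le (by simp)).contDiffAt.mul h2
  · exact contDiffAt_const.congr_of_eventuallyEq
      (vortexPhase_eventuallyEq_zero hr (hR.trans_le (not_lt.1 hzr)))

lemma differentiableAt_vortexPhase (h : IsPole Ω a e K R) (hr : 0 < r) (hR : 2 * r < R) {z : ℂ}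
    (hz : z ∈ closure Ω) (hza : z ≠ a) : DifferentiableAt ℝ (vortexPhase a e r) z :=
  (h.contDiffAt_vortexPhase hr hR hz hza).differentiableAt (by simp)

lemma locallyLipschitzOn_vortexPhase (h : IsPole Ω a e K R) (hΩ : IsOpen Ω) (haΩ : a ∉ Ω)
    (hr : 0 < r) (hR : 2 * r < R) : LocallyLipschitzOn Ω (vortexPhase a e r) :=
  ContDiffOn.locallyLipschitzOn_of_isOpen hΩ fun _ hz => ContDiffAt.contDiffWithinAt <|
    h.contDiffAt_vortexPhase hr hR (subset_closure hz) fun h0 => haΩ (h0 ▸ hz)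

end IsPole

/-! ### The regular part of the boundary data -/

lemma exists_pos_le_forall {ι : Type*} [Finite ι] {f : ι → ℝ} (h : ∀ j, 0 < f j) :
    ∃ r > 0, ∀ j, r ≤ f j := by
  have h1 : ∀ᶠ r in 𝓝[>] (0 : ℝ), ∀ j, r ≤ f j :=
    eventually_all.2 fun j => by filter_upwards [Ioo_mem_nhdsGT (h j)] with r hr using hr.2.le
  obtain ⟨r, hr, hr0⟩ := (h1.and self_mem_nhdsWithin).exists
  exact ⟨r, hr0, hr⟩

lemma intervalIntegrable_sum {ι : Type*} [Fintype ι] {f : ι → ℝ → ℝ} {a b : ℝ}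
    (h : ∀ j, IntervalIntegrable (f j) volume a b) :
    IntervalIntegrable (fun t => ∑ j, f j t) volume a b := by
  have := IntervalIntegrable.sum (μ := volume) (a := a) (b := b) Finset.univ fun j _ => h j
  rwa [show ∑ j, f j = fun t => ∑ j, f j t from funext fun t => Finset.sum_apply _ _ _] at this

lemma lipschitzOnWith_arg : LipschitzOnWith 2 Complex.arg (Metric.closedBall (1 : ℂ) (1 / 2)) := by
  have hre : ∀ z ∈ Metric.closedBall (1 : ℂ) (1 / 2), 1 / 2 ≤ z.re := fun z hz => by
    rw [mem_closedBall_iff_norm] at hz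
    have := (abs_le.1 ((Complex.abs_re_le_norm (z - 1)).trans hz)).1
    simp only [Complex.sub_re, Complex.one_re] at this
    linarith
  have h1 : LipschitzOnWith 2 Complex.log (Metric.closedBall (1 : ℂ) (1 / 2)) := by
    refine (convex_closedBall _ _).lipschitzOnWith_of_nnnorm_hasDerivWithin_le
      (f' := fun z => z⁻¹) (fun z hz => ?_) fun z hz => ?_
    · exact (Complex.hasDerivAt_log (Or.inl (by linarith [hre z hz]))).hasDerivWithinAt
    · rw [nnnorm_inv, ← NNReal.coe_le_coe]
      push_cast
      have h2 : (1 / 2 : ℝ) ≤ ‖z‖ := (hre z hz).trans (Complex.re_le_norm z)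
      calc ‖z‖⁻¹ ≤ (1 / 2 : ℝ)⁻¹ := by gcongr
        _ = 2 := by norm_num
  refine LipschitzOnWith.of_dist_le_mul fun z hz w hw => ?_
  refine le_trans ?_ (h1.dist_le_mul z hz w hw)
  rw [← Complex.log_im, ← Complex.log_im, Real.dist_eq, ← Complex.sub_im, dist_eq_norm]
  exact Complex.abs_im_le_norm _

lemma lipschitzWith_mul_of_bound {H B : ℝ → ℝ} {C C' : ℝ≥0} {M M' : ℝ} (hH : LipschitzWith C H)
    (hB : LipschitzWith C' B) (hHM : ∀ t, |H t| ≤ M) (hBM : ∀ t, |B t| ≤ M') :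
    LipschitzWith (M * C' + M' * C).toNNReal fun t => H t * B t := by
  have hM : 0 ≤ M := (abs_nonneg _).trans (hHM 0)
  have hM' : 0 ≤ M' := (abs_nonneg _).trans (hBM 0)
  refine LipschitzWith.of_dist_le_mul fun x y => ?_
  rw [Real.coe_toNNReal _ (by positivity), Real.dist_eq,
    show H x * B x - H y * B y = H x * (B x - B y) + B y * (H x - H y) by ring]
  refine (abs_add_le _ _).trans ?_
  rw [abs_mul, abs_mul, add_mul, mul_assoc, mul_assoc]
  gcongr
  · exact hHM x
  · exact hB.dist_le_mul x y
  · exact hBM y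
  · exact hH.dist_le_mul x y

lemma _root_.Function.Periodic.deriv_of_periodic {ζ : ℝ → ℝ} {L : ℝ} (h : Function.Periodic ζ L) :
    Function.Periodic (deriv ζ) L := fun t => by
  rw [← deriv_comp_add_const, funext h]

lemma IsBoundaryParam.lipschitzWith_one {Ω : Set ℂ} {L : ℝ} {γ : ℝ → ℂ}
    (hγ : IsBoundaryParam Ω L γ) : LipschitzWith 1 γ :=
  lipschitzWith_of_nnnorm_deriv_le hγ.differentiable fun s => by
    rw [← NNReal.coe_le_coe, coe_nnnorm, hγ.unit_speed]
    simp

/-- Along the boundary, the angle around `γ s₀` equals `∓ π / 2` plus a Lipschitz function on the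
two sides of `s₀`, because `γ s - γ s₀` is `s - s₀` times the secant slope. -/
lemma IsBoundaryParam.exists_vortexPhase_eq {Ω : Set ℂ} {L : ℝ} {γ : ℝ → ℂ}
    (hγ : IsBoundaryParam Ω L γ) (s₀ : ℝ) : ∃ r₀ > 0, ∀ r, 0 < r → r ≤ r₀ →
      ∃ (C : ℝ≥0) (Fp Fm : ℝ → ℝ), LipschitzWith C Fp ∧ LipschitzWith C Fm ∧
        Fp s₀ = -(Real.pi / 2) ∧ Fm s₀ = Real.pi / 2 ∧ Fp (s₀ + L / 2) = 0 ∧ Fm (s₀ - L / 2) = 0 ∧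
        (∀ s ∈ Ioc s₀ (s₀ + L / 2),
          vortexPhase (γ s₀) (Complex.I * deriv γ s₀) r (γ s) = Fp s) ∧
        ∀ s ∈ Ico (s₀ - L / 2) s₀,
          vortexPhase (γ s₀) (Complex.I * deriv γ s₀) r (γ s) = Fm s := by
  obtain ⟨c, hc, hca⟩ := hγ.exists_chord_arc
  obtain ⟨K, hK⟩ := hγ.exists_secant_lipschitz s₀
  have hL := hγ.pos
  set τ := deriv γ s₀ with hτ
  have hτ1 : ‖τ‖ = 1 := hγ.unit_speed s₀
  have hτ0 : τ ≠ 0 := fun h => by simp [h] at hτ1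
  -- `g` is the secant slope in units of the tangent, within `1 / 2` of `g s₀ = 1` up to distance `δ`
  set δ := min (1 / (2 * (K + 1) : ℝ)) (L / 4) with hδ
  have hδ0 : 0 < δ := lt_min (by positivity) (by positivity)
  have hδK : K * δ ≤ 1 / 2 := by
    have : δ ≤ 1 / (2 * (K + 1) : ℝ) := min_le_left _ _
    rw [le_div_iff₀ (by positivity)] at this
    nlinarith
  have hδL : δ ≤ L / 4 := min_le_right _ _
  set g : ℝ → ℂ := fun s => secant γ s₀ s / τ with hg
  have hgL : LipschitzWith K g := LipschitzWith.of_dist_le_mul fun x y => by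
    rw [hg, dist_eq_norm, ← sub_div, norm_div, hτ1, div_one, ← dist_eq_norm]
    exact hK.dist_le_mul x y
  have hg1 : g s₀ = 1 := by
    simp only [hg]
    rw [IsBoundaryParam.secant_self, div_self hτ0]
  -- clamping the parameter makes the argument `A` of `g` a globally defined Lipschitz function
  set cl : ℝ → ℝ := fun s => max (s₀ - δ) (min (s₀ + δ) s) with hcl
  have hclL : LipschitzWith 1 cl := (LipschitzWith.id.const_min (s₀ + δ)).const_max (s₀ - δ)
  have hclm : ∀ s, |cl s - s₀| ≤ δ := fun s => by
    rw [abs_le]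
    constructor
    · have := le_max_left (s₀ - δ) (min (s₀ + δ) s)
      linarith
    · have : cl s ≤ s₀ + δ := max_le (by linarith) (min_le_left _ _)
      linarith
  have hcle : ∀ s, |s - s₀| < δ → cl s = s := fun s hs => by
    rw [abs_lt] at hs
    simp only [hcl]
    rw [min_eq_right (by linarith), max_eq_right (by linarith)]
  have hgb : ∀ s, g (cl s) ∈ Metric.closedBall (1 : ℂ) (1 / 2) := fun s => by
    have := hgL.dist_le_mul (cl s) s₀
    rw [hg1, Real.dist_eq] at this
    exact this.trans ((mul_le_mul_of_nonneg_left (hclm s) K.2).trans hδK)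
  set A : ℝ → ℝ := fun s => Complex.arg (g (cl s)) with hA
  have hAL : LipschitzWith (2 * (K * 1)) A := LipschitzWith.of_dist_le_mul fun x y => by
    refine (lipschitzOnWith_arg.dist_le_mul _ (hgb x) _ (hgb y)).trans ?_
    push_cast
    rw [mul_assoc]
    gcongr
    exact_mod_cast (hgL.comp hclL).dist_le_mul x y
  have hre : ∀ s, |A s| < Real.pi / 2 := fun s => by
    rw [hA, Complex.abs_arg_lt_pi_div_two_iff]
    left
    have := hgb s
    rw [mem_closedBall_iff_norm] at this
    have := (abs_le.1 ((Complex.abs_re_le_norm _).trans this)).1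
    simp only [Complex.sub_re, Complex.one_re] at this
    linarith
  have hA0 : A s₀ = 0 := by
    rw [hA]
    simp only [hcle s₀ (by simpa using hδ0), hg1, Complex.arg_one]
  have hfac : ∀ s, (γ s - γ s₀) / (Complex.I * τ) = ((s - s₀ : ℝ) : ℂ) * (-Complex.I * g s) := by
    intro s
    rw [hγ.sub_eq_smul_secant s₀ s, Complex.real_smul, hg]
    field_simp
    rw [Complex.I_sq]
    ring
  have hpi := Real.pi_pos
  -- by the chord-arc property, the cutoff at this radius only sees parameters at distance below `δ`
  refine ⟨c * δ / 2, by positivity, fun r hr hr0 => ?_⟩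
  obtain ⟨CH, hCH⟩ := ((contDiff_vortexCutoff (γ s₀) r).lipschitzWith_of_hasCompactSupport
    (hasCompactSupport_vortexCutoff hr) (by simp))
  set H : ℝ → ℝ := fun s => vortexCutoff (γ s₀) r (γ s) with hH
  have hHL : LipschitzWith (CH * 1) H := hCH.comp hγ.lipschitzWith_one
  have hH1 : ∀ s, |H s| ≤ 1 := fun s => by
    rw [hH, abs_of_nonneg (vortexCutoff_nonneg _ _ _)]
    exact vortexCutoff_le_one _ _ _
  have hHs : ∀ s, |s - s₀| ≤ L / 2 → H s ≠ 0 → |s - s₀| < δ := fun s hs h0 => by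
    have h1 := norm_lt_of_vortexCutoff_ne_zero hr h0
    have h2 := hca s₀ s hs
    have h3 : c * |s - s₀| < c * δ := by linarith
    exact lt_of_mul_lt_mul_left h3 hc.le
  have hH0 : H s₀ = 1 := vortexCutoff_eq_one hr (by simpa using hr.le)
  have hHend : ∀ s, |s - s₀| = L / 2 → H s = 0 := fun s hs => by
    by_contra h0
    have := hHs s hs.le h0
    linarith
  have hBp : LipschitzWith (2 * (K * 1) + 0) fun s => A s + -(Real.pi / 2) :=
    hAL.add (LipschitzWith.const _)
  have hBm : LipschitzWith (2 * (K * 1) + 0) fun s => A s + Real.pi / 2 :=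
    hAL.add (LipschitzWith.const _)
  have hBpb : ∀ s, |A s + -(Real.pi / 2)| ≤ Real.pi := fun s => by
    have := abs_lt.1 (hre s)
    exact abs_le.2 ⟨by linarith, by linarith⟩
  have hBmb : ∀ s, |A s + Real.pi / 2| ≤ Real.pi := fun s => by
    have := abs_lt.1 (hre s)
    exact abs_le.2 ⟨by linarith, by linarith⟩
  refine ⟨_, fun s => H s * (A s + -(Real.pi / 2)), fun s => H s * (A s + Real.pi / 2),
    lipschitzWith_mul_of_bound hHL hBp hH1 hBpb, lipschitzWith_mul_of_bound hHL hBm hH1 hBmb,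
    by simp [hH0, hA0], by simp [hH0, hA0], ?_, ?_, fun s hs => ?_, fun s hs => ?_⟩
  · simp only [hHend (s₀ + L / 2) (by rw [add_sub_cancel_left, abs_of_pos (by linarith)]), zero_mul]
  · simp only [hHend (s₀ - L / 2) (by
      rw [sub_sub_cancel_left, abs_neg, abs_of_pos (by linarith)]), zero_mul]
  · rw [vortexPhase]
    by_cases h0 : H s = 0
    · simp only [h0, zero_mul]
      rw [hH] at h0
      simp only [h0, zero_mul]
    · congr 1
      have hs' := hHs s (by rw [abs_of_pos (by linarith [hs.1])]; linarith [hs.2]) h0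
      have hgne : g s ≠ 0 := fun h => by
        have := hgb s
        rw [hcle s hs', h] at this
        norm_num at this
      rw [vortexAngle, hfac, Complex.arg_real_mul _ (by linarith [hs.1] : 0 < s - s₀)]
      have hAs : A s = Complex.arg (g s) := by simp only [hA, hcle s hs']
      have := abs_lt.1 (hre s)
      rw [Complex.arg_mul (by simp) hgne, Complex.arg_neg_I, hAs]
      · ring
      · rw [Complex.arg_neg_I, ← hAs]
        constructor <;> linarith
  · rw [vortexPhase]
    by_cases h0 : H s = 0
    · simp only [h0, zero_mul]
      rw [hH] at h0
      simp only [h0, zero_mul]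
    · congr 1
      have hs' := hHs s (by rw [abs_of_neg (by linarith [hs.2])]; linarith [hs.1]) h0
      have hgne : g s ≠ 0 := fun h => by
        have := hgb s
        rw [hcle s hs', h] at this
        norm_num at this
      rw [vortexAngle, hfac, show ((s - s₀ : ℝ) : ℂ) * (-Complex.I * g s) =
        ((s₀ - s : ℝ) : ℂ) * (Complex.I * g s) by push_cast; ring,
        Complex.arg_real_mul _ (by linarith [hs.2] : 0 < s₀ - s)]
      have hAs : A s = Complex.arg (g s) := by simp only [hA, hcle s hs']
      have := abs_lt.1 (hre s)
      rw [Complex.arg_mul (by simp) hgne, Complex.arg_I, hAs]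
      · ring
      · rw [Complex.arg_I, ← hAs]
        constructor <;> linarith

/-- The distributional derivative along the boundary of the phase at `γ s₀` is a bounded function
minus `π` times a Dirac mass. -/
lemma IsBoundaryParam.exists_vortexPhase_weak_deriv {Ω : Set ℂ} {L : ℝ} {γ : ℝ → ℂ}
    (hγ : IsBoundaryParam Ω L γ) (s₀ : ℝ) : ∃ r₀ > 0, ∀ r, 0 < r → r ≤ r₀ →
      ∃ (k : ℝ → ℝ) (M : ℝ), Function.Periodic k L ∧ Measurable k ∧ (∀ t, |k t| ≤ M) ∧
        ∀ ζ : ℝ → ℝ, ContDiff ℝ 1 ζ → Function.Periodic ζ L →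
          -∫ t in (0 : ℝ)..L, vortexPhase (γ s₀) (Complex.I * deriv γ s₀) r (γ t) * deriv ζ t =
            (∫ t in (0 : ℝ)..L, k t * ζ t) - Real.pi * ζ s₀ := by
  obtain ⟨r₀, hr₀, h⟩ := hγ.exists_vortexPhase_eq s₀
  refine ⟨r₀, hr₀, fun r hr hrr => ?_⟩
  obtain ⟨C, Fp, Fm, hFp, hFm, hFp0, hFm0, hFp1, hFm1, hup, hum⟩ := h r hr hrr
  have hL := hγ.pos
  set u : ℝ → ℝ := fun t => vortexPhase (γ s₀) (Complex.I * deriv γ s₀) r (γ t) with hu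
  have huP : Function.Periodic u L := fun t => by simp only [hu, hγ.periodic t]
  have hγc : Continuous γ := hγ.differentiable.continuous
  have hui : ∀ a b, IntervalIntegrable u volume a b := fun a b =>
    intervalIntegrable_of_bound ((measurable_vortexPhase _ _ _).comp hγc.measurable)
      (fun t => abs_vortexPhase_le _ _ _ _) a b
  -- the pointwise derivative, clamped to the Lipschitz constant to be bounded at every point
  set k : ℝ → ℝ := fun t => max (-(C : ℝ)) (min C (deriv u t)) with hk
  have hkm : Measurable k := measurable_const.max (measurable_const.min (measurable_deriv u))
  have hkM : ∀ t, |k t| ≤ C := fun t => abs_le.2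
    ⟨le_max_left _ _, max_le (by linarith [C.2]) (min_le_left _ _)⟩
  have hkP : Function.Periodic k L := fun t => by simp only [hk, huP.deriv_of_periodic t]
  have hkd : ∀ {F : ℝ → ℝ} {t : ℝ}, LipschitzWith C F → u =ᶠ[𝓝 t] F → k t = deriv F t := by
    intro F t hF hFu
    have := abs_le.1 (norm_deriv_le_of_lipschitz (x₀ := t) hF)
    simp only [hk]
    rw [hFu.deriv_eq, min_eq_right this.2, max_eq_right this.1]
  refine ⟨k, C, hkP, hkm, hkM, fun ζ hζ hζP => ?_⟩
  have hζc : Continuous (deriv ζ) := hζ.continuous_deriv (by simp)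
  have hprodP : Function.Periodic (fun t => u t * deriv ζ t) L := fun t => by
    simp only [huP t, hζP.deriv_of_periodic t]
  have hkζP : Function.Periodic (fun t => k t * ζ t) L := fun t => by simp only [hkP t, hζP t]
  have huζi : ∀ a b, IntervalIntegrable (fun t => u t * deriv ζ t) volume a b := fun a b =>
    (hui a b).mul_continuousOn hζc.continuousOn
  have hkζi : ∀ a b, IntervalIntegrable (fun t => k t * ζ t) volume a b := fun a b =>
    (intervalIntegrable_of_bound hkm hkM a b).mul_continuousOn hζ.continuous.continuousOn
  have hne : ∀ᵐ t : ℝ, t ≠ s₀ := by simp [ae_iff]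
  have hne2 : ∀ᵐ t : ℝ, t ≠ s₀ + L / 2 := by simp [ae_iff]
  -- integrate by parts on both sides of `s₀`: the one-sided limits `± π / 2` produce the Dirac mass
  have el : ∫ t in (s₀ - L / 2)..s₀, u t * deriv ζ t = ∫ t in (s₀ - L / 2)..s₀, Fm t * deriv ζ t := by
    refine intervalIntegral.integral_congr_ae ?_
    filter_upwards [hne] with t ht hti
    rw [uIoc_of_le (by linarith)] at hti
    rw [← hum t ⟨hti.1.le, lt_of_le_of_ne hti.2 ht⟩]
  have er : ∫ t in s₀..(s₀ + L / 2), u t * deriv ζ t = ∫ t in s₀..(s₀ + L / 2), Fp t * deriv ζ t := by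
    refine intervalIntegral.integral_congr_ae (.of_forall fun t hti => ?_)
    rw [uIoc_of_le (by linarith)] at hti
    rw [← hup t hti]
  have dl : ∫ t in (s₀ - L / 2)..s₀, deriv Fm t * ζ t = ∫ t in (s₀ - L / 2)..s₀, k t * ζ t := by
    refine intervalIntegral.integral_congr_ae ?_
    filter_upwards [hne] with t ht hti
    rw [uIoc_of_le (by linarith)] at hti
    rw [hkd hFm]
    filter_upwards [Ioo_mem_nhds hti.1 (lt_of_le_of_ne hti.2 ht)] with x hx
    exact hum x ⟨hx.1.le, hx.2⟩
  have dr : ∫ t in s₀..(s₀ + L / 2), deriv Fp t * ζ t = ∫ t in s₀..(s₀ + L / 2), k t * ζ t := by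
    refine intervalIntegral.integral_congr_ae ?_
    filter_upwards [hne2] with t ht hti
    rw [uIoc_of_le (by linarith)] at hti
    rw [hkd hFp]
    filter_upwards [Ioo_mem_nhds hti.1 (lt_of_le_of_ne hti.2 ht)] with x hx
    exact hup x ⟨hx.1, hx.2.le⟩
  have w1 := hprodP.intervalIntegral_add_eq 0 (s₀ - L / 2)
  have w2 := hkζP.intervalIntegral_add_eq 0 (s₀ - L / 2)
  rw [zero_add, show s₀ - L / 2 + L = s₀ + L / 2 by ring,
    ← intervalIntegral.integral_add_adjacent_intervals (a := s₀ - L / 2) (b := s₀)] at w1 w2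
  · rw [w1, w2, el, er, integral_mul_deriv_of_lipschitz hFm hζ,
      integral_mul_deriv_of_lipschitz hFp hζ, hFp0, hFm0, hFp1, hFm1, dl, dr]
    ring
  all_goals first | exact huζi _ _ | exact hkζi _ _

/-- The boundary data are the sum of the phases at the vortices and of a Lipschitz function: the
jumps cancel, so that the difference has a bounded tangential derivative. -/
lemma IsBoundaryData.exists_lipschitz_regular_part {N : ℕ} {Ω : Set ℂ} {L : ℝ} {γ : ℝ → ℂ}
    {a : Fin N → ℂ} {d : Fin N → ℤ} {φb : ℂ → ℝ} (hφ : IsBoundaryData Ω L γ a d φb)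
    (hγ : IsBoundaryParam Ω L γ) {s : Fin N → ℝ} (hs : ∀ j, γ (s j) = a j) :
    ∃ r₀ > 0, ∀ r, 0 < r → r ≤ r₀ →
      (∀ j, ∀ z ∈ frontier Ω, z ≠ a j →
        ContinuousAt (vortexPhase (a j) (Complex.I * deriv γ (s j)) r) z) →
      ∃ (Q : ℂ → ℝ) (C : ℝ≥0), LipschitzWith C Q ∧ ∀ z ∈ frontier Ω \ range a,
        φb z = Q z + ∑ j, (d j : ℝ) * vortexPhase (a j) (Complex.I * deriv γ (s j)) r z := by
  choose r₁ hr₁ hr using fun j => hγ.exists_vortexPhase_weak_deriv (s j)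
  obtain ⟨r₀, hr₀, hr₀le⟩ : ∃ r₀ > 0, ∀ j, r₀ ≤ r₁ j := by
    exact exists_pos_le_forall hr₁
  refine ⟨r₀, hr₀, fun r hr0 hrr hcont => ?_⟩
  choose k M hkP hkm hkM hk using fun j => hr j r hr0 (hrr.trans (hr₀le j))
  simp only [hs] at hk
  have hL := hγ.pos
  have hγc : Continuous γ := hγ.differentiable.continuous
  set θ : Fin N → ℂ → ℝ := fun j => vortexPhase (a j) (Complex.I * deriv γ (s j)) r with hθ
  obtain ⟨Kγ, hKγ⟩ := hγ.lipschitz_deriv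
  have hγ'P : Function.Periodic (deriv γ) L := fun t => by
    rw [← deriv_comp_add_const, funext hγ.periodic]
  have hγ''P : Function.Periodic (deriv (deriv γ)) L := fun t => by
    rw [← deriv_comp_add_const, funext hγ'P]
  have hκP : Function.Periodic (curvature γ) L := fun t => by
    simp only [curvature, hγ'P t, hγ''P t]
  have hκm : Measurable (curvature γ) :=
    (measurable_deriv _).inner (measurable_const.mul (measurable_deriv _))
  have hκM : ∀ t, |curvature γ t| ≤ Kγ := fun t => by
    refine (abs_real_inner_le_norm _ _).trans ?_
    rw [norm_mul, Complex.norm_I, hγ.unit_speed, mul_one, mul_one]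
    exact norm_deriv_le_of_lipschitz hKγ
  have hθi : ∀ j, IntervalIntegrable (fun t => θ j (γ t)) volume 0 L := fun j =>
    intervalIntegrable_of_bound ((measurable_vortexPhase _ _ _).comp hγc.measurable)
      (fun t => abs_vortexPhase_le _ _ _ _) 0 L
  have hφi : IntervalIntegrable (fun t => φb (γ t)) volume 0 L := by
    obtain ⟨p, q, hp, hq, he⟩ :=
      hφ.boundedVariation.locallyBoundedVariationOn.exists_monotoneOn_sub_monotoneOn
    rw [he]
    rw [← uIcc_of_le hL.le] at hp hq
    exact hp.intervalIntegrable.sub hq.intervalIntegrable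
  have hsumi : IntervalIntegrable (fun t => ∑ j, (d j : ℝ) * θ j (γ t)) volume 0 L := by
    exact intervalIntegrable_sum fun j => (hθi j).const_mul _
  -- the Dirac masses cancel, and the weak derivative is bounded because the curvature is
  obtain ⟨v, hv, huv⟩ := exists_lipschitz_of_weak_deriv hL
    (u := fun t => φb (γ t) - ∑ j, (d j : ℝ) * θ j (γ t))
    (k := fun t => curvature γ t - ∑ j, (d j : ℝ) * k j t)
    (M := Kγ + ∑ j, |(d j : ℝ)| * M j) (fun t => by simp only [hγ.periodic t]) (hφi.sub hsumi)
    (fun t => by simp only [hκP t, hkP _ t])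
    (hκm.sub (Finset.measurable_sum _ fun j _ => (hkm j).const_mul _)) (fun t => by
      refine (abs_sub _ _).trans (add_le_add (hκM t) ((Finset.abs_sum_le_sum_abs _ _).trans
        (Finset.sum_le_sum fun j _ => ?_)))
      rw [abs_mul]
      gcongr
      exact hkM j t) (fun ζ hζ hζP => by
      have hζc : Continuous (deriv ζ) := hζ.continuous_deriv (by simp)
      have h1 := hφ.tangentialDeriv s hs ζ hζ hζP
      have e1 : ∫ t in (0 : ℝ)..L, (φb (γ t) - ∑ j, (d j : ℝ) * θ j (γ t)) * deriv ζ t =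
          (∫ t in (0 : ℝ)..L, φb (γ t) * deriv ζ t) -
            ∑ j, (d j : ℝ) * ∫ t in (0 : ℝ)..L, θ j (γ t) * deriv ζ t := by
        simp_rw [← intervalIntegral.integral_const_mul]
        rw [← intervalIntegral.integral_finsetSum fun j _ =>
          ((hθi j).mul_continuousOn hζc.continuousOn).const_mul _, ← intervalIntegral.integral_sub
            (hφi.mul_continuousOn hζc.continuousOn)]
        · congr 1 with t
          rw [sub_mul, Finset.sum_mul]
          simp only [mul_assoc]
        · have := hsumi.mul_continuousOn hζc.continuousOn
          simpa only [Finset.sum_mul, mul_assoc] using this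
      have i2 : ∀ j, IntervalIntegrable (fun t => k j t * ζ t) volume 0 L := fun j =>
        (intervalIntegrable_of_bound (hkm j) (hkM j) 0 L).mul_continuousOn
          hζ.continuous.continuousOn
      have e2 : ∫ t in (0 : ℝ)..L, (curvature γ t - ∑ j, (d j : ℝ) * k j t) * ζ t =
          (∫ t in (0 : ℝ)..L, curvature γ t * ζ t) -
            ∑ j, (d j : ℝ) * ∫ t in (0 : ℝ)..L, k j t * ζ t := by
        simp_rw [← intervalIntegral.integral_const_mul]
        rw [← intervalIntegral.integral_finsetSum fun j _ => (i2 j).const_mul _,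
          ← intervalIntegral.integral_sub ((intervalIntegrable_of_bound hκm hκM 0 L).mul_continuousOn
            hζ.continuous.continuousOn)]
        · congr 1 with t
          rw [sub_mul, Finset.sum_mul]
          simp only [mul_assoc]
        · exact intervalIntegrable_sum fun j => (i2 j).const_mul _
      have h2 : ∑ j, (d j : ℝ) * -∫ t in (0 : ℝ)..L, θ j (γ t) * deriv ζ t =
          ∑ j, (d j : ℝ) * ((∫ t in (0 : ℝ)..L, k j t * ζ t) - Real.pi * ζ (s j)) :=
        Finset.sum_congr rfl fun j _ => by rw [hk j ζ hζ hζP]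
      simp only [mul_neg, mul_sub, Finset.sum_neg_distrib, Finset.sum_sub_distrib] at h2
      have h3 : ∑ j, (d j : ℝ) * (Real.pi * ζ (s j)) = Real.pi * ∑ j, (d j : ℝ) * ζ (s j) := by
        rw [Finset.mul_sum]
        exact Finset.sum_congr rfl fun j _ => by ring
      rw [e1, e2]
      linarith)
  have hfr : ∀ t, γ t ∈ frontier Ω := fun t => hγ.range_eq ▸ mem_range_self t
  -- `v` is the Lipschitz representative, and there is no difference at points of continuity
  have hval : ∀ t, γ t ∉ range a → φb (γ t) - ∑ j, (d j : ℝ) * θ j (γ t) = v t := by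
    intro t ht
    refine huv t ?_
    have hopen : ∀ᶠ x in 𝓝 t, γ x ∉ range a :=
      hγc.continuousAt.preimage_mem_nhds ((finite_range a).isClosed.isOpen_compl.mem_nhds ht)
    have h1 : ContinuousAt (fun t => φb (γ t)) t := by
      have := (hφ.continuousOn _ ⟨hfr t, ht⟩).tendsto.comp
        (tendsto_nhdsWithin_iff.2 ⟨hγc.continuousAt, hopen.mono fun x hx => ⟨hfr x, hx⟩⟩)
      exact this
    refine h1.sub (tendsto_finsetSum _ fun j _ => ?_)
    have h2 := hcont j (γ t) (hfr t) fun h => ht (h ▸ mem_range_self j)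
    exact continuousAt_const.mul (h2.comp hγc.continuousAt)
  obtain ⟨c, hc, hca⟩ := hγ.exists_chord_arc
  set M₀ := (Kγ + ∑ j, |(d j : ℝ)| * M j).toNNReal with hM₀
  -- from the parameter to the plane: distances along the curve are controlled by chords
  have hlip : LipschitzOnWith (M₀ * c.toNNReal⁻¹)
      (fun z => φb z - ∑ j, (d j : ℝ) * θ j z) (frontier Ω \ range a) := by
    refine LipschitzOnWith.of_dist_le_mul fun z hz z' hz' => ?_
    obtain ⟨t, -, rfl⟩ := hγ.exists_mem_Ico hz.1 0
    obtain ⟨t', ht', rfl⟩ := hγ.exists_mem_Ico hz'.1 (t - L / 2)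
    rw [hval t hz.2, hval t' hz'.2]
    refine (hv.dist_le_mul t t').trans ?_
    have h1 := hca t t' (abs_le.2 ⟨by linarith [ht'.1], by linarith [ht'.2]⟩)
    push_cast
    rw [mul_assoc, Real.coe_toNNReal _ hc.le, dist_comm, dist_comm (γ t), Real.dist_eq, dist_eq_norm]
    gcongr
    rwa [inv_mul_eq_div, le_div_iff₀ hc, mul_comm]
  obtain ⟨Q, hQ, hQe⟩ := hlip.extend_real
  exact ⟨Q, _, hQ, fun z hz => by rw [← hQe hz]; ring⟩

/-! ### Soft thresholding and compactly supported truncations -/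

/-- Soft thresholding: the values in `[-ε, ε]` are moved to `0`. -/
def shrink (ε t : ℝ) : ℝ := t - max (-ε) (min ε t)

lemma shrink_eq_zero {ε t : ℝ} (h : |t| ≤ ε) : shrink ε t = 0 := by
  rw [abs_le] at h
  rw [shrink, min_eq_right h.2, max_eq_right h.1, sub_self]

lemma shrink_of_lt {ε t : ℝ} (hε : 0 ≤ ε) (h : ε < t) : shrink ε t = t - ε := by
  rw [shrink, min_eq_left h.le, max_eq_right (by linarith)]

lemma shrink_of_lt_neg {ε t : ℝ} (hε : 0 ≤ ε) (h : t < -ε) : shrink ε t = t + ε := by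
  rw [shrink, min_eq_right (by linarith), max_eq_left h.le, sub_neg_eq_add]

lemma abs_shrink_le {ε : ℝ} (hε : 0 ≤ ε) (t : ℝ) : |shrink ε t| ≤ |t| := by
  rcases lt_trichotomy t 0 with h | h | h
  · rcases lt_or_ge t (-ε) with h1 | h1
    · rw [shrink_of_lt_neg hε h1, abs_of_nonpos (by linarith), abs_of_neg h]
      linarith
    · rw [shrink_eq_zero (abs_le.2 ⟨h1, by linarith⟩), abs_zero]
      exact abs_nonneg t
  · rw [h, shrink_eq_zero (by simpa using hε)]
  · rcases lt_or_ge ε t with h1 | h1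
    · rw [shrink_of_lt hε h1, abs_of_nonneg (by linarith), abs_of_pos h]
      linarith
    · rw [shrink_eq_zero (abs_le.2 ⟨by linarith, h1⟩), abs_zero]
      exact abs_nonneg t

lemma abs_shrink_sub_le {ε : ℝ} (hε : 0 ≤ ε) (t : ℝ) : |shrink ε t - t| ≤ ε := by
  rw [shrink, sub_sub_cancel_left, abs_neg, abs_le]
  exact ⟨le_max_left _ _, max_le (by linarith) (min_le_left _ _)⟩

lemma locallyLipschitz_shrink (ε : ℝ) : LocallyLipschitz (shrink ε) :=
  (LipschitzWith.id.sub ((LipschitzWith.id.const_min ε).const_max (-ε))).locallyLipschitz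

/-- The chain rule for the soft thresholding: almost everywhere on `Ω`, the gradient is kept where the
threshold is exceeded and vanishes elsewhere. -/
lemma ae_gradient_shrink {Ω : Set ℂ} (hΩ : IsOpen Ω) {u : ℂ → ℝ} (hu : LocallyLipschitzOn Ω u)
    {ε : ℝ} (hε : 0 ≤ ε) : ∀ᵐ x, x ∈ Ω →
      (ε < |u x| → gradient (fun x => shrink ε (u x)) x = gradient u x) ∧
      (|u x| ≤ ε → gradient (fun x => shrink ε (u x)) x = 0) := by
  have habs : LocallyLipschitzOn Ω fun x => |shrink ε (u x)| :=
    (hu.comp_locallyLipschitz (locallyLipschitz_shrink ε)).comp_locallyLipschitz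
      (lipschitzWith_one_norm (E := ℝ)).locallyLipschitz
  filter_upwards [(hu.comp_locallyLipschitz (locallyLipschitz_shrink ε)).ae_differentiableAt hΩ,
    habs.ae_differentiableAt hΩ] with x h1 h2 hx
  have hc : ContinuousAt u x := (hu.continuousOn x hx).continuousAt (hΩ.mem_nhds hx)
  have hgrad : ∀ {f g : ℂ → ℝ}, fderiv ℝ f x = fderiv ℝ g x → gradient f x = gradient g x :=
    fun h => by rw [gradient, gradient, h]
  refine ⟨fun h => hgrad ?_, fun h => ?_⟩
  · rcases lt_abs.1 h with h | h
    · have : (fun x => shrink ε (u x)) =ᶠ[𝓝 x] fun x => u x - ε := by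
        filter_upwards [hc.eventually_const_lt h] with y hy using shrink_of_lt hε hy
      rw [this.fderiv_eq, fderiv_sub_const]
    · have : (fun x => shrink ε (u x)) =ᶠ[𝓝 x] fun x => u x + ε := by
        filter_upwards [hc.eventually_lt_const (show u x < -ε by linarith)] with y hy
          using shrink_of_lt_neg hε hy
      rw [this.fderiv_eq, fderiv_add_const]
  · -- a nonnegative function has a minimum at its zeros
    have h0 : shrink ε (u x) = 0 := shrink_eq_zero h
    have hmin : IsLocalMin (fun x => |shrink ε (u x)|) x :=
      .of_forall fun y => by simp only [h0, abs_zero, abs_nonneg]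
    have hd := (h2 hx).hasFDerivAt
    rw [hmin.fderiv_eq_zero] at hd
    have hd' : HasFDerivAt (fun x => shrink ε (u x)) (0 : ℂ →L[ℝ] ℝ) x := by
      rw [hasFDerivAt_iff_isLittleO] at hd ⊢
      simp only [h0, abs_zero, sub_zero, zero_apply] at hd ⊢
      exact hd.of_norm_left.congr_left fun _ => rfl
    rw [← norm_eq_zero, norm_gradient, hd'.fderiv, norm_zero]

/-- Functions on `Ω` which vanish near every boundary point have compact support in `Ω`. -/
lemma hasCompactSupport_indicator {Ω : Set ℂ} (hb : Bornology.IsBounded Ω)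
    {u : ℂ → ℝ} (h : ∀ p ∈ frontier Ω, ∀ᶠ x in 𝓝[Ω] p, u x = 0) :
    HasCompactSupport (Ω.indicator u) ∧ tsupport (Ω.indicator u) ⊆ Ω := by
  have hsub : Function.support (Ω.indicator u) ⊆ Ω := fun x hx => by
    by_contra h0
    exact hx (indicator_of_notMem h0 u)
  have hcl : tsupport (Ω.indicator u) ⊆ closure Ω := closure_mono hsub
  refine ⟨hb.isCompact_closure.of_isClosed_subset (isClosed_tsupport _) hcl, fun p hp => ?_⟩
  by_contra hpΩ
  have hpf : p ∈ frontier Ω := by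
    have := hcl hp
    rw [closure_eq_self_union_frontier] at this
    exact this.resolve_left hpΩ
  have h1 : Ω.indicator u =ᶠ[𝓝 p] 0 := by
    filter_upwards [eventually_nhdsWithin_iff.1 (h p hpf)] with x hx
    by_cases hxΩ : x ∈ Ω
    · rw [indicator_of_mem hxΩ, hx hxΩ]
      rfl
    · rw [indicator_of_notMem hxΩ]
      rfl
  exact notMem_tsupport_iff_eventuallyEq.2 h1 hp

lemma indicator_eventuallyEq {Ω : Set ℂ} (hΩ : IsOpen Ω) (u : ℂ → ℝ) {x : ℂ} (hx : x ∈ Ω) :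
    Ω.indicator u =ᶠ[𝓝 x] u := by
  filter_upwards [hΩ.mem_nhds hx] with y hy using indicator_of_mem hy u

lemma _root_.LocallyLipschitzOn.indicator {Ω : Set ℂ} {u : ℂ → ℝ}
    (hu : LocallyLipschitzOn Ω u) : LocallyLipschitzOn Ω (Ω.indicator u) := by
  intro x hx
  obtain ⟨K, t, ht, h⟩ := hu hx
  exact ⟨K, t ∩ Ω, inter_mem ht self_mem_nhdsWithin, fun y hy z hz => by
    rw [indicator_of_mem hy.2, indicator_of_mem hz.2]
    exact h hy.1 hz.1⟩

/-- Divergence free `C¹` fields are orthogonal to gradients of compactly supported functions. -/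
lemma integral_inner_gradient_eq_zero {Ω : Set ℂ} (hΩ : IsOpen Ω) {X : ℂ → ℂ}
    (hX : ContDiffOn ℝ 1 X Ω) (hdiv : ∀ x ∈ Ω, divergence X x = 0) {ξ : ℂ → ℝ}
    (hξ : LocallyLipschitzOn Ω ξ) (hc : HasCompactSupport ξ) (hs : tsupport ξ ⊆ Ω) :
    IntegrableOn (fun x => inner ℝ (X x) (gradient ξ x)) Ω ∧
      ∫ x in Ω, inner ℝ (X x) (gradient ξ x) = 0 := by
  have hre : ContDiffOn ℝ 1 (fun x => (X x).re) Ω := Complex.reCLM.contDiff.comp_contDiffOn hX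
  have him : ContDiffOn ℝ 1 (fun x => (X x).im) Ω := Complex.imCLM.contDiff.comp_contDiffOn hX
  obtain ⟨i1, i1', e1⟩ := integral_mul_fderiv_add hΩ (hre.locallyLipschitzOn_of_isOpen hΩ) hξ hc hs 1
  obtain ⟨i2, i2', e2⟩ := integral_mul_fderiv_add hΩ (him.locallyLipschitzOn_of_isOpen hΩ) hξ hc hs
    Complex.I
  have e : ∀ x, inner ℝ (X x) (gradient ξ x) =
      (X x).re * fderiv ℝ ξ x 1 + (X x).im * fderiv ℝ ξ x Complex.I := fun x => by
    rw [real_inner_comm, inner_gradient]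
    conv_lhs => rw [show X x = (X x).re • (1 : ℂ) + (X x).im • Complex.I by simp, map_add,
      map_smul, map_smul]
    rfl
  simp_rw [e]
  refine ⟨i1.add i2, ?_⟩
  rw [integral_add i1 i2, e1, e2, ← neg_add, ← integral_add i1' i2', neg_eq_zero]
  refine setIntegral_eq_zero_of_forall_eq_zero fun x hx => ?_
  have hXd := (hX.differentiableOn (by simp) x hx).differentiableAt (hΩ.mem_nhds hx)
  have d1 : HasFDerivAt (fun x => (X x).re) (Complex.reCLM.comp (fderiv ℝ X x)) x :=
    Complex.reCLM.hasFDerivAt.comp x hXd.hasFDerivAt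
  have d2 : HasFDerivAt (fun x => (X x).im) (Complex.imCLM.comp (fderiv ℝ X x)) x :=
    Complex.imCLM.hasFDerivAt.comp x hXd.hasFDerivAt
  rw [d1.fderiv, d2.fderiv, ← mul_add]
  have := hdiv x hx
  rw [divergence] at this
  simp only [ContinuousLinearMap.comp_apply, Complex.reCLM_apply, Complex.imCLM_apply, this, mul_zero]

lemma contDiffOn_gradient {Ω : Set ℂ} {φ : ℂ → ℝ} (h : ∀ x ∈ Ω, ContDiffAt ℝ 2 φ x) :
    ContDiffOn ℝ 1 (gradient φ) Ω := fun x hx => by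
  have h1 : ContDiffAt ℝ 1 (fderiv ℝ φ) x := (h x hx).fderiv_right (by norm_num)
  exact ((InnerProductSpace.toDual ℝ ℂ).symm.toContinuousLinearEquiv.contDiff.contDiffAt.comp x
    h1).contDiffWithinAt

lemma divergence_gradient {φ : ℂ → ℝ} {x : ℂ} (h : ContDiffAt ℝ 2 φ x) :
    divergence (gradient φ) x = Laplacian.laplacian φ x := by
  have h1 : DifferentiableAt ℝ (fderiv ℝ φ) x :=
    (h.fderiv_right (m := 1) (by norm_num)).differentiableAt (by simp)
  have h2 : DifferentiableAt ℝ (gradient φ) x :=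
    ((InnerProductSpace.toDual ℝ ℂ).symm.toContinuousLinearEquiv.differentiableAt.comp x h1)
  have key : ∀ v : ℂ, inner ℝ (fderiv ℝ (gradient φ) x v) v = fderiv ℝ (fderiv ℝ φ) x v v := by
    intro v
    have e1 : HasFDerivAt (fun y => inner ℝ (gradient φ y) v)
        ((innerSL ℝ v).comp (fderiv ℝ (gradient φ) x)) x := by
      have := (innerSL ℝ v).hasFDerivAt.comp x h2.hasFDerivAt
      refine this.congr_of_eventuallyEq (.of_forall fun y => ?_)
      rw [Function.comp_apply, innerSL_apply_apply, real_inner_comm]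
    have e2 : HasFDerivAt (fun y => fderiv ℝ φ y v)
        ((ContinuousLinearMap.apply ℝ ℝ v).comp (fderiv ℝ (fderiv ℝ φ) x)) x :=
      (ContinuousLinearMap.apply ℝ ℝ v).hasFDerivAt.comp x h1.hasFDerivAt
    simp only [inner_gradient] at e1
    have := congrArg (fun l => l v) (e1.unique e2)
    simpa [real_inner_comm] using this
  have k1 := key 1
  have k2 := key Complex.I
  rw [Complex.inner] at k1 k2
  rw [InnerProductSpace.laplacian_eq_iteratedFDeriv_complexPlane]
  beta_reduce
  rw [iteratedFDeriv_two_apply, iteratedFDeriv_two_apply]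
  simp at k1 k2
  simp [divergence, k1, ← k2]

lemma contDiffAt_vortexField {a x : ℂ} (h : x ≠ a) {n : WithTop ℕ∞} :
    ContDiffAt ℝ n (vortexField a) x := by
  have h1 : ContDiffAt ℝ n (fun z : ℂ => ‖z - a‖ ^ 2) x :=
    ((contDiff_norm_sq ℝ).comp (contDiff_id.sub contDiff_const)).contDiffAt
  exact (h1.inv (by simpa [sub_eq_zero] using h)).smul (by fun_prop)

/-- The vortex field is divergence free. -/
lemma divergence_vortexField {a x : ℂ} (h : x ≠ a) : divergence (vortexField a) x = 0 := by
  have hn : ‖x - a‖ ^ 2 ≠ 0 := by simpa [sub_eq_zero] using h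
  have h1 : HasFDerivAt (fun z : ℂ => (‖z - a‖ ^ 2)⁻¹) _ x :=
    (hasDerivAt_inv hn).comp_hasFDerivAt x (hasFDerivAt_norm_sub_sq a x)
  have h2 : HasFDerivAt (fun z : ℂ => Complex.I * (z - a))
      (Complex.I • ContinuousLinearMap.id ℝ ℂ) x := by
    have := ((hasFDerivAt_id (𝕜 := ℝ) x).sub_const a).const_smul Complex.I
    exact this
  have h3 := divergence_smul h1.differentiableAt h2.differentiableAt
  change divergence (fun z => (‖z - a‖ ^ 2)⁻¹ • (Complex.I * (z - a))) x = 0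
  rw [h3, inner_gradient, h1.fderiv, divergence, h2.fderiv]
  simp [Complex.inner]
  ring_nf
  simp

/-- The gradient of a radial function is orthogonal to the vortex field, so that the product is
divergence free. -/
lemma divergence_radial_smul {a x : ℂ} (h : x ≠ a) {κ : ℝ → ℝ} (hκ : Differentiable ℝ κ) :
    divergence (fun z => κ (‖z - a‖ ^ 2) • vortexField a z) x = 0 := by
  have h2 : HasFDerivAt (fun z => κ (‖z - a‖ ^ 2)) _ x :=
    (hκ _).hasDerivAt.comp_hasFDerivAt x (hasFDerivAt_norm_sub_sq a x)
  rw [divergence_smul h2.differentiableAt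
    ((contDiffAt_vortexField (n := 1) h).differentiableAt (by simp)), divergence_vortexField h,
    inner_gradient, h2.fderiv]
  have h3 : inner ℝ (x - a) (Complex.I * (x - a)) = 0 := by
    rw [Complex.inner]
    simp
    ring
  have hv : inner ℝ (x - a) (vortexField a x) = 0 := by
    rw [vortexField, real_inner_smul_right, h3, mul_zero]
  simp only [smul_apply, innerSL_apply_apply, hv, smul_zero, mul_zero, add_zero]

/-! ### Energy bounds and traces of the remainder -/

section remainder

variable {Ω : Set ℂ} {w : ℂ → ℝ}

/-- The pointwise inequality behind the energy estimate. -/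
lemma half_norm_sq_le (p q B : ℂ) {t : ℝ} (h0 : 0 ≤ t) (h1 : t ≤ 1) :
    ‖p‖ ^ 2 / 2 ≤ (‖p‖ ^ 2 + t * inner ℝ B p + 2 * inner ℝ q p + 2 * t * inner ℝ q B) +
      (2 * ‖B‖ ^ 2 + 5 * ‖q‖ ^ 2) := by
  have i1 := (abs_le.1 (abs_real_inner_le_norm B p)).1
  have i2 := (abs_le.1 (abs_real_inner_le_norm q p)).1
  have i3 := (abs_le.1 (abs_real_inner_le_norm q B)).1
  have j1 : -(‖B‖ * ‖p‖) ≤ t * inner ℝ B p := by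
    nlinarith [mul_nonneg (norm_nonneg B) (norm_nonneg p)]
  have j3 : -(‖q‖ * ‖B‖) ≤ t * inner ℝ q B := by
    nlinarith [mul_nonneg (norm_nonneg q) (norm_nonneg B)]
  nlinarith [sq_nonneg (‖p‖ / 2 - ‖B‖), sq_nonneg (‖p‖ / 2 - 2 * ‖q‖), sq_nonneg (‖q‖ - ‖B‖)]

/-- Truncation and cutoff of a function with zero boundary values off a finite set. -/
lemma hasCompactSupport_cutoff_shrink (hb : Bornology.IsBounded Ω) {s : Set ℂ}
    (hw0 : ∀ p ∈ frontier Ω \ s, Tendsto w (𝓝[Ω] p) (𝓝 0)) {η : ℂ → ℝ}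
    (hηs : ∀ p ∈ s, p ∉ tsupport η) {ε : ℝ} (hε : 0 < ε) :
    HasCompactSupport (Ω.indicator fun x => η x * shrink ε (w x)) ∧
      tsupport (Ω.indicator fun x => η x * shrink ε (w x)) ⊆ Ω := by
  refine hasCompactSupport_indicator hb fun p hp => ?_
  by_cases hps : p ∈ s
  · have := notMem_tsupport_iff_eventuallyEq.1 (hηs p hps)
    filter_upwards [mem_nhdsWithin_of_mem_nhds this] with x hx
    have hx' : η x = 0 := hx
    rw [hx', zero_mul]
  · have := (hw0 p ⟨hp, hps⟩).abs.eventually_lt_const (show |(0 : ℝ)| < ε by simpa using hε)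
    filter_upwards [this] with x hx
    rw [shrink_eq_zero hx.le, mul_zero]

/-- As the threshold tends to zero, almost every point keeps its gradient eventually; at the zeros of
`w` both gradients vanish. -/
lemma ae_eventually_gradient_shrink (hΩ : IsOpen Ω) (hw : LocallyLipschitzOn Ω w) {ε : ℕ → ℝ}
    (hε : ∀ n, 0 < ε n) (hlim : Tendsto ε atTop (𝓝 0)) : ∀ᵐ x ∂volume.restrict Ω,
      ∀ᶠ n in atTop, gradient (fun x => shrink (ε n) (w x)) x = gradient w x := by
  rw [ae_restrict_iff' hΩ.measurableSet]
  have h1 : ∀ᵐ x, ∀ n : ℕ, x ∈ Ω → _ := ae_all_iff.2 fun n : ℕ =>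
    ae_gradient_shrink hΩ hw (hε n).le
  filter_upwards [h1, ae_gradient_shrink hΩ hw le_rfl] with x hx hx0 hxΩ
  by_cases hw0 : w x = 0
  · have e0 : gradient w x = 0 := by
      have := (hx0 hxΩ).2 (by simp [hw0])
      rwa [show (fun x => shrink 0 (w x)) = w by ext x; simp [shrink]] at this
    exact Eventually.of_forall fun n => by
      rw [(hx n hxΩ).2 (by simpa [hw0] using (hε n).le), e0]
  · filter_upwards [hlim.eventually_lt_const (abs_pos.2 hw0)] with n hn using (hx n hxΩ).1 hn

/-- The energy estimate: testing the orthogonality of `Z = ∇w + B` with `η² y`, where `y` is the soft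
thresholding of `w`, and absorbing the mixed terms bounds `η ∇y` in `L²`, uniformly in the threshold
and in the cutoff `η`. -/
lemma cutoff_energy_le (hΩ : IsOpen Ω) (hb : Bornology.IsBounded Ω) {s : Set ℂ}
    (hw : LocallyLipschitzOn Ω w) {M : ℝ} (hM : ∀ x ∈ Ω, |w x| ≤ M)
    (hw0 : ∀ p ∈ frontier Ω \ s, Tendsto w (𝓝[Ω] p) (𝓝 0)) {Z B : ℂ → ℂ} {C : ℝ}
    (hBC : ∀ x, ‖B x‖ ≤ C) (hZ : ∀ᵐ x, x ∈ Ω → Z x = gradient w x + B x)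
    (horth : ∀ ξ : ℂ → ℝ, LocallyLipschitzOn Ω ξ → HasCompactSupport ξ → tsupport ξ ⊆ Ω →
      IntegrableOn (fun x => inner ℝ (Z x) (gradient ξ x)) Ω ∧
      ∫ x in Ω, inner ℝ (Z x) (gradient ξ x) = 0) {η : ℂ → ℝ} (hη : ContDiff ℝ ∞ η)
    (hη1 : ∀ x, 0 ≤ η x ∧ η x ≤ 1) (hηs : ∀ p ∈ s, p ∉ tsupport η)
    (hηE : eLpNorm (gradient η) 2 volume ≤ 1) {ε : ℝ} (hε : 0 < ε) :
    eLpNorm (fun x => η x • gradient (fun x => shrink ε (w x)) x) 2 (volume.restrict Ω) ^ 2 ≤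
      ENNReal.ofReal (2 * (2 * C ^ 2 * volume.real Ω + 5 * M ^ 2)) := by
  have hfin : IsFiniteMeasure (volume.restrict Ω) := ⟨by simpa using hb.measure_lt_top⟩
  set y : ℂ → ℝ := fun x => shrink ε (w x) with hy
  have hyL : LocallyLipschitzOn Ω y := hw.comp_locallyLipschitz (locallyLipschitz_shrink ε)
  have hηL : LocallyLipschitzOn Ω η :=
    (hη.of_le (by simp)).contDiffOn.locallyLipschitzOn_of_isOpen hΩ
  have hη2 : ∀ p ∈ s, p ∉ tsupport fun x => η x * η x := fun p hp h =>
    hηs p hp (tsupport_mul_subset_left h)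
  obtain ⟨hξc, hξs⟩ := hasCompactSupport_cutoff_shrink hb hw0 hη2 hε
  set ξ : ℂ → ℝ := Ω.indicator fun x => η x * η x * y x with hξ
  obtain ⟨hint, hzero⟩ := horth ξ (((hηL.real_mul hηL).real_mul hyL).indicator) hξc hξs
  obtain ⟨CK, hCK⟩ := hw.exists_bound hΩ hξc hξs
  set p : ℂ → ℂ := fun x => η x • gradient y x with hp
  -- the pointwise identity for the tested field
  have hae : ∀ᵐ x ∂volume.restrict Ω, ‖p x‖ ≤ |CK| ∧ ‖p x‖ ^ 2 / 2 ≤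
      inner ℝ (Z x) (gradient ξ x) + (2 * C ^ 2 + 5 * M ^ 2 * ‖gradient η x‖ ^ 2) := by
    rw [ae_restrict_iff' hΩ.measurableSet]
    filter_upwards [hZ, ae_gradient_shrink hΩ hw hε.le, hyL.ae_differentiableAt hΩ] with x hx1 hx2
      hx3 hx
    have hyd := hx3 hx
    have hηd : DifferentiableAt ℝ η x := hη.differentiable (by simp) x
    have hηη : DifferentiableAt ℝ (fun x => η x * η x) x := hηd.mul hηd
    have hgξ : gradient ξ x = (η x * η x) • gradient y x + (2 * η x * y x) • gradient η x := by
      rw [hξ, (indicator_eventuallyEq hΩ _ hx).gradient_eq,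
        gradient_fun_mul hηη hyd, gradient_fun_mul hηd hηd]
      module
    have hq : ‖y x • gradient η x‖ ^ 2 ≤ M ^ 2 * ‖gradient η x‖ ^ 2 := by
      rw [norm_smul, mul_pow, Real.norm_eq_abs]
      gcongr
      exact (abs_shrink_le hε.le _).trans (hM x hx)
    have hB2 : ‖B x‖ ^ 2 ≤ C ^ 2 := by
      gcongr
      exact hBC x
    have key := half_norm_sq_le (p x) (y x • gradient η x) (B x) (hη1 x).1 (hη1 x).2
    have hid : inner ℝ (Z x) (gradient ξ x) = ‖p x‖ ^ 2 + η x * inner ℝ (B x) (p x) +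
        2 * inner ℝ (y x • gradient η x) (p x) + 2 * η x * inner ℝ (y x • gradient η x) (B x) := by
      rw [hgξ, hx1 hx]
      rcases le_or_gt |w x| ε with h | h
      · have h0 : y x = 0 := shrink_eq_zero h
        have hgy : gradient y x = 0 := (hx2 hx).2 h
        simp only [hp, hgy, h0]
        simp
      · rw [← (hx2 hx).1 h]
        simp only [hp, inner_add_left, inner_add_right, real_inner_smul_right, real_inner_smul_left,
          norm_smul, mul_pow, ← real_inner_self_eq_norm_sq, Real.norm_eq_abs, sq_abs]
        rw [real_inner_comm (gradient η x) (gradient y x), real_inner_comm (gradient η x) (B x)]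
        ring
    refine ⟨?_, by rw [hid]; linarith⟩
    -- off the support of `ξ` the field `p` vanishes, on it the gradient of `w` is bounded
    by_cases hξx : ξ x = 0
    · rw [hξ, indicator_of_mem hx] at hξx
      have : p x = 0 := by
        rcases mul_eq_zero.1 hξx with h0 | h0
        · simp only [hp, mul_self_eq_zero.1 h0, zero_smul]
        · have : |w x| ≤ ε := by
            by_contra! hlt
            rcases lt_abs.1 hlt with h | h
            · rw [hy] at h0
              simp only [shrink_of_lt hε.le h] at h0
              linarith
            · rw [hy] at h0
              simp only [shrink_of_lt_neg hε.le (show w x < -ε by linarith)] at h0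
              linarith
          simp only [hp, hy, (hx2 hx).2 this, smul_zero]
      rw [this, norm_zero]
      exact abs_nonneg _
    · have hxK := hCK x (subset_tsupport _ hξx)
      simp only [hp, norm_smul, Real.norm_eq_abs, abs_of_nonneg (hη1 x).1]
      refine (mul_le_of_le_one_left (norm_nonneg _) (hη1 x).2).trans (le_trans ?_ (le_abs_self CK))
      rcases le_or_gt |w x| ε with h | h
      · simp only [hy, (hx2 hx).2 h, norm_zero]
        exact (norm_nonneg _).trans hxK.2
      · simp only [hy, (hx2 hx).1 h, norm_gradient]
        exact hxK.2
  have hpm : AEStronglyMeasurable p (volume.restrict Ω) :=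
    (hη.continuous.measurable.smul (measurable_gradient y)).aestronglyMeasurable
  have hpL : MemLp p 2 (volume.restrict Ω) :=
    MemLp.of_bound hpm |CK| (hae.mono fun x hx => hx.1)
  have hηL2 : MemLp (gradient η) 2 (volume.restrict Ω) :=
    ⟨(measurable_gradient η).aestronglyMeasurable,
      ((eLpNorm_mono_measure _ Measure.restrict_le_self).trans hηE).trans_lt ENNReal.one_lt_top⟩
  have hη2i := integrable_norm_sq_of_memLp hηL2
  have hηint : ∫ x in Ω, ‖gradient η x‖ ^ 2 ≤ 1 := by
    rw [← norm_toLp_sq hηL2, Lp.norm_toLp]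
    refine pow_le_one₀ ENNReal.toReal_nonneg ?_
    have := (eLpNorm_mono_measure (gradient η) (Measure.restrict_le_self (s := Ω))).trans hηE
    simpa using ENNReal.toReal_mono ENNReal.one_ne_top this
  have hI : ∫ x in Ω, ‖p x‖ ^ 2 / 2 ≤ 2 * C ^ 2 * volume.real Ω + 5 * M ^ 2 := by
    have i2 : Integrable (fun x => 2 * C ^ 2 + 5 * M ^ 2 * ‖gradient η x‖ ^ 2)
      (volume.restrict Ω) := (integrable_const _).add (hη2i.const_mul _)
    have i12 : Integrable (fun x => inner ℝ (Z x) (gradient ξ x) +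
      (2 * C ^ 2 + 5 * M ^ 2 * ‖gradient η x‖ ^ 2)) (volume.restrict Ω) := hint.add i2
    calc ∫ x in Ω, ‖p x‖ ^ 2 / 2 ≤ ∫ x in Ω, (inner ℝ (Z x) (gradient ξ x) +
          (2 * C ^ 2 + 5 * M ^ 2 * ‖gradient η x‖ ^ 2)) :=
          integral_mono_ae ((integrable_norm_sq_of_memLp hpL).div_const 2) i12
            (hae.mono fun x hx => hx.2)
      _ = 2 * C ^ 2 * volume.real Ω + 5 * M ^ 2 * ∫ x in Ω, ‖gradient η x‖ ^ 2 := by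
          rw [integral_add hint i2, hzero, zero_add,
            integral_add (integrable_const _) (hη2i.const_mul _), integral_const_mul (5 * M ^ 2)]
          rw [integral_const, measureReal_restrict_apply_univ, smul_eq_mul]
          ring
      _ ≤ _ := by nlinarith [sq_nonneg M]
  have hpe : eLpNorm p 2 (volume.restrict Ω) = ENNReal.ofReal ‖hpL.toLp p‖ := by
    rw [Lp.norm_toLp, ENNReal.ofReal_toReal hpL.2.ne]
  rw [hpe, ← ENNReal.ofReal_pow (norm_nonneg _), norm_toLp_sq]
  refine ENNReal.ofReal_le_ofReal ?_
  rw [integral_div] at hI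
  linarith

/-- The remainder has finite energy: Fatou's lemma applied to the uniform bound of `cutoff_energy_le`
while the thresholds and the energies of the cutoffs tend to zero. -/
lemma memLp_gradient_of_orthogonal (hΩ : IsOpen Ω) (hb : Bornology.IsBounded Ω) {s : Finset ℂ}
    (hs : ∀ p ∈ s, p ∉ Ω)
    (hw : LocallyLipschitzOn Ω w) {M : ℝ} (hM : ∀ x ∈ Ω, |w x| ≤ M)
    (hw0 : ∀ p ∈ frontier Ω \ s, Tendsto w (𝓝[Ω] p) (𝓝 0)) {Z B : ℂ → ℂ} {C : ℝ}
    (hBC : ∀ x, ‖B x‖ ≤ C) (hZ : ∀ᵐ x, x ∈ Ω → Z x = gradient w x + B x)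
    (horth : ∀ ξ : ℂ → ℝ, LocallyLipschitzOn Ω ξ → HasCompactSupport ξ → tsupport ξ ⊆ Ω →
      IntegrableOn (fun x => inner ℝ (Z x) (gradient ξ x)) Ω ∧
      ∫ x in Ω, inner ℝ (Z x) (gradient ξ x) = 0) :
    MemLp (gradient w) 2 (volume.restrict Ω) := by
  have hε : ∀ n : ℕ, 0 < 1 / ((n : ℝ) + 1) := fun n => by positivity
  have hε1 : ∀ n : ℕ, 1 / ((n : ℝ) + 1) ≤ 1 := fun n => by
    rw [div_le_one (by positivity)]
    linarith [n.cast_nonneg (α := ℝ)]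
  have hlim : Tendsto (fun n : ℕ => 1 / ((n : ℝ) + 1)) atTop (𝓝 0) :=
    tendsto_one_div_add_atTop_nhds_zero_nat
  choose η hη hη1 hηs hη2 hηE using fun n => exists_cutoff s (hε n)
  set p : ℕ → ℂ → ℂ := fun n x => η n x • gradient (fun x => shrink (1 / ((n : ℝ) + 1)) (w x)) x
  have hbd : ∀ n, eLpNorm (p n) 2 (volume.restrict Ω) ^ 2 ≤
      ENNReal.ofReal (2 * (2 * C ^ 2 * volume.real Ω + 5 * M ^ 2)) := fun n =>
    cutoff_energy_le hΩ hb hw hM hw0 hBC hZ horth (hη n) (hη1 n) (hηs n)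
      ((hηE n).trans (by simpa using ENNReal.ofReal_le_ofReal (hε1 n))) (hε n)
  have hpm : ∀ n, AEStronglyMeasurable (p n) (volume.restrict Ω) := fun n =>
    ((hη n).continuous.measurable.smul (measurable_gradient _)).aestronglyMeasurable
  have hconv : ∀ᵐ x ∂volume.restrict Ω, Tendsto (fun n => p n x) atTop (𝓝 (gradient w x)) := by
    filter_upwards [ae_eventually_gradient_shrink hΩ hw hε hlim,
      ae_restrict_mem hΩ.measurableSet] with x hx hxΩ
    have : ∀ᶠ n : ℕ in atTop, ∀ a ∈ s, 1 / ((n : ℝ) + 1) < ‖x - a‖ := by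
      rw [Filter.eventually_all_finset]
      intro a ha
      exact hlim.eventually_lt_const
        (norm_pos_iff.2 (sub_ne_zero.2 fun h => hs a ha (h ▸ hxΩ)))
    refine tendsto_const_nhds.congr' ?_
    filter_upwards [hx, this] with n hn hn'
    simp only [p, hη2 n x fun a ha => (hn' a ha).le, hn, one_smul]
  refine ⟨(measurable_gradient w).aestronglyMeasurable, ?_⟩
  refine (Lp.eLpNorm_lim_le_liminf_eLpNorm hpm _ hconv).trans_lt ?_
  set A := ENNReal.ofReal (2 * (2 * C ^ 2 * volume.real Ω + 5 * M ^ 2))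
  have hbd' : ∀ n, eLpNorm (p n) 2 (volume.restrict Ω) ≤ 1 + A := fun n => by
    rcases le_total (eLpNorm (p n) 2 (volume.restrict Ω)) 1 with h | h
    · exact h.trans le_self_add
    · calc eLpNorm (p n) 2 (volume.restrict Ω) ≤ eLpNorm (p n) 2 (volume.restrict Ω) ^ 2 := by
            rw [sq]
            exact le_mul_of_one_le_left' h
        _ ≤ A := hbd n
        _ ≤ 1 + A := le_add_self
  have hA : 1 + A < ⊤ := ENNReal.add_lt_top.2 ⟨ENNReal.one_lt_top, ENNReal.ofReal_lt_top⟩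
  refine lt_of_le_of_lt (liminf_le_of_le (by isBoundedDefault) fun b hb => ?_)
    hA
  obtain ⟨n, hn⟩ := hb.exists
  exact hn.trans (hbd' n)

/-- A locally Lipschitz function of finite energy which tends to zero at the boundary off the `a j`
has zero trace there. -/
lemma zeroTrace_of_tendsto {N : ℕ} {a : Fin N → ℂ} (hΩ : IsOpen Ω) (hb : Bornology.IsBounded Ω)
    (hw : LocallyLipschitzOn Ω w) {M : ℝ} (hM : ∀ x ∈ Ω, |w x| ≤ M)
    (hw0 : ∀ p ∈ frontier Ω \ range a, Tendsto w (𝓝[Ω] p) (𝓝 0))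
    (hE : MemLp (gradient w) 2 (volume.restrict Ω)) : ZeroTrace Ω a w (gradient w) := by
  have hfin : IsFiniteMeasure (volume.restrict Ω) := ⟨by simpa using hb.measure_lt_top⟩
  intro ζ hζ hc ha v
  have hε : ∀ n : ℕ, 0 < 1 / ((n : ℝ) + 1) := fun n => by positivity
  have hlim : Tendsto (fun n : ℕ => 1 / ((n : ℝ) + 1)) atTop (𝓝 0) :=
    tendsto_one_div_add_atTop_nhds_zero_nat
  set y : ℕ → ℂ → ℝ := fun n x => shrink (1 / ((n : ℝ) + 1)) (w x) with hy
  have hyL : ∀ n, LocallyLipschitzOn Ω (y n) := fun n =>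
    hw.comp_locallyLipschitz (locallyLipschitz_shrink _)
  have hζL : LocallyLipschitzOn Ω ζ :=
    (hζ.of_le (by simp)).contDiffOn.locallyLipschitzOn_of_isOpen hΩ
  have hζd : Continuous fun x => fderiv ℝ ζ x v :=
    (hζ.continuous_fderiv (by simp)).clm_apply continuous_const
  obtain ⟨Cζ, hCζ⟩ := hζ.continuous.bounded_above_of_compact_support hc
  obtain ⟨Cd, hCd⟩ := hζd.bounded_above_of_compact_support (hc.fderiv_apply ℝ v)
  -- the truncations have compact support in `Ω` after multiplication by `ζ`
  have hzero : ∀ n,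
      ∫ x in Ω, (y n x * fderiv ℝ ζ x v + inner ℝ (gradient (y n) x) v * ζ x) = 0 := by
    intro n
    obtain ⟨hξc, hξs⟩ := hasCompactSupport_cutoff_shrink hb hw0 (η := ζ)
      (by rintro _ ⟨j, rfl⟩; exact ha j) (hε n)
    have h1 := (integral_mul_fderiv_add hΩ (f := fun _ => 1) (fun x _ => ⟨0, univ, univ_mem, by
      intro x _ y _; simp⟩) ((hζL.real_mul (hyL n)).indicator) hξc hξs v).2.2
    simp only [one_mul, fderiv_fun_const, Pi.zero_apply, zero_apply, mul_zero, integral_zero,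
      neg_zero] at h1
    rw [← h1]
    refine setIntegral_congr_ae hΩ.measurableSet ?_
    filter_upwards [(hyL n).ae_differentiableAt hΩ] with x hx hxΩ
    rw [(indicator_eventuallyEq hΩ _ hxΩ).fderiv_eq,
      fderiv_fun_mul (hζ.differentiable (by simp) x) (hx hxΩ), inner_gradient]
    simp only [add_apply, smul_apply, smul_eq_mul, hy]
    ring
  have hlim' : Tendsto (fun n => ∫ x in Ω, (y n x * fderiv ℝ ζ x v +
      inner ℝ (gradient (y n) x) v * ζ x)) atTop
      (𝓝 (∫ x in Ω, (w x * fderiv ℝ ζ x v + inner ℝ (gradient w x) v * ζ x))) := by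
    refine tendsto_integral_of_dominated_convergence
      (fun x => M * Cd + ‖gradient w x‖ * (‖v‖ * Cζ)) (fun n => ?_) ?_ (fun n => ?_) ?_
    · have hym : AEStronglyMeasurable (y n) (volume.restrict Ω) :=
        ((hyL n).continuousOn.aestronglyMeasurable hΩ.measurableSet)
      exact (hym.mul hζd.aestronglyMeasurable).add
        (((measurable_gradient _).inner measurable_const).mul
          hζ.continuous.measurable).aestronglyMeasurable
    · exact (integrable_const _).add ((hE.integrable (by norm_num)).norm.mul_const _)
    · rw [ae_restrict_iff' hΩ.measurableSet]
      filter_upwards [ae_gradient_shrink hΩ hw (hε n).le] with x hx hxΩ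
      refine (norm_add_le _ _).trans (add_le_add ?_ ?_)
      · rw [norm_mul]
        exact mul_le_mul ((abs_shrink_le (hε n).le _).trans (hM x hxΩ)) (hCd x) (norm_nonneg _)
          ((abs_nonneg _).trans (hM x hxΩ))
      · have : ‖gradient (y n) x‖ ≤ ‖gradient w x‖ := by
          rcases le_or_gt |w x| (1 / ((n : ℝ) + 1)) with h | h
          · have h0 : gradient (y n) x = 0 := (hx hxΩ).2 h
            simp [h0]
          · exact (congrArg norm ((hx hxΩ).1 h)).le
        rw [norm_mul, ← mul_assoc]
        exact mul_le_mul ((norm_inner_le_norm _ _).trans (by gcongr)) (hCζ x) (norm_nonneg _)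
          (by positivity)
    · filter_upwards [ae_eventually_gradient_shrink hΩ hw hε hlim] with x hx
      refine Tendsto.add (Tendsto.mul_const _ ?_) (Tendsto.mul_const _ ?_)
      · rw [tendsto_iff_norm_sub_tendsto_zero]
        exact squeeze_zero (fun _ => norm_nonneg _) (fun n => abs_shrink_sub_le (hε n).le _) hlim
      · exact Tendsto.inner (tendsto_const_nhds.congr' (hx.mono fun n hn => hn.symm))
          tendsto_const_nhds
  simp_rw [hzero] at hlim'
  exact (tendsto_nhds_unique hlim' tendsto_const_nhds)

end remainder

/-! ### Splitting off the singular part -/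

lemma gradient_fun_const_mul {f : ℂ → ℝ} {x : ℂ} (h : DifferentiableAt ℝ f x) (c : ℝ) :
    gradient (fun x => c * f x) x = c • gradient f x := by
  rw [gradient_fun_mul (differentiableAt_const c) h]
  have : gradient (fun _ : ℂ => c) x = 0 := gradient_const x c
  rw [this, smul_zero, add_zero]

lemma gradient_fun_sum {ι : Type*} (s : Finset ι) {f : ι → ℂ → ℝ} {x : ℂ}
    (h : ∀ i, DifferentiableAt ℝ (f i) x) :
    DifferentiableAt ℝ (fun x => ∑ i ∈ s, f i x) x ∧
      gradient (fun x => ∑ i ∈ s, f i x) x = ∑ i ∈ s, gradient (f i) x := by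
  classical
  have hd : ∀ s : Finset ι, DifferentiableAt ℝ (fun x => ∑ i ∈ s, f i x) x := fun s =>
    DifferentiableAt.fun_sum fun i _ => h i
  refine ⟨hd s, ?_⟩
  induction s using Finset.induction_on with
  | empty => simp
  | insert i s hi ih =>
    simp only [Finset.sum_insert hi]
    rw [gradient_fun_add (h i) (hd s), ih]

lemma _root_.LocallyLipschitzOn.real_add {Ω : Set ℂ} {f g : ℂ → ℝ}
    (hf : LocallyLipschitzOn Ω f) (hg : LocallyLipschitzOn Ω g) :
    LocallyLipschitzOn Ω (fun x => f x + g x) := by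
  have h0 : LocallyLipschitzOn Ω fun _ : ℂ => (0 : ℝ) :=
    (LocallyLipschitz.const (0 : ℝ)).locallyLipschitzOn
  simpa using hf.real_sub (h0.real_sub hg)

lemma _root_.LocallyLipschitzOn.real_sum {ι : Type*} (s : Finset ι) {Ω : Set ℂ} {f : ι → ℂ → ℝ}
    (hf : ∀ i, LocallyLipschitzOn Ω (f i)) : LocallyLipschitzOn Ω (fun x => ∑ i ∈ s, f i x) := by
  classical
  induction s using Finset.induction_on with
  | empty => simpa using (LocallyLipschitz.const (0 : ℝ)).locallyLipschitzOn
  | insert i s hi ih => simpa [Finset.sum_insert hi] using (hf i).real_add ih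

/-- The model `Q + ∑ d_j χ_j θ_j` of a function with the jumps `-π d_j` at the boundary points
`a_j`, where `θ_j` is the angle around `a_j` measured from the direction `e_j`, and `χ_j` cuts off
at distance `r`. -/
def phaseModel {N : ℕ} (a e : Fin N → ℂ) (d : Fin N → ℝ) (r : ℝ) (Q : ℂ → ℝ) (z : ℂ) : ℝ :=
  Q z + ∑ j, d j * vortexPhase (a j) (e j) r z

/-- The singular part `∑ d_j χ_j ∇θ_j` of the gradient of `phaseModel`. -/
def singularField {N : ℕ} (a : Fin N → ℂ) (d : Fin N → ℝ) (r : ℝ) (z : ℂ) : ℂ :=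
  ∑ j, d j • (vortexCutoff (a j) r z • vortexField (a j) z)

/-- The bounded part of the gradient of `phaseModel`. -/
def regularField {N : ℕ} (a e : Fin N → ℂ) (d : Fin N → ℝ) (r : ℝ) (Q : ℂ → ℝ) (z : ℂ) : ℂ :=
  gradient Q z + ∑ j, d j • (vortexAngle (a j) (e j) z • gradient (vortexCutoff (a j) r) z)

/-- `φ` is a bounded harmonic function on `Ω` with the boundary values of the model
`Q + ∑ d_j χ_j θ_j` off the points `a_j`, the supports of the cutoffs being disjoint and so small
that the angle `θ_j` around `a_j` is smooth on the part of `Ω` where it enters. -/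
structure IsSplitting {N : ℕ} (Ω : Set ℂ) (a e : Fin N → ℂ) (d : Fin N → ℝ) (r : ℝ)
    (Q φ : ℂ → ℝ) : Prop where
  isOpen : IsOpen Ω
  bounded : Bornology.IsBounded Ω
  cone : HasInwardCone Ω
  r_pos : 0 < r
  pole : ∀ j, ∃ K R, 0 ≤ K ∧ 2 * r < R ∧ IsPole Ω (a j) (e j) K R
  sep : ∀ i j, i ≠ j → 4 * r ≤ ‖a i - a j‖
  notMem : ∀ j, a j ∉ Ω
  abs_d : ∀ j, |d j| = 1
  lipschitz : ∃ C, LipschitzWith C Q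
  smooth : ∀ x ∈ Ω, ContDiffAt ℝ 2 φ x
  harmonic : ∀ x ∈ Ω, divergence (gradient φ) x = 0
  bound : ∃ C : ℝ, ∀ x ∈ Ω, |φ x| ≤ C
  boundary : ∀ x ∈ frontier Ω \ range a,
    Tendsto (fun x => φ x - phaseModel a e d r Q x) (𝓝[Ω] x) (𝓝 0)

namespace IsSplitting

variable {N : ℕ} {Ω : Set ℂ} {a e : Fin N → ℂ} {d : Fin N → ℝ} {r : ℝ} {Q φ : ℂ → ℝ}

lemma ne (h : IsSplitting Ω a e d r Q φ) {x : ℂ} (hx : x ∈ Ω) (j : Fin N) : x ≠ a j :=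
  fun hxa => h.notMem j (hxa ▸ hx)

lemma locallyLipschitzOn_phaseModel (h : IsSplitting Ω a e d r Q φ) :
    LocallyLipschitzOn Ω (phaseModel a e d r Q) := by
  obtain ⟨C, hC⟩ := h.lipschitz
  refine hC.locallyLipschitz.locallyLipschitzOn.real_add
    (LocallyLipschitzOn.real_sum _ fun j => ?_)
  obtain ⟨K, R, hK, hR, hp⟩ := h.pole j
  exact (LocallyLipschitz.const (d j)).locallyLipschitzOn.real_mul
    (hp.locallyLipschitzOn_vortexPhase h.isOpen (h.notMem j) h.r_pos hR)

lemma locallyLipschitzOn (h : IsSplitting Ω a e d r Q φ) : LocallyLipschitzOn Ω φ :=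
  ContDiffOn.locallyLipschitzOn_of_isOpen h.isOpen fun x hx =>
    ((h.smooth x hx).of_le one_le_two).contDiffWithinAt

lemma ae_gradient_phaseModel (h : IsSplitting Ω a e d r Q φ) : ∀ᵐ x, x ∈ Ω →
    gradient (phaseModel a e d r Q) x = singularField a d r x + regularField a e d r Q x := by
  obtain ⟨C, hC⟩ := h.lipschitz
  filter_upwards [hC.ae_differentiableAt] with x hx hxΩ
  have hd : ∀ j, DifferentiableAt ℝ (vortexPhase (a j) (e j) r) x := fun j => by
    obtain ⟨K, R, hK, hR, hp⟩ := h.pole j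
    exact hp.differentiableAt_vortexPhase h.r_pos hR (subset_closure hxΩ) (h.ne hxΩ j)
  have hs := gradient_fun_sum Finset.univ (f := fun j x => d j * vortexPhase (a j) (e j) r x)
    (x := x) fun j => (hd j).const_mul (d j)
  have e1 : gradient (phaseModel a e d r Q) x = gradient Q x +
      gradient (fun x => ∑ j, d j * vortexPhase (a j) (e j) r x) x := gradient_fun_add hx hs.1
  rw [e1, hs.2, singularField, regularField, add_left_comm, ← Finset.sum_add_distrib]
  congr 1
  refine Finset.sum_congr rfl fun j _ => ?_
  obtain ⟨K, R, hK, hR, hp⟩ := h.pole j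
  rw [gradient_fun_const_mul (hd j), hp.gradient_vortexPhase h.r_pos hR (subset_closure hxΩ)
    (h.ne hxΩ j), smul_add]

lemma exists_regularField_bound (h : IsSplitting Ω a e d r Q φ) :
    ∃ C, ∀ x, ‖regularField a e d r Q x‖ ≤ C := by
  obtain ⟨C, hC⟩ := h.lipschitz
  have hb : ∀ j, ∃ D, ∀ x, ‖gradient (vortexCutoff (a j) r) x‖ ≤ D := fun j => by
    have hcs := hasCompactSupport_vortexCutoff (a := a j) h.r_pos
    obtain ⟨D, hD⟩ := ((contDiff_vortexCutoff (a := a j) (r := r)).continuous_fderiv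
      (by simp)).bounded_above_of_compact_support (hcs.fderiv ℝ)
    exact ⟨D, fun x => norm_gradient _ x ▸ hD x⟩
  choose D hD using hb
  refine ⟨C + ∑ j, Real.pi * D j, fun x => (norm_add_le _ _).trans (add_le_add ?_ ?_)⟩
  · rw [norm_gradient]
    exact norm_fderiv_le_of_lipschitz ℝ hC
  · refine (norm_sum_le _ _).trans (Finset.sum_le_sum fun j _ => ?_)
    rw [norm_smul, norm_smul, Real.norm_eq_abs, h.abs_d, one_mul, Real.norm_eq_abs]
    exact mul_le_mul (abs_vortexAngle_le _ _ _) (hD j x) (norm_nonneg _) Real.pi_pos.le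

lemma measurable_regularField : Measurable (regularField a e d r Q) :=
  (measurable_gradient Q).add (Finset.measurable_sum _ fun j _ =>
    ((measurable_vortexAngle (a j) (e j)).smul (measurable_gradient _)).const_smul (d j))

lemma contDiffAt_singularField (h : IsSplitting Ω a e d r Q φ) {x : ℂ} (hx : x ∈ Ω) :
    ContDiffAt ℝ 1 (singularField a d r) x := by
  refine ContDiffAt.sum fun j _ => ContDiffAt.const_smul _ ?_
  have h1 : ContDiffAt ℝ 1 (vortexCutoff (a j) r) x :=
    ((contDiff_vortexCutoff (a := a j) (r := r)).of_le (by simp)).contDiffAt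
  exact h1.smul (contDiffAt_vortexField (h.ne hx j))

lemma divergence_singularField (h : IsSplitting Ω a e d r Q φ) {x : ℂ} (hx : x ∈ Ω) :
    divergence (singularField a d r) x = 0 := by
  have hd : ∀ j, DifferentiableAt ℝ (fun z => vortexCutoff (a j) r z • vortexField (a j) z) x :=
    fun j => by
      have h1 : ContDiffAt ℝ 1 (vortexCutoff (a j) r) x :=
        ((contDiff_vortexCutoff (a := a j) (r := r)).of_le (by simp)).contDiffAt
      exact (h1.smul (contDiffAt_vortexField (h.ne hx j))).differentiableAt (by simp)
  have hf : fderiv ℝ (singularField a d r) x =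
      ∑ j, d j • fderiv ℝ (fun z => vortexCutoff (a j) r z • vortexField (a j) z) x := by
    have := HasFDerivAt.fun_sum (u := Finset.univ) fun j _ => (hd j).hasFDerivAt.const_smul (d j)
    exact this.fderiv
  rw [divergence, hf]
  have h0 : ∀ j, divergence (fun z => vortexCutoff (a j) r z • vortexField (a j) z) x = 0 :=
    fun j => divergence_radial_smul (h.ne hx j) (κ := fun t => Real.smoothTransition (2 - t / r ^ 2))
      ((Real.smoothTransition.contDiff (n := 1)).differentiable (by simp) |>.comp (by fun_prop))
  simp only [divergence] at h0
  simp only [sum_apply, smul_apply, Complex.re_sum, Complex.im_sum, Complex.smul_re,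
    Complex.smul_im, smul_eq_mul, ← Finset.sum_add_distrib, ← mul_add, h0, mul_zero,
    Finset.sum_const_zero]

/-- The divergence free field `∇φ - ∑ d_j χ_j ∇θ_j` is orthogonal to gradients. -/
lemma orthogonal (h : IsSplitting Ω a e d r Q φ) {ξ : ℂ → ℝ} (hξ : LocallyLipschitzOn Ω ξ)
    (hc : HasCompactSupport ξ) (hs : tsupport ξ ⊆ Ω) :
    IntegrableOn (fun x => inner ℝ (gradient φ x - singularField a d r x) (gradient ξ x)) Ω ∧
      ∫ x in Ω, inner ℝ (gradient φ x - singularField a d r x) (gradient ξ x) = 0 := by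
  have h1 : ContDiffOn ℝ 1 (gradient φ) Ω := contDiffOn_gradient h.smooth
  have h2 : ContDiffOn ℝ 1 (singularField a d r) Ω := fun x hx =>
    (h.contDiffAt_singularField hx).contDiffWithinAt
  refine integral_inner_gradient_eq_zero h.isOpen (h1.sub h2) (fun x hx => ?_) hξ hc hs
  have d1 := ((h1 x hx).contDiffAt (h.isOpen.mem_nhds hx)).differentiableAt (by simp)
  have d2 := (h.contDiffAt_singularField hx).differentiableAt (by simp)
  have h3 := h.harmonic x hx
  have h4 := h.divergence_singularField hx
  simp only [divergence] at h3 h4 ⊢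
  rw [fderiv_fun_sub d1 d2]
  simp only [sub_apply, Complex.sub_re, Complex.sub_im]
  linarith

lemma exists_remainder_bound (h : IsSplitting Ω a e d r Q φ) :
    ∃ M : ℝ, ∀ x ∈ Ω, |φ x - phaseModel a e d r Q x| ≤ M := by
  obtain ⟨C, hC⟩ := h.bound
  obtain ⟨C', hC'⟩ := h.lipschitz
  obtain ⟨D, hD⟩ : ∃ D, ∀ x ∈ Ω, |Q x| ≤ D := by
    obtain ⟨D, hD⟩ := (hC'.isBounded_image h.bounded).exists_norm_le
    exact ⟨D, fun x hx => hD _ (mem_image_of_mem Q hx)⟩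
  refine ⟨C + (D + ∑ j : Fin N, Real.pi), fun x hx => ?_⟩
  refine (abs_sub _ _).trans (add_le_add (hC x hx) ((abs_add_le _ _).trans (add_le_add ?_ ?_)))
  · exact hD x hx
  · refine (Finset.abs_sum_le_sum_abs _ _).trans (Finset.sum_le_sum fun j _ => ?_)
    rw [abs_mul, h.abs_d, one_mul]
    exact abs_vortexPhase_le _ _ _ _

lemma locallyLipschitzOn_remainder (h : IsSplitting Ω a e d r Q φ) :
    LocallyLipschitzOn Ω fun x => φ x - phaseModel a e d r Q x :=
  h.locallyLipschitzOn.real_sub h.locallyLipschitzOn_phaseModel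

lemma ae_gradient_remainder (h : IsSplitting Ω a e d r Q φ) : ∀ᵐ x, x ∈ Ω →
    gradient φ x - singularField a d r x =
      gradient (fun x => φ x - phaseModel a e d r Q x) x + regularField a e d r Q x := by
  filter_upwards [h.ae_gradient_phaseModel,
    h.locallyLipschitzOn_phaseModel.ae_differentiableAt h.isOpen] with x h1 h2 hx
  rw [gradient_fun_sub ((h.smooth x hx).differentiableAt (by simp)) (h2 hx), h1 hx]
  abel

lemma memLp_gradient_remainder (h : IsSplitting Ω a e d r Q φ) :
    MemLp (gradient fun x => φ x - phaseModel a e d r Q x) 2 (volume.restrict Ω) := by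
  classical
  obtain ⟨M, hM⟩ := h.exists_remainder_bound
  obtain ⟨C, hC⟩ := h.exists_regularField_bound
  have hs : ((Finset.univ.image a : Finset ℂ) : Set ℂ) = range a := by simp
  refine memLp_gradient_of_orthogonal h.isOpen h.bounded (s := Finset.univ.image a) (fun p hp => ?_)
    h.locallyLipschitzOn_remainder hM (hs ▸ h.boundary) hC h.ae_gradient_remainder
    fun ξ h1 h2 h3 => h.orthogonal h1 h2 h3
  obtain ⟨j, -, rfl⟩ := Finset.mem_image.1 hp
  exact h.notMem j

lemma zeroTrace_remainder (h : IsSplitting Ω a e d r Q φ) :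
    ZeroTrace Ω a (fun x => φ x - phaseModel a e d r Q x)
      (gradient fun x => φ x - phaseModel a e d r Q x) := by
  obtain ⟨M, hM⟩ := h.exists_remainder_bound
  exact zeroTrace_of_tendsto h.isOpen h.bounded h.locallyLipschitzOn_remainder hM h.boundary
    h.memLp_gradient_remainder

lemma isFiniteMeasure (h : IsSplitting Ω a e d r Q φ) : IsFiniteMeasure (volume.restrict Ω) :=
  ⟨by simpa using h.bounded.measure_lt_top⟩

lemma memLp_remainder (h : IsSplitting Ω a e d r Q φ) :
    MemLp (fun x => φ x - phaseModel a e d r Q x) 2 (volume.restrict Ω) := by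
  have := h.isFiniteMeasure
  obtain ⟨C, hC⟩ := h.exists_remainder_bound
  exact MemLp.of_bound (h.locallyLipschitzOn_remainder.continuousOn.aestronglyMeasurable
    h.isOpen.measurableSet) C
    ((ae_restrict_iff' h.isOpen.measurableSet).2 (ae_of_all _ fun x hx => hC x hx))

lemma memLp_regularField (h : IsSplitting Ω a e d r Q φ) :
    MemLp (regularField a e d r Q) 2 (volume.restrict Ω) := by
  have := h.isFiniteMeasure
  obtain ⟨C, hC⟩ := h.exists_regularField_bound
  exact MemLp.of_bound measurable_regularField.aestronglyMeasurable C (ae_of_all _ hC)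

lemma memLp_sub_singularField (h : IsSplitting Ω a e d r Q φ) :
    MemLp (fun x => gradient φ x - singularField a d r x) 2 (volume.restrict Ω) :=
  (h.memLp_gradient_remainder.add h.memLp_regularField).ae_eq <| by
    rw [EventuallyEq, ae_restrict_iff' h.isOpen.measurableSet]
    filter_upwards [h.ae_gradient_remainder] with x hx hxΩ using (hx hxΩ).symm

end IsSplitting

/-! ### The trace of the harmonic extension -/

/-- Mollification approximates a compactly supported Lipschitz function uniformly and in energy. -/
lemma exists_smooth_approx_lipschitz {P : ℂ → ℝ} {C : ℝ≥0} (hP : LipschitzWith C P)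
    (hc : HasCompactSupport P) : MemLp (gradient P) 2 volume ∧
    ∃ p : ℕ → ℂ → ℝ, (∀ n, ContDiff ℝ ∞ (p n)) ∧ (∀ n x, |p n x - P x| ≤ C / ((n : ℝ) + 1)) ∧
      (∀ n, MemLp (gradient (p n)) 2 volume) ∧
      Tendsto (fun n => eLpNorm (fun x => gradient (p n) x - gradient P x) 2 volume)
        atTop (𝓝 0) := by
  have hcg : HasCompactSupport (gradient P) :=
    (hc.fderiv ℝ).comp_left (g := (InnerProductSpace.toDual ℝ ℂ).symm) (map_zero _)
  have hg : MemLp (gradient P) 2 volume :=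
    hcg.memLp_of_bound (measurable_gradient P).aestronglyMeasurable C (ae_of_all _ fun x => by
      rw [norm_gradient]
      exact norm_fderiv_le_of_lipschitz ℝ hP)
  refine ⟨hg, ?_⟩
  have hε : ∀ n : ℕ, 0 < 1 / ((n : ℝ) + 1) := fun n => by positivity
  choose δ hδ hδt using fun n => exists_eLpNorm_translate_sub_le hg (hε n)
  have hρ : ∀ n, 0 < min (δ n) (1 / ((n : ℝ) + 1)) := fun n => lt_min (hδ n) (hε n)
  let k : ∀ n : ℕ, ContDiffBump (0 : ℂ) := fun n =>
    ⟨min (δ n) (1 / ((n : ℝ) + 1)) / 2, min (δ n) (1 / ((n : ℝ) + 1)), half_pos (hρ n),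
      half_lt_self (hρ n)⟩
  have hk : ∀ n, IsMollifier ((k n).normed volume) := fun n => isMollifier_normed (k n)
  have hPw : HasWeakGrad univ P (gradient P) :=
    hasWeakGrad_of_locallyLipschitzOn isOpen_univ hP.locallyLipschitz.locallyLipschitzOn
  have hcd : ∀ n, ContDiff ℝ ∞ (mollify ((k n).normed volume) P) := fun n =>
    (hk n).contDiff_mollify hP.continuous.locallyIntegrable
  have hle : ∀ n, eLpNorm (fun x => gradient (mollify ((k n).normed volume) P) x - gradient P x) 2
      volume ≤ ENNReal.ofReal (1 / ((n : ℝ) + 1)) := fun n => by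
    simp only [(hk n).gradient_mollify hPw]
    refine (hk n).eLpNorm_mollify_sub_le (hg.locallyIntegrable (by norm_num)) fun y hy =>
      hδt n y ?_
    have hy' : y ∈ Function.support ((k n).normed volume) := hy
    rw [(k n).support_normed_eq, mem_ball_zero_iff] at hy'
    exact hy'.trans_le (min_le_left _ _)
  refine ⟨fun n => mollify ((k n).normed volume) P, hcd, fun n x => ?_, fun n => ?_, ?_⟩
  · refine (k n).dist_normed_convolution_le hP.continuous.aestronglyMeasurable fun y hy => ?_
    refine (hP.dist_le_mul y x).trans ?_
    rw [div_eq_mul_one_div]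
    exact mul_le_mul_of_nonneg_left ((Metric.mem_ball.1 hy).le.trans (min_le_right _ _)) C.2
  · have hm : MemLp (fun x => gradient (mollify ((k n).normed volume) P) x - gradient P x) 2
        volume := ⟨((measurable_gradient _).sub (measurable_gradient _)).aestronglyMeasurable,
      (hle n).trans_lt ENNReal.ofReal_lt_top⟩
    exact (hm.add hg).ae_eq (ae_of_all _ fun x => sub_add_cancel _ _)
  · refine tendsto_of_tendsto_of_tendsto_of_le_of_le tendsto_const_nhds
      (h := fun n : ℕ => ENNReal.ofReal (1 / ((n : ℝ) + 1))) ?_ (fun _ => zero_le) hle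
    simpa using ENNReal.tendsto_ofReal (tendsto_one_div_add_atTop_nhds_zero_nat (𝕜 := ℝ))

/-- The Gauss-Green formula for the product of a Lipschitz function and a smooth field. -/
lemma gauss_green_lipschitz {Ω : Set ℂ} (hΩ : IsOpen Ω) (hC : IsC11 Ω) {L : ℝ} {γ : ℝ → ℂ}
    (hγ : IsBoundaryParam Ω L γ) {P : ℂ → ℝ} {C : ℝ≥0} (hP : LipschitzWith C P)
    (hPc : HasCompactSupport P) {Φ : ℂ → ℂ} (hΦ : ContDiff ℝ ∞ Φ) (hc : HasCompactSupport Φ) :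
    ∫ x in Ω, (P x * divergence Φ x + inner ℝ (gradient P x) (Φ x)) =
      ∫ s in (0 : ℝ)..L, P (γ s) * inner ℝ (Φ (γ s)) (outerNormal γ s) := by
  obtain ⟨hg, p, hp, hpP, hpL, hpg⟩ := exists_smooth_approx_lipschitz hP hPc
  have hdc : Continuous (divergence Φ) := continuous_divergence (hΦ.of_le (by simp))
  have hds : HasCompactSupport (divergence Φ) := hasCompactSupport_divergence hc
  have hΦL : MemLp Φ 2 (volume.restrict Ω) := hΦ.continuous.memLp_of_hasCompactSupport hc
  have hlim : Tendsto (fun n : ℕ => (C : ℝ) / ((n : ℝ) + 1)) atTop (𝓝 0) := by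
    simpa only [mul_zero, mul_one_div] using
      (tendsto_one_div_add_atTop_nhds_zero_nat (𝕜 := ℝ)).const_mul (C : ℝ)
  have hpt : ∀ x, Tendsto (fun n => p n x) atTop (𝓝 (P x)) := fun x => by
    rw [tendsto_iff_norm_sub_tendsto_zero]
    exact squeeze_zero (fun _ => norm_nonneg _) (fun n => hpP n x) hlim
  have hple : ∀ n x, |p n x| ≤ |P x| + C := fun n x => by
    have h1 := hpP n x
    have h2 : (C : ℝ) / ((n : ℝ) + 1) ≤ C := div_le_self C.2 (by linarith [n.cast_nonneg (α := ℝ)])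
    have h3 := abs_sub_abs_le_abs_sub (p n x) (P x)
    linarith
  have hpgc : ∀ n, Continuous (gradient (p n)) := fun n =>
    (InnerProductSpace.toDual ℝ ℂ).symm.continuous.comp ((hp n).continuous_fderiv (by simp))
  have hi1 : ∀ f : ℂ → ℝ, Continuous f → IntegrableOn (fun x => f x * divergence Φ x) Ω :=
    fun f hf => ((hf.mul hdc).integrable_of_hasCompactSupport hds.mul_left).integrableOn
  have hi2 : ∀ n, IntegrableOn (fun x => inner ℝ (gradient (p n) x) (Φ x)) Ω := fun n =>
    (((hpgc n).inner hΦ.continuous).integrable_of_hasCompactSupport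
      (hc.mono fun x hx hx0 => hx (by simp [hx0]))).integrableOn
  have hi3 : IntegrableOn (fun x => inner ℝ (gradient P x) (Φ x)) Ω :=
    integrable_inner_of_memLp (hg.restrict Ω) hΦL
  have hgn : ∀ n, (∫ x in Ω, p n x * divergence Φ x) + ∫ x in Ω, inner ℝ (gradient (p n) x) (Φ x) =
      ∫ s in (0 : ℝ)..L, p n (γ s) * inner ℝ (Φ (γ s)) (outerNormal γ s) := fun n => by
    have hp1 : ContDiff ℝ 1 (p n) := (hp n).of_le (by simp)
    have hΦ1 : ContDiff ℝ 1 Φ := hΦ.of_le (by simp)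
    have := gauss_green hΩ hC hγ (X := fun x => p n x • Φ x) (hp1.smul hΦ1)
      (hc.mono fun x hx hx0 => hx (by simp [hx0]))
    simp only [real_inner_smul_left] at this
    rw [← this, ← integral_add (hi1 _ (hp n).continuous) (hi2 n)]
    refine integral_congr_ae (ae_of_all _ fun x => ?_)
    exact (divergence_smul (hp1.differentiable (by simp) x) (hΦ1.differentiable (by simp) x)).symm
  have l1 : Tendsto (fun n => ∫ x in Ω, p n x * divergence Φ x) atTop
      (𝓝 (∫ x in Ω, P x * divergence Φ x)) := by
    refine tendsto_integral_of_dominated_convergence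
      (fun x => (|P x| + C) * |divergence Φ x|) (fun n => (hi1 _ (hp n).continuous).1) ?_
      (fun n => ae_of_all _ fun x => ?_) (ae_of_all _ fun x => (hpt x).mul_const _)
    · have hcont : Continuous fun x => (|P x| + C) * |divergence Φ x| := by
        have := hP.continuous
        fun_prop
      exact (hcont.integrable_of_hasCompactSupport
        (hds.mono fun x hx hx0 => hx (by simp [hx0]))).integrableOn
    · rw [norm_mul]
      exact mul_le_mul_of_nonneg_right (hple n x) (abs_nonneg _)
  have l2 : Tendsto (fun n => ∫ x in Ω, inner ℝ (gradient (p n) x) (Φ x)) atTop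
      (𝓝 (∫ x in Ω, inner ℝ (gradient P x) (Φ x))) := by
    have hlim' := tendsto_of_tendsto_of_tendsto_of_le_of_le tendsto_const_nhds hpg
      (fun _ => zero_le) fun n =>
        eLpNorm_mono_measure (fun x => gradient (p n) x - gradient P x)
          (Measure.restrict_le_self (μ := volume) (s := Ω))
    exact tendsto_integral_inner (fun n => (hpL n).restrict Ω) (hg.restrict Ω) hΦL hlim'
  have l3 : Tendsto (fun n => ∫ s in (0 : ℝ)..L, p n (γ s) * inner ℝ (Φ (γ s)) (outerNormal γ s))
      atTop (𝓝 (∫ s in (0 : ℝ)..L, P (γ s) * inner ℝ (Φ (γ s)) (outerNormal γ s))) := by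
    have hγc := hγ.differentiable.continuous
    have hnc := continuous_outerNormal hγ
    have hΦc := hΦ.continuous
    have hPc := hP.continuous
    refine intervalIntegral.tendsto_integral_filter_of_dominated_convergence
      (fun s => (|P (γ s)| + C) * |inner ℝ (Φ (γ s)) (outerNormal γ s)|)
      (Eventually.of_forall fun n => ?_) (Eventually.of_forall fun n => ae_of_all _ fun s _ => ?_) ?_
      (ae_of_all _ fun s _ => (hpt _).mul_const _)
    · have := (hp n).continuous
      exact Continuous.aestronglyMeasurable (by fun_prop)
    · rw [norm_mul]
      exact mul_le_mul_of_nonneg_right (hple n _) (abs_nonneg _)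
    · exact Continuous.intervalIntegrable (by fun_prop) _ _
  rw [integral_add (hi1 _ hP.continuous) hi3]
  exact tendsto_nhds_unique (l1.add l2) (l3.congr fun n => (hgn n).symm)

lemma _root_.MeasureTheory.MemLp.restrict_perforated {N : ℕ} {Ω : Set ℂ} {a : Fin N → ℂ} {E : Type*}
    [NormedAddCommGroup E] {f : ℂ → E} (hf : MemLp f 2 (volume.restrict Ω)) (ρ : ℝ) :
    MemLp f 2 (volume.restrict (perforated Ω a ρ)) :=
  hf.mono_measure (Measure.restrict_mono (perforated_subset Ω a ρ) le_rfl)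

lemma divergence_smul_const {ζ : ℂ → ℝ} {x : ℂ} (hζ : DifferentiableAt ℝ ζ x) (v : ℂ) :
    divergence (fun x => ζ x • v) x = fderiv ℝ ζ x v := by
  rw [divergence_smul hζ (differentiableAt_const v), inner_gradient]
  simp [divergence]

lemma integrableOn_mul_divergence_add_inner {N : ℕ} {Ω : Set ℂ} (hΩ : IsOpen Ω) {a : Fin N → ℂ}
    {f : ℂ → ℝ} {g : ℂ → ℂ} (hf : ∀ ρ > 0, MemLp f 2 (volume.restrict (perforated Ω a ρ)))
    (hg : ∀ ρ > 0, MemLp g 2 (volume.restrict (perforated Ω a ρ))) {Φ : ℂ → ℂ}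
    (hΦ : ContDiff ℝ ∞ Φ) (hc : HasCompactSupport Φ) (ha : ∀ j, a j ∉ tsupport Φ) :
    IntegrableOn (fun x => f x * divergence Φ x + inner ℝ (g x) (Φ x)) Ω := by
  obtain ⟨ρ, hρ, hρs⟩ := exists_radius (isClosed_tsupport Φ) ha
  have h1 : MemLp (divergence Φ) 2 (volume.restrict (perforated Ω a ρ)) :=
    (continuous_divergence (hΦ.of_le (by simp))).memLp_of_hasCompactSupport
      (hasCompactSupport_divergence hc)
  have h2 : MemLp Φ 2 (volume.restrict (perforated Ω a ρ)) :=
    hΦ.continuous.memLp_of_hasCompactSupport hc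
  refine IntegrableOn.of_forall_sdiff_eq_zero (s := perforated Ω a ρ) ?_ hΩ.measurableSet
    fun x hx => ?_
  · refine (Integrable.add (integrable_inner_of_memLp h1 (hf ρ hρ))
      (integrable_inner_of_memLp (hg ρ hρ) h2)).congr (ae_of_all _ fun x => rfl)
  · have hxs : x ∉ tsupport Φ := fun h => hx.2 (mem_perforated.2 ⟨hx.1, hρs x h⟩)
    rw [divergence_eq_zero hxs, image_eq_zero_of_notMem_tsupport hxs, mul_zero, inner_zero_right,
      add_zero]

/-- `ZeroTrace` is formulated with scalar test functions in a fixed direction; decomposing a field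
into its components shows: for a function with zero trace the Gauss-Green formula has no boundary term. -/
lemma ZeroTrace.integral_divergence_eq_zero {N : ℕ} {Ω : Set ℂ} {a : Fin N → ℂ} {f : ℂ → ℝ}
    {g : ℂ → ℂ} (hΩ : IsOpen Ω) (hz : ZeroTrace Ω a f g)
    (hf : ∀ ρ > 0, MemLp f 2 (volume.restrict (perforated Ω a ρ)))
    (hg : ∀ ρ > 0, MemLp g 2 (volume.restrict (perforated Ω a ρ))) {Φ : ℂ → ℂ}
    (hΦ : ContDiff ℝ ∞ Φ) (hc : HasCompactSupport Φ) (ha : ∀ j, a j ∉ tsupport Φ) :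
    ∫ x in Ω, (f x * divergence Φ x + inner ℝ (g x) (Φ x)) = 0 := by
  have key : ∀ (l : ℂ →L[ℝ] ℝ) (v : ℂ), Differentiable ℝ (fun x => l (Φ x) • v) ∧
      IntegrableOn (fun x => f x * divergence (fun x => l (Φ x) • v) x +
        inner ℝ (g x) (l (Φ x) • v)) Ω ∧
      ∫ x in Ω, (f x * divergence (fun x => l (Φ x) • v) x + inner ℝ (g x) (l (Φ x) • v)) = 0 := by
    intro l v
    have hl : ContDiff ℝ ∞ fun x => l (Φ x) := l.contDiff.comp hΦ
    have hlv : ContDiff ℝ ∞ fun x => l (Φ x) • v := hl.smul contDiff_const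
    have hls : HasCompactSupport fun x => l (Φ x) := hc.comp_left (map_zero l)
    have hla : ∀ j, a j ∉ tsupport fun x => l (Φ x) := fun j hj =>
      ha j (tsupport_comp_subset (map_zero l) Φ hj)
    have h0 : l 0 • v = 0 := by rw [map_zero, zero_smul]
    refine ⟨hlv.differentiable (by simp), integrableOn_mul_divergence_add_inner hΩ hf hg hlv
      (hc.comp_left (g := fun z => l z • v) h0) (fun j hj => ha j
        (tsupport_comp_subset (g := fun z => l z • v) h0 Φ hj)), ?_⟩
    rw [← hz _ hl hls hla v]
    refine integral_congr_ae (ae_of_all _ fun x => ?_)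
    simp only [divergence_smul_const (hl.differentiable (by simp) x) v, real_inner_smul_right,
      mul_comm (l (Φ x))]
  obtain ⟨d1, i1, z1⟩ := key Complex.reCLM 1
  obtain ⟨d2, i2, z2⟩ := key Complex.imCLM Complex.I
  have hsum : ∀ x, Φ x = Complex.reCLM (Φ x) • (1 : ℂ) + Complex.imCLM (Φ x) • Complex.I :=
    fun x => by simp
  have hdiv : ∀ x, divergence Φ x = divergence (fun x => Complex.reCLM (Φ x) • (1 : ℂ)) x +
      divergence (fun x => Complex.imCLM (Φ x) • Complex.I) x := fun x => by
    conv_lhs => rw [show Φ = fun x => Complex.reCLM (Φ x) • (1 : ℂ) +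
      Complex.imCLM (Φ x) • Complex.I from funext hsum]
    simp only [divergence]
    rw [fderiv_fun_add (d1 x) (d2 x)]
    simp only [add_apply, Complex.add_re, Complex.add_im]
    ring
  have hint : (fun x => f x * divergence Φ x + inner ℝ (g x) (Φ x)) = fun x =>
      (f x * divergence (fun x => Complex.reCLM (Φ x) • (1 : ℂ)) x +
        inner ℝ (g x) (Complex.reCLM (Φ x) • (1 : ℂ))) +
      (f x * divergence (fun x => Complex.imCLM (Φ x) • Complex.I) x +
        inner ℝ (g x) (Complex.imCLM (Φ x) • Complex.I)) := by
    ext x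
    have hi : inner ℝ (g x) (Φ x) = inner ℝ (g x) (Complex.reCLM (Φ x) • (1 : ℂ)) +
        inner ℝ (g x) (Complex.imCLM (Φ x) • Complex.I) := by
      rw [← inner_add_right, ← hsum]
    rw [hdiv, hi]
    ring
  rw [hint, integral_add i1 i2, z1, z2, add_zero]

namespace IsSplitting

variable {N : ℕ} {Ω : Set ℂ} {a e : Fin N → ℂ} {d : Fin N → ℝ} {r : ℝ} {Q φ : ℂ → ℝ}

/-- Away from the `a_j`, the model agrees on `closure Ω` with a Lipschitz function. -/
lemma exists_lipschitz_eq_phaseModel (h : IsSplitting Ω a e d r Q φ) {S : Set ℂ} (hS : IsClosed S)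
    (ha : ∀ j, a j ∉ S) : ∃ (P : ℂ → ℝ) (C : ℝ≥0), LipschitzWith C P ∧ HasCompactSupport P ∧
      ∀ x ∈ closure Ω ∩ S, P =ᶠ[𝓝 x] phaseModel a e d r Q := by
  set f := phaseModel a e d r Q with hf
  set U : Set ℂ := {x | ∃ K : ℝ≥0, ∃ t ∈ 𝓝 x, LipschitzOnWith K f t} with hUdef
  have hUo : IsOpen U := by
    rw [isOpen_iff_mem_nhds]
    rintro x ⟨K, t, ht, hK⟩
    filter_upwards [eventually_mem_nhds_iff.2 ht] with y hy using ⟨K, t, hy, hK⟩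
  have hfU : LocallyLipschitzOn U f := fun x ⟨K, t, ht, hK⟩ =>
    ⟨K, t, mem_nhdsWithin_of_mem_nhds ht, hK⟩
  have hKU : closure Ω ∩ S ⊆ U := by
    rintro x ⟨hx, hxS⟩
    obtain ⟨C, hC⟩ := h.lipschitz
    have h1 : ContDiffAt ℝ 1 (fun z => ∑ j, d j * vortexPhase (a j) (e j) r z) x := by
      refine ContDiffAt.sum fun j _ => contDiffAt_const.mul ?_
      obtain ⟨K, R, hK, hR, hp⟩ := h.pole j
      exact hp.contDiffAt_vortexPhase h.r_pos hR hx fun hxa => ha j (hxa ▸ hxS)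
    obtain ⟨K, t, ht, hK⟩ := h1.exists_lipschitzOnWith
    exact ⟨C + K, t, ht, hC.lipschitzOnWith.add hK⟩
  obtain ⟨κ, hκ, hκc, hκU, hκ1⟩ := exists_smooth_eq_one
    (h.bounded.isCompact_closure.inter_right hS) hUo hKU
  have hP : LocallyLipschitzOn U fun x => κ x * f x :=
    ((hκ.of_le (by simp)).contDiffOn.locallyLipschitzOn_of_isOpen hUo).real_mul hfU
  have hPs : tsupport (fun x => κ x * f x) ⊆ U := (tsupport_mul_subset_left).trans hκU
  have hPc : HasCompactSupport fun x => κ x * f x := hκc.mul_right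
  obtain ⟨C, hC⟩ := (locallyLipschitz_of_tsupport_subset hUo hP hPs).exists_lipschitzWith hPc
  refine ⟨_, C, hC, hPc, fun x hx => ?_⟩
  filter_upwards [hκ1 x hx] with y hy
  rw [hy, one_mul]

/-- `φ` has on `∂Ω \ {a_j}` the boundary values of the model in the sense of traces: near the support
of a test field, `φ` is the sum of the remainder, which has zero trace, and of a Lipschitz function. -/
lemma hasTrace (h : IsSplitting Ω a e d r Q φ) (hC : IsC11 Ω) {L : ℝ} {γ : ℝ → ℂ}
    (hγ : IsBoundaryParam Ω L γ) {φb : ℂ → ℝ}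
    (hφb : ∀ x ∈ frontier Ω \ range a, φb x = phaseModel a e d r Q x) : HasTrace Ω L γ a φ φb := by
  intro Φ hΦ hc ha
  obtain ⟨P, C, hP, hPc, hPe⟩ := h.exists_lipschitz_eq_phaseModel (isClosed_tsupport Φ) ha
  set w : ℂ → ℝ := fun x => φ x - phaseModel a e d r Q x with hw
  have hwp : ∀ ρ > 0, MemLp w 2 (volume.restrict (perforated Ω a ρ)) := fun ρ _ =>
    h.memLp_remainder.restrict_perforated ρ
  have hgp : ∀ ρ > 0, MemLp (gradient w) 2 (volume.restrict (perforated Ω a ρ)) := fun ρ _ =>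
    h.memLp_gradient_remainder.restrict_perforated ρ
  have i1 := integrableOn_mul_divergence_add_inner h.isOpen hwp hgp hΦ hc ha
  have z1 := h.zeroTrace_remainder.integral_divergence_eq_zero h.isOpen hwp hgp hΦ hc ha
  have hgw := (hasWeakGrad_of_locallyLipschitzOn h.isOpen h.locallyLipschitzOn).weakGrad_ae_eq
    h.isOpen
  have hint : ∀ᵐ x ∂volume.restrict Ω, φ x * divergence Φ x + inner ℝ (weakGrad Ω φ x) (Φ x) =
      (w x * divergence Φ x + inner ℝ (gradient w x) (Φ x)) +
        (P x * divergence Φ x + inner ℝ (gradient P x) (Φ x)) := by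
    have hd := h.locallyLipschitzOn_phaseModel.ae_differentiableAt h.isOpen
    filter_upwards [hgw, (ae_restrict_iff' h.isOpen.measurableSet).2 hd,
      ae_restrict_mem h.isOpen.measurableSet] with x h1 h2 hx
    by_cases hxs : x ∈ tsupport Φ
    · have hPx := hPe x ⟨subset_closure hx, hxs⟩
      rw [h1, hPx.gradient_eq, hPx.eq_of_nhds, hw,
        gradient_fun_sub ((h.smooth x hx).differentiableAt (by simp)) h2, inner_sub_left]
      ring
    · rw [divergence_eq_zero hxs, image_eq_zero_of_notMem_tsupport hxs]
      simp
  have hPi : IntegrableOn (fun x => P x * divergence Φ x + inner ℝ (gradient P x) (Φ x)) Ω := by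
    have hdc : Continuous (divergence Φ) := continuous_divergence (hΦ.of_le (by simp))
    refine Integrable.add ((hP.continuous.mul hdc).integrable_of_hasCompactSupport
      (hasCompactSupport_divergence hc).mul_left).integrableOn ?_
    exact integrable_inner_of_memLp ((exists_smooth_approx_lipschitz hP hPc).1.restrict Ω)
      (hΦ.continuous.memLp_of_hasCompactSupport hc)
  rw [integral_congr_ae hint, integral_add i1 hPi, z1, zero_add,
    gauss_green_lipschitz h.isOpen hC hγ hP hPc hΦ hc]
  refine intervalIntegral.integral_congr fun s _ => ?_
  have hs : γ s ∈ frontier Ω := hγ.range_eq ▸ mem_range_self s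
  by_cases hxs : γ s ∈ tsupport Φ
  · have hna : γ s ∉ range a := by
      rintro ⟨j, hj⟩
      exact ha j (hj ▸ hxs)
    simp only [(hPe _ ⟨frontier_subset_closure hs, hxs⟩).eq_of_nhds, hφb _ ⟨hs, hna⟩]
  · simp only [image_eq_zero_of_notMem_tsupport hxs, inner_zero_left, mul_zero]

end IsSplitting

/-! ### The energy of the singular field -/

/-- A function on the plane with an integrable singularity along both axes. The exponent `-2 / 3` is
large enough for integrability and small enough to dominate both `‖w‖⁻¹` and, where
`|re w| ≤ K ‖w‖²`, also `‖w‖⁻²`. -/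
def axisWeight (w : ℂ) : ℝ := |w.re| ^ (-(2 / 3) : ℝ) * |w.im| ^ (-(2 / 3) : ℝ)

lemma integrableOn_axisWeight (R : ℝ) : IntegrableOn axisWeight (Metric.ball 0 R) := by
  have h1 : ∀ R : ℝ, IntervalIntegrable (fun t : ℝ => |t| ^ (-(2 / 3) : ℝ)) volume 0 R := by
    have h0 : ∀ R : ℝ, 0 ≤ R →
        IntervalIntegrable (fun t : ℝ => |t| ^ (-(2 / 3) : ℝ)) volume 0 R := fun R hR => by
      refine (intervalIntegral.intervalIntegrable_rpow' (r := -(2 / 3)) (by norm_num)).congr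
        fun t ht => ?_
      rw [uIoc_of_le hR] at ht
      simp only [abs_of_pos ht.1]
    intro R
    rcases le_total 0 R with hR | hR
    · exact h0 R hR
    · have := h0 (-R) (by linarith)
      rw [IntervalIntegrable.iff_comp_neg] at this
      simpa using this
  have h2 : IntegrableOn (fun t : ℝ => |t| ^ (-(2 / 3) : ℝ)) (Ioc (-R) R) :=
    ((h1 (-R)).symm.trans (h1 R)).1
  have h3 : IntegrableOn (fun p : ℝ × ℝ => |p.1| ^ (-(2 / 3) : ℝ) * |p.2| ^ (-(2 / 3) : ℝ))
      (Ioc (-R) R ×ˢ Ioc (-R) R) := by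
    rw [IntegrableOn, Measure.volume_eq_prod, ← Measure.prod_restrict]
    exact h2.mul_prod h2
  have h4 : IntegrableOn axisWeight (Complex.measurableEquivRealProd ⁻¹' (Ioc (-R) R ×ˢ Ioc (-R) R)) :=
    (Complex.volume_preserving_equiv_real_prod.integrableOn_comp_preimage
      Complex.measurableEquivRealProd.measurableEmbedding).2 h3
  refine h4.mono_set fun w hw => ?_
  have hw' : ‖w‖ < R := by simpa using hw
  have a1 := abs_le.1 ((Complex.abs_re_le_norm w))
  have a2 := abs_le.1 ((Complex.abs_im_le_norm w))
  exact ⟨⟨by simp; linarith, by simp; linarith⟩, ⟨by simp; linarith, by simp; linarith⟩⟩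

lemma ae_re_im_ne_zero : ∀ᵐ w : ℂ, w.re ≠ 0 ∧ w.im ≠ 0 := by
  refine .and ?_ ?_
  · have h := Measure.addHaar_submodule (volume : Measure ℂ) (LinearMap.ker Complex.reLm) fun h => by
      have : (1 : ℂ) ∈ LinearMap.ker Complex.reLm := h ▸ trivial
      simp at this
    refine measure_mono_null (fun w hw => ?_) h
    simpa using hw
  · have h := Measure.addHaar_submodule (volume : Measure ℂ) (LinearMap.ker Complex.imLm) fun h => by
      have : Complex.I ∈ LinearMap.ker Complex.imLm := h ▸ trivial
      simp at this
    refine measure_mono_null (fun w hw => ?_) h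
    simpa using hw

lemma integrable_of_axisWeight {g : ℂ → ℝ} (hg : Measurable g) {R c : ℝ}
    (h0 : ∀ w, R ≤ ‖w‖ → g w = 0) (hc : ∀ w : ℂ, w.re ≠ 0 → w.im ≠ 0 → ‖w‖ < R →
      |g w| * (|w.re| * |w.im|) ^ (2 / 3 : ℝ) ≤ c) : Integrable g := by
  rw [← integrableOn_iff_integrable_of_support_subset (s := Metric.ball 0 R)]
  · refine ((integrableOn_axisWeight R).const_mul c).mono' hg.aestronglyMeasurable ?_
    filter_upwards [ae_restrict_of_ae ae_re_im_ne_zero, ae_restrict_mem Metric.isOpen_ball.measurableSet]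
      with w hw hwR
    have h1 := hc w hw.1 hw.2 (by simpa using hwR)
    have hpos : 0 < (|w.re| * |w.im|) ^ (2 / 3 : ℝ) :=
      Real.rpow_pos_of_pos (mul_pos (abs_pos.2 hw.1) (abs_pos.2 hw.2)) _
    have h2 : axisWeight w = ((|w.re| * |w.im|) ^ (2 / 3 : ℝ))⁻¹ := by
      rw [axisWeight, ← Real.mul_rpow (abs_nonneg _) (abs_nonneg _), Real.rpow_neg (by positivity)]
    rw [h2, Real.norm_eq_abs, ← div_eq_mul_inv, le_div_iff₀ hpos]
    exact h1
  · intro w hw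
    by_contra hR
    exact hw (h0 w (by simpa using hR))

lemma integrable_norm_inv (R : ℝ) : Integrable (indicator {w : ℂ | ‖w‖ < R} fun w => ‖w‖⁻¹) := by
  refine integrable_of_axisWeight (R := R) (c := |R| ^ (1 / 3 : ℝ)) ?_ (fun w hw => ?_)
    fun w h1 h2 hw => ?_
  · exact (measurable_norm.inv).indicator (measurableSet_lt measurable_norm measurable_const)
  · exact indicator_of_notMem (by simpa using hw) _
  · have hn : 0 < ‖w‖ := norm_pos_iff.2 fun h => h1 (by simp [h])
    rw [indicator_of_mem (by simpa using hw), abs_of_pos (inv_pos.2 hn), inv_mul_le_iff₀ hn]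
    calc (|w.re| * |w.im|) ^ (2 / 3 : ℝ) ≤ (‖w‖ ^ (2 : ℝ)) ^ (2 / 3 : ℝ) := by
          rw [Real.rpow_two, sq]
          gcongr
          exacts [Complex.abs_re_le_norm w, Complex.abs_im_le_norm w]
      _ = ‖w‖ * ‖w‖ ^ (1 / 3 : ℝ) := by
          rw [← Real.rpow_mul hn.le, ← Real.rpow_one_add' hn.le (by norm_num)]
          norm_num
      _ ≤ ‖w‖ * |R| ^ (1 / 3 : ℝ) := by
          gcongr
          exact hw.le.trans (le_abs_self R)

/-- The symmetric difference of a half disc and a domain with a `C^{1,1}` boundary is so thin at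
the boundary point that the energy density of the vortex field is integrable there. -/
lemma integrable_norm_sq_inv {K : ℝ} (hK : 0 ≤ K) (R : ℝ) :
    Integrable (indicator {w : ℂ | ‖w‖ < R ∧ |w.re| ≤ K * ‖w‖ ^ 2} fun w => (‖w‖ ^ 2)⁻¹) := by
  have hm : MeasurableSet {w : ℂ | ‖w‖ < R ∧ |w.re| ≤ K * ‖w‖ ^ 2} :=
    (measurableSet_lt measurable_norm measurable_const).inter
      (measurableSet_le Complex.measurable_re.abs (by fun_prop))
  refine integrable_of_axisWeight (R := R) (c := K ^ (2 / 3 : ℝ)) ?_ (fun w hw => ?_)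
    fun w h1 h2 hw => ?_
  · exact ((measurable_norm.pow_const 2).inv).indicator hm
  · exact indicator_of_notMem (fun h => by linarith [h.1]) _
  · have hn : 0 < ‖w‖ := norm_pos_iff.2 fun h => h1 (by simp [h])
    by_cases hD : w ∈ {w : ℂ | ‖w‖ < R ∧ |w.re| ≤ K * ‖w‖ ^ 2}
    · rw [indicator_of_mem hD, abs_of_pos (by positivity), inv_mul_le_iff₀ (by positivity)]
      calc (|w.re| * |w.im|) ^ (2 / 3 : ℝ) ≤ (K * ‖w‖ ^ (3 : ℝ)) ^ (2 / 3 : ℝ) := by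
            have h3 : K * ‖w‖ ^ (3 : ℝ) = (K * ‖w‖ ^ 2) * ‖w‖ := by
              rw [show (3 : ℝ) = ((3 : ℕ) : ℝ) by norm_num, Real.rpow_natCast]
              ring
            rw [h3]
            gcongr
            exacts [hD.2, Complex.abs_im_le_norm w]
        _ = ‖w‖ ^ 2 * K ^ (2 / 3 : ℝ) := by
            rw [Real.mul_rpow hK (by positivity), ← Real.rpow_mul hn.le, mul_comm]
            norm_num
    · rw [indicator_of_notMem hD, abs_zero, zero_mul]
      positivity

/-- The integral over sets which exhaust the whole space. -/
lemma tendsto_setIntegral_of_eventually_mem {α E : Type*} [MeasurableSpace α] {μ : Measure α}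
    [NormedAddCommGroup E] [NormedSpace ℝ E] {S : ℝ → Set α} (hS : ∀ ρ, MeasurableSet (S ρ))
    {f : α → E} (hf : Integrable f μ) (h : ∀ᵐ x ∂μ, ∀ᶠ ρ in 𝓝[>] (0 : ℝ), x ∈ S ρ) :
    Tendsto (fun ρ => ∫ x in S ρ, f x ∂μ) (𝓝[>] 0) (𝓝 (∫ x, f x ∂μ)) := by
  simp_rw [← integral_indicator (hS _)]
  refine tendsto_integral_filter_of_dominated_convergence (fun x => ‖f x‖)
    (Eventually.of_forall fun ρ => (hf.1.indicator (hS ρ)))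
    (Eventually.of_forall fun ρ => ae_of_all _ fun x => norm_indicator_le_norm_self _ _) hf.norm ?_
  filter_upwards [h] with x hx
  refine tendsto_const_nhds.congr' ?_
  filter_upwards [hx] with ρ hρ
  rw [indicator_of_mem hρ]

lemma measurableSet_le_norm_sub (a : ℂ) (ρ : ℝ) : MeasurableSet {x : ℂ | ρ ≤ ‖x - a‖} :=
  measurableSet_le measurable_const (by fun_prop)

lemma integrableOn_cutoff_energy (a : ℂ) {r ρ : ℝ} (hr : 0 < r) (hρ : 0 < ρ) :
    IntegrableOn (fun x => vortexCutoff a r x ^ 2 * (‖x - a‖ ^ 2)⁻¹) {x | ρ ≤ ‖x - a‖} := by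
  have hm : Measurable fun x => vortexCutoff a r x ^ 2 * (‖x - a‖ ^ 2)⁻¹ :=
    ((contDiff_vortexCutoff a r).continuous.measurable.pow_const 2).mul (by fun_prop)
  rw [← integrable_indicator_iff (measurableSet_le_norm_sub a ρ)]
  refine integrable_of_bound_of_compact (C := (ρ ^ 2)⁻¹)
    (hm.indicator (measurableSet_le_norm_sub a ρ)).aestronglyMeasurable
    (isCompact_closedBall a (2 * r)) (fun x _ => ?_) fun x hx => ?_
  · by_cases hxρ : ρ ≤ ‖x - a‖
    · rw [indicator_of_mem (show x ∈ {x | ρ ≤ ‖x - a‖} from hxρ), norm_mul, norm_pow, norm_inv,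
        norm_pow, norm_norm, Real.norm_eq_abs, abs_of_nonneg (vortexCutoff_nonneg a r x)]
      calc vortexCutoff a r x ^ 2 * (‖x - a‖ ^ 2)⁻¹ ≤ 1 * (ρ ^ 2)⁻¹ := by
            gcongr
            exact pow_le_one₀ (vortexCutoff_nonneg a r x) (vortexCutoff_le_one a r x)
        _ = _ := one_mul _
    · rw [indicator_of_notMem (show x ∉ {x | ρ ≤ ‖x - a‖} from hxρ), norm_zero]
      positivity
  · have h2 : vortexCutoff a r x = 0 := vortexCutoff_eq_zero hr (by
      rw [Metric.mem_closedBall, dist_eq_norm] at hx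
      linarith)
    simp [indicator, h2]

/-- Inside radius `r` the cutoff is `1`, and the energy is that of the annulus from `ρ` to `r`. -/
lemma integral_cutoff_energy (a : ℂ) {r ρ : ℝ} (hr : 0 < r) (hρ : 0 < ρ) (hρr : ρ ≤ r) :
    ∫ x in {x : ℂ | ρ ≤ ‖x - a‖}, vortexCutoff a r x ^ 2 * (‖x - a‖ ^ 2)⁻¹ =
      2 * Real.pi * (Real.log r + Real.log (1 / ρ)) +
        ∫ x in {x : ℂ | r ≤ ‖x - a‖}, vortexCutoff a r x ^ 2 * (‖x - a‖ ^ 2)⁻¹ := by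
  have hu : {x : ℂ | ρ ≤ ‖x - a‖} = {x | ρ ≤ ‖x - a‖ ∧ ‖x - a‖ < r} ∪ {x | r ≤ ‖x - a‖} := by
    ext x
    simp only [mem_ofPred_eq, mem_union]
    constructor
    · intro h
      rcases lt_or_ge ‖x - a‖ r with h' | h'
      exacts [Or.inl ⟨h, h'⟩, Or.inr h']
    · rintro (h | h)
      exacts [h.1, hρr.trans h]
  have hi := integrableOn_cutoff_energy a hr hρ
  have hdisj : Disjoint {x : ℂ | ρ ≤ ‖x - a‖ ∧ ‖x - a‖ < r} {x | r ≤ ‖x - a‖} :=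
    Set.disjoint_left.2 fun x h1 h2 => absurd h1.2 (not_lt.2 h2)
  rw [hu] at hi ⊢
  rw [setIntegral_union hdisj (measurableSet_le_norm_sub a r) hi.left_of_union hi.right_of_union]
  congr 1
  have hlog : Real.log r + Real.log (1 / ρ) = Real.log (r / ρ) := by
    rw [← Real.log_mul hr.ne' (by positivity), mul_one_div]
  rw [hlog, ← (integral_annulus_inv_sq a hρ hρr).2]
  refine setIntegral_congr_fun (measurableSet_annulus a ρ r) fun x hx => ?_
  simp only [vortexCutoff_eq_one hr hx.2.le, one_pow, one_mul]

namespace IsPole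

variable {Ω : Set ℂ} {a e : ℂ} {K R r : ℝ}

/-- Reflection at the pole maps `Ω` to its complement up to a thin set. -/
lemma integrable_reflection_defect (h : IsPole Ω a e K R) (hK : 0 ≤ K) (hΩ : IsOpen Ω) (hr : 0 < r)
    (hR : 2 * r < R) : Integrable fun x : ℂ => (Ω.indicator (1 : ℂ → ℝ) x +
      Ω.indicator (1 : ℂ → ℝ) (2 * a - x) - 1) * (vortexCutoff a r x ^ 2 * (‖x - a‖ ^ 2)⁻¹) := by
  let T : ℂ ≃ₗᵢ[ℝ] ℂ := rotation ⟨starRingEnd ℂ e, by simp [Submonoid.unitSphere, h.norm_eq]⟩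
  have hT : ∀ w, (T w).re = inner ℝ e w := fun w => by
    rw [show T w = starRingEnd ℂ e * w from rfl, Complex.inner, mul_comm]
  have hD := ((T.measurePreserving.comp (measurePreserving_sub_right volume a)).integrable_comp
    (integrable_norm_sq_inv hK (2 * r)).1).2 (integrable_norm_sq_inv hK (2 * r))
  have hm : Measurable (Ω.indicator (1 : ℂ → ℝ)) := measurable_one.indicator hΩ.measurableSet
  refine hD.mono' ?_ (ae_of_all _ fun x => ?_)
  · exact (((hm.add (hm.comp (by fun_prop))).sub_const 1).mul
      (((contDiff_vortexCutoff a r).continuous.measurable.pow_const 2).mul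
        (by fun_prop))).aestronglyMeasurable
  · have hind : ∀ y : ℂ, 0 ≤ Ω.indicator (1 : ℂ → ℝ) y ∧ Ω.indicator (1 : ℂ → ℝ) y ≤ 1 := fun y => by
      by_cases hy : y ∈ Ω <;> simp [hy]
    simp only [Function.comp_apply]
    set D : Set ℂ := {w : ℂ | ‖w‖ < 2 * r ∧ |w.re| ≤ K * ‖w‖ ^ 2}
    have hnn : 0 ≤ D.indicator (fun w => (‖w‖ ^ 2)⁻¹) (T (x - a)) :=
      indicator_nonneg (fun _ _ => by positivity) _
    rcases le_or_gt (2 * r) ‖x - a‖ with h2 | h2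
    · rw [vortexCutoff_eq_zero hr h2]
      simpa using hnn
    have h2R : ‖x - a‖ < R := h2.trans hR
    have hxa : 2 * a - x - a = -(x - a) := by ring
    have h2R' : ‖2 * a - x - a‖ < R := by rwa [hxa, norm_neg]
    by_cases hxD : |inner ℝ e (x - a)| ≤ K * ‖x - a‖ ^ 2
    · have hmem : T (x - a) ∈ D := ⟨by rwa [T.norm_map], by rwa [hT, T.norm_map]⟩
      rw [indicator_of_mem hmem, T.norm_map, norm_mul, Real.norm_eq_abs, Real.norm_eq_abs]
      have h3 : |Ω.indicator (1 : ℂ → ℝ) x + Ω.indicator (1 : ℂ → ℝ) (2 * a - x) - 1| ≤ 1 := by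
        have := hind x
        have := hind (2 * a - x)
        rw [abs_le]
        constructor <;> linarith
      have h4 : |vortexCutoff a r x ^ 2 * (‖x - a‖ ^ 2)⁻¹| ≤ (‖x - a‖ ^ 2)⁻¹ := by
        rw [abs_of_nonneg (by positivity)]
        exact mul_le_of_le_one_left (by positivity)
          (pow_le_one₀ (vortexCutoff_nonneg a r x) (vortexCutoff_le_one a r x))
      exact (mul_le_mul h3 h4 (abs_nonneg _) zero_le_one).trans (one_mul _).le
    · have h0 : Ω.indicator (1 : ℂ → ℝ) x + Ω.indicator (1 : ℂ → ℝ) (2 * a - x) - 1 = 0 := by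
        rcases lt_abs.1 (not_le.1 hxD) with h3 | h3
        · have m1 : x ∈ Ω := by
            by_contra hx
            linarith [h.upper x hx h2R]
          have m2 : 2 * a - x ∉ Ω := fun hx => by
            have := h.lower _ hx h2R'
            rw [hxa, norm_neg, inner_neg_right] at this
            linarith
          simp [m1, m2]
        · have m1 : x ∉ Ω := fun hx => by linarith [h.lower x hx h2R]
          have m2 : 2 * a - x ∈ Ω := by
            by_contra hx
            have := h.upper _ hx h2R'
            rw [hxa, norm_neg, inner_neg_right] at this
            linarith
          simp [m1, m2]
      rw [h0, zero_mul, norm_zero]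
      exact hnn

/-- The energy of the vortex field around a boundary point is half of the energy around an interior
point up to a convergent quantity. -/
lemma exists_tendsto_energy (h : IsPole Ω a e K R) (hK : 0 ≤ K) (hΩ : IsOpen Ω) (hr : 0 < r)
    (hR : 2 * r < R) : ∃ c, Tendsto (fun ρ => (∫ x in Ω ∩ {x : ℂ | ρ ≤ ‖x - a‖},
      vortexCutoff a r x ^ 2 * (‖x - a‖ ^ 2)⁻¹) - Real.pi * Real.log (1 / ρ)) (𝓝[>] 0) (𝓝 c) := by
  set g : ℂ → ℝ := fun x => vortexCutoff a r x ^ 2 * (‖x - a‖ ^ 2)⁻¹ with hg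
  set u : ℂ → ℝ := Ω.indicator 1 with hu
  have hdef := h.integrable_reflection_defect hK hΩ hr hR
  have hum : Measurable u := measurable_one.indicator hΩ.measurableSet
  have hub : ∀ x, ‖u x‖ ≤ 1 := fun x => by
    by_cases hx : x ∈ Ω <;> simp [hu, hx]
  have hneg : ∀ x : ℂ, 2 * a - x - a = -(x - a) := fun x => by ring
  have hgs : ∀ x, g (2 * a - x) = g x := fun x => by
    simp only [hg, vortexCutoff, hneg, norm_neg]
  have hA := measurableSet_le_norm_sub a
  -- `u = (1 + (u - u ∘ T)) / 2 + (u + u ∘ T - 1) / 2` for the reflection `T` at `a`, under which `g` is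
  -- invariant: half of the full energy plus half of the reflection defect
  have key : ∀ ρ, 0 < ρ → ρ ≤ r → (∫ x in Ω ∩ {x : ℂ | ρ ≤ ‖x - a‖}, g x) -
      Real.pi * Real.log (1 / ρ) = Real.pi * Real.log r + (∫ x in {x : ℂ | r ≤ ‖x - a‖}, g x) / 2 +
        (∫ x in {x : ℂ | ρ ≤ ‖x - a‖}, (u x + u (2 * a - x) - 1) * g x) / 2 := by
    intro ρ hρ hρr
    have hgi := integrableOn_cutoff_energy a hr hρ
    have hug : IntegrableOn (fun x => u x * g x) {x : ℂ | ρ ≤ ‖x - a‖} :=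
      Integrable.bdd_mul hgi hum.aestronglyMeasurable (ae_of_all _ hub)
    have hug' : IntegrableOn (fun x => u (2 * a - x) * g x) {x : ℂ | ρ ≤ ‖x - a‖} :=
      Integrable.bdd_mul hgi (hum.comp (by fun_prop)).aestronglyMeasurable
        (ae_of_all _ fun x => hub _)
    have e1 : ∫ x in Ω ∩ {x : ℂ | ρ ≤ ‖x - a‖}, g x =
        ∫ x in {x : ℂ | ρ ≤ ‖x - a‖}, u x * g x := by
      rw [inter_comm, ← setIntegral_indicator hΩ.measurableSet]
      refine integral_congr_ae (ae_of_all _ fun x => ?_)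
      by_cases hx : x ∈ Ω <;> simp [hu, hx]
    have e2 : ∫ x in {x : ℂ | ρ ≤ ‖x - a‖}, u (2 * a - x) * g x =
        ∫ x in {x : ℂ | ρ ≤ ‖x - a‖}, u x * g x := by
      rw [← integral_indicator (hA ρ), ← integral_indicator (hA ρ),
        ← integral_sub_left_eq_self _ volume (2 * a)]
      congr 1 with x
      by_cases hx : ρ ≤ ‖x - a‖
      · rw [indicator_of_mem (show 2 * a - x ∈ {x : ℂ | ρ ≤ ‖x - a‖} by
          rwa [mem_ofPred_eq, hneg, norm_neg]), indicator_of_mem (show x ∈ {x : ℂ | ρ ≤ ‖x - a‖} from hx),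
          hgs, sub_sub_cancel]
      · rw [indicator_of_notMem (show 2 * a - x ∉ {x : ℂ | ρ ≤ ‖x - a‖} by
          rwa [mem_ofPred_eq, hneg, norm_neg]),
          indicator_of_notMem (show x ∉ {x : ℂ | ρ ≤ ‖x - a‖} from hx)]
    have e3 : ∫ x in {x : ℂ | ρ ≤ ‖x - a‖}, (u x + u (2 * a - x) - 1) * g x =
        (∫ x in {x : ℂ | ρ ≤ ‖x - a‖}, u x * g x) + (∫ x in {x : ℂ | ρ ≤ ‖x - a‖},
          u (2 * a - x) * g x) - ∫ x in {x : ℂ | ρ ≤ ‖x - a‖}, g x := by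
      have hug2 : IntegrableOn (fun x => u x * g x + u (2 * a - x) * g x) {x : ℂ | ρ ≤ ‖x - a‖} :=
        hug.add hug'
      rw [← integral_add hug hug', ← integral_sub hug2 hgi]
      refine integral_congr_ae (ae_of_all _ fun x => ?_)
      simp only [hg]
      ring
    have e4 := integral_cutoff_energy a hr hρ hρr
    rw [e1, e3, e2]
    simp only [← hg] at e4
    rw [e4]
    ring
  refine ⟨Real.pi * Real.log r + (∫ x in {x : ℂ | r ≤ ‖x - a‖}, g x) / 2 +
    (∫ x, (u x + u (2 * a - x) - 1) * g x) / 2, ?_⟩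
  have hlim := tendsto_setIntegral_of_eventually_mem (S := fun ρ => {x : ℂ | ρ ≤ ‖x - a‖}) hA hdef
    (by
      have hne : ∀ᵐ x : ℂ, x ≠ a := by simp [ae_iff]
      filter_upwards [hne] with x hx
      have := norm_pos_iff.2 (sub_ne_zero.2 hx)
      filter_upwards [Ioo_mem_nhdsGT this] with ρ hρ using hρ.2.le)
  refine (tendsto_const_nhds.add (hlim.div_const 2)).congr' ?_
  filter_upwards [Ioc_mem_nhdsGT hr] with ρ hρ using (key ρ hρ.1 hρ.2).symm

end IsPole

/-! ### Orthogonality to the singular field -/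

lemma norm_sub_sq_eventually_le {a : ℂ} {δ : ℝ} (hδ : 0 < δ) : ∀ᶠ z in 𝓝 a, ‖z - a‖ ^ 2 ≤ δ := by
  have : Tendsto (fun z : ℂ => ‖z - a‖ ^ 2) (𝓝 a) (𝓝 0) := by
    have h : Continuous fun z : ℂ => ‖z - a‖ ^ 2 := by fun_prop
    simpa using h.tendsto a
  filter_upwards [this.eventually_lt_const hδ] with z hz using hz.le

/-- A radial multiple of the vortex field that vanishes at the center is smooth and divergence
free. -/
lemma contDiff_radial_smul {κ : ℝ → ℝ} (hκ : ContDiff ℝ ∞ κ) {δ : ℝ} (hδ : 0 < δ)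
    (h0 : ∀ t ≤ δ, κ t = 0) (a : ℂ) :
    ContDiff ℝ ∞ (fun z => κ (‖z - a‖ ^ 2) • vortexField a z) ∧
      ∀ x, divergence (fun z => κ (‖z - a‖ ^ 2) • vortexField a z) x = 0 := by
  have hz : (fun z => κ (‖z - a‖ ^ 2) • vortexField a z) =ᶠ[𝓝 a] fun _ => 0 := by
    filter_upwards [norm_sub_sq_eventually_le (a := a) hδ] with z hz
    rw [h0 _ hz, zero_smul]
  constructor
  · rw [contDiff_iff_contDiffAt]
    intro x
    rcases eq_or_ne x a with rfl | hx
    · exact contDiffAt_const.congr_of_eventuallyEq hz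
    · have h1 : ContDiff ℝ ∞ fun z : ℂ => κ (‖z - a‖ ^ 2) :=
        hκ.comp ((contDiff_id.sub contDiff_const).norm_sq ℝ)
      exact h1.contDiffAt.smul (contDiffAt_vortexField hx)
  · intro x
    rcases eq_or_ne x a with rfl | hx
    · rw [divergence, hz.fderiv_eq]
      simp
    · exact divergence_radial_smul hx (hκ.differentiable (by simp))

namespace IsSplitting

variable {N : ℕ} {Ω : Set ℂ} {a e : Fin N → ℂ} {d : Fin N → ℝ} {r : ℝ} {Q φ : ℂ → ℝ}

lemma two_mul_le_norm (h : IsSplitting Ω a e d r Q φ) {x : ℂ} {i j : Fin N} (hij : i ≠ j)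
    (hi : ‖x - a i‖ < 2 * r) : 2 * r ≤ ‖x - a j‖ := by
  have h1 := h.sep i j hij
  have h2 : ‖a i - a j‖ ≤ ‖x - a i‖ + ‖x - a j‖ := by
    have := norm_sub_le (x - a j) (x - a i)
    rw [sub_sub_sub_cancel_left] at this
    linarith
  linarith

lemma vortexCutoff_eq_zero_of_ne (h : IsSplitting Ω a e d r Q φ) {x : ℂ} {i j : Fin N} (hij : i ≠ j)
    (hi : ‖x - a i‖ < 2 * r) : vortexCutoff (a j) r x = 0 :=
  vortexCutoff_eq_zero h.r_pos (h.two_mul_le_norm hij hi)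

lemma norm_singularField_sq (h : IsSplitting Ω a e d r Q φ) (x : ℂ) :
    ‖singularField a d r x‖ ^ 2 = ∑ j, vortexCutoff (a j) r x ^ 2 * (‖x - a j‖ ^ 2)⁻¹ := by
  by_cases hx : ∃ i, ‖x - a i‖ < 2 * r
  · obtain ⟨i, hi⟩ := hx
    rw [singularField, Finset.sum_eq_single i, Finset.sum_eq_single i]
    · rw [norm_smul, norm_smul, norm_vortexField, Real.norm_eq_abs, h.abs_d, one_mul, mul_pow,
        Real.norm_eq_abs, sq_abs, inv_pow]
    · intro j _ hj
      rw [h.vortexCutoff_eq_zero_of_ne hj.symm hi]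
      ring
    · simp
    · intro j _ hj
      rw [h.vortexCutoff_eq_zero_of_ne hj.symm hi, zero_smul, smul_zero]
    · simp
  · push Not at hx
    have h0 := fun j => vortexCutoff_eq_zero h.r_pos (hx j)
    simp [singularField, h0]

lemma measurable_singularField : Measurable (singularField a d r) :=
  Finset.measurable_sum _ fun j _ =>
    ((contDiff_vortexCutoff (a j) r).continuous.measurable.smul (by
      unfold vortexField
      fun_prop)).const_smul (d j)

lemma norm_singularField_le (h : IsSplitting Ω a e d r Q φ) (x : ℂ) :
    ‖singularField a d r x‖ ≤ ∑ j, vortexCutoff (a j) r x * ‖x - a j‖⁻¹ := by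
  refine (norm_sum_le _ _).trans (Finset.sum_le_sum fun j _ => ?_)
  rw [norm_smul, norm_smul, norm_vortexField, Real.norm_eq_abs, h.abs_d, one_mul, Real.norm_eq_abs,
    abs_of_nonneg (vortexCutoff_nonneg _ _ _)]

lemma memLp_singularField (h : IsSplitting Ω a e d r Q φ) {ρ : ℝ} (hρ : 0 < ρ) :
    MemLp (singularField a d r) 2 (volume.restrict (perforated Ω a ρ)) := by
  have : IsFiniteMeasure (volume.restrict (perforated Ω a ρ)) :=
    ⟨by simpa using (h.bounded.subset (perforated_subset Ω a ρ)).measure_lt_top⟩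
  refine MemLp.of_bound measurable_singularField.aestronglyMeasurable (∑ _j : Fin N, 1 * ρ⁻¹)
    ((ae_restrict_iff' (measurableSet_perforated h.isOpen a ρ)).2 (ae_of_all _ fun x hx => ?_))
  refine (h.norm_singularField_le x).trans (Finset.sum_le_sum fun j _ => ?_)
  have := (mem_perforated.1 hx).2 j
  gcongr
  exact vortexCutoff_le_one _ _ _

/-- The renormalized energy of the singular field. -/
lemma exists_tendsto_singular_energy (h : IsSplitting Ω a e d r Q φ) :
    ∃ c, Tendsto (fun ρ => (∫ x in perforated Ω a ρ, ‖singularField a d r x‖ ^ 2) -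
      Real.pi * N * Real.log (1 / ρ)) (𝓝[>] 0) (𝓝 c) := by
  have hj : ∀ j, ∃ c, Tendsto (fun ρ => (∫ x in Ω ∩ {x : ℂ | ρ ≤ ‖x - a j‖},
      vortexCutoff (a j) r x ^ 2 * (‖x - a j‖ ^ 2)⁻¹) - Real.pi * Real.log (1 / ρ))
      (𝓝[>] 0) (𝓝 c) := fun j => by
    obtain ⟨K, R, hK, hR, hp⟩ := h.pole j
    exact hp.exists_tendsto_energy hK h.isOpen h.r_pos hR
  choose c hc using hj
  refine ⟨∑ j, c j, (tendsto_finsetSum Finset.univ fun j _ => hc j).congr' ?_⟩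
  filter_upwards [Ioc_mem_nhdsGT (show 0 < 2 * r by linarith [h.r_pos])] with ρ hρ
  have e1 : ∀ j, ∫ x in Ω ∩ {x : ℂ | ρ ≤ ‖x - a j‖}, vortexCutoff (a j) r x ^ 2 *
      (‖x - a j‖ ^ 2)⁻¹ = ∫ x in perforated Ω a ρ, vortexCutoff (a j) r x ^ 2 *
      (‖x - a j‖ ^ 2)⁻¹ := fun j => by
    refine setIntegral_eq_of_subset_of_forall_sdiff_eq_zero
      (h.isOpen.measurableSet.inter (measurableSet_le_norm_sub (a j) ρ))
      (fun x hx => ⟨(mem_perforated.1 hx).1, (mem_perforated.1 hx).2 j⟩) fun x hx => ?_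
    obtain ⟨⟨hxΩ, hxj⟩, hxp⟩ := hx
    have : ∃ i, ‖x - a i‖ < ρ := by
      by_contra! hall
      exact hxp (mem_perforated.2 ⟨hxΩ, hall⟩)
    obtain ⟨i, hi⟩ := this
    have hij : i ≠ j := fun hij => absurd hi (not_lt.2 (hij ▸ hxj))
    rw [h.vortexCutoff_eq_zero_of_ne hij (hi.trans_le hρ.2)]
    ring
  have hint : ∀ j, IntegrableOn (fun x => vortexCutoff (a j) r x ^ 2 * (‖x - a j‖ ^ 2)⁻¹)
      (perforated Ω a ρ) := fun j =>
    (integrableOn_cutoff_energy (a j) h.r_pos hρ.1).mono_set fun x hx => (mem_perforated.1 hx).2 j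
  simp_rw [h.norm_singularField_sq, e1]
  rw [integral_finsetSum _ fun j _ => hint j, Finset.sum_sub_distrib]
  simp
  ring

/-- The vortex fields carry no energy product with functions vanishing at the boundary, since they
are tangential to the circles around the poles. -/
lemma integral_inner_singularField_eq_zero (h : IsSplitting Ω a e d r Q φ) {f : ℂ → ℝ} {g : ℂ → ℂ}
    (hz : ZeroTrace Ω a f g) (hf : ∀ ρ > 0, MemLp f 2 (volume.restrict (perforated Ω a ρ)))
    (hg : ∀ ρ > 0, MemLp g 2 (volume.restrict (perforated Ω a ρ))) {ρ : ℝ} (hρ : 0 < ρ)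
    (hρr : ρ ≤ 2 * r) : ∫ x in perforated Ω a ρ, inner ℝ (g x) (singularField a d r x) = 0 := by
  have hr := h.r_pos
  -- smooth approximations of the indicator function of `[ρ², ∞)`, multiplied by the cutoff
  set ε : ℕ → ℝ := fun n => ρ ^ 2 / 2 * (1 / ((n : ℝ) + 1)) with hε
  have hε0 : ∀ n, 0 < ε n := fun n => by positivity
  have hε1 : ∀ n, ε n ≤ ρ ^ 2 / 2 := fun n => by
    have : 1 / ((n : ℝ) + 1) ≤ 1 := by
      rw [div_le_one (by positivity)]
      linarith [n.cast_nonneg (α := ℝ)]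
    exact mul_le_of_le_one_right (by positivity) this
  have hεlim : Tendsto ε atTop (𝓝 0) := by
    simpa [hε] using (tendsto_one_div_add_atTop_nhds_zero_nat (𝕜 := ℝ)).const_mul (ρ ^ 2 / 2)
  set κ : ℕ → ℝ → ℝ := fun n t => Real.smoothTransition (2 - t / r ^ 2) *
    Real.smoothTransition ((t - ρ ^ 2) / ε n + 1) with hκ
  have hκs : ∀ n, ContDiff ℝ ∞ (κ n) := fun n => by
    have h1 : ContDiff ℝ ∞ fun t : ℝ => Real.smoothTransition (2 - t / r ^ 2) :=
      Real.smoothTransition.contDiff.comp (by fun_prop)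
    have h2 : ContDiff ℝ ∞ fun t : ℝ => Real.smoothTransition ((t - ρ ^ 2) / ε n + 1) :=
      Real.smoothTransition.contDiff.comp (by fun_prop)
    exact h1.mul h2
  have hκz : ∀ n t, t ≤ ρ ^ 2 - ε n → κ n t = 0 := fun n t ht => by
    have : (t - ρ ^ 2) / ε n + 1 ≤ 0 := by
      rw [div_add_one (hε0 n).ne']
      exact div_nonpos_of_nonpos_of_nonneg (by linarith) (hε0 n).le
    simp only [hκ, Real.smoothTransition.zero_of_nonpos this, mul_zero]
  have hκ0 : ∀ n, ∀ t ≤ ρ ^ 2 / 4, κ n t = 0 := fun n t ht =>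
    hκz n t (by have := hε1 n; nlinarith)
  have hκle : ∀ n t, |κ n t| ≤ 1 := fun n t => by
    rw [abs_of_nonneg (mul_nonneg (Real.smoothTransition.nonneg _) (Real.smoothTransition.nonneg _))]
    exact mul_le_one₀ (Real.smoothTransition.le_one _) (Real.smoothTransition.nonneg _)
      (Real.smoothTransition.le_one _)
  have hκfar : ∀ n j x, 2 * r ≤ ‖x - a j‖ → κ n (‖x - a j‖ ^ 2) = 0 := fun n j x hx => by
    have : vortexCutoff (a j) r x = 0 := vortexCutoff_eq_zero hr hx
    rw [vortexCutoff] at this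
    simp only [hκ, this, zero_mul]
  set Φ : ℕ → ℂ → ℂ := fun n x => ∑ j, d j • (κ n (‖x - a j‖ ^ 2) • vortexField (a j) x) with hΦ
  have hsm := fun n j => contDiff_radial_smul (hκs n) (show 0 < ρ ^ 2 / 4 by positivity) (hκ0 n) (a j)
  have hΦs : ∀ n, ContDiff ℝ ∞ (Φ n) := fun n =>
    ContDiff.sum fun j _ => (hsm n j).1.const_smul (d j)
  have hΦd : ∀ n x, divergence (Φ n) x = 0 := fun n x => by
    have := divergence_sum Finset.univ (X := fun j x =>
      d j • (κ n (‖x - a j‖ ^ 2) • vortexField (a j) x)) (fun j =>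
        ((hsm n j).1.const_smul (d j)).differentiable (by simp)) x
    refine this.trans (Finset.sum_eq_zero fun j _ => ?_)
    have h1 := divergence_smul (differentiableAt_const (d j)) ((hsm n j).1.differentiable (by simp) x)
    have h2 : gradient (fun _ : ℂ => d j) x = 0 := gradient_const x (d j)
    rw [h1, h2, (hsm n j).2 x]
    simp
  -- the fields vanish close to the poles
  have hΦnear : ∀ n j x, ‖x - a j‖ < ρ / 2 → Φ n x = 0 := fun n j x hx => by
    refine Finset.sum_eq_zero fun i _ => ?_
    rcases eq_or_ne j i with rfl | hij
    · rw [hκ0 n _ (by nlinarith [norm_nonneg (x - a j)]), zero_smul, smul_zero]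
    · rw [hκfar n i x (h.two_mul_le_norm hij (by linarith)), zero_smul, smul_zero]
  have hΦa : ∀ n j, a j ∉ tsupport (Φ n) := fun n j => by
    rw [notMem_tsupport_iff_eventuallyEq]
    filter_upwards [Metric.ball_mem_nhds (a j) (show 0 < ρ / 2 by positivity)] with x hx
    exact hΦnear n j x (by simpa [dist_eq_norm] using hx)
  have hΦc : ∀ n, HasCompactSupport (Φ n) := fun n => by
    have hK : IsCompact (⋃ j, Metric.closedBall (a j) (2 * r)) :=
      isCompact_iUnion fun j => isCompact_closedBall _ _
    refine HasCompactSupport.intro hK fun x hx => Finset.sum_eq_zero fun j _ => ?_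
    rw [hκfar n j x, zero_smul, smul_zero]
    by_contra! hlt
    exact hx (mem_iUnion.2 ⟨j, by simpa [dist_eq_norm] using hlt.le⟩)
  have hzero : ∀ n, ∫ x in perforated Ω a (ρ / 2), inner ℝ (g x) (Φ n x) = 0 := fun n => by
    have := hz.integral_divergence_eq_zero h.isOpen hf hg (hΦs n) (hΦc n) (hΦa n)
    simp only [hΦd, mul_zero, zero_add] at this
    rw [← this]
    refine (setIntegral_eq_of_subset_of_forall_sdiff_eq_zero h.isOpen.measurableSet
      (perforated_subset Ω a _) fun x hx => ?_).symm
    have : ∃ i, ‖x - a i‖ < ρ / 2 := by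
      by_contra! hall
      exact hx.2 (mem_perforated.2 ⟨hx.1, hall⟩)
    obtain ⟨i, hi⟩ := this
    rw [hΦnear n i x hi, inner_zero_right]
  have hm := measurableSet_perforated h.isOpen a ρ
  have hsub : perforated Ω a ρ ⊆ perforated Ω a (ρ / 2) := fun x hx =>
    mem_perforated.2 ⟨(mem_perforated.1 hx).1, fun j => by linarith [(mem_perforated.1 hx).2 j]⟩
  have hfin : IsFiniteMeasure (volume.restrict (perforated Ω a (ρ / 2))) :=
    ⟨by simpa using (h.bounded.subset (perforated_subset Ω a _)).measure_lt_top⟩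
  have hgρ := hg (ρ / 2) (by positivity)
  have hlim : Tendsto (fun n => ∫ x in perforated Ω a (ρ / 2), inner ℝ (g x) (Φ n x)) atTop
      (𝓝 (∫ x in perforated Ω a (ρ / 2), (perforated Ω a ρ).indicator
        (fun x => inner ℝ (g x) (singularField a d r x)) x)) := by
    refine tendsto_integral_of_dominated_convergence
      (fun x => ‖g x‖ * ∑ _j : Fin N, (ρ / 2)⁻¹)
      (fun n => hgρ.1.inner (hΦs n).continuous.aestronglyMeasurable)
      ((hgρ.integrable (by norm_num)).norm.mul_const _) (fun n => ?_) ?_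
    · refine (ae_restrict_iff' (measurableSet_perforated h.isOpen a _)).2
        (ae_of_all _ fun x hx => (norm_inner_le_norm _ _).trans ?_)
      gcongr
      refine (norm_sum_le _ _).trans (Finset.sum_le_sum fun j _ => ?_)
      rw [norm_smul, norm_smul, norm_vortexField, Real.norm_eq_abs, h.abs_d, one_mul]
      have hxj := (mem_perforated.1 hx).2 j
      calc ‖κ n (‖x - a j‖ ^ 2)‖ * ‖x - a j‖⁻¹ ≤ 1 * (ρ / 2)⁻¹ := by
            gcongr
            exact hκle _ _
        _ = _ := one_mul _
    · refine (ae_restrict_iff' (measurableSet_perforated h.isOpen a _)).2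
        (ae_of_all _ fun x hx => ?_)
      by_cases hxρ : x ∈ perforated Ω a ρ
      · rw [indicator_of_mem hxρ]
        have : ∀ n, Φ n x = singularField a d r x := fun n => by
          refine Finset.sum_congr rfl fun j _ => ?_
          have hxj := (mem_perforated.1 hxρ).2 j
          have h1 : 1 ≤ (‖x - a j‖ ^ 2 - ρ ^ 2) / ε n + 1 := by
            have : 0 ≤ (‖x - a j‖ ^ 2 - ρ ^ 2) / ε n :=
              div_nonneg (by nlinarith) (hε0 n).le
            linarith
          simp only [hκ, Real.smoothTransition.one_of_one_le h1, mul_one]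
          rfl
        simp only [this]
        exact tendsto_const_nhds
      · rw [indicator_of_notMem hxρ]
        have : ∃ i, ‖x - a i‖ < ρ := by
          by_contra! hall
          exact hxρ (mem_perforated.2 ⟨(mem_perforated.1 hx).1, hall⟩)
        obtain ⟨i, hi⟩ := this
        refine tendsto_const_nhds.congr' ?_
        have hlt : 0 < ρ ^ 2 - ‖x - a i‖ ^ 2 := by nlinarith [norm_nonneg (x - a i)]
        filter_upwards [hεlim.eventually_lt_const hlt] with n hn
        have : Φ n x = 0 := by
          refine Finset.sum_eq_zero fun j _ => ?_
          rcases eq_or_ne i j with rfl | hij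
          · rw [hκz n _ (by linarith), zero_smul, smul_zero]
          · rw [hκfar n j x (h.two_mul_le_norm hij (by linarith)), zero_smul, smul_zero]
        rw [this, inner_zero_right]
  simp_rw [hzero] at hlim
  rw [setIntegral_indicator hm, inter_eq_self_of_subset_right hsub] at hlim
  exact (tendsto_nhds_unique hlim tendsto_const_nhds)

/-- The product of the singular field with a bounded field is integrable. -/
lemma integrable_inner_regularField (h : IsSplitting Ω a e d r Q φ) :
    IntegrableOn (fun x => inner ℝ (regularField a e d r Q x) (singularField a d r x)) Ω := by
  obtain ⟨C, hC⟩ := h.exists_regularField_bound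
  have hj : ∀ j, Integrable fun x => vortexCutoff (a j) r x * ‖x - a j‖⁻¹ := fun j => by
    refine ((integrable_norm_inv (2 * r)).comp_sub_right (a j)).mono' ?_ (ae_of_all _ fun x => ?_)
    · exact ((contDiff_vortexCutoff (a j) r).continuous.measurable.mul
        (by fun_prop)).aestronglyMeasurable
    · rcases le_or_gt (2 * r) ‖x - a j‖ with hx | hx
      · rw [vortexCutoff_eq_zero h.r_pos hx, zero_mul, norm_zero]
        exact indicator_nonneg (fun _ _ => by positivity) _
      · rw [indicator_of_mem (show x - a j ∈ {w : ℂ | ‖w‖ < 2 * r} from hx), norm_mul,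
          Real.norm_eq_abs, abs_of_nonneg (vortexCutoff_nonneg _ _ _), norm_inv, norm_norm]
        exact mul_le_of_le_one_left (by positivity) (vortexCutoff_le_one _ _ _)
  refine Integrable.mono' (((integrable_finsetSum Finset.univ fun j _ => hj j).const_mul C).restrict)
    (measurable_regularField.inner measurable_singularField).aestronglyMeasurable
    (ae_of_all _ fun x => (norm_inner_le_norm _ _).trans ?_)
  exact mul_le_mul (hC x) (h.norm_singularField_le x) (norm_nonneg _) ((norm_nonneg _).trans (hC x))

end IsSplitting

/-! ### The excess energy -/

lemma MemH10.exists_tendsto {Ω : Set ℂ} {σ : ℂ → ℝ} (h : MemH10 Ω σ) :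
    ∃ ζ : ℕ → ℂ → ℝ, (∀ n, IsTest Ω (ζ n)) ∧
      Tendsto (fun n => eLpNorm (fun x => ζ n x - σ x) 2 (volume.restrict Ω)) atTop (𝓝 0) ∧
      Tendsto (fun n => eLpNorm (fun x => gradient (ζ n) x - weakGrad Ω σ x) 2
        (volume.restrict Ω)) atTop (𝓝 0) := by
  obtain ⟨-, -, -, ζ, h1, h2, h3⟩ := h
  have e1 : ∀ n, eLpNorm (fun x => σ x - ζ n x) 2 (volume.restrict Ω) =
      eLpNorm (fun x => ζ n x - σ x) 2 (volume.restrict Ω) := fun n =>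
    eLpNorm_sub_comm σ (ζ n) 2 _
  have e2 : ∀ n, eLpNorm (fun x => weakGrad Ω σ x - gradient (ζ n) x) 2 (volume.restrict Ω) =
      eLpNorm (fun x => gradient (ζ n) x - weakGrad Ω σ x) 2 (volume.restrict Ω) := fun n =>
    eLpNorm_sub_comm (weakGrad Ω σ) (gradient (ζ n)) 2 _
  simp_rw [e1] at h2
  simp_rw [e2] at h3
  exact ⟨ζ, h1, h2, h3⟩

lemma memH10_zero {Ω : Set ℂ} (hΩ : IsOpen Ω) : MemH10 Ω fun _ => 0 := by
  have hg0 : ∀ x : ℂ, gradient (fun _ : ℂ => (0 : ℝ)) x = 0 := fun x => gradient_const x 0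
  have hw : HasWeakGrad Ω (fun _ => 0) (gradient fun _ : ℂ => (0 : ℝ)) :=
    hasWeakGrad_of_locallyLipschitzOn hΩ (LocallyLipschitz.const (0 : ℝ)).locallyLipschitzOn
  have hg : MemLp (gradient fun _ : ℂ => (0 : ℝ)) 2 (volume.restrict Ω) := by
    rw [show (gradient fun _ : ℂ => (0 : ℝ)) = fun _ => 0 from funext hg0]
    exact MemLp.zero
  exact memH10_of_tendsto hΩ hw MemLp.zero hg (z := fun _ _ => 0) (fun _ => isTest_zero Ω)
    (by simp) (by simp)

/-- For test functions this is integration by parts, and both terms pass to the limit in `H¹`. -/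
lemma MemH10.zeroTrace {N : ℕ} {Ω : Set ℂ} (hΩ : IsOpen Ω) (a : Fin N → ℂ) {σ : ℂ → ℝ}
    (h : MemH10 Ω σ) : ZeroTrace Ω a σ (weakGrad Ω σ) := by
  intro ζ hζ hc _ v
  obtain ⟨z, hz, h1, h2⟩ := h.exists_tendsto
  have hd : MemLp (fun x => fderiv ℝ ζ x v) 2 (volume.restrict Ω) :=
    ((hζ.continuous_fderiv (by simp)).clm_apply continuous_const).memLp_of_hasCompactSupport
      (hc.fderiv_apply ℝ v)
  have hv : MemLp (fun x => ζ x • v) 2 (volume.restrict Ω) :=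
    (hζ.continuous.smul continuous_const).memLp_of_hasCompactSupport
      (hc.mono fun x hx hx0 => hx (show ζ x • v = 0 by rw [show ζ x = 0 from hx0, zero_smul]))
  have l1 := tendsto_integral_inner (fun n => (hz n).memLp _) h.2.1 hd h1
  have l2 := tendsto_integral_inner (fun n => (hz n).memLp_gradient _) h.memLp_weakGrad hv h2
  have hzero : ∀ n, (∫ x in Ω, inner ℝ (z n x) (fderiv ℝ ζ x v)) +
      ∫ x in Ω, inner ℝ (gradient (z n) x) (ζ x • v) = 0 := fun n => by
    have := (integral_mul_fderiv_add hΩ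
      ((hζ.of_le (by simp)).contDiffOn.locallyLipschitzOn_of_isOpen hΩ)
      (((hz n).1.of_le (by simp)).contDiffOn.locallyLipschitzOn_of_isOpen hΩ) (hz n).2.1
      (hz n).2.2 v).2.2
    have e1 : ∫ x in Ω, inner ℝ (z n x) (fderiv ℝ ζ x v) = ∫ x in Ω, z n x * fderiv ℝ ζ x v :=
      integral_congr_ae (ae_of_all _ fun x => mul_comm _ _)
    have e2 : ∫ x in Ω, inner ℝ (gradient (z n) x) (ζ x • v) =
        ∫ x in Ω, ζ x * fderiv ℝ (z n) x v :=
      integral_congr_ae (ae_of_all _ fun x => by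
        simp only [real_inner_smul_right, inner_gradient])
    rw [e1, e2, this, add_neg_cancel]
  have hlim := l1.add l2
  simp_rw [hzero] at hlim
  have h0 := tendsto_nhds_unique hlim tendsto_const_nhds
  rw [← integral_add (integrable_inner_of_memLp h.2.1 hd)
    (integrable_inner_of_memLp h.memLp_weakGrad hv)] at h0
  rw [← h0]
  refine integral_congr_ae (ae_of_all _ fun x => ?_)
  simp only [real_inner_smul_right, mul_comm (ζ x)]
  rw [mul_comm (σ x)]
  rfl

lemma tendsto_integral_perforated {N : ℕ} {Ω : Set ℂ} {a : Fin N → ℂ}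
    (ha : ∀ j, a j ∉ Ω) (hΩ : IsOpen Ω) {f : ℂ → ℝ} (hf : IntegrableOn f Ω) :
    Tendsto (fun ρ => ∫ x in perforated Ω a ρ, f x) (𝓝[>] 0) (𝓝 (∫ x in Ω, f x)) := by
  have hS : ∀ ρ : ℝ, MeasurableSet {x : ℂ | ∀ j, ρ ≤ ‖x - a j‖} := fun ρ => by
    simp only [ofPred_forall]
    exact MeasurableSet.iInter fun j => measurableSet_le_norm_sub (a j) ρ
  have hlim := tendsto_setIntegral_of_eventually_mem hS hf
    ((ae_restrict_iff' hΩ.measurableSet).2 (ae_of_all _ fun x hx => by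
      have hj : ∀ j, ∀ᶠ ρ in 𝓝[>] (0 : ℝ), ρ ≤ ‖x - a j‖ := fun j => by
        have := norm_pos_iff.2 (sub_ne_zero.2 fun h : x = a j => ha j (h ▸ hx))
        filter_upwards [Ioo_mem_nhdsGT this] with ρ hρ using hρ.2.le
      exact eventually_all.2 hj))
  refine hlim.congr fun ρ => ?_
  rw [Measure.restrict_restrict (hS ρ)]
  congr 2
  ext x
  simp only [mem_inter_iff, mem_ofPred_eq, mem_perforated, and_comm]

/-- `∫_{Ω \ ⋃ B_ρ(a_j)} (|V|² + 2 B · V) - π N log (1/ρ)` for the singular part `V` and the bounded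
part `B` of the gradient of the model. -/
def modelExcess {N : ℕ} (Ω : Set ℂ) (a e : Fin N → ℂ) (d : Fin N → ℝ) (r : ℝ) (Q : ℂ → ℝ)
    (ρ : ℝ) : ℝ :=
  (∫ x in perforated Ω a ρ, ‖singularField a d r x‖ ^ 2) - Real.pi * N * Real.log (1 / ρ) +
    2 * ∫ x in perforated Ω a ρ, inner ℝ (regularField a e d r Q x) (singularField a d r x)

namespace IsSplitting

variable {N : ℕ} {Ω : Set ℂ} {a e : Fin N → ℂ} {d : Fin N → ℝ} {r : ℝ} {Q φ : ℂ → ℝ}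

lemma exists_tendsto_modelExcess (h : IsSplitting Ω a e d r Q φ) :
    ∃ c, Tendsto (modelExcess Ω a e d r Q) (𝓝[>] 0) (𝓝 c) := by
  obtain ⟨c, hc⟩ := h.exists_tendsto_singular_energy
  exact ⟨_, hc.add ((tendsto_integral_perforated h.notMem h.isOpen
    h.integrable_inner_regularField).const_mul 2)⟩

lemma hasWeakGrad (h : IsSplitting Ω a e d r Q φ) : HasWeakGrad Ω φ (gradient φ) :=
  hasWeakGrad_of_locallyLipschitzOn h.isOpen h.locallyLipschitzOn

lemma memLp (h : IsSplitting Ω a e d r Q φ) : MemLp φ 2 (volume.restrict Ω) := by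
  have := h.isFiniteMeasure
  obtain ⟨C, hC⟩ := h.bound
  exact MemLp.of_bound (h.locallyLipschitzOn.continuousOn.aestronglyMeasurable
    h.isOpen.measurableSet) C
    ((ae_restrict_iff' h.isOpen.measurableSet).2 (ae_of_all _ fun x hx => hC x hx))

lemma memLp_gradient (h : IsSplitting Ω a e d r Q φ) {ρ : ℝ} (hρ : 0 < ρ) :
    MemLp (gradient φ) 2 (volume.restrict (perforated Ω a ρ)) :=
  ((h.memLp_sub_singularField.restrict_perforated ρ).add (h.memLp_singularField hρ)).ae_eq
    (ae_of_all _ fun _ => sub_add_cancel _ _)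

/-- The excess energy of `φ + σ` for a perturbation `σ` with zero boundary values: the singular
field only interacts with the bounded part of the gradient of the model. -/
lemma excessEnergy_add (h : IsSplitting Ω a e d r Q φ) {σ : ℂ → ℝ} {g : ℂ → ℂ}
    (hw : HasWeakGrad Ω σ g) (hz : ZeroTrace Ω a σ g)
    (hσ : ∀ ρ > 0, MemLp σ 2 (volume.restrict (perforated Ω a ρ)))
    (hg : ∀ ρ > 0, MemLp g 2 (volume.restrict (perforated Ω a ρ))) {ρ : ℝ} (hρ : 0 < ρ)
    (hρr : ρ ≤ 2 * r) : excessEnergy Ω a (fun x => φ x + σ x) ρ =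
      (∫ x in perforated Ω a ρ, ‖gradient φ x - singularField a d r x + g x‖ ^ 2) +
        modelExcess Ω a e d r Q ρ := by
  have hm := measurableSet_perforated h.isOpen a ρ
  have hsub := perforated_subset Ω a ρ
  have hV := h.memLp_singularField hρ
  have hZg : MemLp (fun x => gradient φ x - singularField a d r x + g x) 2
      (volume.restrict (perforated Ω a ρ)) :=
    (h.memLp_sub_singularField.restrict_perforated ρ).add (hg ρ hρ)
  set w : ℂ → ℝ := fun x => φ x - phaseModel a e d r Q x with hwdef
  have hwg : ∀ ρ > 0, MemLp (gradient w) 2 (volume.restrict (perforated Ω a ρ)) := fun ρ _ =>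
    h.memLp_gradient_remainder.restrict_perforated ρ
  have o1 := h.integral_inner_singularField_eq_zero hz hσ hg hρ hρr
  have o2 := h.integral_inner_singularField_eq_zero h.zeroTrace_remainder
    (fun ρ _ => h.memLp_remainder.restrict_perforated ρ) hwg hρ hρr
  have hB := h.integrable_inner_regularField.mono_set hsub
  have e1 : ∫ x in perforated Ω a ρ, inner ℝ (gradient φ x - singularField a d r x + g x)
      (singularField a d r x) = ∫ x in perforated Ω a ρ,
        inner ℝ (regularField a e d r Q x) (singularField a d r x) := by
    have i1 := integrable_inner_of_memLp (hwg ρ hρ) hV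
    have i2 := integrable_inner_of_memLp (hg ρ hρ) hV
    have hae : ∀ᵐ x ∂volume.restrict (perforated Ω a ρ),
        inner ℝ (gradient φ x - singularField a d r x + g x) (singularField a d r x) =
        (inner ℝ (gradient w x) (singularField a d r x) + inner ℝ (g x) (singularField a d r x)) +
          inner ℝ (regularField a e d r Q x) (singularField a d r x) := by
      filter_upwards [ae_restrict_of_ae h.ae_gradient_remainder, ae_restrict_mem hm] with x hx hxp
      rw [hx (hsub hxp), inner_add_left, inner_add_left]
      ring
    have i12 : Integrable (fun x => inner ℝ (gradient w x) (singularField a d r x) +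
      inner ℝ (g x) (singularField a d r x)) (volume.restrict (perforated Ω a ρ)) := i1.add i2
    rw [integral_congr_ae hae, integral_add i12 hB, integral_add i1 i2, o1, o2]
    simp
  have e2 : ∫ x in perforated Ω a ρ, ‖weakGrad Ω (fun x => φ x + σ x) x‖ ^ 2 =
      (∫ x in perforated Ω a ρ, ‖gradient φ x - singularField a d r x + g x‖ ^ 2) +
        2 * (∫ x in perforated Ω a ρ, inner ℝ (gradient φ x - singularField a d r x + g x)
          (singularField a d r x)) + ∫ x in perforated Ω a ρ, ‖singularField a d r x‖ ^ 2 := by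
    have hwk := (h.hasWeakGrad.add h.isOpen hw).weakGrad_ae_eq h.isOpen
    have i1 := integrable_norm_sq_of_memLp hZg
    have i2 := (integrable_inner_of_memLp hZg hV).const_mul 2
    have i3 := integrable_norm_sq_of_memLp hV
    have i12 : Integrable (fun x => ‖gradient φ x - singularField a d r x + g x‖ ^ 2 +
      2 * inner ℝ (gradient φ x - singularField a d r x + g x) (singularField a d r x))
      (volume.restrict (perforated Ω a ρ)) := i1.add i2
    rw [← integral_const_mul, ← integral_add i1 i2, ← integral_add i12 i3]
    refine integral_congr_ae ?_
    filter_upwards [ae_restrict_of_ae_restrict_of_subset hsub hwk] with x hx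
    rw [hx, ← norm_add_sq_real]
    congr 2
    abel
  rw [excessEnergy, modelExcess, e2, e1]
  ring

/-- The field `∇φ - V` is orthogonal to the gradients of functions in `H¹₀(Ω)`. -/
lemma integral_inner_weakGrad_eq_zero (h : IsSplitting Ω a e d r Q φ) {σ : ℂ → ℝ}
    (hσ : MemH10 Ω σ) :
    ∫ x in Ω, inner ℝ (weakGrad Ω σ x) (gradient φ x - singularField a d r x) = 0 := by
  obtain ⟨z, hz, -, h2⟩ := hσ.exists_tendsto
  have hlim := tendsto_integral_inner (fun n => (hz n).memLp_gradient _) hσ.memLp_weakGrad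
    h.memLp_sub_singularField h2
  refine tendsto_nhds_unique hlim (tendsto_const_nhds.congr fun n => ?_)
  rw [← (h.orthogonal (((hz n).1.of_le (by simp)).contDiffOn.locallyLipschitzOn_of_isOpen h.isOpen)
    (hz n).2.1 (hz n).2.2).2]
  exact integral_congr_ae (ae_of_all _ fun x => real_inner_comm _ _)

/-- The renormalized energy of `φ + σ`. -/
lemma exists_tendsto_excessEnergy (h : IsSplitting Ω a e d r Q φ) :
    ∃ W₀, Tendsto (excessEnergy Ω a φ) (𝓝[>] 0) (𝓝 W₀) ∧ ∀ σ, MemH10 Ω σ →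
      Tendsto (excessEnergy Ω a fun x => φ x + σ x) (𝓝[>] 0)
        (𝓝 (W₀ + ∫ x in Ω, ‖weakGrad Ω σ x‖ ^ 2)) := by
  obtain ⟨c, hc⟩ := h.exists_tendsto_modelExcess
  have hZ := h.memLp_sub_singularField
  have key : ∀ σ, MemH10 Ω σ → Tendsto (excessEnergy Ω a fun x => φ x + σ x) (𝓝[>] 0)
      (𝓝 ((∫ x in Ω, ‖gradient φ x - singularField a d r x‖ ^ 2) + c +
        ∫ x in Ω, ‖weakGrad Ω σ x‖ ^ 2)) := fun σ hσ => by
    have hg := hσ.memLp_weakGrad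
    have hZg : MemLp (fun x => gradient φ x - singularField a d r x + weakGrad Ω σ x) 2
      (volume.restrict Ω) := hZ.add hg
    have hlim := (tendsto_integral_perforated h.notMem h.isOpen
      (integrable_norm_sq_of_memLp hZg)).add hc
    have e1 : ∫ x in Ω, ‖gradient φ x - singularField a d r x + weakGrad Ω σ x‖ ^ 2 =
        (∫ x in Ω, ‖gradient φ x - singularField a d r x‖ ^ 2) +
          ∫ x in Ω, ‖weakGrad Ω σ x‖ ^ 2 := by
      have i1 := integrable_norm_sq_of_memLp hZ
      have i2 := (integrable_inner_of_memLp hg hZ).const_mul 2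
      have i3 := integrable_norm_sq_of_memLp hg
      have i12 : Integrable (fun x => ‖gradient φ x - singularField a d r x‖ ^ 2 +
        2 * inner ℝ (weakGrad Ω σ x) (gradient φ x - singularField a d r x))
        (volume.restrict Ω) := i1.add i2
      have h0 := h.integral_inner_weakGrad_eq_zero hσ
      calc ∫ x in Ω, ‖gradient φ x - singularField a d r x + weakGrad Ω σ x‖ ^ 2
          = ∫ x in Ω, (‖gradient φ x - singularField a d r x‖ ^ 2 +
            2 * inner ℝ (weakGrad Ω σ x) (gradient φ x - singularField a d r x) +
            ‖weakGrad Ω σ x‖ ^ 2) := by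
            refine integral_congr_ae (ae_of_all _ fun x => ?_)
            simp only [norm_add_sq_real]
            rw [real_inner_comm]
        _ = _ := by
            rw [integral_add i12 i3, integral_add i1 i2, integral_const_mul 2, h0]
            ring
    rw [e1] at hlim
    have e2 : (∫ x in Ω, ‖gradient φ x - singularField a d r x‖ ^ 2) + c +
        ∫ x in Ω, ‖weakGrad Ω σ x‖ ^ 2 =
        (∫ x in Ω, ‖gradient φ x - singularField a d r x‖ ^ 2) +
          (∫ x in Ω, ‖weakGrad Ω σ x‖ ^ 2) + c := by ring
    rw [e2]
    refine hlim.congr' ?_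
    filter_upwards [Ioc_mem_nhdsGT (show 0 < 2 * r by linarith [h.r_pos])] with ρ hρ
    exact (h.excessEnergy_add (hasWeakGrad_weakGrad hσ.1) (hσ.zeroTrace h.isOpen a)
      (fun ρ _ => hσ.2.1.restrict_perforated ρ) (fun ρ _ => hg.restrict_perforated ρ) hρ.1 hρ.2).symm
  refine ⟨_, ?_, key⟩
  have h0 := key _ (memH10_zero h.isOpen)
  have hw0 : ∫ x in Ω, ‖weakGrad Ω (fun _ => 0) x‖ ^ 2 = 0 := by
    have hw : HasWeakGrad Ω (fun _ => 0) (gradient fun _ : ℂ => (0 : ℝ)) :=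
      hasWeakGrad_of_locallyLipschitzOn h.isOpen (LocallyLipschitz.const (0 : ℝ)).locallyLipschitzOn
    refine integral_eq_zero_of_ae ?_
    filter_upwards [hw.weakGrad_ae_eq h.isOpen] with x hx
    have hg0 : gradient (fun _ : ℂ => (0 : ℝ)) x = 0 := gradient_const x 0
    rw [hx, hg0, norm_zero, zero_pow two_ne_zero, Pi.zero_apply]
  rw [hw0, add_zero] at h0
  simpa only [add_zero] using h0

end IsSplitting

/-! ### Competitors -/

/-- The boundary terms of two functions with the same trace cancel. -/
lemma zeroTrace_sub_of_hasTrace {N : ℕ} {Ω : Set ℂ} (hΩ : IsOpen Ω) {L : ℝ} {γ : ℝ → ℂ}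
    {a : Fin N → ℂ} {φb f f' : ℂ → ℝ} (hf : HasTrace Ω L γ a f φb) (hf' : HasTrace Ω L γ a f' φb)
    (hL : ∀ ρ > 0, MemLp f 2 (volume.restrict (perforated Ω a ρ)) ∧
      MemLp (weakGrad Ω f) 2 (volume.restrict (perforated Ω a ρ)))
    (hL' : ∀ ρ > 0, MemLp f' 2 (volume.restrict (perforated Ω a ρ)) ∧
      MemLp (weakGrad Ω f') 2 (volume.restrict (perforated Ω a ρ))) :
    ZeroTrace Ω a (fun x => f x - f' x) (fun x => weakGrad Ω f x - weakGrad Ω f' x) := by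
  intro ζ hζ hc ha v
  have h0 : (0 : ℝ) • v = 0 := zero_smul _ _
  have hΦ : ContDiff ℝ ∞ fun x => ζ x • v := hζ.smul contDiff_const
  have hΦc : HasCompactSupport fun x => ζ x • v := hc.comp_left (g := fun t : ℝ => t • v) h0
  have hΦa : ∀ j, a j ∉ tsupport fun x => ζ x • v := fun j hj =>
    ha j (tsupport_comp_subset (g := fun t : ℝ => t • v) h0 ζ hj)
  have i1 := integrableOn_mul_divergence_add_inner hΩ (fun ρ hρ => (hL ρ hρ).1)
    (fun ρ hρ => (hL ρ hρ).2) hΦ hΦc hΦa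
  have i2 := integrableOn_mul_divergence_add_inner hΩ (fun ρ hρ => (hL' ρ hρ).1)
    (fun ρ hρ => (hL' ρ hρ).2) hΦ hΦc hΦa
  have h1 := (hf _ hΦ hΦc hΦa).trans (hf' _ hΦ hΦc hΦa).symm
  rw [← sub_eq_zero, ← integral_sub i1 i2] at h1
  rw [← h1]
  refine integral_congr_ae (ae_of_all _ fun x => ?_)
  simp only [divergence_smul_const (hζ.differentiable (by simp) x) v, real_inner_smul_right,
    inner_sub_left]
  ring

/-- Fatou's lemma along a sequence of radii tending to zero. -/
lemma memLp_of_frequently_le {N : ℕ} {Ω : Set ℂ} (hΩ : IsOpen Ω) {a : Fin N → ℂ}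
    (ha : ∀ j, a j ∉ Ω) {f : ℂ → ℂ} (hfm : AEStronglyMeasurable f (volume.restrict Ω))
    (hf : ∀ ρ > 0, MemLp f 2 (volume.restrict (perforated Ω a ρ))) {C : ℝ}
    (hC : ∃ᶠ ρ in 𝓝[>] (0 : ℝ), ∫ x in perforated Ω a ρ, ‖f x‖ ^ 2 ≤ C) :
    MemLp f 2 (volume.restrict Ω) := by
  have hex : ∀ n : ℕ, ∃ ρ, (∫ x in perforated Ω a ρ, ‖f x‖ ^ 2 ≤ C) ∧ 0 < ρ ∧
      ρ < 1 / ((n : ℝ) + 1) := fun n =>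
    (hC.and_eventually (Ioo_mem_nhdsGT (show (0 : ℝ) < 1 / ((n : ℝ) + 1) by positivity))).exists
  choose ρ hρC hρ0 hρ1 using hex
  have hm := fun n => measurableSet_perforated hΩ a (ρ n)
  have hρlim : Tendsto ρ atTop (𝓝 0) := squeeze_zero (fun n => (hρ0 n).le) (fun n => (hρ1 n).le)
    tendsto_one_div_add_atTop_nhds_zero_nat
  have hbd : ∀ n, eLpNorm ((perforated Ω a (ρ n)).indicator f) 2 (volume.restrict Ω) ≤
      ENNReal.ofReal (1 + |C|) := fun n => by
    rw [eLpNorm_indicator_eq_eLpNorm_restrict (hm n), Measure.restrict_restrict (hm n),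
      inter_eq_self_of_subset_left (perforated_subset Ω a _)]
    have h1 := hρC n
    have hL := hf _ (hρ0 n)
    rw [← norm_toLp_sq hL] at h1
    rw [show eLpNorm f 2 (volume.restrict (perforated Ω a (ρ n))) =
      ENNReal.ofReal ‖hL.toLp f‖ by rw [Lp.norm_toLp, ENNReal.ofReal_toReal hL.2.ne]]
    refine ENNReal.ofReal_le_ofReal ?_
    nlinarith [le_abs_self C, sq_nonneg (‖hL.toLp f‖ - 1), abs_nonneg C]
  refine ⟨hfm, ?_⟩
  have hconv : ∀ᵐ x ∂volume.restrict Ω,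
      Tendsto (fun n => (perforated Ω a (ρ n)).indicator f x) atTop (𝓝 (f x)) := by
    refine (ae_restrict_iff' hΩ.measurableSet).2 (ae_of_all _ fun x hx => ?_)
    have hj : ∀ᶠ n in atTop, ∀ j, ρ n ≤ ‖x - a j‖ := eventually_all.2 fun j =>
      (hρlim.eventually_lt_const (norm_pos_iff.2 (sub_ne_zero.2 fun h : x = a j =>
        ha j (h ▸ hx)))).mono fun n hn => hn.le
    refine tendsto_const_nhds.congr' ?_
    filter_upwards [hj] with n hn
    rw [indicator_of_mem (mem_perforated.2 ⟨hx, hn⟩)]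
  refine (Lp.eLpNorm_lim_le_liminf_eLpNorm (fun n => hfm.indicator (hm n)) _ hconv).trans_lt ?_
  refine lt_of_le_of_lt (liminf_le_of_le (by isBoundedDefault) fun b hb => ?_)
    (ENNReal.ofReal_lt_top (r := 1 + |C|))
  obtain ⟨n, hn⟩ := hb.exists
  exact hn.trans (hbd n)

lemma energyG_eq_of_tendsto {N : ℕ} {Ω : Set ℂ} {a : Fin N → ℂ} (h : ℂ) {ψ : ℂ → ℝ} {w : ℝ}
    (hw : Tendsto (excessEnergy Ω a ψ) (𝓝[>] 0) (𝓝 w)) :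
    energyG Ω a h ψ = ((w - ∫ x in Ω, zeeman h ψ x : ℝ) : EReal) := by
  have : Tendsto (fun ρ => (excessEnergy Ω a ψ ρ : EReal)) (𝓝[>] 0) (𝓝 (w : EReal)) :=
    (continuous_coe_real_ereal.tendsto w).comp hw
  rw [energyG, this.liminf_eq, EReal.coe_sub]

/-- In `EReal`, subtracting a real number from `⊤` gives `⊤`; otherwise the lower limit is below some
real number, and so is the excess energy for arbitrarily small radii. -/
lemma energyG_eq_top_or {N : ℕ} (Ω : Set ℂ) (a : Fin N → ℂ) (h : ℂ) (ψ : ℂ → ℝ) :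
    energyG Ω a h ψ = ⊤ ∨ ∃ C : ℝ, ∃ᶠ ρ in 𝓝[>] (0 : ℝ), excessEnergy Ω a ψ ρ ≤ C := by
  by_cases htop : liminf (fun ρ : ℝ => (excessEnergy Ω a ψ ρ : EReal)) (𝓝[>] (0 : ℝ)) = ⊤
  · left
    rw [energyG, htop, EReal.top_sub_coe]
  · right
    obtain ⟨C, hC, -⟩ := EReal.lt_iff_exists_real_btwn.1 (lt_top_iff_ne_top.2 htop)
    refine ⟨C, (frequently_lt_of_liminf_lt (by isBoundedDefault) hC).mono fun ρ hρ => ?_⟩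
    exact (EReal.coe_lt_coe_iff.1 hρ).le

namespace IsSplitting

variable {N : ℕ} {Ω : Set ℂ} {a e : Fin N → ℂ} {d : Fin N → ℝ} {r : ℝ} {Q φ : ℂ → ℝ}

lemma memLp_weakGrad (h : IsSplitting Ω a e d r Q φ) {ρ : ℝ} (hρ : 0 < ρ) :
    MemLp (weakGrad Ω φ) 2 (volume.restrict (perforated Ω a ρ)) :=
  (h.memLp_gradient hρ).ae_eq (ae_restrict_of_ae_restrict_of_subset (perforated_subset Ω a ρ)
    (h.hasWeakGrad.weakGrad_ae_eq h.isOpen).symm)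

/-- Perturbations in `H¹₀(Ω)` lead to competitors. -/
lemma isCompetitor_add (h : IsSplitting Ω a e d r Q φ) {L : ℝ} {γ : ℝ → ℂ} {φb : ℂ → ℝ}
    (hφ : HasTrace Ω L γ a φ φb) {σ : ℂ → ℝ} (hσ : MemH10 Ω σ) :
    IsCompetitor Ω L γ a φb fun x => φ x + σ x := by
  have hw := (hasWeakGrad_weakGrad ⟨_, h.hasWeakGrad⟩).add h.isOpen (hasWeakGrad_weakGrad hσ.1)
  have hae := hw.weakGrad_ae_eq h.isOpen
  have hφL : ∀ ρ > 0, MemLp φ 2 (volume.restrict (perforated Ω a ρ)) := fun ρ _ =>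
    h.memLp.restrict_perforated ρ
  have hφg : ∀ ρ > 0, MemLp (weakGrad Ω φ) 2 (volume.restrict (perforated Ω a ρ)) := fun ρ hρ =>
    h.memLp_weakGrad hρ
  have hσL : ∀ ρ > 0, MemLp σ 2 (volume.restrict (perforated Ω a ρ)) := fun ρ _ =>
    hσ.2.1.restrict_perforated ρ
  have hσg : ∀ ρ > 0, MemLp (weakGrad Ω σ) 2 (volume.restrict (perforated Ω a ρ)) := fun ρ _ =>
    hσ.memLp_weakGrad.restrict_perforated ρ
  refine ⟨⟨⟨_, hw⟩, fun ρ hρ => ⟨(hφL ρ hρ).add (hσL ρ hρ), ?_⟩⟩, fun Φ hΦ hc ha => ?_⟩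
  · exact ((hφg ρ hρ).add (hσg ρ hρ)).ae_eq
      (ae_restrict_of_ae_restrict_of_subset (perforated_subset Ω a ρ) hae.symm)
  · have i1 := integrableOn_mul_divergence_add_inner h.isOpen hφL hφg hΦ hc ha
    have i2 := integrableOn_mul_divergence_add_inner h.isOpen hσL hσg hΦ hc ha
    have z2 := (hσ.zeroTrace h.isOpen a).integral_divergence_eq_zero h.isOpen hσL hσg hΦ hc ha
    rw [← hφ Φ hΦ hc ha, ← add_zero (∫ x in Ω, (φ x * divergence Φ x + _)), ← z2,
      ← integral_add i1 i2]
    refine integral_congr_ae ?_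
    filter_upwards [hae] with x hx
    rw [hx, inner_add_left]
    ring

/-- A competitor whose excess energy does not tend to infinity differs from the harmonic extension by
a function in `H¹₀(Ω)`. -/
lemma memH10_sub (h : IsSplitting Ω a e d r Q φ) {L : ℝ} {γ : ℝ → ℂ} {φb : ℂ → ℝ}
    (hφ : HasTrace Ω L γ a φ φb) {ψ : ℂ → ℝ}
    (hψ : IsCompetitor Ω L γ a φb ψ) {C : ℝ}
    (hC : ∃ᶠ ρ in 𝓝[>] (0 : ℝ), excessEnergy Ω a ψ ρ ≤ C) : MemH10 Ω fun x => ψ x - φ x := by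
  obtain ⟨⟨hψw, hψL⟩, hψt⟩ := hψ
  have hφL : ∀ ρ > 0, MemLp φ 2 (volume.restrict (perforated Ω a ρ)) ∧
      MemLp (weakGrad Ω φ) 2 (volume.restrict (perforated Ω a ρ)) := fun ρ hρ =>
    ⟨h.memLp.restrict_perforated ρ, h.memLp_weakGrad hρ⟩
  have hz := zeroTrace_sub_of_hasTrace h.isOpen hψt hφ hψL hφL
  set g : ℂ → ℂ := fun x => weakGrad Ω ψ x - weakGrad Ω φ x
  have hw : HasWeakGrad Ω (fun x => ψ x - φ x) g :=
    (hasWeakGrad_weakGrad hψw).sub h.isOpen (hasWeakGrad_weakGrad ⟨_, h.hasWeakGrad⟩)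
  have hσ : ∀ ρ > 0, MemLp (fun x => ψ x - φ x) 2 (volume.restrict (perforated Ω a ρ)) :=
    fun ρ hρ => (hψL ρ hρ).1.sub (hφL ρ hρ).1
  have hg : ∀ ρ > 0, MemLp g 2 (volume.restrict (perforated Ω a ρ)) :=
    fun ρ hρ => (hψL ρ hρ).2.sub (hφL ρ hρ).2
  have hgm : AEStronglyMeasurable g (volume.restrict Ω) := hw.2.1.aestronglyMeasurable
  have hZ := h.memLp_sub_singularField
  obtain ⟨c, hc⟩ := h.exists_tendsto_modelExcess
  -- the part of the excess energy that does not depend on the competitor is bounded below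
  have hbd : ∃ᶠ ρ in 𝓝[>] (0 : ℝ),
      ∫ x in perforated Ω a ρ, ‖gradient φ x - singularField a d r x + g x‖ ^ 2 ≤ C - (c - 1) := by
    refine (hC.and_eventually ((hc.eventually_const_lt (sub_one_lt c)).and
      (Ioc_mem_nhdsGT (show 0 < 2 * r by linarith [h.r_pos])))).mono fun ρ hρ => ?_
    obtain ⟨h1, h2, h3⟩ := hρ
    have := h.excessEnergy_add hw hz hσ hg h3.1 h3.2
    simp only [add_sub_cancel] at this
    linarith
  have hZg := memLp_of_frequently_le h.isOpen h.notMem (hZ.1.add hgm)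
    (fun ρ hρ => (hZ.restrict_perforated ρ).add (hg ρ hρ)) hbd
  have hgL : MemLp g 2 (volume.restrict Ω) :=
    (hZg.sub hZ).ae_eq (ae_of_all _ fun _ => add_sub_cancel_left _ _)
  exact hz.memH10 h.isOpen h.bounded h.cone hw hσ hgL

end IsSplitting

/-! ### Minimality -/

lemma energyF_eq_sub {Ω : Set ℂ} (hb : Bornology.IsBounded Ω) (h : ℂ) {φ σ : ℂ → ℝ}
    (hφ : AEStronglyMeasurable φ (volume.restrict Ω)) (hσ : MemH10 Ω σ) :
    energyF Ω h φ σ = (∫ x in Ω, ‖weakGrad Ω σ x‖ ^ 2) - ∫ x in Ω, zeeman h (fun y => φ y + σ y) x := by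
  rw [energyF_eq hb h hφ hσ, norm_toLp_sq]
  simp only [add_comm]

/-- For competitors of the form `φ + σ` with `σ ∈ H¹₀(Ω)`, the energy `G` is a constant plus `F σ`; all
other competitors have infinite energy. -/
theorem IsSplitting.exists_isRenormalizedEnergy {N : ℕ} {Ω : Set ℂ} {a e : Fin N → ℂ} {d : Fin N → ℝ}
    {r : ℝ} {Q φ : ℂ → ℝ} (h : IsSplitting Ω a e d r Q φ) {L : ℝ} {γ : ℝ → ℂ} {φb : ℂ → ℝ}
    (hφ : HasTrace Ω L γ a φ φb) (hext : ℂ) :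
    ∃ W : ℝ, IsRenormalizedEnergy Ω a hext φ W ∧
      (∀ ψ : ℂ → ℝ, IsCompetitor Ω L γ a φb ψ → (W : EReal) ≤ energyG Ω a hext ψ) ∧
      (∀ σ : ℂ → ℝ, IsMinimizerF Ω hext φ σ → IsCompetitor Ω L γ a φb (fun x => φ x + σ x) ∧
        energyG Ω a hext (fun x => φ x + σ x) = (W : EReal)) := by
  have hφm := h.memLp.1
  obtain ⟨W₀, hW₀, hW⟩ := h.exists_tendsto_excessEnergy
  obtain ⟨σ₀, hσ₀⟩ := exists_minimizer h.isOpen h.bounded hext hφm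
  have hG : ∀ σ, MemH10 Ω σ →
      energyG Ω a hext (fun x => φ x + σ x) = ((W₀ + energyF Ω hext φ σ : ℝ) : EReal) := by
    intro σ hσ
    rw [energyG_eq_of_tendsto hext (hW σ hσ), energyF_eq_sub h.bounded hext hφm hσ, add_sub_assoc]
  refine ⟨W₀ + energyF Ω hext φ σ₀, ⟨W₀, σ₀, hW₀, hσ₀, rfl⟩, fun ψ hψ => ?_, fun σ hσ =>
    ⟨h.isCompetitor_add hφ hσ.1, ?_⟩⟩
  · rcases energyG_eq_top_or Ω a hext ψ with htop | ⟨C, hC⟩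
    · rw [htop]
      exact le_top
    · have hσ := h.memH10_sub hφ hψ hC
      have := hG _ hσ
      simp only [add_sub_cancel] at this
      rw [this, EReal.coe_le_coe_iff]
      linarith [hσ₀.2 _ hσ]
  · rw [hG σ hσ.1, le_antisymm (hσ.2 _ hσ₀.1) (hσ₀.2 _ hσ.1)]

/-- The harmonic extension of boundary data with jumps `-π d_j` is a bounded function with the boundary
values of a model. The directions `e j = I * deriv γ (s j)` are the inner normals at the `a_j`. -/
lemma exists_isSplitting {Ω : Set ℂ} (hΩ : IsOpen Ω) (hb : Bornology.IsBounded Ω) (hC : IsC11 Ω)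
    {L : ℝ} {γ : ℝ → ℂ} (hγ : IsBoundaryParam Ω L γ) {N : ℕ} {a : Fin N → ℂ}
    (ha : Function.Injective a) (haΩ : ∀ j, a j ∈ frontier Ω) {d : Fin N → ℤ}
    (hd : ∀ j, d j = 1 ∨ d j = -1) {φb φ : ℂ → ℝ} (hφb : IsBoundaryData Ω L γ a d φb)
    (hφ : IsHarmonicExtension Ω a φb φ) :
    ∃ (e : Fin N → ℂ) (r : ℝ) (Q : ℂ → ℝ), IsSplitting Ω a e (fun j => (d j : ℝ)) r Q φ ∧
      ∀ x ∈ frontier Ω \ range a, φb x = phaseModel a e (fun j => (d j : ℝ)) r Q x := by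
  have hs : ∀ j, ∃ s, γ s = a j := fun j => by
    have := haΩ j
    rwa [← hγ.range_eq] at this
  choose s hs using hs
  obtain ⟨r₀, hr₀, hreg⟩ := hφb.exists_lipschitz_regular_part hγ hs
  choose K hK R hR hpole using fun j => hC.exists_isPole hΩ hγ (s j)
  obtain ⟨R', hR', hRle⟩ := exists_pos_le_forall hR
  obtain ⟨δ, hδ, hδle⟩ : ∃ δ > 0, ∀ p : {p : Fin N × Fin N // p.1 ≠ p.2},
      δ ≤ ‖a p.1.1 - a p.1.2‖ :=
    exists_pos_le_forall fun p => norm_pos_iff.2 (sub_ne_zero.2 fun hp => p.2 (ha hp))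
  -- below a quarter of the radii at the poles and of the distances of the `a_j`
  set r : ℝ := min r₀ (min (R' / 4) (δ / 4)) with hr
  have hr0 : 0 < r := by positivity
  have hrR : ∀ j, 2 * r < R j := fun j => by
    have : r ≤ R' / 4 := (min_le_right _ _).trans (min_le_left _ _)
    linarith [hRle j]
  have hp : ∀ j, IsPole Ω (a j) (Complex.I * deriv γ (s j)) (K j) (R j) := fun j =>
    hs j ▸ hpole j (R j) (hR j) le_rfl
  obtain ⟨Q, C, hQ, hφQ⟩ := hreg r hr0 (min_le_left _ _) fun j z hz hza =>
    ((hp j).contDiffAt_vortexPhase hr0 (hrR j) (frontier_subset_closure hz) hza).continuousAt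
  refine ⟨fun j => Complex.I * deriv γ (s j), r, Q, ?_, hφQ⟩
  refine ⟨hΩ, hb, hC.hasInwardCone hΩ, hr0, fun j => ⟨K j, R j, hK j, hrR j, hp j⟩,
    fun i j hij => ?_, fun j hj => ?_, fun j => ?_, ⟨C, hQ⟩, fun x hx => (hφ.harmonic x hx).1,
    fun x hx => ?_, hφ.bounded, fun x hx => ?_⟩
  · have : r ≤ δ / 4 := (min_le_right _ _).trans (min_le_right _ _)
    linarith [hδle ⟨(i, j), hij⟩]
  · exact (hΩ.inter_frontier_eq ▸ (⟨hj, haΩ j⟩ : a j ∈ Ω ∩ frontier Ω) : a j ∈ (∅ : Set ℂ))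
  · rcases hd j with h | h <;> simp [h]
  · rw [divergence_gradient (hφ.harmonic x hx).1]
    exact (hφ.harmonic x hx).2.eq_of_nhds
  · have hcont : ContinuousAt (phaseModel a (fun j => Complex.I * deriv γ (s j))
        (fun j => (d j : ℝ)) r Q) x := by
      refine hQ.continuous.continuousAt.add (tendsto_finsetSum _ fun j _ => ?_)
      refine ContinuousAt.mul continuousAt_const
        ((hp j).contDiffAt_vortexPhase hr0 (hrR j) (frontier_subset_closure hx.1) ?_).continuousAt
      rintro rfl
      exact hx.2 (mem_range_self j)
    have := (hφ.boundary x hx).sub (hcont.tendsto.mono_left nhdsWithin_le_nhds)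
    rwa [← show φb x = phaseModel a (fun j => Complex.I * deriv γ (s j)) (fun j => (d j : ℝ)) r Q x
      from hφQ x hx, sub_self] at this

end BoundaryVortex

end

theorem mainTheorem5
    (Ω : Set ℂ) (hΩ_open : IsOpen Ω) (hΩ_bdd : Bornology.IsBounded Ω)
    (hΩ_sc : SimplyConnectedSpace Ω) (hΩ_C11 : BoundaryVortex.IsC11 Ω)
    (L : ℝ) (γ : ℝ → ℂ) (hγ : BoundaryVortex.IsBoundaryParam Ω L γ)
    (N : ℕ) (hN : 2 ≤ N) (a : Fin N → ℂ) (ha_inj : Function.Injective a)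
    (ha_mem : ∀ j, a j ∈ frontier Ω)
    (d : Fin N → ℤ) (hd : ∀ j, d j = 1 ∨ d j = -1) (hd_sum : ∑ j, d j = 2)
    (φb : ℂ → ℝ) (hφb : BoundaryVortex.IsBoundaryData Ω L γ a d φb)
    (φs : ℂ → ℝ) (hφs : BoundaryVortex.IsHarmonicExtension Ω a φb φs)
    (h : ℂ) :
    ∃ W : ℝ, BoundaryVortex.IsRenormalizedEnergy Ω a h φs W ∧
      (∀ ψ : ℂ → ℝ, BoundaryVortex.IsCompetitor Ω L γ a φb ψ →
        (W : EReal) ≤ BoundaryVortex.energyG Ω a h ψ) ∧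
      (∀ σs : ℂ → ℝ, BoundaryVortex.IsMinimizerF Ω h φs σs →
        BoundaryVortex.IsCompetitor Ω L γ a φb (fun x => φs x + σs x) ∧
          BoundaryVortex.energyG Ω a h (fun x => φs x + σs x) = (W : EReal)) := by
  obtain ⟨e, r, Q, hs, hb⟩ := BoundaryVortex.exists_isSplitting hΩ_open hΩ_bdd hΩ_C11 hγ ha_inj
    ha_mem hd hφb hφs
  exact hs.exists_isRenormalizedEnergy (hs.hasTrace hΩ_C11 hγ hb) h
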